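/- **Conventions.** Let $\mathcal C$ be a symmetric monoidal category (written below with elements) and $B$ a Hopf algebra in $\mathcal C$ with product $m$, unit $\iota$, coproduct $\Delta(b)=b_1\otimes b_2$, counit $\varepsilon$ and invertible antipode $S$. A *Drinfeld–Yetter $B$-module* is an object $V$ with a left action $\pi:B\otimes V\to V$, $b\otimes v\mapsto bv$, and a right coaction $\pi^*:V\to B\otimes V$, $\pi^*(v)=v_B\otimes v_V$ (that is, $(\Delta^{21}\otimes\mathrm{id})\pi^*=(\mathrm{id}\otimes\pi^*)\pi^*$ and $(\varepsilon\otimes\mathrm{id})\pi^*=\mathrm{id}$) such that $$\pi^*(bv)=b_3\,v_B\,S^{-1}(b_1)\otimes b_2\,v_V .$$ Morphisms commute with $\pi$ and $\pi^*$. Drinfeld–Yetter modules form a braided monoidal category $\mathrm{DY}(B)$ with $b(v\otimes w)=b_1v\otimes b_2w$, $\pi^*(v\otimes w)=w_Bv_B\otimes v_V\otimes w_W$, the associativity and unit constraints of $\mathcal C$, and braiding $\beta_{VW}(v\otimes w)=w_W\otimes w_Bv$. For a Hopf algebra $D$ with quasitriangular structure $R_D$, $\mathrm{Rep}(D)$ denotes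 the category of left $D$-modules in $\mathcal C$, with $d(v\otimes w)=d_1v\otimes d_2w$ and braiding $v\otimes w\mapsto(1\,2)\,R_D(v\otimes w)$. If $(B,A)$ is a matched pair of Hopf algebras, with a left action $\rhd:A\otimes B\to B$ and a right action $\lhd:A\otimes B\to A$, its *double cross product* $B\bowtie A$ is the Hopf algebra with underlying coalgebra $B\otimes A$ and product $(b\otimes a)(b'\otimes a')=b\,(a_1\rhd b'_1)\otimes(a_2\lhd b'_2)\,a'$; it contains $B$ and $A$ as Hopf subalgebras via the inclusions $i_B,i_A$. **Part 1.** Let $\mathsf k$ be a field and $B$ a finite-dimensional Hopf algebra over $\mathsf k$. Then the antipode of $B$ is invertible. Let $B^\circ$ be the dual Hopf algebra $B^*$ with opposite coproduct, i.e. $(fg)(x)=f(x_1)g(x_2)$ and $f_1(x)f_2(y)=f(yx)$, and set $$f\rhd b=\langle f,b_3S^{-1}(b_1)\rangle\,b_2,\qquad (f\lhd b)(x)=\langle f,b_2\,x\,S^{-1}(b_1)\rangle .$$ Then $(B,B^\circ,\rhd,\lhd)$ is a matched pair of Hopf algebras, and the double cross product $DB=B\bowtie B^\circ$ is quasitriangular,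 with $R$-matrix the image of the canonical element $R_B=\sum_i b_i\otimes b^i\in B\otimes B^\circ$ under $i_B\otimes i_{B^\circ}$. The formulae $$\Xi(V,\pi_V,\pi_V^*)=(V,\xi_V),\qquad \xi_V(b\otimes f\otimes v)=\langle f,v_B\rangle\,b\,v_V,$$ $$\Theta(V,\xi_V)=(V,\pi_V,\pi_V^*),\qquad \pi_V=\xi_V\circ(i_B\otimes\mathrm{id}),\qquad \pi^*_V(v)=\sum_i b_i\otimes\xi_V(i_{B^\circ}(b^i)\otimes v)$$ (identity on morphisms, with modules of arbitrary dimension) define mutually inverse equivalences $\Xi:\mathrm{DY}(B)\rightleftarrows\mathrm{Rep}(DB):\Theta$ of braided tensor categories, whose tensor structures are the identities. **Part 2.** Let $\mathsf k$ be a field of characteristic zero, $\mathsf K=\mathsf k[[\hbar]]$, and let $\mathcal C$ be the category of $\hbar$-torsion free, $\hbar$-adically complete and separated $\mathsf K$-modules (equivalently, those isomorphic to $V_0[[\hbar]]$ for a discrete vector space $V_0$), with their $\hbar$-adic topology and the $\hbar$-completed tensor product $\otimes$. Let $B$ be a quantised universal enveloping algebra: a Hopf algebra in $\mathcal C$ with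 $B/\hbar B\cong U\mathfrak b$ as Hopf algebras, where $\mathfrak b$ is a finite-dimensional Lie algebra (which is then a Lie bialgebra). The antipode of $B$ is invertible. Put $$B'=\{b\in B\mid(\mathrm{id}-\iota\varepsilon)^{\otimes n}\Delta^{(n)}(b)\in\hbar^nB^{\otimes n}\text{ for all }n\ge0\},$$ with the topology induced by the $\hbar$-adic topology of $B$. For $V$ in $\mathcal C$, $B'\otimes V\subseteq B\otimes V$ is the completed tensor product (the closure of the image of the algebraic one). Let $B^\vee$ be the $\mathsf K$-module of continuous linear functionals $B'\to\mathsf K$, with the $\hbar$-adic topology; it is an object of $\mathcal C$, and a Hopf algebra as the dual of $B'$ with opposite coproduct. A Drinfeld–Yetter $B$-module $V$ in $\mathcal C$ is *admissible* if $\pi_V^*$ factors through $B'\otimes V$; admissible modules form a full braided monoidal subcategory $\mathrm{DY}^{\mathrm{adm}}(B)$ of $\mathrm{DY}(B)$. The adjoint action $b\otimes x\mapsto b_2xS^{-1}(b_1)$ of $B$ preserves $B'$, and the adjoint coaction $b\mapsto b_3S^{-1}(b_1)\otimes b_2$ of $B$ takes values in $B'\otimes B$. Hence the formulae of Part 1 define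 $\rhd:B^\vee\otimes B\to B$ and $\lhd:B^\vee\otimes B\to B^\vee$; there is a canonical element $R_B\in B'\otimes B^\vee\subseteq B\otimes B^\vee$, $(f\otimes\mathrm{id})(R_B)=f$ for all $f\in B^\vee$; $(B,B^\vee,\rhd,\lhd)$ is a matched pair of Hopf algebras; and the QUE quantum double $DB=B\bowtie B^\vee$ is quasitriangular with $R$-matrix the image of $R_B$. The formulae of Part 1 define mutually inverse equivalences $\Xi:\mathrm{DY}^{\mathrm{adm}}(B)\rightleftarrows\mathrm{Rep}(DB):\Theta$ of braided tensor categories, whose tensor structures are the identities. -/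

import Mathlib

open CategoryTheory MonoidalCategory
open scoped MonObj ComonObj HopfObj

namespace QuantumDouble

noncomputable section

section Generic

universe v u

variable {C : Type u} [Category.{v} C] [MonoidalCategory C] [SymmetricCategory C]

/-- The inverse of the antipode (a junk value if the antipode is not invertible). -/
def antipodeInv (B : C) [HopfObj B] : B ⟶ B :=
  open scoped Classical in if _h : IsIso (𝒮[B]) then inv (𝒮[B]) else 𝒮[B]

/-- The iterated coproduct `b ↦ (b₁ ⊗ b₂) ⊗ b₃`. -/
def comul₃ (B : C) [HopfObj B] : B ⟶ (B ⊗ B) ⊗ B := Δ[B] ≫ Δ[B] ▷ B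

/-- The iterated product `(a ⊗ b) ⊗ c ↦ a b c`. -/
def mul₃ (B : C) [HopfObj B] : (B ⊗ B) ⊗ B ⟶ B := μ[B] ▷ B ≫ μ[B]

/-- `act : D ⊗ V ⟶ V` is a left action of the algebra `D`. -/
structure IsAction (D : C) [MonObj D] (V : C) (act : D ⊗ V ⟶ V) : Prop where
  one_act : η[D] ▷ V ≫ act = (λ_ V).hom
  mul_act : μ[D] ▷ V ≫ act = (α_ D D V).hom ≫ D ◁ act ≫ act

/-- `coact : V ⟶ B ⊗ V` is a right coaction, written with `B` on the left:
`(Δ²¹ ⊗ id) ∘ π* = (id ⊗ π*) ∘ π*`. -/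
structure IsCoaction (B : C) [ComonObj B] (V : C) (coact : V ⟶ B ⊗ V) : Prop where
  counit_coact : coact ≫ ε[B] ▷ V = (λ_ V).inv
  comul_coact : coact ≫ (Δ[B] ≫ (β_ B B).hom) ▷ V = coact ≫ B ◁ coact ≫ (α_ B B V).inv

/-- The map `b ⊗ v ↦ b₃ v₍B₎ S⁻¹(b₁) ⊗ b₂ v₍V₎`, where `π*(v) = v₍B₎ ⊗ v₍V₎`. -/
def dyTwist (B : C) [HopfObj B] (V : C) (act : B ⊗ V ⟶ V) (coact : V ⟶ B ⊗ V) :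
    B ⊗ V ⟶ B ⊗ V :=
  (comul₃ B ⊗ₘ coact) ≫ (((antipodeInv B ▷ B) ▷ B) ▷ (B ⊗ V)) ⊗≫
    (β_ (B ⊗ B) (B ⊗ B)).hom ▷ V ⊗≫ (mul₃ B ⊗ₘ act)

/-- The axioms of a Drinfeld-Yetter module over the Hopf algebra `B`. -/
structure IsDrinfeldYetter (B : C) [HopfObj B] (V : C) (act : B ⊗ V ⟶ V)
    (coact : V ⟶ B ⊗ V) : Prop where
  isAction : IsAction B V act
  isCoaction : IsCoaction B V coact
  compat : act ≫ coact = dyTwist B V act coact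

/-- Drinfeld-Yetter modules over the Hopf algebra `B`. -/
structure DY (B : C) [HopfObj B] where
  X : C
  act : B ⊗ X ⟶ X
  coact : X ⟶ B ⊗ X
  isDY : IsDrinfeldYetter B X act coact

namespace DY

variable {B : C} [HopfObj B]

/-- `f` commutes with the actions and the coactions. -/
structure IsHom (V W : DY B) (f : V.X ⟶ W.X) : Prop where
  act_comm : V.act ≫ f = B ◁ f ≫ W.act
  coact_comm : V.coact ≫ B ◁ f = f ≫ W.coact

/-- Morphisms of Drinfeld-Yetter modules. -/
@[ext]
structure Hom (V W : DY B) where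
  hom : V.X ⟶ W.X
  isHom : IsHom V W hom

instance : Category (DY B) where
  Hom V W := Hom V W
  id V := ⟨𝟙 V.X, by constructor <;> simp⟩
  comp f g := ⟨f.hom ≫ g.hom, by
    constructor
    · rw [← Category.assoc, f.isHom.act_comm, Category.assoc, g.isHom.act_comm]; simp
    · rw [whiskerLeft_comp, ← Category.assoc, f.isHom.coact_comm, Category.assoc,
        g.isHom.coact_comm]; simp⟩
  id_comp _ := Hom.ext (Category.id_comp _)
  comp_id _ := Hom.ext (Category.comp_id _)
  assoc _ _ _ := Hom.ext (Category.assoc _ _ _)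

@[ext] lemma hom_ext {V W : DY B} {f g : V ⟶ W} (h : f.hom = g.hom) : f = g := Hom.ext h

@[simp] lemma id_hom (V : DY B) : Hom.hom (𝟙 V) = 𝟙 V.X := rfl

@[simp] lemma comp_hom {U V W : DY B} (f : U ⟶ V) (g : V ⟶ W) :
    (f ≫ g).hom = f.hom ≫ g.hom := rfl

/-- The underlying object. -/
@[simps] def forget (B : C) [HopfObj B] : DY B ⥤ C where
  obj V := V.X
  map f := f.hom

instance : (forget B).Faithful where
  map_injective h := hom_ext h

/-- An isomorphism of the underlying objects which is a morphism of Drinfeld-Yetter modules. -/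
@[simps] def mkIso {V W : DY B} (e : V.X ≅ W.X) (h : IsHom V W e.hom) : V ≅ W where
  hom := ⟨e.hom, h⟩
  inv := ⟨e.inv, by
    constructor
    · rw [← cancel_mono e.hom, Category.assoc, Category.assoc, h.act_comm]
      simp [← whiskerLeft_comp_assoc]
    · rw [← cancel_epi e.hom, ← Category.assoc, ← h.coact_comm]
      simp [← whiskerLeft_comp]⟩

/-- The trivial action on the unit object. -/
def unitAct (B : C) [HopfObj B] : B ⊗ 𝟙_ C ⟶ 𝟙_ C := (ρ_ B).hom ≫ ε[B]

/-- The trivial coaction on the unit object. -/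
def unitCoact (B : C) [HopfObj B] : 𝟙_ C ⟶ B ⊗ 𝟙_ C := η[B] ≫ (ρ_ B).inv

/-- The action on the tensor product: `b (v ⊗ w) = b₁ v ⊗ b₂ w`. -/
def tensorAct (V W : DY B) : B ⊗ (V.X ⊗ W.X) ⟶ V.X ⊗ W.X :=
  Δ[B] ▷ (V.X ⊗ W.X) ≫ tensorμ B B V.X W.X ≫ (V.act ⊗ₘ W.act)

/-- The coaction on the tensor product: `v ⊗ w ↦ w₍B₎ v₍B₎ ⊗ v₍V₎ ⊗ w₍W₎`. -/
def tensorCoact (V W : DY B) : V.X ⊗ W.X ⟶ B ⊗ (V.X ⊗ W.X) :=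
  (V.coact ⊗ₘ W.coact) ≫ tensorμ B V.X B W.X ≫ ((β_ B B).hom ≫ μ[B]) ▷ (V.X ⊗ W.X)

/-- The map `R_{VW} : v ⊗ w ↦ w₍B₎ v ⊗ w₍W₎`. -/
def rMatrix (V W : DY B) : V.X ⊗ W.X ⟶ V.X ⊗ W.X :=
  V.X ◁ W.coact ≫ (α_ V.X B W.X).inv ≫ (β_ V.X B).hom ▷ W.X ≫ V.act ▷ W.X

/-- The braiding `β_{VW} = (2 1) ∘ R_{VW}`. -/
def braid (V W : DY B) : V.X ⊗ W.X ⟶ W.X ⊗ V.X := rMatrix V W ≫ (β_ V.X W.X).hom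

/-- The trivial module, the above tensor product, and the associativity and unit constraints of
the underlying category are well-defined on Drinfeld-Yetter modules. -/
structure IsMonoidal (B : C) [HopfObj B] : Prop where
  unit : IsDrinfeldYetter B (𝟙_ C) (unitAct B) (unitCoact B)
  tensor : ∀ V W : DY B, IsDrinfeldYetter B (V.X ⊗ W.X) (tensorAct V W) (tensorCoact V W)
  assoc : ∀ U V W : DY B,
    IsHom ⟨_, _, _, tensor ⟨_, _, _, tensor U V⟩ W⟩ ⟨_, _, _, tensor U ⟨_, _, _, tensor V W⟩⟩
      (α_ U.X V.X W.X).hom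
  leftUnitor : ∀ V : DY B, IsHom ⟨_, _, _, tensor ⟨_, _, _, unit⟩ V⟩ V (λ_ V.X).hom
  rightUnitor : ∀ V : DY B, IsHom ⟨_, _, _, tensor V ⟨_, _, _, unit⟩⟩ V (ρ_ V.X).hom

lemma tensorHom_isHom (h : IsMonoidal B) {V₁ V₂ W₁ W₂ : DY B} (f : V₁ ⟶ V₂) (g : W₁ ⟶ W₂) :
    IsHom ⟨_, _, _, h.tensor V₁ W₁⟩ ⟨_, _, _, h.tensor V₂ W₂⟩ (f.hom ⊗ₘ g.hom) := by
  constructor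
  · have e : (B ⊗ B) ◁ (f.hom ⊗ₘ g.hom) ≫ tensorμ B B V₂.X W₂.X =
        tensorμ B B V₁.X W₁.X ≫ (B ◁ f.hom ⊗ₘ B ◁ g.hom) := by
      have := id_tensorHom (B ⊗ B) (f.hom ⊗ₘ g.hom)
      rw [← id_tensorHom_id] at this
      rw [← this, ← id_tensorHom, ← id_tensorHom]
      exact
        tensorμ_natural (𝟙 B) (𝟙 B) f.hom g.hom
    simp only [tensorAct, Category.assoc, tensorHom_comp_tensorHom, f.isHom.act_comm,
      g.isHom.act_comm]
    rw [whisker_exchange_assoc, reassoc_of% e, tensorHom_comp_tensorHom]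
  · have e : (B ◁ f.hom ⊗ₘ B ◁ g.hom) ≫ tensorμ B V₂.X B W₂.X =
        tensorμ B V₁.X B W₁.X ≫ (B ⊗ B) ◁ (f.hom ⊗ₘ g.hom) := by
      have := id_tensorHom (B ⊗ B) (f.hom ⊗ₘ g.hom)
      rw [← id_tensorHom_id] at this
      rw [← this, ← id_tensorHom, ← id_tensorHom]
      exact
        tensorμ_natural (𝟙 B) f.hom (𝟙 B) g.hom
    simp only [tensorCoact, Category.assoc]
    rw [tensorHom_comp_tensorHom_assoc, ← f.isHom.coact_comm, ← g.isHom.coact_comm,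
      ← tensorHom_comp_tensorHom_assoc, reassoc_of% e, whisker_exchange]

/-- The monoidal category of Drinfeld-Yetter modules. -/
@[reducible] def monoidalStruct (h : IsMonoidal B) : MonoidalCategoryStruct (DY B) where
  tensorObj V W := ⟨V.X ⊗ W.X, tensorAct V W, tensorCoact V W, h.tensor V W⟩
  tensorUnit := ⟨𝟙_ C, unitAct B, unitCoact B, h.unit⟩
  tensorHom f g := ⟨f.hom ⊗ₘ g.hom, tensorHom_isHom h f g⟩
  whiskerLeft V _ _ f := ⟨V.X ◁ f.hom, by simpa using tensorHom_isHom h (𝟙 V) f⟩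
  whiskerRight f W := ⟨f.hom ▷ W.X, by simpa using tensorHom_isHom h f (𝟙 W)⟩
  associator U V W := mkIso (α_ U.X V.X W.X) (h.assoc U V W)
  leftUnitor V := mkIso (λ_ V.X) (h.leftUnitor V)
  rightUnitor V := mkIso (ρ_ V.X) (h.rightUnitor V)

@[reducible] def monoidal (h : IsMonoidal B) : MonoidalCategory (DY B) :=
  { monoidalStruct h with
    tensorHom_def := fun f g => hom_ext (MonoidalCategory.tensorHom_def f.hom g.hom)
    id_tensorHom_id := fun V W => hom_ext (MonoidalCategory.id_tensorHom_id V.X W.X)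
    tensorHom_comp_tensorHom := fun f₁ f₂ g₁ g₂ => hom_ext
      (MonoidalCategory.tensorHom_comp_tensorHom f₁.hom f₂.hom g₁.hom g₂.hom)
    whiskerLeft_id := fun V W => hom_ext (MonoidalCategory.whiskerLeft_id V.X W.X)
    id_whiskerRight := fun V W => hom_ext (MonoidalCategory.id_whiskerRight V.X W.X)
    associator_naturality := fun f g k => hom_ext
      (MonoidalCategory.associator_naturality f.hom g.hom k.hom)
    leftUnitor_naturality := fun f => hom_ext (MonoidalCategory.leftUnitor_naturality f.hom)
    rightUnitor_naturality := fun f => hom_ext (MonoidalCategory.rightUnitor_naturality f.hom)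
    pentagon := fun U V W Z => hom_ext (MonoidalCategory.pentagon U.X V.X W.X Z.X)
    triangle := fun U V => hom_ext (MonoidalCategory.triangle U.X V.X) }

/-- The map `braid` is an isomorphism of Drinfeld-Yetter modules and satisfies the hexagon
identities. -/
structure IsBraided (h : IsMonoidal B) : Prop where
  isHom : ∀ V W : DY B, IsHom ⟨_, _, _, h.tensor V W⟩ ⟨_, _, _, h.tensor W V⟩ (braid V W)
  isIso : ∀ V W : DY B, IsIso (braid V W)
  hexagon_forward : ∀ U V W : DY B,
    (α_ U.X V.X W.X).hom ≫ braid U ⟨_, _, _, h.tensor V W⟩ ≫ (α_ V.X W.X U.X).hom =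
      braid U V ▷ W.X ≫ (α_ V.X U.X W.X).hom ≫ V.X ◁ braid U W
  hexagon_reverse : ∀ U V W : DY B,
    (α_ U.X V.X W.X).inv ≫ braid ⟨_, _, _, h.tensor U V⟩ W ≫ (α_ W.X U.X V.X).inv =
      U.X ◁ braid V W ≫ (α_ U.X W.X V.X).inv ≫ braid U W ▷ V.X

lemma braid_naturality {V₁ V₂ W₁ W₂ : DY B} (f : V₁ ⟶ V₂) (g : W₁ ⟶ W₂) :
    (f.hom ⊗ₘ g.hom) ≫ braid V₂ W₂ = braid V₁ W₁ ≫ (g.hom ⊗ₘ f.hom) := by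
  have e : (f.hom ⊗ₘ g.hom) ≫ rMatrix V₂ W₂ = rMatrix V₁ W₁ ≫ (f.hom ⊗ₘ g.hom) := by
    simp only [rMatrix, Category.assoc]
    have h₁ := f.isHom.act_comm
    have h₂ := g.isHom.coact_comm
    have h₃ : (f.hom ⊗ₘ g.hom) ≫ V₂.X ◁ W₂.coact =
        V₁.X ◁ W₁.coact ≫ (f.hom ⊗ₘ 𝟙 B ⊗ₘ g.hom) := by
      rw [← id_tensorHom, ← id_tensorHom, tensorHom_comp_tensorHom, tensorHom_comp_tensorHom,
        id_tensorHom, h₂, Category.comp_id, Category.id_comp]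
    rw [reassoc_of% h₃, associator_inv_naturality_assoc, tensorHom_id,
      ← tensorHom_id (β_ V₂.X B).hom, ← tensorHom_id V₂.act, ← tensorHom_id (β_ V₁.X B).hom,
      ← tensorHom_id V₁.act]
    simp only [tensorHom_comp_tensorHom, Category.comp_id, Category.id_comp,
      BraidedCategory.braiding_naturality_left_assoc, h₁]
  rw [braid, reassoc_of% e, BraidedCategory.braiding_naturality, braid, Category.assoc]

/-- The braided monoidal category of Drinfeld-Yetter modules. -/
@[reducible] def braided (h : IsMonoidal B) (h' : IsBraided h) :
    letI := monoidal h
    BraidedCategory (DY B) :=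
  letI := monoidal h
  { braiding := fun V W =>
      haveI := h'.isIso V W
      mkIso (V := V ⊗ W) (W := W ⊗ V) (asIso (braid V W)) (h'.isHom V W)
    braiding_naturality_right := fun V _ _ f => hom_ext
      (by have := braid_naturality (𝟙 V) f; rw [id_hom, id_tensorHom, tensorHom_id] at this; exact this)
    braiding_naturality_left := fun f W => hom_ext
      (by have := braid_naturality f (𝟙 W); rw [id_hom, id_tensorHom, tensorHom_id] at this; exact this)
    hexagon_forward := fun U V W => hom_ext (h'.hexagon_forward U V W)
    hexagon_reverse := fun U V W => hom_ext (h'.hexagon_reverse U V W) }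

end DY

/-- Left modules over the Hopf algebra `D`. -/
structure HopfRep (D : C) [HopfObj D] where
  X : C
  act : D ⊗ X ⟶ X
  isAction : IsAction D X act

namespace HopfRep

variable {D : C} [HopfObj D]

/-- `f` commutes with the actions. -/
def IsHom (V W : HopfRep D) (f : V.X ⟶ W.X) : Prop := V.act ≫ f = D ◁ f ≫ W.act

/-- Morphisms of modules. -/
@[ext]
structure Hom (V W : HopfRep D) where
  hom : V.X ⟶ W.X
  isHom : IsHom V W hom

instance : Category (HopfRep D) where
  Hom V W := Hom V W
  id V := ⟨𝟙 V.X, by simp [IsHom]⟩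
  comp f g := ⟨f.hom ≫ g.hom, by
    rw [IsHom, ← Category.assoc, f.isHom, Category.assoc, g.isHom]; simp⟩
  id_comp _ := Hom.ext (Category.id_comp _)
  comp_id _ := Hom.ext (Category.comp_id _)
  assoc _ _ _ := Hom.ext (Category.assoc _ _ _)

@[ext] lemma hom_ext {V W : HopfRep D} {f g : V ⟶ W} (h : f.hom = g.hom) : f = g := Hom.ext h

@[simp] lemma id_hom (V : HopfRep D) : Hom.hom (𝟙 V) = 𝟙 V.X := rfl

@[simp] lemma comp_hom {U V W : HopfRep D} (f : U ⟶ V) (g : V ⟶ W) :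
    (f ≫ g).hom = f.hom ≫ g.hom := rfl

/-- The underlying object. -/
@[simps] def forget (D : C) [HopfObj D] : HopfRep D ⥤ C where
  obj V := V.X
  map f := f.hom

/-- An isomorphism of the underlying objects which is a morphism of modules. -/
@[simps] def mkIso {V W : HopfRep D} (e : V.X ≅ W.X) (h : IsHom V W e.hom) : V ≅ W where
  hom := ⟨e.hom, h⟩
  inv := ⟨e.inv, by
    rw [IsHom] at *
    rw [← cancel_mono e.hom, Category.assoc, Category.assoc, h]
    simp [← whiskerLeft_comp_assoc]⟩

/-- The trivial action on the unit object. -/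
def unitAct (D : C) [HopfObj D] : D ⊗ 𝟙_ C ⟶ 𝟙_ C := (ρ_ D).hom ≫ ε[D]

/-- The action on the tensor product: `d (v ⊗ w) = d₁ v ⊗ d₂ w`. -/
def tensorAct (V W : HopfRep D) : D ⊗ (V.X ⊗ W.X) ⟶ V.X ⊗ W.X :=
  Δ[D] ▷ (V.X ⊗ W.X) ≫ tensorμ D D V.X W.X ≫ (V.act ⊗ₘ W.act)

/-- The braiding `v ⊗ w ↦ (2 1) (R (v ⊗ w))` defined by `R ∈ D ⊗ D`. -/
def braid (R : 𝟙_ C ⟶ D ⊗ D) (V W : HopfRep D) : V.X ⊗ W.X ⟶ W.X ⊗ V.X :=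
  (λ_ (V.X ⊗ W.X)).inv ≫ R ▷ (V.X ⊗ W.X) ≫ tensorμ D D V.X W.X ≫ (V.act ⊗ₘ W.act) ≫
    (β_ V.X W.X).hom

/-- The trivial module, the above tensor product, and the associativity and unit constraints of
the underlying category are well-defined on modules. -/
structure IsMonoidal (D : C) [HopfObj D] : Prop where
  unit : IsAction D (𝟙_ C) (unitAct D)
  tensor : ∀ V W : HopfRep D, IsAction D (V.X ⊗ W.X) (tensorAct V W)
  assoc : ∀ U V W : HopfRep D,
    IsHom ⟨_, _, tensor ⟨_, _, tensor U V⟩ W⟩ ⟨_, _, tensor U ⟨_, _, tensor V W⟩⟩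
      (α_ U.X V.X W.X).hom
  leftUnitor : ∀ V : HopfRep D, IsHom ⟨_, _, tensor ⟨_, _, unit⟩ V⟩ V (λ_ V.X).hom
  rightUnitor : ∀ V : HopfRep D, IsHom ⟨_, _, tensor V ⟨_, _, unit⟩⟩ V (ρ_ V.X).hom

lemma tensorμ_whisker (D : C) {V₁ V₂ W₁ W₂ : C} (f : V₁ ⟶ V₂) (g : W₁ ⟶ W₂) :
    (D ⊗ D) ◁ (f ⊗ₘ g) ≫ tensorμ D D V₂ W₂ = tensorμ D D V₁ W₁ ≫ (D ◁ f ⊗ₘ D ◁ g) := by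
  have := id_tensorHom (D ⊗ D) (f ⊗ₘ g)
  rw [← id_tensorHom_id] at this
  rw [← this, ← id_tensorHom, ← id_tensorHom]
  exact tensorμ_natural (𝟙 D) (𝟙 D) f g

lemma tensorHom_isHom (h : IsMonoidal D) {V₁ V₂ W₁ W₂ : HopfRep D} (f : V₁ ⟶ V₂) (g : W₁ ⟶ W₂) :
    IsHom ⟨_, _, h.tensor V₁ W₁⟩ ⟨_, _, h.tensor V₂ W₂⟩ (f.hom ⊗ₘ g.hom) := by
  have hf := f.isHom
  have hg := g.isHom
  rw [IsHom] at hf hg ⊢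
  simp only [tensorAct, Category.assoc, tensorHom_comp_tensorHom, hf, hg]
  rw [whisker_exchange_assoc, reassoc_of% (tensorμ_whisker D f.hom g.hom),
    tensorHom_comp_tensorHom]

@[reducible] def monoidalStruct (h : IsMonoidal D) : MonoidalCategoryStruct (HopfRep D) where
  tensorObj V W := ⟨V.X ⊗ W.X, tensorAct V W, h.tensor V W⟩
  tensorUnit := ⟨𝟙_ C, unitAct D, h.unit⟩
  tensorHom f g := ⟨f.hom ⊗ₘ g.hom, tensorHom_isHom h f g⟩
  whiskerLeft V _ _ f := ⟨V.X ◁ f.hom, by simpa using tensorHom_isHom h (𝟙 V) f⟩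
  whiskerRight f W := ⟨f.hom ▷ W.X, by simpa using tensorHom_isHom h f (𝟙 W)⟩
  associator U V W := mkIso (α_ U.X V.X W.X) (h.assoc U V W)
  leftUnitor V := mkIso (λ_ V.X) (h.leftUnitor V)
  rightUnitor V := mkIso (ρ_ V.X) (h.rightUnitor V)

/-- The monoidal category of modules. -/
@[reducible] def monoidal (h : IsMonoidal D) : MonoidalCategory (HopfRep D) :=
  { monoidalStruct h with
    tensorHom_def := fun f g => hom_ext (MonoidalCategory.tensorHom_def f.hom g.hom)
    id_tensorHom_id := fun V W => hom_ext (MonoidalCategory.id_tensorHom_id V.X W.X)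
    tensorHom_comp_tensorHom := fun f₁ f₂ g₁ g₂ => hom_ext
      (MonoidalCategory.tensorHom_comp_tensorHom f₁.hom f₂.hom g₁.hom g₂.hom)
    whiskerLeft_id := fun V W => hom_ext (MonoidalCategory.whiskerLeft_id V.X W.X)
    id_whiskerRight := fun V W => hom_ext (MonoidalCategory.id_whiskerRight V.X W.X)
    associator_naturality := fun f g k => hom_ext
      (MonoidalCategory.associator_naturality f.hom g.hom k.hom)
    leftUnitor_naturality := fun f => hom_ext (MonoidalCategory.leftUnitor_naturality f.hom)
    rightUnitor_naturality := fun f => hom_ext (MonoidalCategory.rightUnitor_naturality f.hom)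
    pentagon := fun U V W Z => hom_ext (MonoidalCategory.pentagon U.X V.X W.X Z.X)
    triangle := fun U V => hom_ext (MonoidalCategory.triangle U.X V.X) }

/-- The map `braid R` is an isomorphism of modules and satisfies the hexagon identities. -/
structure IsBraided (h : IsMonoidal D) (R : 𝟙_ C ⟶ D ⊗ D) : Prop where
  isHom : ∀ V W : HopfRep D, IsHom ⟨_, _, h.tensor V W⟩ ⟨_, _, h.tensor W V⟩ (braid R V W)
  isIso : ∀ V W : HopfRep D, IsIso (braid R V W)
  hexagon_forward : ∀ U V W : HopfRep D,
    (α_ U.X V.X W.X).hom ≫ braid R U ⟨_, _, h.tensor V W⟩ ≫ (α_ V.X W.X U.X).hom =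
      braid R U V ▷ W.X ≫ (α_ V.X U.X W.X).hom ≫ V.X ◁ braid R U W
  hexagon_reverse : ∀ U V W : HopfRep D,
    (α_ U.X V.X W.X).inv ≫ braid R ⟨_, _, h.tensor U V⟩ W ≫ (α_ W.X U.X V.X).inv =
      U.X ◁ braid R V W ≫ (α_ U.X W.X V.X).inv ≫ braid R U W ▷ V.X

lemma braid_naturality (R : 𝟙_ C ⟶ D ⊗ D) {V₁ V₂ W₁ W₂ : HopfRep D} (f : V₁ ⟶ V₂) (g : W₁ ⟶ W₂) :
    (f.hom ⊗ₘ g.hom) ≫ braid R V₂ W₂ = braid R V₁ W₁ ≫ (g.hom ⊗ₘ f.hom) := by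
  have hf := f.isHom
  have hg := g.isHom
  rw [IsHom] at hf hg
  simp only [braid, Category.assoc, ← BraidedCategory.braiding_naturality]
  rw [leftUnitor_inv_naturality_assoc, whisker_exchange_assoc,
    reassoc_of% (tensorμ_whisker D f.hom g.hom)]
  simp only [tensorHom_comp_tensorHom_assoc, hf, hg]

/-- The braided monoidal category of modules. -/
@[reducible] def braided (h : IsMonoidal D) (R : 𝟙_ C ⟶ D ⊗ D) (h' : IsBraided h R) :
    letI := monoidal h
    BraidedCategory (HopfRep D) :=
  letI := monoidal h
  { braiding := fun V W =>
      haveI := h'.isIso V W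
      mkIso (V := V ⊗ W) (W := W ⊗ V) (asIso (braid R V W)) (h'.isHom V W)
    braiding_naturality_right := fun V _ _ f => hom_ext (by
      have := braid_naturality R (𝟙 V) f; rw [id_hom, id_tensorHom, tensorHom_id] at this; exact this)
    braiding_naturality_left := fun f W => hom_ext (by
      have := braid_naturality R f (𝟙 W); rw [id_hom, id_tensorHom, tensorHom_id] at this; exact this)
    hexagon_forward := fun U V W => hom_ext (h'.hexagon_forward U V W)
    hexagon_reverse := fun U V W => hom_ext (h'.hexagon_reverse U V W) }

/-- The functor to modules given by an action of `D`, natural in `X`, on the objects `U X`. -/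
@[simps] def lift {A : Type*} [Category* A] (U : A ⥤ C) (act : ∀ X, D ⊗ U.obj X ⟶ U.obj X)
    (h : ∀ X, IsAction D (U.obj X) (act X))
    (nat : ∀ {X Y : A} (f : X ⟶ Y), act X ≫ U.map f = D ◁ U.map f ≫ act Y) : A ⥤ HopfRep D where
  obj X := ⟨U.obj X, act X, h X⟩
  map f := ⟨U.map f, nat f⟩

end HopfRep

/-- `R ∈ D ⊗ D` is a quasitriangular structure on the Hopf algebra `D`. -/
structure IsQuasitriangular (D : C) [HopfObj D] (R : 𝟙_ C ⟶ D ⊗ D) : Prop where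
  /-- `R` is invertible in the algebra `D ⊗ D`. -/
  invertible : ∃ R' : 𝟙_ C ⟶ D ⊗ D,
    (λ_ _).inv ≫ (R ⊗ₘ R') ≫ μ[D ⊗ D] = η[D ⊗ D] ∧
    (λ_ _).inv ≫ (R' ⊗ₘ R) ≫ μ[D ⊗ D] = η[D ⊗ D]
  /-- `R Δ(x) = Δ²¹(x) R`. -/
  comm : (λ_ D).inv ≫ (R ⊗ₘ Δ[D]) ≫ μ[D ⊗ D] =
    (ρ_ D).inv ≫ ((Δ[D] ≫ (β_ D D).hom) ⊗ₘ R) ≫ μ[D ⊗ D]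
  /-- `(Δ ⊗ id)(R) = R₁₃ R₂₃`. -/
  comul_left : R ≫ Δ[D] ▷ D ≫ (α_ D D D).hom =
    (λ_ _).inv ≫ ((R ≫ D ◁ ((λ_ D).inv ≫ η[D] ▷ D)) ⊗ₘ (R ≫ (λ_ _).inv ≫ η[D] ▷ (D ⊗ D))) ≫
      μ[D ⊗ (D ⊗ D)]
  /-- `(id ⊗ Δ)(R) = R₁₃ R₁₂`. -/
  comul_right : R ≫ D ◁ Δ[D] =
    (λ_ _).inv ≫ ((R ≫ D ◁ ((λ_ D).inv ≫ η[D] ▷ D)) ⊗ₘ (R ≫ D ◁ ((ρ_ D).inv ≫ D ◁ η[D]))) ≫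
      μ[D ⊗ (D ⊗ D)]

/-- A matched pair of Hopf algebras `(B, A)`: a left action `▷ : A ⊗ B ⟶ B` and a right action
`◁ : A ⊗ B ⟶ A`, compatible with the Hopf algebra structures. -/
structure IsMatchedPair (B A : C) [HopfObj B] [HopfObj A] (lact : A ⊗ B ⟶ B)
    (ract : A ⊗ B ⟶ A) : Prop where
  /-- `▷` is a left action of `A` on `B`. -/
  isAction : IsAction A B lact
  /-- `a ◁ 1 = a`. -/
  ract_one : A ◁ η[B] ≫ ract = (ρ_ A).hom
  /-- `a ◁ (b b') = (a ◁ b) ◁ b'`. -/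
  ract_mul : A ◁ μ[B] ≫ ract = (α_ A B B).inv ≫ ract ▷ B ≫ ract
  /-- `Δ(a ▷ b) = (a₁ ▷ b₁) ⊗ (a₂ ▷ b₂)`. -/
  lact_comul : lact ≫ Δ[B] = (Δ[A] ⊗ₘ Δ[B]) ≫ tensorμ A A B B ≫ (lact ⊗ₘ lact)
  /-- `ε(a ▷ b) = ε(a) ε(b)`. -/
  lact_counit : lact ≫ ε[B] = (ε[A] ⊗ₘ ε[B]) ≫ (λ_ _).hom
  /-- `Δ(a ◁ b) = (a₁ ◁ b₁) ⊗ (a₂ ◁ b₂)`. -/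
  ract_comul : ract ≫ Δ[A] = (Δ[A] ⊗ₘ Δ[B]) ≫ tensorμ A A B B ≫ (ract ⊗ₘ ract)
  /-- `ε(a ◁ b) = ε(a) ε(b)`. -/
  ract_counit : ract ≫ ε[A] = (ε[A] ⊗ₘ ε[B]) ≫ (λ_ _).hom
  /-- `a ▷ 1 = ε(a) 1`. -/
  lact_one : A ◁ η[B] ≫ lact = (ρ_ A).hom ≫ ε[A] ≫ η[B]
  /-- `1 ◁ b = ε(b) 1`. -/
  one_ract : η[A] ▷ B ≫ ract = (λ_ B).hom ≫ ε[B] ≫ η[A]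
  /-- `a ▷ (b b') = (a₁ ▷ b₁) ((a₂ ◁ b₂) ▷ b')`. -/
  lact_mul : A ◁ μ[B] ≫ lact = (α_ A B B).inv ≫
    ((Δ[A] ⊗ₘ Δ[B]) ≫ tensorμ A A B B ≫ (lact ⊗ₘ ract)) ▷ B ≫ (α_ B A B).hom ≫
      B ◁ lact ≫ μ[B]
  /-- `(a a') ◁ b = (a ◁ (a'₁ ▷ b₁)) (a'₂ ◁ b₂)`. -/
  mul_ract : μ[A] ▷ B ≫ ract = (α_ A A B).hom ≫
    A ◁ ((Δ[A] ⊗ₘ Δ[B]) ≫ tensorμ A A B B ≫ (lact ⊗ₘ ract)) ≫ (α_ A B A).inv ≫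
      ract ▷ A ≫ μ[A]
  /-- `(a₁ ▷ b₁) ⊗ (a₂ ◁ b₂) = (a₂ ▷ b₂) ⊗ (a₁ ◁ b₁)`. -/
  compat : (Δ[A] ⊗ₘ Δ[B]) ≫ tensorμ A A B B ≫ (lact ⊗ₘ ract) =
    ((Δ[A] ≫ (β_ A A).hom) ⊗ₘ (Δ[B] ≫ (β_ B B).hom)) ≫ tensorμ A A B B ≫ (lact ⊗ₘ ract)

/-- The underlying object `B ⊗ A` of the double cross product of `B` and `A`. -/
def DoubleCross (B A : C) : C := B ⊗ A

/-- The inclusion `b ↦ b ⊗ 1`. -/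
def inl (B A : C) [HopfObj B] [HopfObj A] : B ⟶ DoubleCross B A := (ρ_ B).inv ≫ B ◁ η[A]

/-- The inclusion `a ↦ 1 ⊗ a`. -/
def inr (B A : C) [HopfObj B] [HopfObj A] : A ⟶ DoubleCross B A := (λ_ A).inv ≫ η[B] ▷ A

/-- The exchange map `a ⊗ b ↦ (a₁ ▷ b₁) ⊗ (a₂ ◁ b₂)`. -/
def exchange {B A : C} [HopfObj B] [HopfObj A] (lact : A ⊗ B ⟶ B) (ract : A ⊗ B ⟶ A) :
    A ⊗ B ⟶ B ⊗ A :=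
  (Δ[A] ⊗ₘ Δ[B]) ≫ tensorμ A A B B ≫ (lact ⊗ₘ ract)

/-- The Hopf algebra structure on `B ⊗ A` is that of the double cross product:
`(b ⊗ a)(b' ⊗ a') = b (a₁ ▷ b'₁) ⊗ (a₂ ◁ b'₂) a'`, with the tensor product coalgebra structure
and with antipode `b ⊗ a ↦ (1 ⊗ S(a)) (S(b) ⊗ 1)`. -/
structure IsDoubleCrossProduct {B A : C} [HopfObj B] [HopfObj A] (lact : A ⊗ B ⟶ B)
    (ract : A ⊗ B ⟶ A) [HopfObj (DoubleCross B A)] : Prop where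
  one_eq : η[DoubleCross B A] = (λ_ _).inv ≫ (η[B] ⊗ₘ η[A])
  mul_eq : μ[DoubleCross B A] = (α_ B A (B ⊗ A)).hom ≫ B ◁ (α_ A B A).inv ≫
    B ◁ exchange lact ract ▷ A ≫ B ◁ (α_ B A A).hom ≫ (α_ B B (A ⊗ A)).inv ≫ (μ[B] ⊗ₘ μ[A])
  counit_eq : ε[DoubleCross B A] = (ε[B] ⊗ₘ ε[A]) ≫ (λ_ _).hom
  comul_eq : Δ[DoubleCross B A] = (Δ[B] ⊗ₘ Δ[A]) ≫ tensorμ B B A A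
  antipode_eq : 𝒮[DoubleCross B A] =
    (β_ B A).hom ≫ (𝒮[A] ⊗ₘ 𝒮[B]) ≫ exchange lact ract
  /-- `B` is a Hopf subalgebra. -/
  inl_isBimonHom : IsBimonHom (inl B A)
  /-- `A` is a Hopf subalgebra. -/
  inr_isBimonHom : IsBimonHom (inr B A)

/-- The element of `(B ⊗ A) ⊗ (B ⊗ A)` defined by an element of `B ⊗ A`. -/
def doubleR {B A : C} [HopfObj B] [HopfObj A] (R : 𝟙_ C ⟶ B ⊗ A) :
    𝟙_ C ⟶ DoubleCross B A ⊗ DoubleCross B A := R ≫ (inl B A ⊗ₘ inr B A)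

/-- The adjoint action `b ⊗ x ↦ b₂ x S⁻¹(b₁)`. -/
def adAct (B : C) [HopfObj B] : B ⊗ B ⟶ B :=
  (Δ[B] ≫ antipodeInv B ▷ B) ▷ B ≫ (α_ B B B).hom ≫ (β_ B (B ⊗ B)).hom ≫ mul₃ B

/-- The adjoint coaction `b ↦ b₃ S⁻¹(b₁) ⊗ b₂`. -/
def adCoact (B : C) [HopfObj B] : B ⟶ B ⊗ B :=
  comul₃ B ≫ (antipodeInv B ▷ B) ▷ B ≫ (β_ (B ⊗ B) B).hom ≫ (α_ B B B).inv ≫ μ[B] ▷ B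

section Theta

variable {B A : C} [HopfObj B] [HopfObj A] [HopfObj (DoubleCross B A)]

/-- The action of `B` on a `B ⋈ A`-module: `π_V = ξ_V ∘ (i_B ⊗ id)`. -/
def thetaAct (V : HopfRep (DoubleCross B A)) : B ⊗ V.X ⟶ V.X := inl B A ▷ V.X ≫ V.act

/-- The coaction of `B` on a `B ⋈ A`-module:
`π*_V = (id ⊗ ξ_V) ∘ (id ⊗ i_A ⊗ id) ∘ (R ⊗ id)`. -/
def thetaCoact (R : 𝟙_ C ⟶ B ⊗ A) (V : HopfRep (DoubleCross B A)) : V.X ⟶ B ⊗ V.X :=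
  (λ_ V.X).inv ≫ R ▷ V.X ≫ (α_ B A V.X).hom ≫ B ◁ (inr B A ▷ V.X ≫ V.act)

/-- The functor `Θ : (V, ξ_V) ↦ (V, π_V, π*_V)`. -/
@[simps] def theta (R : 𝟙_ C ⟶ B ⊗ A)
    (h : ∀ V : HopfRep (DoubleCross B A), IsDrinfeldYetter B V.X (thetaAct V) (thetaCoact R V)) :
    HopfRep (DoubleCross B A) ⥤ DY B where
  obj V := ⟨V.X, thetaAct V, thetaCoact R V, h V⟩
  map {V W} f := ⟨f.hom, by
    have hf := f.isHom
    rw [HopfRep.IsHom] at hf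
    constructor
    · simp only [thetaAct, Category.assoc, hf, whisker_exchange_assoc]
    · simp only [thetaCoact, Category.assoc, ← whiskerLeft_comp, hf]
      simp only [whiskerLeft_comp, ← associator_naturality_right_assoc, ← whisker_exchange_assoc,
        ← leftUnitor_inv_naturality_assoc]⟩

end Theta

end Generic

section GenericXi

universe v u

variable {C : Type u} [Category.{v} C] [MonoidalCategory C] [SymmetricCategory C]
  {B A : C} [HopfObj B]

/-- The left coadjoint action `f ▷ b = ⟨f, b₃ S⁻¹(b₁)⟩ b₂` of `A` on `B`, where
`⟨-,-⟩ : A ⊗ B ⟶ 𝟙` is a pairing: the transpose of the adjoint coaction. -/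
def coadLeft (ev : A ⊗ B ⟶ 𝟙_ C) : A ⊗ B ⟶ B :=
  A ◁ adCoact B ≫ (α_ A B B).inv ≫ ev ▷ B ≫ (λ_ B).hom

/-- The action of `A` on a Drinfeld-Yetter module: `f ⊗ v ↦ ⟨f, v₍B₎⟩ v₍V₎`. -/
def dualAct (ev : A ⊗ B ⟶ 𝟙_ C) (V : DY B) : A ⊗ V.X ⟶ V.X :=
  A ◁ V.coact ≫ (α_ A B V.X).inv ≫ ev ▷ V.X ≫ (λ_ V.X).hom

/-- The action of `B ⋈ A` on a Drinfeld-Yetter module: `ξ_V (b ⊗ f ⊗ v) = ⟨f, v₍B₎⟩ b v₍V₎`. -/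
def xiAct (ev : A ⊗ B ⟶ 𝟙_ C) (V : DY B) : DoubleCross B A ⊗ V.X ⟶ V.X :=
  (α_ B A V.X).hom ≫ B ◁ dualAct ev V ≫ V.act

lemma xiAct_natural (ev : A ⊗ B ⟶ 𝟙_ C) {V W : DY B} (f : V ⟶ W) :
    xiAct ev V ≫ f.hom = DoubleCross B A ◁ f.hom ≫ xiAct ev W := by
  have h₁ : dualAct ev V ≫ f.hom = A ◁ f.hom ≫ dualAct ev W := by
    simp only [dualAct, Category.assoc]
    rw [← leftUnitor_naturality, ← whisker_exchange_assoc, ← whiskerLeft_comp_assoc,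
      ← f.isHom.coact_comm, whiskerLeft_comp_assoc, associator_inv_naturality_right_assoc]
  change ((α_ B A V.X).hom ≫ B ◁ dualAct ev V ≫ V.act) ≫ f.hom =
    (B ⊗ A) ◁ f.hom ≫ (α_ B A W.X).hom ≫ B ◁ dualAct ev W ≫ W.act
  rw [Category.assoc, Category.assoc, f.isHom.act_comm, ← whiskerLeft_comp_assoc, h₁,
    whiskerLeft_comp_assoc, ← associator_naturality_right_assoc]

/-- The functor `Ξ : (V, π_V, π*_V) ↦ (V, ξ_V)`. -/
@[simps!] def xi [HopfObj (DoubleCross B A)] (ev : A ⊗ B ⟶ 𝟙_ C)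
    (h : ∀ V : DY B, IsAction (DoubleCross B A) V.X (xiAct ev V)) :
    DY B ⥤ HopfRep (DoubleCross B A) :=
  HopfRep.lift (DY.forget B) (xiAct ev) h (xiAct_natural ev)

end GenericXi

section FiniteDimensional

universe u

variable {k : Type u} [Field k]

open scoped TensorProduct

/-- The vector space `B* = B°`. -/
abbrev dual (B : ModuleCat.{u} k) : ModuleCat.{u} k := ModuleCat.of k (Module.Dual k B)

/-- The evaluation pairing `f ⊗ b ↦ f(b)`. -/
def evDual (B : ModuleCat.{u} k) : dual B ⊗ B ⟶ 𝟙_ (ModuleCat.{u} k) :=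
  ModuleCat.ofHom (contractLeft k B)

/-- The canonical element `R = ∑ bᵢ ⊗ bⁱ` of `B ⊗ B*`. -/
def canonicalR (B : ModuleCat.{u} k) [FiniteDimensional k B] :
    𝟙_ (ModuleCat.{u} k) ⟶ B ⊗ dual B :=
  ModuleCat.ofHom (coevaluation k B)

/-- The adjoint action of `B` on itself as a bilinear map. -/
def adBilin (B : ModuleCat.{u} k) [HopfObj B] : B →ₗ[k] B →ₗ[k] B :=
  (TensorProduct.mk k B B).compr₂ (adAct B).hom

/-- The right coadjoint action of `B` on `B*`: `(f ◁ b)(x) = f(b₂ x S⁻¹(b₁))`. -/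
def coadRight (B : ModuleCat.{u} k) [HopfObj B] : dual B ⊗ B ⟶ dual B :=
  ModuleCat.ofHom (TensorProduct.lift
    (LinearMap.mk₂ k (fun (f : Module.Dual k B) (b : B) => (f ∘ₗ adBilin B b : Module.Dual k B))
      (fun _ _ _ => rfl) (fun _ _ _ => rfl)
      (fun f b c => by rw [map_add, LinearMap.comp_add])
      (fun c f b => by rw [map_smul, LinearMap.comp_smul])))

/-- The Hopf algebra structure on `B*` is that of `B°`, the dual of `B` with opposite
coproduct. -/
structure IsOppositeDual (B : ModuleCat.{u} k) [HopfObj B] [HopfObj (dual B)] : Prop where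
  one_apply : ∀ x : B, (η[dual B].hom (1 : k) : Module.Dual k B) x = (ε[B].hom x : k)
  mul_apply : ∀ (f g : Module.Dual k B) (x : B),
    (μ[dual B].hom (f ⊗ₜ[k] g) : Module.Dual k B) x =
      TensorProduct.dualDistrib k B B (f ⊗ₜ[k] g) (Δ[B].hom x)
  counit_apply : ∀ f : Module.Dual k B, (ε[dual B].hom f : k) = f (η[B].hom (1 : k))
  comul_apply : ∀ (f : Module.Dual k B) (x y : B),
    TensorProduct.dualDistrib k B B (Δ[dual B].hom f) (x ⊗ₜ[k] y) = f (μ[B].hom (y ⊗ₜ[k] x))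

end FiniteDimensional

section TopFree

open scoped TensorProduct PowerSeries

universe u

/-- The ideal `(ħ)` of `k⟦ħ⟧`. -/
abbrev hIdeal (k : Type u) [Field k] : Ideal k⟦X⟧ := Ideal.span {(PowerSeries.X : k⟦X⟧)}

/-- Topologically free `k⟦ħ⟧`-modules with their `ħ`-adic topology: `k⟦ħ⟧`-modules which are
`ħ`-torsion free and `ħ`-adically complete and separated. Equivalently, modules which are
isomorphic to `V₀⟦ħ⟧` for some `k`-vector space `V₀`. -/
structure TopFree (k : Type u) [Field k] : Type (u + 1) where
  carrier : Type u
  [addCommGroup : AddCommGroup carrier]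
  [module : Module k⟦X⟧ carrier]
  torsionFree : ∀ v : carrier, (PowerSeries.X : k⟦X⟧) • v = 0 → v = 0
  [complete : IsAdicComplete (hIdeal k) carrier]

namespace TopFree

attribute [instance] addCommGroup module complete

variable {k : Type u} [Field k]

instance : CoeSort (TopFree k) (Type u) := ⟨carrier⟩

/-- Morphisms are `k⟦ħ⟧`-linear maps; these are automatically continuous. -/
@[ext] structure Hom (V W : TopFree k) where
  hom : V →ₗ[k⟦X⟧] W

instance : Category (TopFree k) where
  Hom V W := Hom V W
  id V := ⟨LinearMap.id⟩
  comp f g := ⟨g.hom ∘ₗ f.hom⟩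

@[ext] lemma hom_ext {V W : TopFree k} {f g : V ⟶ W} (h : f.hom = g.hom) : f = g := Hom.ext h

@[simp] lemma comp_hom {U V W : TopFree k} (f : U ⟶ V) (g : V ⟶ W) :
    (f ≫ g).hom = g.hom ∘ₗ f.hom := rfl

@[simp] lemma id_hom (U : TopFree k) : Hom.hom (𝟙 U) = LinearMap.id := rfl

lemma hIdeal_fg : (hIdeal k).FG := ⟨{PowerSeries.X}, by simp [hIdeal]⟩

section Completion

variable {M N T : Type u} [AddCommGroup M] [Module k⟦X⟧ M] [AddCommGroup N] [Module k⟦X⟧ N]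
  [AddCommGroup T] [Module k⟦X⟧ T]

lemma smul_top_iff (n : ℕ) (x : M) :
    x ∈ ((hIdeal k) ^ n • ⊤ : Submodule k⟦X⟧ M) ↔ ∃ y : M, x = (PowerSeries.X : k⟦X⟧) ^ n • y := by
  rw [hIdeal, Ideal.span_singleton_pow, Submodule.ideal_span_singleton_smul,
    Submodule.mem_smul_pointwise_iff_exists]
  simp [eq_comm]

lemma smodEq_iff (n : ℕ) (x y : M) :
    x ≡ y [SMOD ((hIdeal k) ^ n • ⊤ : Submodule k⟦X⟧ M)] ↔
      ∃ z : M, x - y = (PowerSeries.X : k⟦X⟧) ^ n • z := by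
  rw [SModEq.sub_mem, smul_top_iff]

lemma isAdicComplete_of
    (haus : ∀ x : M, (∀ n : ℕ, ∃ y : M, x = (PowerSeries.X : k⟦X⟧) ^ n • y) → x = 0)
    (prec : ∀ f : ℕ → M,
      (∀ m n, m ≤ n → ∃ y : M, f m - f n = (PowerSeries.X : k⟦X⟧) ^ m • y) →
        ∃ l : M, ∀ n, ∃ y : M, f n - l = (PowerSeries.X : k⟦X⟧) ^ n • y) :
    IsAdicComplete (hIdeal k) M :=
  { haus' := fun x hx => haus x fun n => by simpa using (smodEq_iff n x 0).1 (hx n)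
    prec' := fun f hf => by
      obtain ⟨l, hl⟩ := prec f fun m n h => (smodEq_iff m _ _).1 (hf h)
      exact ⟨l, fun n => (smodEq_iff n _ _).2 (hl n)⟩ }

lemma completion_hom_ext [IsHausdorff (hIdeal k) T]
    {f g : AdicCompletion (hIdeal k) M →ₗ[k⟦X⟧] T}
    (h : ∀ m, f (AdicCompletion.of _ M m) = g (AdicCompletion.of _ M m)) : f = g := by
  refine LinearMap.ext fun x => ?_
  rw [IsHausdorff.eq_iff_smodEq (I := hIdeal k)]
  intro n
  obtain ⟨m, hm⟩ := Submodule.mkQ_surjective _ (AdicCompletion.eval (hIdeal k) M n x)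
  have hx : x - AdicCompletion.of _ M m ∈
      ((hIdeal k) ^ n • ⊤ : Submodule k⟦X⟧ (AdicCompletion (hIdeal k) M)) := by
    rw [AdicCompletion.pow_smul_top_eq_ker_eval hIdeal_fg, LinearMap.mem_ker, map_sub,
      AdicCompletion.eval_of, hm, sub_self]
  obtain ⟨y, hy⟩ := (smul_top_iff n _).1 hx
  rw [SModEq.sub_mem, smul_top_iff]
  refine ⟨f y - g y, ?_⟩
  have hxe : x = AdicCompletion.of _ M m + (PowerSeries.X : k⟦X⟧) ^ n • y := by
    rw [← hy]; abel
  rw [hxe, map_add, map_add, h, smul_sub, ← map_smul, ← map_smul]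
  abel

/-- The extension of a linear map to a complete module to the completion of its source. -/
def completionLift [IsAdicComplete (hIdeal k) T] :
    (M →ₗ[k⟦X⟧] T) →ₗ[k⟦X⟧] (AdicCompletion (hIdeal k) M →ₗ[k⟦X⟧] T) where
  toFun f := (AdicCompletion.ofLinearEquiv (hIdeal k) T).symm.toLinearMap ∘ₗ
    AdicCompletion.map (hIdeal k) f
  map_add' f g := completion_hom_ext fun m => by simp [AdicCompletion.map_of]
  map_smul' c f := completion_hom_ext fun m => by simp [AdicCompletion.map_of]

@[simp] lemma completionLift_of [IsAdicComplete (hIdeal k) T] (f : M →ₗ[k⟦X⟧] T) (m : M) :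
    completionLift f (AdicCompletion.of _ M m) = f m := by
  simp [completionLift, AdicCompletion.map_of]

lemma completion_torsionFree (h : ∀ m : M, (PowerSeries.X : k⟦X⟧) • m = 0 → m = 0)
    (x : AdicCompletion (hIdeal k) M) (hx : (PowerSeries.X : k⟦X⟧) • x = 0) : x = 0 := by
  ext n
  obtain ⟨m, hm⟩ := Submodule.mkQ_surjective _ (AdicCompletion.eval (hIdeal k) M (n + 1) x)
  have h1 : (Submodule.mkQ ((hIdeal k) ^ (n + 1) • ⊤ : Submodule k⟦X⟧ M))
      ((PowerSeries.X : k⟦X⟧) • m) = 0 := by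
    rw [map_smul, hm, ← map_smul, hx, map_zero]
  rw [Submodule.mkQ_apply, Submodule.Quotient.mk_eq_zero, smul_top_iff] at h1
  obtain ⟨y, hy⟩ := h1
  have h2 : m = (PowerSeries.X : k⟦X⟧) ^ n • y := by
    have := h (m - (PowerSeries.X : k⟦X⟧) ^ n • y) (by rw [smul_sub, hy, smul_smul, pow_succ']; simp)
    exact sub_eq_zero.1 this
  have h3 : AdicCompletion.eval (hIdeal k) M n x = Submodule.mkQ _ m :=
    (AdicCompletion.transitionMap_comp_eval_apply (hIdeal k) M (Nat.le_succ n) x).symm.trans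
      (congrArg (AdicCompletion.transitionMap (hIdeal k) M (Nat.le_succ n)) hm.symm)
  change AdicCompletion.eval (hIdeal k) M n x = 0
  rw [h3, Submodule.mkQ_apply, Submodule.Quotient.mk_eq_zero, smul_top_iff]
  exact ⟨y, h2⟩

end Completion

instance isTorsionFree (V : TopFree k) : Module.IsTorsionFree k⟦X⟧ V := by
  refine Module.IsTorsionFree.of_smul_eq_zero fun r v h => ?_
  by_cases hr : r = 0
  · exact Or.inl hr
  refine Or.inr ?_
  obtain ⟨u, hu⟩ : ∃ u : k⟦X⟧ˣ, r = PowerSeries.X ^ r.order.toNat * (u : k⟦X⟧) :=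
    ⟨PowerSeries.Unit_of_divided_by_X_pow_order r, by
      rw [PowerSeries.Unit_of_divided_by_X_pow_order_nonzero hr]
      exact PowerSeries.X_pow_order_mul_divXPowOrder.symm⟩
  rw [hu, mul_comm, mul_smul] at h
  have h' : (PowerSeries.X : k⟦X⟧) ^ r.order.toNat • v = 0 := by
    simpa using congrArg (fun w => (↑u⁻¹ : k⟦X⟧) • w) h
  revert h'
  generalize r.order.toNat = n
  induction n with
  | zero => simp
  | succ n ih =>
    intro h'
    exact ih (V.torsionFree _ (by rw [smul_smul, ← pow_succ', h']))

lemma tensor_torsionFree (V W : TopFree k) (x : V ⊗[k⟦X⟧] W)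
    (hx : (PowerSeries.X : k⟦X⟧) • x = 0) : x = 0 := by
  have : Module.IsTorsionFree k⟦X⟧ (V ⊗[k⟦X⟧] W) := inferInstance
  exact (smul_eq_zero.1 hx).resolve_left PowerSeries.X_ne_zero

/-- The completed tensor product. -/
@[simps carrier] def tensorObj (V W : TopFree k) : TopFree k where
  carrier := AdicCompletion (hIdeal k) (V ⊗[k⟦X⟧] W)
  torsionFree := completion_torsionFree (tensor_torsionFree V W)
  complete := AdicCompletion.isAdicComplete hIdeal_fg

/-- The unit object `k⟦ħ⟧`. -/
@[simps carrier] def unitObj (k : Type u) [Field k] : TopFree k where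
  carrier := k⟦X⟧
  torsionFree v h := by simpa using h

/-- The element `v ⊗ w` of the completed tensor product. -/
def tmul {V W : TopFree k} : V →ₗ[k⟦X⟧] W →ₗ[k⟦X⟧] tensorObj V W :=
  (TensorProduct.mk k⟦X⟧ V W).compr₂ (AdicCompletion.of (hIdeal k) (V ⊗[k⟦X⟧] W))

lemma tensor_ext {V W T : TopFree k} {f g : tensorObj V W →ₗ[k⟦X⟧] T}
    (h : ∀ v w, f (tmul v w) = g (tmul v w)) : f = g := by
  refine completion_hom_ext fun m => ?_
  change (f ∘ₗ AdicCompletion.of (hIdeal k) (V ⊗[k⟦X⟧] W)) m =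
    (g ∘ₗ AdicCompletion.of (hIdeal k) (V ⊗[k⟦X⟧] W)) m
  exact LinearMap.congr_fun (TensorProduct.ext' h) m

/-- The linear map on the completed tensor product with given bilinear restriction. -/
def tensorLift {V W T : TopFree k} :
    (V →ₗ[k⟦X⟧] W →ₗ[k⟦X⟧] T) →ₗ[k⟦X⟧] tensorObj V W →ₗ[k⟦X⟧] T :=
  completionLift ∘ₗ (TensorProduct.lift.equiv (.id k⟦X⟧) V W T).toLinearMap

@[simp] lemma tensorLift_tmul {V W T : TopFree k} (f : V →ₗ[k⟦X⟧] W →ₗ[k⟦X⟧] T) (v : V) (w : W) :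
    tensorLift f (tmul v w) = f v w :=
  completionLift_of (TensorProduct.lift f) (v ⊗ₜ w)

lemma tensor_ext₃ {U V W T : TopFree k} {f g : tensorObj (tensorObj U V) W →ₗ[k⟦X⟧] T}
    (h : ∀ u v w, f (tmul (tmul u v) w) = g (tmul (tmul u v) w)) : f = g := by
  refine tensor_ext fun x w => ?_
  have := tensor_ext (f := f ∘ₗ (tmul.flip w)) (g := g ∘ₗ (tmul.flip w)) fun u v => h u v w
  exact LinearMap.congr_fun this x

lemma tensor_ext₃' {U V W T : TopFree k} {f g : tensorObj U (tensorObj V W) →ₗ[k⟦X⟧] T}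
    (h : ∀ u v w, f (tmul u (tmul v w)) = g (tmul u (tmul v w))) : f = g := by
  refine tensor_ext fun u x => ?_
  have := tensor_ext (f := f ∘ₗ (tmul u)) (g := g ∘ₗ (tmul u)) fun v w => h u v w
  exact LinearMap.congr_fun this x

lemma tensor_ext₄ {U V W Z T : TopFree k}
    {f g : tensorObj (tensorObj (tensorObj U V) W) Z →ₗ[k⟦X⟧] T}
    (h : ∀ u v w z, f (tmul (tmul (tmul u v) w) z) = g (tmul (tmul (tmul u v) w) z)) : f = g := by
  refine tensor_ext fun x z => ?_
  have := tensor_ext₃ (f := f ∘ₗ (tmul.flip z)) (g := g ∘ₗ (tmul.flip z)) fun u v w => h u v w z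
  exact LinearMap.congr_fun this x

/-- The tensor product of two morphisms. -/
def tensorMap {V V' W W' : TopFree k} (f : V →ₗ[k⟦X⟧] V') (g : W →ₗ[k⟦X⟧] W') :
    tensorObj V W →ₗ[k⟦X⟧] tensorObj V' W' :=
  tensorLift (tmul.compl₁₂ f g)

@[simp] lemma tensorMap_tmul {V V' W W' : TopFree k} (f : V →ₗ[k⟦X⟧] V') (g : W →ₗ[k⟦X⟧] W')
    (v : V) (w : W) : tensorMap f g (tmul v w) = tmul (f v) (g w) := by
  simp [tensorMap]

/-- The associativity constraint `(u ⊗ v) ⊗ w ↦ u ⊗ (v ⊗ w)`. -/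
def assocMap (U V W : TopFree k) :
    tensorObj (tensorObj U V) W →ₗ[k⟦X⟧] tensorObj U (tensorObj V W) :=
  tensorLift (LinearMap.flip (tensorLift ∘ₗ
    { toFun := fun w => tmul.compl₂ (tmul.flip w)
      map_add' := by intros; ext; simp
      map_smul' := by intros; ext; simp }))

@[simp] lemma assocMap_tmul {U V W : TopFree k} (u : U) (v : V) (w : W) :
    assocMap U V W (tmul (tmul u v) w) = tmul u (tmul v w) := by
  simp [assocMap]

/-- The inverse of the associativity constraint. -/
def assocInv (U V W : TopFree k) :
    tensorObj U (tensorObj V W) →ₗ[k⟦X⟧] tensorObj (tensorObj U V) W :=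
  tensorLift (tensorLift ∘ₗ
    { toFun := fun u => tmul ∘ₗ tmul u
      map_add' := by intros; ext; simp
      map_smul' := by intros; ext; simp })

@[simp] lemma assocInv_tmul {U V W : TopFree k} (u : U) (v : V) (w : W) :
    assocInv U V W (tmul u (tmul v w)) = tmul (tmul u v) w := by
  simp [assocInv]

/-- An element of the unit object as a power series. -/
def toSeries (c : unitObj k) : k⟦X⟧ := c

/-- The multiplication `c ⊗ v ↦ c v`. -/
def unitSMul (V : TopFree k) : unitObj k →ₗ[k⟦X⟧] V →ₗ[k⟦X⟧] V := LinearMap.lsmul k⟦X⟧ V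

@[simp] lemma unitSMul_apply (V : TopFree k) (c : unitObj k) (v : V) :
    unitSMul V c v = toSeries c • v := rfl

/-- The unit element of the unit object. -/
def unitOne (k : Type u) [Field k] : unitObj k := (1 : k⟦X⟧)

@[simp] lemma toSeries_unitOne : toSeries (unitOne k) = 1 := rfl

@[simp] lemma toSeries_smul_unitOne (c : unitObj k) : toSeries c • unitOne k = c :=
  mul_one (M := k⟦X⟧) c

instance : MonoidalCategoryStruct (TopFree k) where
  tensorObj := tensorObj
  tensorUnit := unitObj k
  tensorHom f g := ⟨tensorMap f.hom g.hom⟩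
  whiskerLeft V _ _ f := ⟨tensorMap LinearMap.id f.hom⟩
  whiskerRight f W := ⟨tensorMap f.hom LinearMap.id⟩
  associator U V W :=
    { hom := ⟨assocMap U V W⟩
      inv := ⟨assocInv U V W⟩
      hom_inv_id := hom_ext (tensor_ext₃ fun u v w => by simp)
      inv_hom_id := hom_ext (tensor_ext₃' fun u v w => by simp) }
  leftUnitor V :=
    { hom := ⟨tensorLift (unitSMul V)⟩
      inv := ⟨tmul (unitOne k)⟩
      hom_inv_id := hom_ext (tensor_ext fun c v => by
        have h := LinearMap.congr_fun (map_smul (tmul (W := V)) (toSeries c) (unitOne k)) v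
        simpa using h.symm)
      inv_hom_id := hom_ext (LinearMap.ext fun v => by simp) }
  rightUnitor V :=
    { hom := ⟨tensorLift (unitSMul V).flip⟩
      inv := ⟨tmul.flip (unitOne k)⟩
      hom_inv_id := hom_ext (tensor_ext fun v c => by
        have h := map_smul (tmul v) (toSeries c) (unitOne k)
        simpa using h.symm)
      inv_hom_id := hom_ext (LinearMap.ext fun v => by simp) }

/-- The element `v ⊗ w` of the completed tensor product `V ⊗ W`. -/
def pure {V W : TopFree k} (v : V) (w : W) : (V ⊗ W : TopFree k) := tmul v w

section Simp

variable {U V W V' W' Z T : TopFree k}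

lemma pure_ext {f g : V ⊗ W ⟶ T} (h : ∀ v w, f.hom (pure v w) = g.hom (pure v w)) : f = g :=
  hom_ext (tensor_ext h)

lemma pure_ext₃ {f g : (U ⊗ V) ⊗ W ⟶ T}
    (h : ∀ u v w, f.hom (pure (pure u v) w) = g.hom (pure (pure u v) w)) : f = g :=
  hom_ext (tensor_ext₃ h)

lemma pure_ext₃' {f g : U ⊗ (V ⊗ W) ⟶ T}
    (h : ∀ u v w, f.hom (pure u (pure v w)) = g.hom (pure u (pure v w))) : f = g :=
  hom_ext (tensor_ext₃' h)

lemma pure_ext₄ {f g : ((U ⊗ V) ⊗ W) ⊗ Z ⟶ T}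
    (h : ∀ u v w z, f.hom (pure (pure (pure u v) w) z) = g.hom (pure (pure (pure u v) w) z)) :
    f = g :=
  hom_ext (tensor_ext₄ h)

@[simp] lemma pure_smul_left (c : k⟦X⟧) (v : V) (w : W) : pure (c • v) w = c • pure v w :=
  LinearMap.congr_fun (map_smul tmul c v) w

@[simp] lemma pure_smul_right (c : k⟦X⟧) (v : V) (w : W) : pure v (c • w) = c • pure v w :=
  map_smul (tmul v) c w

@[simp] lemma tensorHom_pure (f : V ⟶ V') (g : W ⟶ W') (v : V) (w : W) :
    (f ⊗ₘ g).hom (pure v w) = pure (f.hom v) (g.hom w) := tensorMap_tmul _ _ _ _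

@[simp] lemma whiskerLeft_pure (f : W ⟶ W') (v : V) (w : W) :
    (V ◁ f).hom (pure v w) = pure v (f.hom w) := tensorMap_tmul _ _ _ _

@[simp] lemma whiskerRight_pure (f : V ⟶ V') (v : V) (w : W) :
    (f ▷ W).hom (pure v w) = pure (f.hom v) w := tensorMap_tmul _ _ _ _

@[simp] lemma associator_hom_pure (u : U) (v : V) (w : W) :
    (α_ U V W).hom.hom (pure (pure u v) w) = pure u (pure v w) := assocMap_tmul _ _ _

@[simp] lemma associator_inv_pure (u : U) (v : V) (w : W) :
    (α_ U V W).inv.hom (pure u (pure v w)) = pure (pure u v) w := assocInv_tmul _ _ _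

@[simp] lemma leftUnitor_hom_pure (c : (𝟙_ (TopFree k) : TopFree k)) (v : V) :
    (λ_ V).hom.hom (pure c v) = toSeries c • v := tensorLift_tmul _ _ _

@[simp] lemma rightUnitor_hom_pure (c : (𝟙_ (TopFree k) : TopFree k)) (v : V) :
    (ρ_ V).hom.hom (pure v c) = toSeries c • v := tensorLift_tmul _ _ _

end Simp

instance : MonoidalCategory (TopFree k) where
  tensorHom_def f g := pure_ext fun v w => by simp
  id_tensorHom_id V W := pure_ext fun v w => by simp
  tensorHom_comp_tensorHom f₁ f₂ g₁ g₂ := pure_ext fun v w => by simp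
  whiskerLeft_id V W := pure_ext fun v w => by simp
  id_whiskerRight V W := pure_ext fun v w => by simp
  associator_naturality f g h := pure_ext₃ fun u v w => by simp
  leftUnitor_naturality f := pure_ext fun c v => by simp
  rightUnitor_naturality f := pure_ext fun c v => by simp
  pentagon U V W Z := pure_ext₄ fun u v w z => by simp
  triangle U V := pure_ext₃ fun u c v => by simp

/-- The symmetry `v ⊗ w ↦ w ⊗ v`. -/
def swapMap (V W : TopFree k) : V ⊗ W ⟶ W ⊗ V := ⟨tensorLift tmul.flip⟩

@[simp] lemma swapMap_pure {V W : TopFree k} (v : V) (w : W) :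
    (swapMap V W).hom (pure v w) = pure w v := tensorLift_tmul _ v w

@[simps] instance : BraidedCategory (TopFree k) where
  braiding V W :=
    { hom := swapMap V W
      inv := swapMap W V
      hom_inv_id := pure_ext fun v w => by simp
      inv_hom_id := pure_ext fun v w => by simp }
  braiding_naturality_right V _ _ f := pure_ext fun v w => by simp
  braiding_naturality_left f W := pure_ext fun v w => by simp
  hexagon_forward U V W := pure_ext₃ fun u v w => by simp
  hexagon_reverse U V W := pure_ext₃' fun u v w => by simp

@[simp] lemma braiding_hom_pure {V W : TopFree k} (v : V) (w : W) :
    (β_ V W).hom.hom (pure v w) = pure w v := swapMap_pure v w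

instance : SymmetricCategory (TopFree k) where
  symmetry V W := pure_ext fun v w => by simp

end TopFree
end TopFree

namespace TopFree

open scoped TensorProduct PowerSeries

universe u

variable {k : Type u} [Field k]

/-- `v = w` modulo `ħⁿ`. -/
def CongMod {V : TopFree k} (n : ℕ) (v w : V) : Prop :=
  ∃ z : V, v = w + (PowerSeries.X : k⟦X⟧) ^ n • z

/-- The tensor power `(⋯ (𝟙 ⊗ V) ⊗ ⋯) ⊗ V`. -/
def tpow (V : TopFree k) : ℕ → TopFree k
  | 0 => 𝟙_ (TopFree k)
  | n + 1 => tpow V n ⊗ V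

/-- The tensor power of a morphism. -/
def tpowMap {V W : TopFree k} (f : V ⟶ W) : ∀ n, tpow V n ⟶ tpow W n
  | 0 => 𝟙 (𝟙_ (TopFree k))
  | n + 1 => tpowMap f n ⊗ₘ f

section Hopf

variable (B : TopFree k) [HopfObj B]

/-- The unit element. -/
def oneElt : B := η[B].hom (unitOne k)

variable {B} in
/-- The product of two elements. -/
def mulElt (x y : B) : B := μ[B].hom (pure x y)

/-- The iterated coproduct `Δ⁽ⁿ⁾ : B ⟶ B^{⊗ n}`, with `Δ⁽⁰⁾ = ε`. -/
def iterComul : ∀ n, B ⟶ tpow B n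
  | 0 => ε[B]
  | n + 1 => Δ[B] ≫ iterComul n ▷ B

/-- The projection `id - η ∘ ε`. -/
def reduced : B ⟶ B := ⟨LinearMap.id - (ε[B] ≫ η[B]).hom⟩

/-- `B` is a quantisation of `U𝔟`, that is `B / ħ B` is isomorphic to `U𝔟` as a Hopf algebra. The
isomorphism is given as a surjection `p : B → U𝔟` with kernel `ħ B`; it is compatible with the
coproducts if any lift of an element of `𝔟` is primitive modulo `ħ`. -/
def IsQUE (b : Type u) [LieRing b] [LieAlgebra k b] : Prop :=
  ∃ p : B →ₛₗ[PowerSeries.constantCoeff (R := k)] UniversalEnvelopingAlgebra k b,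
    Function.Surjective p ∧
    (∀ a, p a = 0 ↔ ∃ a' : B, a = (PowerSeries.X : k⟦X⟧) • a') ∧
    p (oneElt B) = 1 ∧
    (∀ a a', p (mulElt a a') = p a * p a') ∧
    ∀ (a : B) (x : b), p a = UniversalEnvelopingAlgebra.ι k x →
      CongMod 1 (Δ[B].hom a) (pure a (oneElt B) + pure (oneElt B) a)

/-- The quantised formal series Hopf algebra
`B' = {b ∈ B | (id - η ∘ ε)^{⊗ n} (Δ⁽ⁿ⁾ b) ∈ ħⁿ B^{⊗ n} for all n ≥ 0}`. -/
def prime : Submodule k⟦X⟧ B where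
  carrier := {b | ∀ n, ∃ y : tpow B n,
    (iterComul B n ≫ tpowMap (reduced B) n).hom b = (PowerSeries.X : k⟦X⟧) ^ n • y}
  zero_mem' n := ⟨0, by simp⟩
  add_mem' h h' n := by
    obtain ⟨y, hy⟩ := h n
    obtain ⟨y', hy'⟩ := h' n
    exact ⟨y + y', by rw [map_add, hy, hy', smul_add]⟩
  smul_mem' c b h n := by
    obtain ⟨y, hy⟩ := h n
    exact ⟨c • y, by rw [map_smul, hy, smul_comm]⟩

/-- A linear functional on `B'` is continuous for the topology on `B'` induced by the `ħ`-adic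
topology of `B`, and the `ħ`-adic topology of `k⟦ħ⟧`. -/
def IsContinuousFunctional (f : prime B →ₗ[k⟦X⟧] k⟦X⟧) : Prop :=
  ∀ n : ℕ, ∃ m : ℕ, ∀ x : prime B,
    (∃ y : B, (x : B) = (PowerSeries.X : k⟦X⟧) ^ m • y) →
      ∃ c : k⟦X⟧, f x = (PowerSeries.X : k⟦X⟧) ^ n * c

/-- The continuous linear functionals on `B'`. -/
def continuousFunctionals : Submodule k⟦X⟧ (prime B →ₗ[k⟦X⟧] k⟦X⟧) where
  carrier := {f | IsContinuousFunctional B f}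
  zero_mem' n := ⟨0, fun _ _ => ⟨0, by simp⟩⟩
  add_mem' {f g} hf hg n := by
    obtain ⟨m, hm⟩ := hf n
    obtain ⟨m', hm'⟩ := hg n
    refine ⟨m + m', fun x ⟨y, hy⟩ => ?_⟩
    obtain ⟨c, hc⟩ := hm x ⟨_, by rw [hy, pow_add, mul_smul]⟩
    obtain ⟨c', hc'⟩ := hm' x ⟨_, by rw [hy, add_comm m, pow_add, mul_smul]⟩
    exact ⟨c + c', by rw [LinearMap.add_apply, hc, hc', mul_add]⟩
  smul_mem' a f hf n := by
    obtain ⟨m, hm⟩ := hf n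
    refine ⟨m, fun x hx => ?_⟩
    obtain ⟨c, hc⟩ := hm x hx
    exact ⟨a * c, by rw [LinearMap.smul_apply, hc, smul_eq_mul]; ring⟩

variable {B} in
lemma exists_eq_pow_smul (n : ℕ) (h : continuousFunctionals B)
    (hn : ∀ x, ∃ c : k⟦X⟧, h.1 x = (PowerSeries.X : k⟦X⟧) ^ n * c) :
    ∃ g : continuousFunctionals B, h = (PowerSeries.X : k⟦X⟧) ^ n • g := by
  choose c hc using hn
  have hX : (PowerSeries.X : k⟦X⟧) ^ n ≠ 0 := pow_ne_zero _ PowerSeries.X_ne_zero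
  let g : prime B →ₗ[k⟦X⟧] k⟦X⟧ :=
    { toFun := c
      map_add' := fun x y => mul_left_cancel₀ hX (by rw [← hc, map_add, hc, hc, mul_add])
      map_smul' := fun a x => mul_left_cancel₀ hX (by
        rw [← hc, map_smul, hc, smul_eq_mul, RingHom.id_apply, smul_eq_mul]; ring) }
  refine ⟨⟨g, fun N => ?_⟩, Subtype.ext (LinearMap.ext hc)⟩
  obtain ⟨m, hm⟩ := h.2 (n + N)
  refine ⟨m, fun x hx => ?_⟩
  obtain ⟨d, hd⟩ := hm x hx
  refine ⟨d, mul_left_cancel₀ hX ?_⟩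
  rw [← mul_assoc, ← pow_add, ← hd]
  exact (hc x).symm

lemma isAdicComplete_continuousFunctionals :
    IsAdicComplete (hIdeal k) (continuousFunctionals B) := by
  have haus (x y : k⟦X⟧) (h : ∀ n : ℕ, ∃ c : k⟦X⟧, x - y = PowerSeries.X ^ n * c) : x = y := by
    rw [IsHausdorff.eq_iff_smodEq (I := hIdeal k)]
    exact fun n => (smodEq_iff n x y).2 (h n)
  refine isAdicComplete_of (fun f hf => ?_) (fun f hf => ?_)
  · refine Subtype.ext (LinearMap.ext fun x => haus _ 0 fun n => ?_)
    obtain ⟨g, hg⟩ := hf n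
    exact ⟨g.1 x, by rw [sub_zero, hg]; rfl⟩
  · have h (x : prime B) := IsPrecomplete.prec (I := hIdeal k) (M := k⟦X⟧) inferInstance
      (f := fun n => (f n).1 x) fun {m n} hmn => (smodEq_iff m _ _).2 (by
        obtain ⟨g, hg⟩ := hf m n hmn
        exact ⟨g.1 x, LinearMap.congr_fun (congrArg Subtype.val hg) x⟩)
    choose l hl using h
    have hl' (n : ℕ) (x : prime B) : ∃ c : k⟦X⟧, (f n).1 x - l x = PowerSeries.X ^ n * c :=
      (smodEq_iff n _ _).1 (hl x n)
    let L : prime B →ₗ[k⟦X⟧] k⟦X⟧ :=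
      { toFun := l
        map_add' := fun x y => haus _ _ fun n => by
          obtain ⟨c₁, h₁⟩ := hl' n x
          obtain ⟨c₂, h₂⟩ := hl' n y
          obtain ⟨c₃, h₃⟩ := hl' n (x + y)
          rw [map_add] at h₃
          exact ⟨c₁ + c₂ - c₃, by linear_combination h₁ + h₂ - h₃⟩
        map_smul' := fun a x => haus _ _ fun n => by
          obtain ⟨c₁, h₁⟩ := hl' n x
          obtain ⟨c₂, h₂⟩ := hl' n (a • x)
          rw [map_smul, smul_eq_mul] at h₂
          rw [RingHom.id_apply, smul_eq_mul]
          exact ⟨a * c₁ - c₂, by linear_combination a * h₁ - h₂⟩ }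
    have hL : L ∈ continuousFunctionals B := fun n => by
      obtain ⟨m, hm⟩ := (f n).2 n
      refine ⟨m, fun x hx => ?_⟩
      obtain ⟨c, hc⟩ := hm x hx
      obtain ⟨d, hd⟩ := hl' n x
      exact ⟨c - d, by change l x = _; linear_combination hc - hd⟩
    refine ⟨⟨L, hL⟩, fun n => ?_⟩
    exact exists_eq_pow_smul n (f n - ⟨L, hL⟩) fun x => hl' n x

/-- The continuous dual of `B'`, with its `ħ`-adic topology. -/
@[simps carrier] def contDual : TopFree k where
  carrier := continuousFunctionals B
  torsionFree f hf := by
    ext1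
    refine LinearMap.ext fun x => ?_
    have h := LinearMap.congr_fun (congrArg Subtype.val hf) x
    exact (mul_eq_zero.1 h).resolve_left PowerSeries.X_ne_zero
  complete := isAdicComplete_continuousFunctionals B

variable {B}

/-- The functional on `B'` given by an element of its continuous dual. -/
def toFunctional (f : contDual B) : prime B →ₗ[k⟦X⟧] k⟦X⟧ :=
  (show continuousFunctionals B from f).1

/-- The canonical map `B' ⊗ V → B ⊗ V` from the algebraic tensor product. -/
def incl (V : TopFree k) : prime B ⊗[k⟦X⟧] V →ₗ[k⟦X⟧] (B ⊗ V : TopFree k) :=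
  TensorProduct.lift ((tmul : B →ₗ[k⟦X⟧] V →ₗ[k⟦X⟧] tensorObj B V) ∘ₗ (prime B).subtype)

/-- The canonical map `B' ⊗ B' → B ⊗ B` from the algebraic tensor product. -/
def incl₂ : prime B ⊗[k⟦X⟧] prime B →ₗ[k⟦X⟧] (B ⊗ B : TopFree k) :=
  incl B ∘ₗ TensorProduct.map LinearMap.id (prime B).subtype

/-- The map `x ⊗ v ↦ f(x) v` on the algebraic tensor product `B' ⊗ V`. -/
def contract {V : TopFree k} (f : contDual B) : prime B ⊗[k⟦X⟧] V →ₗ[k⟦X⟧] V :=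
  TensorProduct.lift (LinearMap.lsmul k⟦X⟧ V ∘ₗ toFunctional f)

/-- The element `x` of `B ⊗ V` lies in the completed tensor product `B' ⊗ V ⊆ B ⊗ V`, that is the
closure of the image of the algebraic tensor product. -/
def MemPrime {V : TopFree k} (x : (B ⊗ V : TopFree k)) : Prop :=
  ∀ n, ∃ t : prime B ⊗[k⟦X⟧] V, CongMod n x (incl V t)

/-- `x` lies in the completed tensor product `B' ⊗ V ⊆ B ⊗ V` and `v = (f ⊗ id)(x)`: both are
limits of corresponding values on the algebraic tensor product. -/
def IsSlice {V : TopFree k} (f : contDual B) (x : (B ⊗ V : TopFree k)) (v : V) : Prop :=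
  ∀ n, ∃ t : prime B ⊗[k⟦X⟧] V, CongMod n x (incl V t) ∧ CongMod n v (contract f t)

/-- `x` lies in the completed tensor product `B' ⊗ B' ⊆ B ⊗ B` and `c = (f ⊗ g)(x)`. -/
def IsPairing (f g : contDual B) (x : (B ⊗ B : TopFree k)) (c : k⟦X⟧) : Prop :=
  ∀ n, ∃ t : prime B ⊗[k⟦X⟧] prime B, CongMod n x (incl₂ t) ∧
    CongMod (V := unitObj k) n c
      (TensorProduct.dualDistrib k⟦X⟧ _ _ (toFunctional f ⊗ₜ[k⟦X⟧] toFunctional g) t)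

/-- The evaluation of functionals at `x ∈ B'`. -/
def evalAt (x : prime B) : contDual B ⟶ 𝟙_ (TopFree k) :=
  ⟨{ toFun := fun f => toFunctional f x
     map_add' := fun _ _ => rfl
     map_smul' := fun _ _ => rfl }⟩

/-- The evaluation of elements of the completed tensor square of `(B')*` at `x ⊗ y`. -/
def evalAt₂ (x y : prime B) : contDual B ⊗ contDual B ⟶ 𝟙_ (TopFree k) :=
  (evalAt x ⊗ₘ evalAt y) ≫ (λ_ _).hom

variable (B) in
/-- The Hopf algebra structure on `(B')*` is that of `B^∨`, the dual of `B'` with opposite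
coproduct. -/
structure IsOppositeDual [HopfObj (contDual B)] : Prop where
  one_apply : ∀ x : prime B,
    toFunctional (oneElt (contDual B)) x = toSeries (ε[B].hom (x : B))
  mul_apply : ∀ (f g : contDual B) (x : prime B),
    IsPairing f g (Δ[B].hom (x : B)) (toFunctional (mulElt f g) x)
  counit_apply : ∃ h : oneElt B ∈ prime B, ∀ f : contDual B,
    toSeries (ε[contDual B].hom f) = toFunctional f ⟨oneElt B, h⟩
  comul_apply : ∀ x y : prime B, ∃ h : mulElt (y : B) (x : B) ∈ prime B, ∀ f : contDual B,
    toSeries ((evalAt₂ x y).hom (Δ[contDual B].hom f)) = toFunctional f ⟨_, h⟩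

/-- `R` is the canonical element of the completed tensor product `B' ⊗ B^∨ ⊆ B ⊗ B^∨`:
`(f ⊗ id)(R) = f`. -/
def IsCanonical (R : 𝟙_ (TopFree k) ⟶ B ⊗ contDual B) : Prop :=
  ∀ f : contDual B, IsSlice f (R.hom (unitOne k)) f

/-- `lact` is the left coadjoint action `f ▷ b = ⟨f, b₃ S⁻¹(b₁)⟩ b₂` of `B^∨` on `B`, the transpose
of the adjoint coaction `B → B' ⊗ B`. -/
def IsCoadLeft (lact : contDual B ⊗ B ⟶ B) : Prop :=
  ∀ (f : contDual B) (b : B), IsSlice f ((adCoact B).hom b) (lact.hom (pure f b))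

/-- `ract` is the right coadjoint action `(f ◁ b)(x) = f(b₂ x S⁻¹(b₁))` of `B` on `B^∨`, the
transpose of the adjoint action of `B` on `B'`. -/
def IsCoadRight (ract : contDual B ⊗ B ⟶ contDual B) : Prop :=
  ∀ (b : B) (x : prime B), ∃ h : (adAct B).hom (pure b (x : B)) ∈ prime B, ∀ f : contDual B,
    toFunctional (ract.hom (pure f b)) x = toFunctional f ⟨_, h⟩

variable (B) in
/-- A Drinfeld-Yetter module `V` is admissible if its coaction factors through `B' ⊗ V`. -/
def IsAdmissible : ObjectProperty (DY B) := fun V => ∀ v : V.X, MemPrime (V.coact.hom v)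

/-- `act` is the map `b ⊗ f ⊗ v ↦ ⟨f, v₍B₎⟩ b v₍V₎` for an admissible Drinfeld-Yetter module. -/
def IsXiAct (V : DY B) (act : DoubleCross B (contDual B) ⊗ V.X ⟶ V.X) : Prop :=
  ∀ (b : B) (f : contDual B) (v : V.X), ∃ u : V.X, IsSlice f (V.coact.hom v) u ∧
    act.hom (pure (V := DoubleCross B (contDual B)) (pure b f) v) = V.act.hom (pure b u)

end Hopf
end TopFree

end
end QuantumDouble

open QuantumDouble

universe u

/-!
Two ideas carry the proof: a calculus that treats both categories at once, and a reduction of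
everything about the double to one property of the canonical element.

*The calculus.* In both parts the ambient category consists of `K`-modules and all `K`-linear maps
between them (linear maps are automatically `ħ`-adically continuous), and its tensor product
represents bilinear maps. This is recorded by the class `LinCat`. It makes computations in Sweedler
notation rigorous in either category: `tsum t F` is the value at `t : V ⊗ W` of the linear map
induced by the bilinear function `F`, and it may be manipulated like the finite sum of the
`F v w` over a representation of `t` by tensors `v ⊠ w`.

*The double from the canonical element.* Let `B` be a Hopf algebra with invertible antipode and
`R ∈ B ⊗ A` an element which separates the linear maps with source `A` (`Separates`). Suppose that
`A` carries maps which `R` intertwines with the structure maps of `B` (`DualMaps`), and actions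
`▷`, `◁` which `R` intertwines with the adjoint coaction and the adjoint action (`IsDualPair`). An
identity between maps out of tensor powers of `A` then holds as soon as it holds after insertion of
`R`, where it becomes an identity in `B`. In this way the Hopf algebra axioms for `A`, the axioms of
a matched pair, and the axioms for the double `B ⋈ A` and its `R`-matrix are all consequences of the
axioms of `B`. The same principle identifies the modules over the double: an action `ξ` of `B ⋈ A`
corresponds to an action and a coaction of `B` exactly when `ξ (b ⊗ f) = b f` and the coaction is
given by `R` (`IsXi`), and then multiplicativity of `ξ` amounts to the Drinfeld-Yetter condition
(`IsXi.isAction`, `theta_isDY`). Tensor products and braidings agree on the nose, so that the two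
functors are mutually inverse and braided with identity tensor structures (`lift_equivalence`,
`lift_braided`, `theta_lift_braided`).

*Finite-dimensional Hopf algebras.* It remains to see that the antipode `S` is invertible. By
Fitting's lemma some even power `Sⁿ` and a polynomial `q` in `S` satisfy `Sⁿ = S²ⁿ q`, and
`anti_injective_of_pow` deduces injectivity of `S` by a study of coinvariants.

*Quantised enveloping algebras.* Modulo `ħ` the algebra `B` is generated by primitive elements, so
`S² ≡ id`, and `S` is invertible because `B` is complete and torsion free. The essential point is
the structure of `B'`. If `ħᵐ a ∈ B'`, then the reduction of `a` in `U(b)` is annihilated by the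
reduction of the `(m + 1)`-fold convolution power of `id - η ε`. This operator is diagonal on the
powers `yⁿ` of elements `y` of `b`, which span `U(b)`, with eigenvalue the number of surjections from
an `n`-element set onto an `(m + 1)`-element set; since `k` has characteristic zero, the reduction
of `a` lies in the span of the powers of degree at most `m`
(`IsQuantisation.mem_powSpan`), a space of finite dimension. Hence `B'` has a topological basis
which tends to zero in `B` (`Frame`, `IsQUE.nonempty_frame`), and such a basis yields the canonical
element (`Frame.exists_isCanon`) and the contraction of elements of `B' ⊗ V` with functionals on
`B'` (`Frame.exists_sl`).

Membership in `B' ⊗ V` can be tested by linear functionals on `V` (`InPrime`, `Frame.memPrime`).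
This gives that `B'` is closed under the structure maps of `B`, and that `b₃ x S⁻¹(b₁) ⊗ b₂` is in
`B' ⊗ B` for `x ∈ B'` and `b ∈ B` (`IsQuantisation.inPrime_twist`), which contains the statements
on the adjoint action and the adjoint coaction. Contraction of these elements with functionals
defines the structure maps of the dual of `B'` and the two actions, and by construction the canonical
element intertwines them with those of `B`.
-/

namespace QuantumDouble

noncomputable section

/-! ### Linear functions -/

/-- The function `f` is `K`-linear. -/
@[fun_prop] structure Lin (K : Type*) [CommRing K] {M N : Type*} [AddCommGroup M] [Module K M]
    [AddCommGroup N] [Module K N] (f : M → N) : Prop where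
  add : ∀ x y, f (x + y) = f x + f y
  smul : ∀ (c : K) x, f (c • x) = c • f x

section Lin

variable {K : Type*} [CommRing K] {M N P : Type*} [AddCommGroup M] [Module K M]
  [AddCommGroup N] [Module K N] [AddCommGroup P] [Module K P]

@[fun_prop] lemma Lin.id : Lin K (fun x : M => x) := ⟨fun _ _ => rfl, fun _ _ => rfl⟩

@[fun_prop] lemma Lin.comp {f : N → P} {g : M → N} (hf : Lin K f) (hg : Lin K g) :
    Lin K (fun x => f (g x)) :=
  ⟨fun x y => by rw [hg.add, hf.add], fun c x => by rw [hg.smul, hf.smul]⟩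

@[fun_prop] lemma Lin.add' {f g : M → N} (hf : Lin K f) (hg : Lin K g) :
    Lin K (fun x => f x + g x) :=
  ⟨fun x y => by rw [hf.add, hg.add]; abel, fun c x => by rw [hf.smul, hg.smul, smul_add]⟩

@[fun_prop] lemma Lin.smul_right (c : K) {g : M → N} (hg : Lin K g) :
    Lin K (fun x => c • g x) :=
  ⟨fun x y => by rw [hg.add, smul_add], fun a x => by rw [hg.smul, smul_comm]⟩

@[fun_prop] lemma Lin.smul_left {c : M → K} (hc : Lin K c) (y : N) :
    Lin K (fun x => c x • y) :=
  ⟨fun x y => by rw [hc.add, add_smul], fun a x => by rw [hc.smul, smul_assoc]⟩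

@[fun_prop] lemma Lin.linearMap (f : N →ₗ[K] P) {g : M → N} (hg : Lin K g) :
    Lin K (fun x => f (g x)) :=
  ⟨fun x y => by rw [hg.add, map_add], fun a x => by rw [hg.smul, map_smul]⟩

lemma Lin.map_zero {f : M → N} (hf : Lin K f) : f 0 = 0 := by
  simpa using hf.smul 0 0

/-- A linear function as a linear map. -/
def Lin.mk' {f : M → N} (hf : Lin K f) : M →ₗ[K] N :=
  { toFun := f, map_add' := hf.add, map_smul' := hf.smul }

/-- A bilinear function as a bilinear map. -/
def bilin (f : M → N → P) (h₁ : ∀ y, Lin K (fun x => f x y)) (h₂ : ∀ x, Lin K (fun y => f x y)) :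
    M →ₗ[K] N →ₗ[K] P :=
  LinearMap.mk₂ K f (fun x y z => (h₁ z).add x y) (fun c x y => (h₁ y).smul c x)
    (fun x => (h₂ x).add) (fun c x => (h₂ x).smul c)

end Lin

/-! ### Symmetric monoidal categories of modules -/

/-- A presentation of the symmetric monoidal category `C` as a category of `K`-modules and all
`K`-linear maps, such that the tensor product represents bilinear maps between these modules. -/
class LinCat (K : outParam (Type u)) [outParam (CommRing K)] (C : Type (u + 1)) [Category.{u} C]
    [MonoidalCategory C] [SymmetricCategory C] where
  El : C → Type u
  acg : ∀ V, AddCommGroup (El V)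
  mod : ∀ V, Module K (El V)
  lin : ∀ {V W : C}, (V ⟶ W) → (El V →ₗ[K] El W)
  ofLin : ∀ {V W : C}, (El V →ₗ[K] El W) → (V ⟶ W)
  lin_ofLin : ∀ {V W : C} (f : El V →ₗ[K] El W), lin (ofLin f) = f
  ofLin_lin : ∀ {V W : C} (f : V ⟶ W), ofLin (lin f) = f
  lin_id : ∀ (V : C) (x : El V), lin (𝟙 V) x = x
  lin_comp : ∀ {U V W : C} (f : U ⟶ V) (g : V ⟶ W) (x : El U), lin (f ≫ g) x = lin g (lin f x)
  tm : ∀ {V W : C}, El V →ₗ[K] El W →ₗ[K] El (V ⊗ W)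
  lift : ∀ {V W T : C}, (El V →ₗ[K] El W →ₗ[K] El T) → (El (V ⊗ W) →ₗ[K] El T)
  lift_tm : ∀ {V W T : C} (f : El V →ₗ[K] El W →ₗ[K] El T) (v : El V) (w : El W),
    lift f (tm v w) = f v w
  tm_ext : ∀ {V W T : C} (f g : El (V ⊗ W) →ₗ[K] El T), (∀ v w, f (tm v w) = g (tm v w)) → f = g
  one : El (𝟙_ C)
  scal : El (𝟙_ C) →ₗ[K] K
  scal_one : scal one = 1
  scal_smul : ∀ c : El (𝟙_ C), scal c • one = c
  tensorHom_tm : ∀ {V V' W W' : C} (f : V ⟶ V') (g : W ⟶ W') (v : El V) (w : El W),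
    lin (f ⊗ₘ g) (tm v w) = tm (lin f v) (lin g w)
  assoc_tm : ∀ {U V W : C} (u : El U) (v : El V) (w : El W),
    lin (α_ U V W).hom (tm (tm u v) w) = tm u (tm v w)
  leftUnitor_tm : ∀ {V : C} (v : El V), lin (λ_ V).hom (tm one v) = v
  rightUnitor_tm : ∀ {V : C} (v : El V), lin (ρ_ V).hom (tm v one) = v
  braiding_tm : ∀ {V W : C} (v : El V) (w : El W), lin (β_ V W).hom (tm v w) = tm w v

attribute [reducible, instance] LinCat.acg LinCat.mod

section Calculus

variable {K : Type u} [CommRing K] {C : Type (u + 1)} [Category.{u} C] [MonoidalCategory C]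
  [SymmetricCategory C] [LinCat K C]

/-- The elements of an object. -/
abbrev El (V : C) : Type u := LinCat.El V

/-- The value of a morphism at an element. -/
def ap {V W : C} (f : V ⟶ W) (x : El V) : El W := LinCat.lin f x

/-- A pure tensor. -/
def tm {V W : C} (v : El V) (w : El W) : El (V ⊗ W) := LinCat.tm v w

infixr:75 " ⊠ " => tm

/-- The generator of the unit object. -/
def one : El (𝟙_ C) := LinCat.one

/-- An element of the unit object as a scalar. -/
def scal (c : El (𝟙_ C)) : K := LinCat.scal c

variable {U V W T U' V' W' : C} {M : Type*} [AddCommGroup M] [Module K M]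

@[fun_prop] lemma lin_ap (f : V ⟶ W) {g : M → El V} (hg : Lin K g) :
    Lin K (fun x => ap f (g x)) := hg.linearMap _

@[fun_prop] lemma lin_tm_left {g : M → El V} (hg : Lin K g) (w : El W) :
    Lin K (fun x => g x ⊠ w) := hg.linearMap (LinCat.tm.flip w)

@[fun_prop] lemma lin_tm_right (v : El V) {g : M → El W} (hg : Lin K g) :
    Lin K (fun x => v ⊠ g x) := hg.linearMap (LinCat.tm v)

@[fun_prop] lemma lin_scal {g : M → El (𝟙_ C)} (hg : Lin K g) :
    Lin K (fun x => scal (g x)) := hg.linearMap _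

lemma tm_ext {f g : El (V ⊗ W) → El T} (hf : Lin K f) (hg : Lin K g)
    (h : ∀ v w, f (v ⊠ w) = g (v ⊠ w)) (x : El (V ⊗ W)) : f x = g x :=
  LinearMap.congr_fun (LinCat.tm_ext hf.mk' hg.mk' h) x

open scoped Classical in
/-- The sum `∑ F(v, w)` over the terms `v ⊗ w` of the tensor `t`: the value at `t` of the linear
map with bilinear restriction `F` (and zero if `F` is not bilinear). -/
def tsum (t : El (V ⊗ W)) (F : El V → El W → El T) : El T :=
  if h : (∀ w, Lin K (fun v => F v w)) ∧ (∀ v, Lin K (fun w => F v w)) then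
    LinCat.lift (bilin F h.1 h.2) t else 0

lemma tsum_eq (t : El (V ⊗ W)) {F : El V → El W → El T} (h₁ : ∀ w, Lin K (fun v => F v w))
    (h₂ : ∀ v, Lin K (fun w => F v w)) : tsum t F = LinCat.lift (bilin F h₁ h₂) t :=
  dif_pos ⟨h₁, h₂⟩

@[simp] lemma tsum_tm (v : El V) (w : El W) {F : El V → El W → El T}
    (h₁ : ∀ w, Lin K (fun v => F v w)) (h₂ : ∀ v, Lin K (fun w => F v w)) :
    tsum (v ⊠ w) F = F v w := by
  rw [tsum_eq _ h₁ h₂]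
  exact LinCat.lift_tm _ _ _

@[fun_prop] lemma lin_tsum_left {g : M → El (V ⊗ W)} (hg : Lin K g) (F : El V → El W → El T) :
    Lin K (fun x => tsum (g x) F) := by
  unfold tsum
  split_ifs
  · exact hg.linearMap _
  · exact ⟨fun _ _ => by simp, fun _ _ => by simp⟩

@[fun_prop] lemma lin_tsum_right (t : El (V ⊗ W)) {F : M → El V → El W → El T}
    (h : ∀ v w, Lin K (fun x => F x v w))
    (h₁ : ∀ x w, Lin K (fun v => F x v w)) (h₂ : ∀ x v, Lin K (fun w => F x v w)) :
    Lin K (fun x => tsum t (fun v w => F x v w)) := by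
  constructor
  · intro x y
    rw [tsum_eq _ (h₁ (x + y)) (h₂ (x + y)), tsum_eq _ (h₁ x) (h₂ x), tsum_eq _ (h₁ y) (h₂ y),
      ← LinearMap.add_apply]
    refine LinearMap.congr_fun (LinCat.tm_ext _ _ fun v w => ?_) t
    rw [LinearMap.add_apply, LinCat.lift_tm, LinCat.lift_tm, LinCat.lift_tm]
    exact (h v w).add x y
  · intro c x
    rw [tsum_eq _ (h₁ (c • x)) (h₂ (c • x)), tsum_eq _ (h₁ x) (h₂ x), ← LinearMap.smul_apply]
    refine LinearMap.congr_fun (LinCat.tm_ext _ _ fun v w => ?_) t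
    rw [LinearMap.smul_apply, LinCat.lift_tm, LinCat.lift_tm]
    exact (h v w).smul c x

/-- Linear functions commute with sums over tensors. -/
lemma map_tsum {L : El T → El U} (hL : Lin K L) (t : El (V ⊗ W)) {F : El V → El W → El T}
    (h₁ : ∀ w, Lin K (fun v => F v w)) (h₂ : ∀ v, Lin K (fun w => F v w)) :
    L (tsum t F) = tsum t (fun v w => L (F v w)) :=
  tm_ext (f := fun t => L (tsum t F)) (g := fun t => tsum t (fun v w => L (F v w)))
    (by fun_prop) (by fun_prop)
    (fun v w => by
      rw [tsum_tm _ _ h₁ h₂, tsum_tm _ _ (by fun_prop) (by fun_prop)]) t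

section

variable (t : El (V ⊗ W)) {F : El V → El W → El T}
    (h₁ : ∀ w, Lin K (fun v => F v w)) (h₂ : ∀ v, Lin K (fun w => F v w))
include h₁ h₂

@[simp] lemma ap_tsum (f : T ⟶ U) : ap f (tsum t F) = tsum t (fun v w => ap f (F v w)) :=
  map_tsum (by fun_prop) t h₁ h₂

@[simp] lemma tm_tsum (u : El U) : u ⊠ tsum t F = tsum t (fun v w => u ⊠ F v w) :=
  map_tsum (L := fun x => u ⊠ x) (by fun_prop) t h₁ h₂

@[simp] lemma tsum_tm' (u : El U) : tsum t F ⊠ u = tsum t (fun v w => F v w ⊠ u) :=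
  map_tsum (L := fun x => x ⊠ u) (by fun_prop) t h₁ h₂

@[simp] lemma smul_tsum (c : K) : tsum t (fun v w => c • F v w) = c • tsum t F :=
  (map_tsum (L := fun x => c • x) (by fun_prop) t h₁ h₂).symm

end

@[simp] lemma tsum_tsum {X Y : C} (t : El (V ⊗ W)) {F : El V → El W → El (X ⊗ Y)}
    {G : El X → El Y → El T}
    (h₁ : ∀ w, Lin K (fun v => F v w)) (h₂ : ∀ v, Lin K (fun w => F v w)) :
    tsum (tsum t F) G = tsum t (fun v w => tsum (F v w) G) :=
  map_tsum (L := fun x => tsum x G) (by fun_prop) t h₁ h₂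

lemma tsum_comm {X Y : C} (t : El (V ⊗ W)) (s : El (X ⊗ Y))
    {F : El V → El W → El X → El Y → El T}
    (h₁ : ∀ w x y, Lin K (fun v => F v w x y)) (h₂ : ∀ v x y, Lin K (fun w => F v w x y))
    (h₃ : ∀ v w y, Lin K (fun x => F v w x y)) (h₄ : ∀ v w x, Lin K (fun y => F v w x y)) :
    tsum t (fun v w => tsum s (fun x y => F v w x y)) =
      tsum s (fun x y => tsum t (fun v w => F v w x y)) :=
  tm_ext (f := fun t => tsum t (fun v w => tsum s (fun x y => F v w x y)))
    (g := fun t => tsum s (fun x y => tsum t (fun v w => F v w x y)))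
    (by fun_prop) (by fun_prop) (fun v w => by
      rw [tsum_tm _ _ (by fun_prop) (by fun_prop)]
      congr 1
      funext x y
      rw [tsum_tm _ _ (by fun_prop) (by fun_prop)]) t

@[simp] lemma tsum_eta (t : El (V ⊗ W)) : tsum t (fun v w => v ⊠ w) = t :=
  tm_ext (f := fun t => tsum t (fun v w => v ⊠ w)) (g := fun t => t) (by fun_prop) (by fun_prop)
    (fun v w => tsum_tm _ _ (by fun_prop) (by fun_prop)) t

lemma ap_eq_tsum (f : V ⊗ W ⟶ T) (t : El (V ⊗ W)) : ap f t = tsum t (fun v w => ap f (v ⊠ w)) := by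
  conv_lhs => rw [← tsum_eta t]
  rw [ap_tsum _ (by fun_prop) (by fun_prop)]

@[simp] lemma tm_smul (c : K) (v : El V) (w : El W) : v ⊠ (c • w) = c • v ⊠ w :=
  (lin_tm_right v Lin.id).smul c w

@[simp] lemma smul_tm (c : K) (v : El V) (w : El W) : (c • v) ⊠ w = c • v ⊠ w :=
  (lin_tm_left Lin.id w).smul c v

@[simp] lemma ap_smul (c : K) (f : V ⟶ W) (v : El V) : ap f (c • v) = c • ap f v :=
  (lin_ap f Lin.id).smul c v

@[simp] lemma tsum_smul (c : K) (t : El (V ⊗ W)) (F : El V → El W → El T) :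
    tsum (c • t) F = c • tsum t F := (lin_tsum_left Lin.id F).smul c t

@[simp] lemma scal_smul' (c : K) (x : El (𝟙_ C)) : scal (c • x) = c * scal x :=
  (lin_scal Lin.id).smul c x

@[simp] lemma scal_one : scal (one : El (𝟙_ C)) = 1 := LinCat.scal_one

@[simp] lemma scal_smul_one (c : El (𝟙_ C)) : scal c • (one : El (𝟙_ C)) = c := LinCat.scal_smul c

lemma eq_smul_one (c : El (𝟙_ C)) : c = scal c • one := (scal_smul_one c).symm

lemma ap_ext {f g : V ⟶ W} (h : ∀ x, ap f x = ap g x) : f = g := by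
  rw [← LinCat.ofLin_lin f, ← LinCat.ofLin_lin g, LinearMap.ext h]

lemma ap_ext₂ {f g : V ⊗ W ⟶ T} (h : ∀ v w, ap f (v ⊠ w) = ap g (v ⊠ w)) : f = g :=
  ap_ext (tm_ext (by fun_prop) (by fun_prop) h)

lemma ap_ext_one {f g : 𝟙_ C ⟶ W} (h : ap f one = ap g one) : f = g :=
  ap_ext fun x => by rw [eq_smul_one x, ap_smul, ap_smul, h]

/-- The morphism given by a linear function. -/
def mor (f : El V → El W) (hf : Lin K f) : V ⟶ W := LinCat.ofLin hf.mk'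

@[simp] lemma ap_mor (f : El V → El W) (hf : Lin K f) (x : El V) : ap (mor f hf) x = f x := by
  rw [ap, mor, LinCat.lin_ofLin]; rfl

@[simp] lemma ap_id (x : El V) : ap (𝟙 V) x = x := LinCat.lin_id _ _

@[simp] lemma ap_comp (f : U ⟶ V) (g : V ⟶ W) (x : El U) : ap (f ≫ g) x = ap g (ap f x) :=
  LinCat.lin_comp _ _ _

lemma ap_tensorHom_tm (f : V ⟶ V') (g : W ⟶ W') (v : El V) (w : El W) :
    ap (f ⊗ₘ g) (v ⊠ w) = ap f v ⊠ ap g w := LinCat.tensorHom_tm _ _ _ _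

@[simp] lemma ap_tensorHom (f : V ⟶ V') (g : W ⟶ W') (t : El (V ⊗ W)) :
    ap (f ⊗ₘ g) t = tsum t (fun v w => ap f v ⊠ ap g w) := by
  rw [ap_eq_tsum]; simp only [ap_tensorHom_tm]

@[simp] lemma ap_whiskerLeft (V : C) (g : W ⟶ W') (t : El (V ⊗ W)) :
    ap (V ◁ g) t = tsum t (fun v w => v ⊠ ap g w) := by
  rw [← id_tensorHom, ap_tensorHom]; simp only [ap_id]

@[simp] lemma ap_whiskerRight (f : V ⟶ V') (W : C) (t : El (V ⊗ W)) :
    ap (f ▷ W) t = tsum t (fun v w => ap f v ⊠ w) := by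
  rw [← tensorHom_id, ap_tensorHom]; simp only [ap_id]

lemma ap_braiding_tm (v : El V) (w : El W) : ap (β_ V W).hom (v ⊠ w) = w ⊠ v :=
  LinCat.braiding_tm _ _

@[simp] lemma ap_braiding (t : El (V ⊗ W)) : ap (β_ V W).hom t = tsum t (fun v w => w ⊠ v) := by
  rw [ap_eq_tsum]; simp only [ap_braiding_tm]

lemma ap_assoc_tm (u : El U) (v : El V) (w : El W) :
    ap (α_ U V W).hom ((u ⊠ v) ⊠ w) = u ⊠ v ⊠ w := LinCat.assoc_tm _ _ _

@[simp] lemma ap_assoc_tm' (t : El (U ⊗ V)) (w : El W) :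
    ap (α_ U V W).hom (t ⊠ w) = tsum t (fun u v => u ⊠ v ⊠ w) := by
  conv_lhs => rw [← tsum_eta t]
  simp (disch := fun_prop) only [tsum_tm', ap_tsum, ap_assoc_tm]

@[simp] lemma ap_assoc (t : El ((U ⊗ V) ⊗ W)) :
    ap (α_ U V W).hom t = tsum t (fun x w => tsum x (fun u v => u ⊠ v ⊠ w)) := by
  rw [ap_eq_tsum]; simp only [ap_assoc_tm']

lemma ap_assoc_inv_tm (u : El U) (v : El V) (w : El W) :
    ap (α_ U V W).inv (u ⊠ v ⊠ w) = (u ⊠ v) ⊠ w := by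
  rw [← ap_assoc_tm, ← ap_comp, Iso.hom_inv_id, ap_id]

@[simp] lemma ap_assoc_inv (t : El (U ⊗ (V ⊗ W))) :
    ap (α_ U V W).inv t = tsum t (fun u x => tsum x (fun v w => (u ⊠ v) ⊠ w)) := by
  rw [ap_eq_tsum]; congr 1; funext u x
  conv_lhs => rw [← tsum_eta x]
  simp (disch := fun_prop) only [tm_tsum, ap_tsum, ap_assoc_inv_tm]

lemma ap_leftUnitor_tm (c : El (𝟙_ C)) (v : El V) : ap (λ_ V).hom (c ⊠ v) = scal c • v := by
  conv_lhs => rw [eq_smul_one c, smul_tm, ap_smul]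
  congr 1
  exact LinCat.leftUnitor_tm v

@[simp] lemma ap_leftUnitor (t : El (𝟙_ C ⊗ V)) :
    ap (λ_ V).hom t = tsum t (fun c v => scal c • v) := by
  rw [ap_eq_tsum]; simp only [ap_leftUnitor_tm]

lemma ap_rightUnitor_tm (v : El V) (c : El (𝟙_ C)) : ap (ρ_ V).hom (v ⊠ c) = scal c • v := by
  conv_lhs => rw [eq_smul_one c, tm_smul, ap_smul]
  congr 1
  exact LinCat.rightUnitor_tm v

@[simp] lemma ap_rightUnitor (t : El (V ⊗ 𝟙_ C)) :
    ap (ρ_ V).hom t = tsum t (fun v c => scal c • v) := by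
  rw [ap_eq_tsum]; simp only [ap_rightUnitor_tm]

@[simp] lemma ap_leftUnitor_inv (v : El V) : ap (λ_ V).inv v = one ⊠ v := by
  have h : v = ap (λ_ V).hom (one ⊠ v) := by rw [ap_leftUnitor_tm, scal_one, one_smul]
  conv_lhs => rw [h, ← ap_comp, Iso.hom_inv_id, ap_id]

@[simp] lemma ap_rightUnitor_inv (v : El V) : ap (ρ_ V).inv v = v ⊠ one := by
  have h : v = ap (ρ_ V).hom (v ⊠ one) := by rw [ap_rightUnitor_tm, scal_one, one_smul]
  conv_lhs => rw [h, ← ap_comp, Iso.hom_inv_id, ap_id]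

@[simp] lemma ap_tensorμ (U V W T : C) (t : El ((U ⊗ V) ⊗ (W ⊗ T))) :
    ap (tensorμ U V W T) t = tsum t (fun x y => tsum x (fun u v => tsum y (fun w z =>
      (u ⊠ w) ⊠ (v ⊠ z)))) := by
  simp (disch := fun_prop) [tensorμ]

end Calculus

end

end QuantumDouble

namespace QuantumDouble

noncomputable section

section HopfCalculus

variable {K : Type u} [CommRing K] {C : Type (u + 1)} [Category.{u} C] [MonoidalCategory C]
  [SymmetricCategory C] [LinCat K C]

variable {U V W T : C} {M : Type*} [AddCommGroup M] [Module K M]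

/-! ### Elements of monoids, comonoids and Hopf algebras -/

section Mon

variable {D : C} [MonObj D]

instance : Monoid (El D) where
  one := ap η[D] one
  mul x y := ap μ[D] (x ⊠ y)
  one_mul x := by
    have h := congrArg (fun f => ap f (one ⊠ x)) (MonObj.one_mul D)
    simp only [ap_comp, ap_whiskerRight, ap_leftUnitor_tm, scal_one, one_smul] at h
    rwa [tsum_tm _ _ (by fun_prop) (by fun_prop)] at h
  mul_one x := by
    have h := congrArg (fun f => ap f (x ⊠ one)) (MonObj.mul_one D)
    simp only [ap_comp, ap_whiskerLeft, ap_rightUnitor_tm, scal_one, one_smul] at h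
    rwa [tsum_tm _ _ (by fun_prop) (by fun_prop)] at h
  mul_assoc x y z := by
    have h := congrArg (fun f => ap f ((x ⊠ y) ⊠ z)) (MonObj.mul_assoc D)
    simp (disch := fun_prop) only [ap_comp, ap_whiskerRight, ap_whiskerLeft, ap_assoc_tm',
      tsum_tm] at h
    exact h

lemma ap_mu_tm (x y : El D) : ap μ[D] (x ⊠ y) = x * y := rfl

lemma ap_eta_one : ap η[D] one = 1 := rfl

@[simp] lemma ap_mu (t : El (D ⊗ D)) : ap μ[D] t = tsum t (fun x y => x * y) := by
  rw [ap_eq_tsum]; rfl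

@[simp] lemma ap_eta (c : El (𝟙_ C)) : ap η[D] c = scal c • 1 := by
  conv_lhs => rw [eq_smul_one c, ap_smul, ap_eta_one]

@[fun_prop] lemma lin_mul_left {g : M → El D} (hg : Lin K g) (y : El D) :
    Lin K (fun x => g x * y) := lin_ap μ[D] (lin_tm_left hg y)

@[fun_prop] lemma lin_mul_right (x : El D) {g : M → El D} (hg : Lin K g) :
    Lin K (fun y => x * g y) := lin_ap μ[D] (lin_tm_right x hg)

@[simp] lemma smul_mul' (c : K) (x y : El D) : (c • x) * y = c • (x * y) :=
  (lin_mul_left Lin.id y).smul c x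

@[simp] lemma mul_smul' (c : K) (x y : El D) : x * (c • y) = c • (x * y) :=
  (lin_mul_right x Lin.id).smul c y

section

variable (t : El (V ⊗ W)) {F : El V → El W → El D}
    (h₁ : ∀ w, Lin K (fun v => F v w)) (h₂ : ∀ v, Lin K (fun w => F v w))
include h₁ h₂

@[simp] lemma mul_tsum (u : El D) : u * tsum t F = tsum t (fun v w => u * F v w) :=
  map_tsum (L := fun x => u * x) (by fun_prop) t h₁ h₂

end

end Mon

section Comon

variable {B : C} [ComonObj B]

/-- The coproduct of an element. -/
def cop (b : El B) : El (B ⊗ B) := ap Δ[B] b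

/-- The counit of an element. -/
def eps (b : El B) : K := scal (ap ε[B] b)

@[simp] lemma ap_comul (b : El B) : ap Δ[B] b = cop b := rfl

@[simp] lemma ap_counit (b : El B) : ap ε[B] b = eps b • one := (scal_smul_one _).symm

@[fun_prop] lemma lin_cop {g : M → El B} (hg : Lin K g) : Lin K (fun x => cop (g x)) :=
  lin_ap _ hg

@[fun_prop] lemma lin_eps {g : M → El B} (hg : Lin K g) : Lin K (fun x => eps (g x)) :=
  lin_scal (lin_ap _ hg)

@[simp] lemma cop_smul (c : K) (b : El B) : cop (c • b) = c • cop b := (lin_cop Lin.id).smul c b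

@[simp] lemma eps_smul (c : K) (b : El B) : eps (c • b) = c * eps b := (lin_eps Lin.id).smul c b

/-- The counit axiom `ε(b₁) F(b₂) = F(b)`. -/
@[simp] lemma eps_cop_left (b : El B) {F : El B → El T} (hF : Lin K F) :
    tsum (cop b) (fun x y => eps x • F y) = F b := by
  have h := congrArg (fun f => ap f b) (ComonObj.counit_comul B)
  simp (disch := fun_prop) only [ap_comp, ap_comul, ap_whiskerRight, ap_counit,
    ap_leftUnitor_inv, smul_tm] at h
  have h' := congrArg (fun t => tsum t (fun c y => scal c • F y)) h
  simp (disch := fun_prop) only [tsum_tsum, tsum_smul, tsum_tm, scal_one, one_smul] at h'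
  exact h'

@[simp] lemma eps_cop_right (b : El B) {F : El B → El T} (hF : Lin K F) :
    tsum (cop b) (fun x y => eps y • F x) = F b := by
  have h := congrArg (fun f => ap f b) (ComonObj.comul_counit B)
  simp (disch := fun_prop) only [ap_comp, ap_comul, ap_whiskerLeft, ap_counit,
    ap_rightUnitor_inv, tm_smul] at h
  have h' := congrArg (fun t => tsum t (fun y c => scal c • F y)) h
  simp (disch := fun_prop) only [tsum_tsum, tsum_smul, tsum_tm, scal_one, one_smul] at h'
  exact h'

/-- Coassociativity; the right-hand side is the normal form. -/
lemma coassoc (b : El B) {F : El B → El B → El B → El T} (h₁ : ∀ y z, Lin K (fun x => F x y z))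
    (h₂ : ∀ x z, Lin K (fun y => F x y z)) (h₃ : ∀ x y, Lin K (fun z => F x y z)) :
    tsum (cop b) (fun p z => tsum (cop p) (fun x y => F x y z)) =
      tsum (cop b) (fun x p => tsum (cop p) (fun y z => F x y z)) := by
  have h := congrArg (fun f => ap f b) (ComonObj.comul_assoc B)
  simp (disch := fun_prop) only [ap_comp, ap_comul, ap_whiskerLeft, ap_whiskerRight,
    ap_assoc, tsum_tsum, tsum_tm] at h
  have h' := congrArg (fun t => tsum t (fun x p => tsum p (fun y z => F x y z))) h
  simp (disch := fun_prop) only [tsum_tsum, tsum_tm] at h'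
  exact h'.symm

end Comon

section Hopf

variable {B : C} [HopfObj B]

/-- The antipode of an element. -/
def anti (b : El B) : El B := ap 𝒮[B] b

/-- The inverse antipode of an element. -/
def sinv (b : El B) : El B := ap (antipodeInv B) b

@[simp] lemma ap_antipode (b : El B) : ap 𝒮[B] b = anti b := rfl

@[simp] lemma ap_antipodeInv (b : El B) : ap (antipodeInv B) b = sinv b := rfl

@[fun_prop] lemma lin_anti {g : M → El B} (hg : Lin K g) : Lin K (fun x => anti (g x)) :=
  lin_ap _ hg

@[fun_prop] lemma lin_sinv {g : M → El B} (hg : Lin K g) : Lin K (fun x => sinv (g x)) :=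
  lin_ap _ hg

@[simp] lemma anti_smul (c : K) (b : El B) : anti (c • b) = c • anti b :=
  (lin_anti Lin.id).smul c b

@[simp] lemma sinv_smul (c : K) (b : El B) : sinv (c • b) = c • sinv b :=
  (lin_sinv Lin.id).smul c b

@[simp] lemma eps_one : eps (1 : El B) = 1 := by
  have h := congrArg (fun f => ap f one) (BimonObj.one_counit B)
  simp only [ap_comp, ap_eta, scal_one, one_smul, ap_counit, ap_id] at h
  have h' := congrArg scal h
  simpa using h'

lemma eps_tm {B A : C} [ComonObj B] [ComonObj A] (x : El B) (y : El A) :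
    eps (x ⊠ y) = eps x * eps y := by
  rw [eps, Comon.tensorObj_counit]
  simp (disch := fun_prop) only [ap_comp, ap_tensorHom, tsum_tm, ap_counit, smul_tm, tm_smul,
    ap_leftUnitor, tsum_smul, scal_one, one_smul, scal_smul', mul_one]
  ring

@[simp] lemma eps_mul (x y : El B) : eps (x * y) = eps x * eps y := by
  have h := congrArg (fun f => scal (ap f (x ⊠ y))) (BimonObj.mul_counit B)
  simp (disch := fun_prop) only [ap_comp, ap_mu, ap_counit, tsum_tm, scal_smul',
    scal_one, mul_one] at h
  rw [h, eps_tm]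

lemma cop_one : cop (1 : El B) = 1 ⊠ 1 := by
  have h := congrArg (fun f => ap f one) (BimonObj.one_comul B)
  simp (disch := fun_prop) only [ap_comp, ap_eta, scal_one, one_smul, ap_comul,
    MonObj.tensorObj.one_def, ap_leftUnitor_inv, ap_tensorHom, tsum_tm] at h
  exact h

lemma cop_mul (x y : El B) : cop (x * y) =
    tsum (cop x) (fun x₁ x₂ => tsum (cop y) (fun y₁ y₂ => (x₁ * y₁) ⊠ (x₂ * y₂))) := by
  have h := congrArg (fun f => ap f (x ⊠ y)) (BimonObj.mul_comul B)
  simp (disch := fun_prop) only [ap_comp, ap_mu, ap_comul, ap_tensorHom, ap_tensorμ, tsum_tm,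
    tsum_tsum] at h
  rw [h]

@[simp] lemma tsum_cop_one {F : El B → El B → El T} (h₁ : ∀ y, Lin K (fun x => F x y))
    (h₂ : ∀ x, Lin K (fun y => F x y)) : tsum (cop (1 : El B)) F = F 1 1 := by
  rw [cop_one, tsum_tm _ _ h₁ h₂]

@[simp] lemma tsum_cop_mul (x y : El B) {F : El B → El B → El T} (h₁ : ∀ y, Lin K (fun x => F x y))
    (h₂ : ∀ x, Lin K (fun y => F x y)) : tsum (cop (x * y)) F =
      tsum (cop x) (fun x₁ x₂ => tsum (cop y) (fun y₁ y₂ => F (x₁ * y₁) (x₂ * y₂))) := by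
  rw [cop_mul]
  simp (disch := fun_prop) only [tsum_tsum, tsum_tm]

lemma anti_mul_cop (b : El B) {F : El B → El T} (hF : Lin K F) :
    tsum (cop b) (fun x y => F (anti x * y)) = eps b • F 1 := by
  have h := congrArg (fun f => F (ap f b)) (HopfObj.antipode_left B)
  simp (disch := fun_prop) only [ap_comp, ap_comul, ap_whiskerRight, ap_antipode, ap_mu, tsum_tsum,
    tsum_tm, ap_counit, ap_smul, ap_eta, scal_one, one_smul] at h
  rw [map_tsum hF _ (by fun_prop) (by fun_prop), hF.smul] at h
  exact h

lemma mul_anti_cop (b : El B) {F : El B → El T} (hF : Lin K F) :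
    tsum (cop b) (fun x y => F (x * anti y)) = eps b • F 1 := by
  have h := congrArg (fun f => F (ap f b)) (HopfObj.antipode_right B)
  simp (disch := fun_prop) only [ap_comp, ap_comul, ap_whiskerLeft, ap_antipode, ap_mu, tsum_tsum,
    tsum_tm, ap_counit, ap_smul, ap_eta, scal_one, one_smul] at h
  rw [map_tsum hF _ (by fun_prop) (by fun_prop), hF.smul] at h
  exact h

@[simp] lemma anti_one : anti (1 : El B) = 1 := by
  have h := congrArg (fun f => ap f one) (HopfObj.one_antipode B)
  simp only [ap_comp, ap_eta_one] at h
  exact h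

@[simp] lemma eps_anti (b : El B) : eps (anti b) = eps b := by
  have h := congrArg (fun f => scal (ap f b)) (HopfObj.antipode_counit B)
  simp only [ap_comp] at h
  exact h

@[simp] lemma anti_mul (x y : El B) : anti (x * y) = anti y * anti x := by
  have h := congrArg (fun f => ap f (x ⊠ y)) (HopfObj.mul_antipode B)
  simpa (disch := fun_prop) using h

lemma cop_anti (b : El B) : cop (anti b) = tsum (cop b) (fun x y => anti y ⊠ anti x) := by
  have h := congrArg (fun f => ap f b) (HopfObj.antipode_comul B)
  simpa (disch := fun_prop) using h

@[simp] lemma tsum_cop_anti (b : El B) {F : El B → El B → El T} (h₁ : ∀ y, Lin K (fun x => F x y))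
    (h₂ : ∀ x, Lin K (fun y => F x y)) :
    tsum (cop (anti b)) F = tsum (cop b) (fun x y => F (anti y) (anti x)) := by
  rw [cop_anti]
  simp (disch := fun_prop) only [tsum_tsum, tsum_tm]

section Inv

variable [IsIso 𝒮[B]]

lemma antipodeInv_eq : antipodeInv B = inv 𝒮[B] := by
  rw [antipodeInv, dif_pos (by infer_instance)]

@[simp] lemma anti_sinv (b : El B) : anti (sinv b) = b := by
  rw [sinv, anti, ← ap_comp, antipodeInv_eq, IsIso.inv_hom_id, ap_id]

@[simp] lemma sinv_anti (b : El B) : sinv (anti b) = b := by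
  rw [sinv, anti, ← ap_comp, antipodeInv_eq, IsIso.hom_inv_id, ap_id]

lemma anti_inj {x y : El B} (h : anti x = anti y) : x = y := by
  rw [← sinv_anti x, h, sinv_anti]

@[simp] lemma sinv_one : sinv (1 : El B) = 1 := anti_inj (by simp)

@[simp] lemma sinv_mul (x y : El B) : sinv (x * y) = sinv y * sinv x := anti_inj (by simp)

@[simp] lemma eps_sinv (b : El B) : eps (sinv b) = eps b := by
  rw [← eps_anti, anti_sinv]

@[simp] lemma tsum_cop_sinv (b : El B) {F : El B → El B → El T} (h₁ : ∀ y, Lin K (fun x => F x y))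
    (h₂ : ∀ x, Lin K (fun y => F x y)) :
    tsum (cop (sinv b)) F = tsum (cop b) (fun x y => F (sinv y) (sinv x)) := by
  have h := tsum_cop_anti (sinv b) (F := fun x y => F (sinv y) (sinv x)) (by fun_prop) (by fun_prop)
  simp only [anti_sinv, sinv_anti] at h
  exact h.symm

lemma sinv_mul_cop (b : El B) {F : El B → El T} (hF : Lin K F) :
    tsum (cop b) (fun x y => F (sinv y * x)) = eps b • F 1 := by
  have h := anti_mul_cop b (F := fun x => F (sinv x)) (by fun_prop)
  simpa using h

lemma mul_sinv_cop (b : El B) {F : El B → El T} (hF : Lin K F) :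
    tsum (cop b) (fun x y => F (y * sinv x)) = eps b • F 1 := by
  have h := mul_anti_cop b (F := fun x => F (sinv x)) (by fun_prop)
  simpa using h

end Inv

section Cancel

lemma cancel₂ (b : El B) {F : El B → El B → El T} (h₁ : ∀ y, Lin K (fun x => F x y))
    {m : El B → El B → El B}
    (hm : ∀ (b : El B) (z : El B), tsum (cop b) (fun x y => F z (m x y)) = eps b • F z 1) :
    tsum (cop b) (fun x p => tsum (cop p) (fun y z => F x (m y z))) = F b 1 := by
  simp (disch := fun_prop) only [hm, eps_cop_right]

variable (b : El B) {F : El B → El B → El T} (h₁ : ∀ y, Lin K (fun x => F x y))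
    (h₂ : ∀ x, Lin K (fun y => F x y))
include h₁ h₂

lemma cancel₁ {m : El B → El B → El B} (hm₁ : ∀ y, Lin K (fun x => m x y))
    (hm₂ : ∀ x, Lin K (fun y => m x y))
    (hm : ∀ (b : El B) (z : El B), tsum (cop b) (fun x y => F (m x y) z) = eps b • F 1 z) :
    tsum (cop b) (fun x p => tsum (cop p) (fun y z => F (m x y) z)) = F 1 b := by
  rw [← coassoc _ (by fun_prop) (by fun_prop) (by fun_prop)]
  simp (disch := fun_prop) only [hm, eps_cop_left]

lemma anti_mul_cancel₁ :
    tsum (cop b) (fun x p => tsum (cop p) (fun y z => F (anti x * y) z)) = F 1 b :=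
  cancel₁ b h₁ h₂ (by fun_prop) (by fun_prop) fun _ z => anti_mul_cop _ (h₁ z)

lemma anti_mul_cancel₂ :
    tsum (cop b) (fun x p => tsum (cop p) (fun y z => F x (anti y * z))) = F b 1 :=
  cancel₂ b h₁ fun _ z => anti_mul_cop _ (h₂ z)

lemma mul_anti_cancel₂ :
    tsum (cop b) (fun x p => tsum (cop p) (fun y z => F x (y * anti z))) = F b 1 :=
  cancel₂ b h₁ fun _ z => mul_anti_cop _ (h₂ z)

variable [IsIso 𝒮[B]]

lemma sinv_mul_cancel₁ :
    tsum (cop b) (fun x p => tsum (cop p) (fun y z => F (sinv y * x) z)) = F 1 b :=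
  cancel₁ b h₁ h₂ (by fun_prop) (by fun_prop) fun _ z => sinv_mul_cop _ (h₁ z)

lemma mul_sinv_cancel₁ :
    tsum (cop b) (fun x p => tsum (cop p) (fun y z => F (y * sinv x) z)) = F 1 b :=
  cancel₁ b h₁ h₂ (by fun_prop) (by fun_prop) fun _ z => mul_sinv_cop _ (h₁ z)

end Cancel

end Hopf

end HopfCalculus

end

end QuantumDouble

namespace QuantumDouble

noncomputable section

section Modules

variable {K : Type u} [CommRing K] {C : Type (u + 1)} [Category.{u} C] [MonoidalCategory C]
  [SymmetricCategory C] [LinCat K C]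

variable {U V W T : C} {M : Type*} [AddCommGroup M] [Module K M]

/-! ### Actions and coactions in terms of elements -/

/-- The action of `d` on `v`. -/
def actE {D V : C} (a : D ⊗ V ⟶ V) (d : El D) (v : El V) : El V := ap a (d ⊠ v)

@[fun_prop] lemma lin_actE_left {D : C} (a : D ⊗ V ⟶ V) {g : M → El D} (hg : Lin K g) (v : El V) :
    Lin K (fun x => actE a (g x) v) := lin_ap a (lin_tm_left hg v)

@[fun_prop] lemma lin_actE_right {D : C} (a : D ⊗ V ⟶ V) (d : El D) {g : M → El V} (hg : Lin K g) :
    Lin K (fun x => actE a d (g x)) := lin_ap a (lin_tm_right d hg)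

section

variable {D : C} (a : D ⊗ V ⟶ V) {X Y : C} (t : El (X ⊗ Y))

@[simp] lemma actE_tsum (d : El D) {F : El X → El Y → El V}
    (h₁ : ∀ w, Lin K (fun v => F v w)) (h₂ : ∀ v, Lin K (fun w => F v w)) :
    actE a d (tsum t F) = tsum t (fun x y => actE a d (F x y)) :=
  map_tsum (by fun_prop) t h₁ h₂

@[simp] lemma tsum_actE (v : El V) {F : El X → El Y → El D}
    (h₁ : ∀ w, Lin K (fun v => F v w)) (h₂ : ∀ v, Lin K (fun w => F v w)) :
    actE a (tsum t F) v = tsum t (fun x y => actE a (F x y) v) :=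
  map_tsum (L := fun d => actE a d v) (by fun_prop) t h₁ h₂

end

lemma ap_act {D : C} (a : D ⊗ V ⟶ V) (t : El (D ⊗ V)) :
    ap a t = tsum t (fun d v => actE a d v) := ap_eq_tsum a t

lemma isAction_iff {D : C} [MonObj D] {V : C} (a : D ⊗ V ⟶ V) : IsAction D V a ↔
    (∀ v, actE a 1 v = v) ∧ ∀ d d' v, actE a (d * d') v = actE a d (actE a d' v) := by
  constructor
  · intro h
    refine ⟨fun v => ?_, fun d d' v => ?_⟩
    · have := congrArg (fun f => ap f (one ⊠ v)) h.one_act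
      simpa (disch := fun_prop) [ap_act a] using this
    · have := congrArg (fun f => ap f ((d ⊠ d') ⊠ v)) h.mul_act
      simpa (disch := fun_prop) [ap_act a] using this
  · rintro ⟨h₁, h₂⟩
    refine ⟨ap_ext₂ fun c v => ?_, ap_ext₂ fun t v => ?_⟩
    · simp (disch := fun_prop) [ap_act a, h₁]
    · simp (disch := fun_prop) [ap_act a, h₂]

lemma isCoaction_iff {B : C} [ComonObj B] {V : C} (c : V ⟶ B ⊗ V) : IsCoaction B V c ↔
    (∀ v, tsum (ap c v) (fun x w => eps x • w) = v) ∧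
    ∀ v, tsum (ap c v) (fun x w => tsum (cop x) (fun x₁ x₂ => (x₂ ⊠ x₁) ⊠ w)) =
      tsum (ap c v) (fun x w => tsum (ap c w) (fun x' w' => (x ⊠ x') ⊠ w')) := by
  constructor
  · intro h
    refine ⟨fun v => ?_, fun v => ?_⟩
    · have := congrArg (fun f => ap f v) h.counit_coact
      have := congrArg (fun t => ap (λ_ V).hom t) this
      simpa (disch := fun_prop) using this
    · have := congrArg (fun f => ap f v) h.comul_coact
      simpa (disch := fun_prop) using this
  · rintro ⟨h₁, h₂⟩
    refine ⟨ap_ext fun v => ?_, ap_ext fun v => ?_⟩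
    · have := h₁ v
      apply_fun (fun w => ap (λ_ V).inv w) at this
      simpa (disch := fun_prop) using this
    · simpa (disch := fun_prop) using h₂ v

lemma IsCoaction.counit_tsum {B : C} [ComonObj B] {V : C} {c : V ⟶ B ⊗ V} (h : IsCoaction B V c)
    (v : El V) {F : El V → El T} (hF : Lin K F) :
    tsum (ap c v) (fun x w => eps x • F w) = F v := by
  conv_rhs => rw [← ((isCoaction_iff c).1 h).1 v, map_tsum hF _ (by fun_prop) (by fun_prop)]
  simp only [hF.smul]

/-- Coassociativity of a coaction, in the form which removes iterated coactions. -/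
lemma IsCoaction.comul_tsum {B : C} [ComonObj B] {V : C} {c : V ⟶ B ⊗ V} (h : IsCoaction B V c)
    (v : El V) {F : El B → El B → El V → El T} (h₁ : ∀ y z, Lin K (fun x => F x y z))
    (h₂ : ∀ x z, Lin K (fun y => F x y z)) (h₃ : ∀ x y, Lin K (fun z => F x y z)) :
    tsum (ap c v) (fun x w => tsum (ap c w) (fun x' w' => F x x' w')) =
    tsum (ap c v) (fun x w => tsum (cop x) (fun x₁ x₂ => F x₂ x₁ w)) := by
  have := congrArg (fun t => tsum t (fun p w => tsum p (fun x y => F x y w)))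
    (((isCoaction_iff c).1 h).2 v)
  simp (disch := fun_prop) only [tsum_tsum, tsum_tm] at this
  exact this.symm

section

variable {B : C} [HopfObj B]

lemma ap_comul₃ (b : El B) : ap (comul₃ B) b =
    tsum (cop b) (fun x p => tsum (cop p) (fun y z => (x ⊠ y) ⊠ z)) := by
  have e (p z : El B) : cop p ⊠ z = tsum (cop p) (fun x y => (x ⊠ y) ⊠ z) := by
    rw [← tsum_tm' _ (by fun_prop) (by fun_prop), tsum_eta]
  rw [← coassoc _ (by fun_prop) (by fun_prop) (by fun_prop)]
  simp only [comul₃, ap_comp, ap_comul, ap_whiskerRight, e]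

lemma ap_dyTwist (a : B ⊗ V ⟶ V) (c : V ⟶ B ⊗ V) (b : El B) (v : El V) :
    ap (dyTwist B V a c) (b ⊠ v) = tsum (cop b) (fun b₁ p => tsum (cop p) (fun b₂ b₃ =>
      tsum (ap c v) (fun x w => (b₃ * x * sinv b₁) ⊠ actE a b₂ w))) := by
  simp only [dyTwist, monoidalComp, MonoidalCoherence.iso]
  simp (disch := fun_prop) only [Iso.trans_hom, Iso.symm_hom, Iso.refl_hom, whiskerRightIso_hom,
    whiskerLeftIso_hom, ap_comp, ap_tensorHom, ap_whiskerRight, ap_whiskerLeft, ap_assoc,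
    ap_assoc_inv, ap_id, tsum_tm, ap_comul₃, mul₃, ap_antipodeInv, ap_braiding,
    tsum_tm', tm_tsum, ap_tsum, ap_mu]
  rfl

lemma ap_adAct (b x : El B) :
    ap (adAct B) (b ⊠ x) = tsum (cop b) fun b₁ b₂ => b₂ * x * sinv b₁ := by
  simp (disch := fun_prop) only [adAct, mul₃, ap_comp, ap_whiskerRight, tsum_tsum, tsum_tm,
    ap_comul, ap_antipodeInv, ap_braiding, ap_assoc, ap_mu]

lemma ap_adCoact (b : El B) : ap (adCoact B) b =
    tsum (cop b) fun b₁ p => tsum (cop p) fun b₂ b₃ => (b₃ * sinv b₁) ⊠ b₂ := by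
  simp (disch := fun_prop) only [adCoact, ap_comp, ap_comul₃, ap_whiskerRight, tsum_tsum, tsum_tm,
    ap_antipodeInv, ap_braiding, ap_assoc_inv, ap_mu]

lemma isDrinfeldYetter_iff (a : B ⊗ V ⟶ V) (c : V ⟶ B ⊗ V) : IsDrinfeldYetter B V a c ↔
    IsAction B V a ∧ IsCoaction B V c ∧ ∀ b v, ap c (actE a b v) =
      tsum (cop b) (fun b₁ p => tsum (cop p) (fun b₂ b₃ =>
        tsum (ap c v) (fun x w => (b₃ * x * sinv b₁) ⊠ actE a b₂ w))) := by
  constructor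
  · intro h
    refine ⟨h.isAction, h.isCoaction, fun b v => ?_⟩
    rw [← ap_dyTwist, ← h.compat, ap_comp]; rfl
  · rintro ⟨h₁, h₂, h₃⟩
    refine ⟨h₁, h₂, ap_ext₂ fun b v => ?_⟩
    rw [ap_dyTwist, ← h₃, ap_comp]; rfl

lemma IsDrinfeldYetter.of_elements (a : B ⊗ V ⟶ V) (c : V ⟶ B ⊗ V) (h₁ : ∀ v, actE a 1 v = v)
    (h₂ : ∀ b b' v, actE a (b * b') v = actE a b (actE a b' v))
    (h₃ : ∀ v, tsum (ap c v) (fun x w => eps x • w) = v)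
    (h₄ : ∀ v, tsum (ap c v) (fun x w => tsum (cop x) (fun x₁ x₂ => (x₂ ⊠ x₁) ⊠ w)) =
      tsum (ap c v) (fun x w => tsum (ap c w) (fun x' w' => (x ⊠ x') ⊠ w')))
    (h₅ : ∀ b v, ap c (actE a b v) =
      tsum (cop b) (fun b₁ p => tsum (cop p) (fun b₂ b₃ =>
        tsum (ap c v) (fun x w => (b₃ * x * sinv b₁) ⊠ actE a b₂ w)))) :
    IsDrinfeldYetter B V a c :=
  (isDrinfeldYetter_iff a c).2 ⟨(isAction_iff a).2 ⟨h₁, h₂⟩, (isCoaction_iff c).2 ⟨h₃, h₄⟩, h₅⟩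

lemma IsDrinfeldYetter.compat_tsum {a : B ⊗ V ⟶ V} {c : V ⟶ B ⊗ V} (h : IsDrinfeldYetter B V a c)
    (b : El B) (v : El V) {F : El B → El V → El T} (h₁ : ∀ y, Lin K (fun x => F x y))
    (h₂ : ∀ x, Lin K (fun y => F x y)) : tsum (ap c (actE a b v)) F =
      tsum (cop b) (fun b₁ p => tsum (cop p) (fun b₂ b₃ =>
        tsum (ap c v) (fun x w => F (b₃ * x * sinv b₁) (actE a b₂ w)))) := by
  rw [((isDrinfeldYetter_iff a c).1 h).2.2]
  simp (disch := fun_prop) only [tsum_tsum, tsum_tm]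

end

lemma ap_ext_iff {f g : V ⟶ W} : f = g ↔ ∀ x, ap f x = ap g x :=
  ⟨fun h _ => h ▸ rfl, ap_ext⟩

lemma ap_ext_one_iff {f g : 𝟙_ C ⟶ W} : f = g ↔ ap f one = ap g one :=
  ⟨fun h => h ▸ rfl, ap_ext_one⟩

lemma ap_ext₃' {f g : U ⊗ (V ⊗ W) ⟶ T}
    (h : ∀ u v w, ap f (u ⊠ v ⊠ w) = ap g (u ⊠ v ⊠ w)) : f = g :=
  ap_ext₂ fun u => tm_ext (by fun_prop) (by fun_prop) (h u)

lemma ap_ext₃ {f g : (U ⊗ V) ⊗ W ⟶ T}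
    (h : ∀ u v w, ap f ((u ⊠ v) ⊠ w) = ap g ((u ⊠ v) ⊠ w)) : f = g :=
  ap_ext₂ fun x w => tm_ext (f := fun x => ap f (x ⊠ w)) (g := fun x => ap g (x ⊠ w))
    (by fun_prop) (by fun_prop) (fun u v => h u v w) x

/-! ### The braided monoidal category of Drinfeld-Yetter modules -/

namespace DY

variable {B : C} [HopfObj B]

lemma one_act (V : DY B) (v : El V.X) : actE V.act 1 v = v :=
  ((isAction_iff _).1 V.isDY.isAction).1 v

lemma mul_act (V : DY B) (b b' : El B) (v : El V.X) : actE V.act (b * b') v =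
    actE V.act b (actE V.act b' v) :=
  ((isAction_iff _).1 V.isDY.isAction).2 b b' v

lemma act_tensorAct (V W : DY B) (b : El B) (v : El V.X) (w : El W.X) :
    actE (tensorAct V W) b (v ⊠ w) = tsum (cop b) (fun b₁ b₂ =>
      actE V.act b₁ v ⊠ actE W.act b₂ w) := by
  simp (disch := fun_prop) only [actE, tensorAct, ap_comp, ap_whiskerRight, tsum_tm,
    ap_comul, ap_tensorμ, ap_tensorHom, ap_tsum]

lemma ap_tensorCoact (V W : DY B) (v : El V.X) (w : El W.X) :
    ap (tensorCoact V W) (v ⊠ w) = tsum (ap V.coact v) (fun x v' => tsum (ap W.coact w)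
      (fun y w' => (y * x) ⊠ (v' ⊠ w'))) := by
  simp (disch := fun_prop) only [tensorCoact, ap_comp, ap_tensorHom, ap_whiskerRight, tsum_tm,
    ap_braiding, ap_tensorμ, ap_mu, tsum_tsum, tsum_tm']

lemma act_unitAct (b : El B) (c : El (𝟙_ C)) :
    actE (unitAct B) b c = eps b • c := by
  simp (disch := fun_prop) only [actE, unitAct, ap_comp, ap_rightUnitor, tsum_tm,
    ap_smul, ap_counit]
  rw [smul_comm, scal_smul_one]

lemma ap_unitCoact (c : El (𝟙_ C)) : ap (unitCoact B) c = 1 ⊠ c := by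
  simp only [unitCoact, ap_comp, ap_eta, ap_smul, ap_rightUnitor_inv]
  rw [← tm_smul, scal_smul_one]

lemma act_braid (V W : DY B) (v : El V.X) (w : El W.X) :
    ap (braid V W) (v ⊠ w) = tsum (ap W.coact w)
      (fun y w' => w' ⊠ actE V.act y v) := by
  simp (disch := fun_prop) only [braid, rMatrix, ap_comp, ap_whiskerLeft, ap_whiskerRight, tsum_tm,
    ap_braiding, ap_assoc_inv, tsum_tsum, tsum_tm']
  rfl

variable [IsIso 𝒮[B]]

include K

lemma unit_isDY : IsDrinfeldYetter B (𝟙_ C) (unitAct B) (unitCoact B) := by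
  refine .of_elements _ _ ?_ ?_ ?_ ?_ ?_
  · simp [act_unitAct]
  · intro b b' v
    simp only [act_unitAct, eps_mul, mul_smul]
  · intro v
    simp (disch := fun_prop) [ap_unitCoact]
  · intro v
    simp (disch := fun_prop) [ap_unitCoact]
  · intro b v
    simp (disch := fun_prop) [act_unitAct, ap_unitCoact]
    rw [mul_sinv_cop b (F := fun x => x ⊠ v) (by fun_prop)]

lemma tensor_isDY (V W : DY B) :
    IsDrinfeldYetter B (V.X ⊗ W.X) (tensorAct V W) (tensorCoact V W) := by
  refine .of_elements _ _ ?_ (fun b b' => ?_) ?_ ?_ (fun b => ?_)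
  · refine tm_ext (by fun_prop) (by fun_prop) fun v w => ?_
    simp (disch := fun_prop) [act_tensorAct, one_act]
  · refine tm_ext (by fun_prop) (by fun_prop) fun v w => ?_
    simp (disch := fun_prop) [act_tensorAct, mul_act]
    exact tsum_comm _ _ (by fun_prop) (by fun_prop) (by fun_prop) (by fun_prop)
  · refine tm_ext (by fun_prop) (by fun_prop) fun v w => ?_
    simp (disch := fun_prop) [ap_tensorCoact, mul_smul, W.isDY.isCoaction.counit_tsum,
      V.isDY.isCoaction.counit_tsum]
  · refine tm_ext (by fun_prop) (by fun_prop) fun v w => ?_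
    simp (disch := fun_prop) [ap_tensorCoact]
    simp (disch := fun_prop) only [tsum_comm (ap W.coact w) (ap V.coact _),
      W.isDY.isCoaction.comul_tsum, V.isDY.isCoaction.comul_tsum]
    simp (disch := fun_prop) only [tsum_comm (cop _) (ap W.coact w)]
    congr 1; funext x v'; congr 1; funext y w'
    exact tsum_comm _ _ (by fun_prop) (by fun_prop) (by fun_prop) (by fun_prop)
  · refine tm_ext (by fun_prop) (by fun_prop) fun v w => ?_
    simp (disch := fun_prop) [act_tensorAct, ap_tensorCoact, V.isDY.compat_tsum, W.isDY.compat_tsum]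
    simp (disch := fun_prop) only [tsum_comm (ap V.coact v) (cop _),
      tsum_comm (ap W.coact w) (cop _), coassoc, mul_assoc]
    congr 1; funext b₁ p; congr 1; funext b₂ q
    have h := sinv_mul_cancel₁ q (F := fun z r => tsum (cop r) fun b₃ b₄ =>
      tsum (ap V.coact v) fun x v' => tsum (ap W.coact w) fun y w' =>
        (b₄ * (y * (z * (x * sinv b₁)))) ⊠ actE V.act b₂ v' ⊠ actE W.act b₃ w')
      (by fun_prop) (by fun_prop)
    simpa only [mul_assoc, one_mul] using h

lemma isMonoidal : IsMonoidal B where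
  unit := unit_isDY
  tensor := tensor_isDY
  assoc U V W := by
    constructor
    · refine ap_ext₂ fun b => tm_ext (by fun_prop) (by fun_prop) fun x w => ?_
      revert x
      refine tm_ext (by fun_prop) (by fun_prop) fun u v => ?_
      simp only [ap_comp, ap_whiskerLeft]
      simp (disch := fun_prop) [ap_act, act_tensorAct, coassoc]
    · refine ap_ext₃ fun u v w => ?_
      simp (disch := fun_prop) [ap_tensorCoact, mul_assoc]
  leftUnitor V := by
    constructor
    · refine ap_ext₃' fun b (c : El (𝟙_ C)) v => ?_
      simp (disch := fun_prop) [ap_act V.act, ap_act (tensorAct _ _), act_tensorAct, act_unitAct]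
    · refine ap_ext₂ fun (c : El (𝟙_ C)) v => ?_
      simp (disch := fun_prop) [ap_tensorCoact, ap_unitCoact]
  rightUnitor V := by
    constructor
    · refine ap_ext₃' fun b v (c : El (𝟙_ C)) => ?_
      simp (disch := fun_prop) [ap_act V.act, ap_act (tensorAct _ _), act_tensorAct, act_unitAct]
    · refine ap_ext₂ fun v (c : El (𝟙_ C)) => ?_
      simp (disch := fun_prop) [ap_tensorCoact, ap_unitCoact]

/-- The inverse `v ⊗ w ↦ S(w_B) v ⊗ w_W` of the map `R_{VW}`, composed with the symmetry. -/
def braidInv (V W : DY B) : W.X ⊗ V.X ⟶ V.X ⊗ W.X :=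
  mor (fun t => tsum t fun w v => tsum (ap W.coact w) fun y w' => actE V.act (anti y) v ⊠ w')
    (by fun_prop)

lemma isBraided : IsBraided (isMonoidal (B := B)) where
  isHom V W := by
    constructor
    · refine ap_ext₃' fun b v w => ?_
      simp (disch := fun_prop) [ap_act (tensorAct _ _), act_tensorAct, act_braid, mul_act,
        W.isDY.compat_tsum]
      simp only [← mul_act]
      rw [sinv_mul_cancel₁ b (F := fun z p => tsum (cop p) fun b₂ b₃ =>
        tsum (ap W.coact w) fun x w' => actE W.act b₂ w' ⊠ actE V.act (b₃ * (x * z)) v)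
        (by fun_prop) (by fun_prop)]
      simp only [mul_one]
      exact tsum_comm _ _ (by fun_prop) (by fun_prop) (by fun_prop) (by fun_prop)
    · refine ap_ext₂ fun v w => ?_
      simp (disch := fun_prop) [ap_tensorCoact, act_braid, V.isDY.compat_tsum]
      simp (disch := fun_prop) only [W.isDY.isCoaction.comul_tsum]
      rw [tsum_comm _ _ (by fun_prop) (by fun_prop) (by fun_prop) (by fun_prop)]
      congr 1; funext y w'
      have h := sinv_mul_cancel₁ y (F := fun z p => tsum (cop p) fun b₂ b₃ =>
        tsum (ap V.coact v) fun x v' => (b₃ * (x * z)) ⊠ w' ⊠ actE V.act b₂ v')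
        (by fun_prop) (by fun_prop)
      simp only [mul_assoc]
      rw [h]
      simp only [mul_one]
      exact tsum_comm _ _ (by fun_prop) (by fun_prop) (by fun_prop) (by fun_prop)
  isIso V W := by
    refine ⟨braidInv V W, ap_ext₂ fun v w => ?_, ap_ext₂ fun w v => ?_⟩
    · simp (disch := fun_prop) [act_braid, braidInv, ← mul_act, W.isDY.isCoaction.comul_tsum]
      have e (x : El B) (w' : El W.X) :=
        anti_mul_cop x (F := fun z => actE V.act z v ⊠ w') (by fun_prop)
      simp (disch := fun_prop) only [e, W.isDY.isCoaction.counit_tsum, one_act]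
    · simp (disch := fun_prop) [act_braid, braidInv, ← mul_act, W.isDY.isCoaction.comul_tsum]
      have e (x : El B) (w' : El W.X) :=
        mul_anti_cop x (F := fun z => w' ⊠ actE V.act z v) (by fun_prop)
      simp (disch := fun_prop) only [e, W.isDY.isCoaction.counit_tsum, one_act]
  hexagon_forward U V W := by
    refine ap_ext₃ fun u v w => ?_
    simp (disch := fun_prop) [act_braid, ap_tensorCoact, mul_act]
  hexagon_reverse U V W := by
    refine ap_ext₃' fun u v w => ?_
    simp (disch := fun_prop) [act_braid, act_tensorAct]
    simp (disch := fun_prop) [W.isDY.isCoaction.comul_tsum]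

end DY

/-! ### The braided monoidal category of modules over a quasitriangular Hopf algebra -/

namespace HopfRep

variable {D : C} [HopfObj D]

lemma one_act (V : HopfRep D) (v : El V.X) : actE V.act 1 v = v :=
  ((isAction_iff _).1 V.isAction).1 v

lemma mul_act (V : HopfRep D) (d d' : El D) (v : El V.X) :
    actE V.act (d * d') v = actE V.act d (actE V.act d' v) :=
  ((isAction_iff _).1 V.isAction).2 d d' v

lemma act_tensorAct (V W : HopfRep D) (d : El D) (v : El V.X) (w : El W.X) :
    actE (tensorAct V W) d (v ⊠ w) = tsum (cop d) (fun d₁ d₂ =>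
      actE V.act d₁ v ⊠ actE W.act d₂ w) := by
  simp (disch := fun_prop) only [actE, tensorAct, ap_comp, ap_whiskerRight, tsum_tm,
    ap_comul, ap_tensorμ, ap_tensorHom, ap_tsum]

lemma act_unitAct (d : El D) (c : El (𝟙_ C)) : actE (unitAct D) d c = eps d • c := by
  simp (disch := fun_prop) only [actE, unitAct, ap_comp, ap_rightUnitor, tsum_tm,
    ap_smul, ap_counit]
  rw [smul_comm, scal_smul_one]

lemma act_braid (R : 𝟙_ C ⟶ D ⊗ D) (V W : HopfRep D) (v : El V.X) (w : El W.X) :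
    ap (braid R V W) (v ⊠ w) = tsum (ap R one) (fun x y => actE W.act y w ⊠ actE V.act x v) := by
  simp (disch := fun_prop) only [braid, ap_comp, ap_leftUnitor_inv, ap_whiskerRight, tsum_tm,
    ap_tensorμ, ap_tensorHom, ap_braiding, tsum_tsum]
  rfl

include K in
lemma isMonoidal : IsMonoidal D where
  unit := (isAction_iff _).2 ⟨fun v => by simp [act_unitAct], fun d d' v => by
    simp only [act_unitAct, eps_mul, mul_smul]⟩
  tensor V W := (isAction_iff _).2 ⟨tm_ext (by fun_prop) (by fun_prop) fun v w => by
      simp (disch := fun_prop) [act_tensorAct, one_act],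
    fun d d' => tm_ext (by fun_prop) (by fun_prop) fun v w => by
      simp (disch := fun_prop) [act_tensorAct, mul_act]
      exact tsum_comm _ _ (by fun_prop) (by fun_prop) (by fun_prop) (by fun_prop)⟩
  assoc U V W := by
    refine ap_ext₂ fun b => tm_ext (by fun_prop) (by fun_prop) fun x w => ?_
    revert x
    refine tm_ext (by fun_prop) (by fun_prop) fun u v => ?_
    simp only [ap_comp, ap_whiskerLeft]
    simp (disch := fun_prop) [ap_act, act_tensorAct, coassoc]
  leftUnitor V := by
    refine ap_ext₃' fun b (c : El (𝟙_ C)) v => ?_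
    simp (disch := fun_prop) [ap_act V.act, ap_act (tensorAct _ _), act_tensorAct, act_unitAct]
  rightUnitor V := by
    refine ap_ext₃' fun b v (c : El (𝟙_ C)) => ?_
    simp (disch := fun_prop) [ap_act V.act, ap_act (tensorAct _ _), act_tensorAct, act_unitAct]

end HopfRep

section Quasitriangular

variable {D : C} [HopfObj D] {R : 𝟙_ C ⟶ D ⊗ D}

/-- A quasitriangular structure in terms of elements. -/
lemma isQuasitriangular_iff : IsQuasitriangular D R ↔
    (∃ R' : 𝟙_ C ⟶ D ⊗ D,
      tsum (ap R one) (fun x y => tsum (ap R' one) (fun x' y' => (x * x') ⊠ (y * y'))) = 1 ⊠ 1 ∧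
      tsum (ap R' one) (fun x y => tsum (ap R one) (fun x' y' => (x * x') ⊠ (y * y'))) = 1 ⊠ 1) ∧
    (∀ d, tsum (ap R one) (fun x y => tsum (cop d) (fun d₁ d₂ => (x * d₁) ⊠ (y * d₂))) =
      tsum (cop d) (fun d₁ d₂ => tsum (ap R one) (fun x y => (d₂ * x) ⊠ (d₁ * y)))) ∧
    tsum (ap R one) (fun x y => tsum (cop x) (fun x₁ x₂ => x₁ ⊠ x₂ ⊠ y)) =
      tsum (ap R one) (fun x y => tsum (ap R one) (fun x' y' => x' ⊠ x ⊠ (y' * y))) ∧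
    tsum (ap R one) (fun x y => x ⊠ cop y) =
      tsum (ap R one) (fun x y => tsum (ap R one) (fun x' y' => (x' * x) ⊠ y ⊠ y')) := by
  have e₁ (R R' : 𝟙_ C ⟶ D ⊗ D) : (λ_ _).inv ≫ (R ⊗ₘ R') ≫ μ[D ⊗ D] = η[D ⊗ D] ↔
    tsum (ap R one) (fun x y => tsum (ap R' one) (fun x' y' => (x * x') ⊠ (y * y'))) = 1 ⊠ 1 := by
    rw [ap_ext_one_iff]
    simp (disch := fun_prop) [MonObj.tensorObj.mul_def, MonObj.tensorObj.one_def]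
  have e₂ : (λ_ D).inv ≫ (R ⊗ₘ Δ[D]) ≫ μ[D ⊗ D] =
    (ρ_ D).inv ≫ ((Δ[D] ≫ (β_ D D).hom) ⊗ₘ R) ≫ μ[D ⊗ D] ↔
    (∀ d, tsum (ap R one) (fun x y => tsum (cop d) (fun d₁ d₂ => (x * d₁) ⊠ (y * d₂))) =
      tsum (cop d) (fun d₁ d₂ => tsum (ap R one) (fun x y => (d₂ * x) ⊠ (d₁ * y)))) := by
    rw [ap_ext_iff]
    simp (disch := fun_prop) [MonObj.tensorObj.mul_def]
  have e₃ : R ≫ Δ[D] ▷ D ≫ (α_ D D D).hom =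
      (λ_ _).inv ≫ ((R ≫ D ◁ ((λ_ D).inv ≫ η[D] ▷ D)) ⊗ₘ
        (R ≫ (λ_ _).inv ≫ η[D] ▷ (D ⊗ D))) ≫ μ[D ⊗ (D ⊗ D)] ↔
      tsum (ap R one) (fun x y => tsum (cop x) (fun x₁ x₂ => x₁ ⊠ x₂ ⊠ y)) =
      tsum (ap R one) (fun x y => tsum (ap R one) (fun x' y' => x' ⊠ x ⊠ (y' * y))) := by
    rw [ap_ext_one_iff]
    simp (disch := fun_prop) [MonObj.tensorObj.mul_def]
  have e₄ : R ≫ D ◁ Δ[D] =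
      (λ_ _).inv ≫ ((R ≫ D ◁ ((λ_ D).inv ≫ η[D] ▷ D)) ⊗ₘ
        (R ≫ D ◁ ((ρ_ D).inv ≫ D ◁ η[D]))) ≫ μ[D ⊗ (D ⊗ D)] ↔
    tsum (ap R one) (fun x y => x ⊠ cop y) =
      tsum (ap R one) (fun x y => tsum (ap R one) (fun x' y' => (x' * x) ⊠ y ⊠ y')) := by
    rw [ap_ext_one_iff]
    simp (disch := fun_prop) [MonObj.tensorObj.mul_def]
  constructor
  · rintro ⟨⟨R', h₁, h₂⟩, h₃, h₄, h₅⟩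
    exact ⟨⟨R', (e₁ R R').1 h₁, (e₁ R' R).1 h₂⟩, e₂.1 h₃, e₃.1 h₄, e₄.1 h₅⟩
  · rintro ⟨⟨R', h₁, h₂⟩, h₃, h₄, h₅⟩
    exact ⟨⟨R', (e₁ R R').2 h₁, (e₁ R' R).2 h₂⟩, e₂.2 h₃, e₃.2 h₄, e₄.2 h₅⟩

namespace IsQuasitriangular

variable (hR : IsQuasitriangular D R)
include hR

lemma comm_tsum (d : El D) {F : El D → El D → El T} (h₁ : ∀ y, Lin K (fun x => F x y))
    (h₂ : ∀ x, Lin K (fun y => F x y)) :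
    tsum (ap R one) (fun x y => tsum (cop d) (fun d₁ d₂ => F (x * d₁) (y * d₂))) =
      tsum (cop d) (fun d₁ d₂ => tsum (ap R one) (fun x y => F (d₂ * x) (d₁ * y))) := by
  have := congrArg (fun t => tsum t F) ((isQuasitriangular_iff.1 hR).2.1 d)
  simpa (disch := fun_prop) only [tsum_tsum, tsum_tm] using this

lemma comul_left_tsum {F : El D → El D → El D → El T} (h₁ : ∀ y z, Lin K (fun x => F x y z))
    (h₂ : ∀ x z, Lin K (fun y => F x y z)) (h₃ : ∀ x y, Lin K (fun z => F x y z)) :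
    tsum (ap R one) (fun x y => tsum (cop x) (fun x₁ x₂ => F x₁ x₂ y)) =
      tsum (ap R one) (fun x y => tsum (ap R one) (fun x' y' => F x' x (y' * y))) := by
  have := congrArg (fun t => tsum t (fun a p => tsum p (fun b c => F a b c)))
    (isQuasitriangular_iff.1 hR).2.2.1
  simpa (disch := fun_prop) only [tsum_tsum, tsum_tm] using this

lemma comul_right_tsum {F : El D → El D → El D → El T} (h₁ : ∀ y z, Lin K (fun x => F x y z))
    (h₂ : ∀ x z, Lin K (fun y => F x y z)) (h₃ : ∀ x y, Lin K (fun z => F x y z)) :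
    tsum (ap R one) (fun x y => tsum (cop y) (fun y₁ y₂ => F x y₁ y₂)) =
      tsum (ap R one) (fun x y => tsum (ap R one) (fun x' y' => F (x' * x) y y')) := by
  have := congrArg (fun t => tsum t (fun a p => tsum p (fun b c => F a b c)))
    (isQuasitriangular_iff.1 hR).2.2.2
  simpa (disch := fun_prop) only [tsum_tsum, tsum_tm] using this

lemma isBraided : HopfRep.IsBraided (HopfRep.isMonoidal (D := D)) R where
  isHom V W := by
    refine ap_ext₃' fun d v w => ?_
    simp (disch := fun_prop) [ap_act (HopfRep.tensorAct _ _), HopfRep.act_tensorAct,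
      HopfRep.act_braid, ← HopfRep.mul_act]
    refine (tsum_comm _ _ (by fun_prop) (by fun_prop) (by fun_prop) (by fun_prop)).trans
      ((hR.comm_tsum d (F := fun a b => actE W.act b w ⊠ actE V.act a v) (by fun_prop)
        (by fun_prop)).trans ?_)
    exact tsum_comm _ _ (by fun_prop) (by fun_prop) (by fun_prop) (by fun_prop)
  isIso V W := by
    obtain ⟨R', h₁, h₂⟩ := (isQuasitriangular_iff.1 hR).1
    refine ⟨mor (fun t => tsum t fun w v => tsum (ap R' one)
      (fun x y => actE V.act x v ⊠ actE W.act y w)) (by fun_prop),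
      ap_ext₂ fun v w => ?_, ap_ext₂ fun w v => ?_⟩
    · have := congrArg (fun t => tsum t (fun a b => actE V.act a v ⊠ actE W.act b w)) h₂
      simp (disch := fun_prop) only [tsum_tsum, tsum_tm, HopfRep.one_act] at this
      rw [tsum_comm _ _ (by fun_prop) (by fun_prop) (by fun_prop) (by fun_prop)] at this
      simpa (disch := fun_prop) [HopfRep.act_braid, ← HopfRep.mul_act] using this
    · have := congrArg (fun t => tsum t (fun a b => actE W.act b w ⊠ actE V.act a v)) h₁
      simp (disch := fun_prop) only [tsum_tsum, tsum_tm, HopfRep.one_act] at this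
      rw [tsum_comm _ _ (by fun_prop) (by fun_prop) (by fun_prop) (by fun_prop)] at this
      simpa (disch := fun_prop) [HopfRep.act_braid, ← HopfRep.mul_act] using this
  hexagon_forward U V W := by
    refine ap_ext₃ fun u v w => ?_
    simp (disch := fun_prop) [HopfRep.act_braid, HopfRep.act_tensorAct, ← HopfRep.mul_act]
    exact hR.comul_right_tsum (F := fun a b c => actE V.act b v ⊠ actE W.act c w ⊠ actE U.act a u)
      (by fun_prop) (by fun_prop) (by fun_prop)
  hexagon_reverse U V W := by
    refine ap_ext₃' fun u v w => ?_
    simp (disch := fun_prop) [HopfRep.act_braid, HopfRep.act_tensorAct, ← HopfRep.mul_act]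
    exact hR.comul_left_tsum
      (F := fun a b c => (actE W.act c w ⊠ actE U.act a u) ⊠ actE V.act b v)
      (by fun_prop) (by fun_prop) (by fun_prop)

end IsQuasitriangular

end Quasitriangular

end Modules

end

end QuantumDouble

namespace QuantumDouble

noncomputable section

section Dual

variable {K : Type u} [CommRing K] {C : Type (u + 1)} [Category.{u} C] [MonoidalCategory C]
  [SymmetricCategory C] [LinCat K C]

variable {U V W T : C}

/-! ### The dual Hopf algebra -/

/-- The element `R` of `B ⊗ A` separates the morphisms with source `A`. -/
def Separates {B A : C} (R : 𝟙_ C ⟶ B ⊗ A) : Prop :=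
  ∀ ⦃V : C⦄ ⦃f g : A ⟶ V⦄, R ≫ B ◁ f = R ≫ B ◁ g → f = g

namespace Separates

variable {B A : C} {R : 𝟙_ C ⟶ B ⊗ A} (hR : Separates R)
include hR

lemma ext {f g : El A → El V} (hf : Lin K f) (hg : Lin K g)
    (h : tsum (ap R one) (fun x a => x ⊠ f a) = tsum (ap R one) (fun x a => x ⊠ g a)) (a : El A) :
    f a = g a := by
  have : mor f hf = mor g hg := hR (ap_ext_one (by simpa using h))
  simpa using congrArg (fun f => ap f a) this

lemma ext₂ {f g : El A → El A → El V} (hf : ∀ a, Lin K (fun b => f a b))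
    (hf' : ∀ b, Lin K (fun a => f a b)) (hg : ∀ a, Lin K (fun b => g a b))
    (hg' : ∀ b, Lin K (fun a => g a b))
    (h : tsum (ap R one) (fun x a => tsum (ap R one) (fun y b => x ⊠ y ⊠ f a b)) =
      tsum (ap R one) (fun x a => tsum (ap R one) (fun y b => x ⊠ y ⊠ g a b))) (a b : El A) :
    f a b = g a b := by
  refine hR.ext (hf a) (hg a) ?_ b
  refine hR.ext (f := fun a => tsum (ap R one) (fun y b => y ⊠ f a b))
    (g := fun a => tsum (ap R one) (fun y b => y ⊠ g a b)) (by fun_prop) (by fun_prop) ?_ a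
  simpa (disch := fun_prop) only [tm_tsum] using h

lemma ext₃ {f g : El A → El A → El A → El V} (hf : ∀ a b, Lin K (fun c => f a b c))
    (hf' : ∀ b c, Lin K (fun a => f a b c)) (hf'' : ∀ a c, Lin K (fun b => f a b c))
    (hg : ∀ a b, Lin K (fun c => g a b c))
    (hg' : ∀ b c, Lin K (fun a => g a b c)) (hg'' : ∀ a c, Lin K (fun b => g a b c))
    (h : tsum (ap R one) (fun x a => tsum (ap R one) (fun y b => tsum (ap R one) (fun z c =>
        x ⊠ y ⊠ z ⊠ f a b c))) =
      tsum (ap R one) (fun x a => tsum (ap R one) (fun y b => tsum (ap R one) (fun z c =>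
        x ⊠ y ⊠ z ⊠ g a b c)))) (a b c : El A) : f a b c = g a b c := by
  refine hR.ext (hf a b) (hg a b) ?_ c
  refine hR.ext₂ (f := fun a b => tsum (ap R one) (fun z c => z ⊠ f a b c))
    (g := fun a b => tsum (ap R one) (fun z c => z ⊠ g a b c)) (by fun_prop) (by fun_prop)
    (by fun_prop) (by fun_prop) ?_ a b
  simpa (disch := fun_prop) only [tm_tsum] using h

end Separates

/-- Structure maps on `A` which correspond under `R ∈ B ⊗ A` to those of the Hopf algebra `B`,
with the coproduct reversed: `(id ⊗ ε)(R) = 1`, `(id ⊗ Δ)(R) = R₁₃ R₁₂`, `R₁₃ R₂₃ = (Δ ⊗ id)(R)` and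
`(id ⊗ S)(R) = (S⁻¹ ⊗ id)(R)`. -/
structure DualMaps {B A : C} [HopfObj B] (R : 𝟙_ C ⟶ B ⊗ A) where
  separates : Separates R
  counit : A ⟶ 𝟙_ C
  comul : A ⟶ A ⊗ A
  mul : A ⊗ A ⟶ A
  antipode : A ⟶ A
  counit_spec : tsum (ap R one) (fun x g => x ⊠ ap counit g) = 1 ⊠ one
  comul_spec : tsum (ap R one) (fun x g => x ⊠ ap comul g) =
    tsum (ap R one) (fun x g => tsum (ap R one) (fun x' g' => (x * x') ⊠ (g' ⊠ g)))
  mul_spec : tsum (ap R one) (fun x g => tsum (ap R one) (fun x' g' => x ⊠ x' ⊠ ap mul (g ⊠ g'))) =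
    tsum (ap R one) (fun x g => tsum (cop x) (fun x₁ x₂ => x₁ ⊠ x₂ ⊠ g))
  antipode_spec : tsum (ap R one) (fun x g => x ⊠ ap antipode g) =
    tsum (ap R one) (fun x g => sinv x ⊠ g)

namespace DualMaps

variable {B A : C} [HopfObj B] {R : 𝟙_ C ⟶ B ⊗ A} (d : DualMaps R)

/-- The unit `(ε ⊗ id)(R)`. -/
def unit {B A : C} [HopfObj B] (R : 𝟙_ C ⟶ B ⊗ A) : 𝟙_ C ⟶ A := R ≫ ε[B] ▷ A ≫ (λ_ A).hom

lemma ap_unit : ap (unit R) one = tsum (ap R one) (fun x g => eps x • g) := by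
  simp (disch := fun_prop) [unit]

/-- The product of `A` in terms of elements. -/
def m (f g : El A) : El A := ap d.mul (f ⊠ g)

/-- The counit of `A` in terms of elements. -/
def e (f : El A) : K := scal (ap d.counit f)

@[fun_prop] lemma lin_m_left {M : Type*} [AddCommGroup M] [Module K M] {f : M → El A}
    (hf : Lin K f) (g : El A) : Lin K (fun x => d.m (f x) g) := lin_ap d.mul (lin_tm_left hf g)

@[fun_prop] lemma lin_m_right {M : Type*} [AddCommGroup M] [Module K M] {f : M → El A} (g : El A)
    (hf : Lin K f) : Lin K (fun x => d.m g (f x)) := lin_ap d.mul (lin_tm_right g hf)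

@[fun_prop] lemma lin_e {M : Type*} [AddCommGroup M] [Module K M] {f : M → El A}
    (hf : Lin K f) : Lin K (fun x => d.e (f x)) := lin_scal (lin_ap _ hf)

lemma ap_mul (t : El (A ⊗ A)) : ap d.mul t = tsum t (fun f g => d.m f g) := ap_eq_tsum _ _

lemma ap_counit (f : El A) : ap d.counit f = d.e f • one := (scal_smul_one _).symm

lemma m_smul (c : K) (f g : El A) : d.m f (c • g) = c • d.m f g := (d.lin_m_right f Lin.id).smul c g

lemma smul_m (c : K) (f g : El A) : d.m (c • f) g = c • d.m f g := (d.lin_m_left Lin.id g).smul c f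

lemma m_tsum (f : El A) (t : El (V ⊗ W)) {F : El V → El W → El A}
    (h₁ : ∀ w, Lin K (fun v => F v w)) (h₂ : ∀ v, Lin K (fun w => F v w)) :
    d.m f (tsum t F) = tsum t (fun v w => d.m f (F v w)) := map_tsum (by fun_prop) t h₁ h₂

lemma tsum_m (f : El A) (t : El (V ⊗ W)) {F : El V → El W → El A}
    (h₁ : ∀ w, Lin K (fun v => F v w)) (h₂ : ∀ v, Lin K (fun w => F v w)) :
    d.m (tsum t F) f = tsum t (fun v w => d.m (F v w) f) :=
  map_tsum (L := fun x => d.m x f) (by fun_prop) t h₁ h₂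

lemma e_tsum {F : El V → El W → El A} (t : El (V ⊗ W))
    (h₁ : ∀ w, Lin K (fun v => F v w)) (h₂ : ∀ v, Lin K (fun w => F v w)) (u : El U) :
    d.e (tsum t F) • u = tsum t (fun v w => d.e (F v w) • u) :=
  map_tsum (L := fun x => d.e x • u) (by fun_prop) t h₁ h₂

lemma counit_tsum {F : El B → El T} (hF : Lin K F) :
    tsum (ap R one) (fun x g => d.e g • F x) = F 1 := by
  have := congrArg (fun t => tsum t (fun x c => scal c • F x)) d.counit_spec
  simp (disch := fun_prop) only [tsum_tsum, tsum_tm, scal_one, one_smul] at this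
  exact this

lemma comul_tsum {F : El B → El A → El A → El T} (h₁ : ∀ y z, Lin K (fun x => F x y z))
    (h₂ : ∀ x z, Lin K (fun y => F x y z)) (h₃ : ∀ x y, Lin K (fun z => F x y z)) :
    tsum (ap R one) (fun x g => tsum (ap d.comul g) (fun g₁ g₂ => F x g₁ g₂)) =
      tsum (ap R one) (fun x g => tsum (ap R one) (fun x' g' => F (x * x') g' g)) := by
  have := congrArg (fun t => tsum t (fun a p => tsum p (fun b c => F a b c))) d.comul_spec
  simpa (disch := fun_prop) only [tsum_tsum, tsum_tm] using this

lemma mul_tsum' {F : El B → El B → El A → El T} (h₁ : ∀ y z, Lin K (fun x => F x y z))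
    (h₂ : ∀ x z, Lin K (fun y => F x y z)) (h₃ : ∀ x y, Lin K (fun z => F x y z)) :
    tsum (ap R one) (fun x g => tsum (ap R one) (fun x' g' => F x x' (d.m g g'))) =
      tsum (ap R one) (fun x g => tsum (cop x) (fun x₁ x₂ => F x₁ x₂ g)) := by
  have := congrArg (fun t => tsum t (fun a p => tsum p (fun b c => F a b c))) d.mul_spec
  simp (disch := fun_prop) only [tsum_tsum, tsum_tm] at this
  exact this

lemma antipode_tsum {F : El B → El A → El T} (h₁ : ∀ y, Lin K (fun x => F x y))
    (h₂ : ∀ x, Lin K (fun y => F x y)) :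
    tsum (ap R one) (fun x g => F x (ap d.antipode g)) =
      tsum (ap R one) (fun x g => F (sinv x) g) := by
  have := congrArg (fun t => tsum t F) d.antipode_spec
  simpa (disch := fun_prop) only [tsum_tsum, tsum_tm] using this

/-- The algebra structure on `A`. -/
@[reducible] def monObj : MonObj A where
  one := unit R
  mul := d.mul
  one_mul := by
    refine ap_ext₂ fun c f => ?_
    simp (disch := fun_prop) only [ap_comp, ap_whiskerRight, tsum_tm, ap_leftUnitor, ap_mul]
    rw [eq_smul_one c, ap_smul, smul_m, scal_smul', scal_one, mul_one]
    congr 1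
    revert f
    refine d.separates.ext (by fun_prop) (by fun_prop) ?_
    simp (disch := fun_prop) only [ap_unit, tsum_m, tm_tsum, smul_m, tm_smul]
    rw [tsum_comm _ _ (by fun_prop) (by fun_prop) (by fun_prop) (by fun_prop)]
    rw [d.mul_tsum' (F := fun x y a => eps x • y ⊠ a) (by fun_prop) (by fun_prop) (by fun_prop)]
    simp (disch := fun_prop) only [eps_cop_left]
  mul_one := by
    refine ap_ext₂ fun f c => ?_
    simp (disch := fun_prop) only [ap_comp, ap_whiskerLeft, tsum_tm, ap_rightUnitor, ap_mul]
    rw [eq_smul_one c, ap_smul, m_smul, scal_smul', scal_one, mul_one]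
    congr 1
    revert f
    refine d.separates.ext (by fun_prop) (by fun_prop) ?_
    simp (disch := fun_prop) only [ap_unit, m_tsum, tm_tsum, m_smul, tm_smul]
    rw [d.mul_tsum' (F := fun x y a => eps y • x ⊠ a) (by fun_prop) (by fun_prop) (by fun_prop)]
    simp (disch := fun_prop) only [eps_cop_right]
  mul_assoc := by
    refine ap_ext₃ fun f g h => ?_
    simp (disch := fun_prop) only [ap_comp, ap_whiskerRight, ap_whiskerLeft, ap_assoc, tsum_tm,
      ap_mul]
    revert f g h
    refine d.separates.ext₃ (by fun_prop) (by fun_prop) (by fun_prop) (by fun_prop) (by fun_prop)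
      (by fun_prop) ?_
    rw [d.mul_tsum' (F := fun x y a => tsum (ap R one) fun z c => x ⊠ y ⊠ z ⊠ d.m a c)
      (by fun_prop) (by fun_prop) (by fun_prop)]
    simp (disch := fun_prop) only [tsum_comm (cop _) (ap R one)]
    rw [d.mul_tsum' (F := fun x z a => tsum (cop x) fun x₁ x₂ => x₁ ⊠ x₂ ⊠ z ⊠ a)
      (by fun_prop) (by fun_prop) (by fun_prop)]
    have e (x : El B) (a : El A) := d.mul_tsum' (F := fun y z b => x ⊠ y ⊠ z ⊠ d.m a b)
      (by fun_prop) (by fun_prop) (by fun_prop)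
    simp only [e]
    rw [d.mul_tsum' (F := fun x y b => tsum (cop y) fun y₁ y₂ => x ⊠ y₁ ⊠ y₂ ⊠ b)
      (by fun_prop) (by fun_prop) (by fun_prop)]
    simp (disch := fun_prop) only [coassoc]

/-- The coalgebra structure on `A`. -/
@[reducible] def comonObj : ComonObj A where
  counit := d.counit
  comul := d.comul
  counit_comul := by
    refine ap_ext fun f => ?_
    simp only [ap_comp, ap_whiskerRight, ap_leftUnitor_inv, ap_counit]
    revert f
    refine d.separates.ext (by fun_prop) (by fun_prop) ?_
    simp (disch := fun_prop) only [tm_tsum, smul_tm, tm_smul]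
    rw [d.comul_tsum (F := fun x a b => d.e a • x ⊠ one ⊠ b)
      (by fun_prop) (by fun_prop) (by fun_prop)]
    have e (x : El B) (g : El A) := d.counit_tsum (F := fun x' => (x * x') ⊠ one ⊠ g) (by fun_prop)
    simp only [e, mul_one]
  comul_counit := by
    refine ap_ext fun f => ?_
    simp only [ap_comp, ap_whiskerLeft, ap_rightUnitor_inv, ap_counit]
    revert f
    refine d.separates.ext (by fun_prop) (by fun_prop) ?_
    simp (disch := fun_prop) only [tm_tsum, tm_smul]
    rw [d.comul_tsum (F := fun x a b => d.e b • x ⊠ a ⊠ one)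
      (by fun_prop) (by fun_prop) (by fun_prop)]
    refine (tsum_comm _ _ (by fun_prop) (by fun_prop) (by fun_prop) (by fun_prop)).trans ?_
    have e (x : El B) (g : El A) := d.counit_tsum (F := fun x' => (x' * x) ⊠ g ⊠ one) (by fun_prop)
    simp only [e, one_mul]
  comul_assoc := by
    refine ap_ext fun f => ?_
    have e (a b : El A) : a ⊠ ap d.comul b = tsum (ap d.comul b) fun c e => a ⊠ c ⊠ e := by
      rw [← tm_tsum _ (by fun_prop) (by fun_prop), tsum_eta]
    have e' (a b : El A) : ap d.comul a ⊠ b = tsum (ap d.comul a) fun c e => (c ⊠ e) ⊠ b := by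
      rw [← tsum_tm' _ (by fun_prop) (by fun_prop), tsum_eta]
    simp (disch := fun_prop) only [ap_comp, ap_whiskerLeft, ap_whiskerRight, ap_assoc, e, e',
      tsum_tsum, tsum_tm]
    revert f
    refine d.separates.ext (by fun_prop) (by fun_prop) ?_
    simp (disch := fun_prop) only [tm_tsum]
    rw [d.comul_tsum (F := fun x a b => tsum (ap d.comul b) fun c e => x ⊠ a ⊠ c ⊠ e)
      (by fun_prop) (by fun_prop) (by fun_prop),
      d.comul_tsum (F := fun x a b => tsum (ap d.comul a) fun c e => x ⊠ c ⊠ e ⊠ b)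
      (by fun_prop) (by fun_prop) (by fun_prop)]
    refine (tsum_comm _ _ (by fun_prop) (by fun_prop) (by fun_prop) (by fun_prop)).trans ?_
    have e₁ (x : El B) (g : El A) := d.comul_tsum (F := fun x' a b => (x' * x) ⊠ g ⊠ a ⊠ b)
      (by fun_prop) (by fun_prop) (by fun_prop)
    have e₂ (x : El B) (g : El A) := d.comul_tsum (F := fun x' a b => (x * x') ⊠ a ⊠ b ⊠ g)
      (by fun_prop) (by fun_prop) (by fun_prop)
    simp only [e₁, e₂, mul_assoc]
    refine (tsum_comm _ _ (by fun_prop) (by fun_prop) (by fun_prop) (by fun_prop)).trans ?_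
    congr 1; funext x g
    exact tsum_comm _ _ (by fun_prop) (by fun_prop) (by fun_prop) (by fun_prop)

lemma comul_m (f g : El A) : ap d.comul (d.m f g) = tsum (ap d.comul f) (fun f₁ f₂ =>
    tsum (ap d.comul g) (fun g₁ g₂ => d.m f₁ g₁ ⊠ d.m f₂ g₂)) := by
  revert f g
  refine d.separates.ext₂ (by fun_prop) (by fun_prop) (by fun_prop) (by fun_prop) ?_
  rw [d.mul_tsum' (F := fun x x' g => x ⊠ x' ⊠ ap d.comul g)
    (by fun_prop) (by fun_prop) (by fun_prop)]
  have e (x x' : El B) (g : El A) : x ⊠ x' ⊠ ap d.comul g =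
      tsum (ap d.comul g) (fun g₁ g₂ => x ⊠ x' ⊠ g₁ ⊠ g₂) := by
    rw [← tm_tsum _ (by fun_prop) (by fun_prop), ← tm_tsum _ (by fun_prop) (by fun_prop), tsum_eta]
  simp (disch := fun_prop) only [e, tm_tsum, tsum_comm (cop _) (ap d.comul _)]
  rw [d.comul_tsum (F := fun x g₁ g₂ => tsum (cop x) fun x₁ x₂ => x₁ ⊠ x₂ ⊠ g₁ ⊠ g₂)
    (by fun_prop) (by fun_prop) (by fun_prop)]
  simp (disch := fun_prop) only [tsum_comm (ap R one) (ap d.comul _), tsum_cop_mul]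
  rw [d.comul_tsum (F := fun x g₁ g₂ => tsum (ap R one) fun x' g' => tsum (ap d.comul g')
    fun h₁ h₂ => x ⊠ x' ⊠ d.m g₁ h₁ ⊠ d.m g₂ h₂) (by fun_prop) (by fun_prop) (by fun_prop)]
  have e₁ (x y : El B) (g h : El A) := d.comul_tsum (F := fun x' h₁ h₂ =>
    (x * y) ⊠ x' ⊠ d.m h h₁ ⊠ d.m g h₂) (by fun_prop) (by fun_prop) (by fun_prop)
  simp only [e₁]
  have e₂ (x : El B) (g : El A) : tsum (ap R one) (fun y h => tsum (ap R one) fun x' g' =>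
      tsum (ap R one) fun y' h' => (x * y) ⊠ (x' * y') ⊠ d.m h h' ⊠ d.m g g') =
      tsum (ap R one) fun x' g' => tsum (ap R one) (fun y h => tsum (cop y) fun y₁ y₂ =>
      (x * y₁) ⊠ (x' * y₂) ⊠ h ⊠ d.m g g') := by
    refine (tsum_comm _ _ (by fun_prop) (by fun_prop) (by fun_prop) (by fun_prop)).trans ?_
    congr 1; funext x' g'
    exact d.mul_tsum' (F := fun y y' h => (x * y) ⊠ (x' * y') ⊠ h ⊠ d.m g g')
      (by fun_prop) (by fun_prop) (by fun_prop)
  simp only [e₂]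
  rw [d.mul_tsum' (F := fun x x' g => tsum (ap R one) fun y h => tsum (cop y) fun y₁ y₂ =>
      (x * y₁) ⊠ (x' * y₂) ⊠ h ⊠ g) (by fun_prop) (by fun_prop) (by fun_prop)]
  congr 1; funext x g
  exact tsum_comm _ _ (by fun_prop) (by fun_prop) (by fun_prop) (by fun_prop)

lemma e_m (f g : El A) : d.e (d.m f g) • (one : El (𝟙_ C)) = (d.e f * d.e g) • one := by
  simp only [mul_smul]
  revert f g
  refine d.separates.ext₂ (by fun_prop) (by fun_prop) (by fun_prop) (by fun_prop) ?_
  rw [d.mul_tsum' (F := fun x x' g => x ⊠ x' ⊠ (d.e g • one))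
    (by fun_prop) (by fun_prop) (by fun_prop)]
  simp (disch := fun_prop) only [tm_smul, smul_tsum]
  rw [d.counit_tsum (F := fun x => tsum (cop x) fun x₁ x₂ => x₁ ⊠ x₂ ⊠ one) (by fun_prop),
    d.counit_tsum (F := fun x => tsum (ap R one) fun x' g' => d.e g' • x ⊠ x' ⊠ one)
      (by fun_prop),
    d.counit_tsum (F := fun x => 1 ⊠ x ⊠ one) (by fun_prop)]
  simp (disch := fun_prop) only [tsum_cop_one]

lemma comul_unit : ap d.comul (ap (unit R) one) = ap (unit R) one ⊠ ap (unit R) one := by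
  have e (a b : El A) : a ⊠ b = tsum (a ⊠ b) (fun a b => a ⊠ b) := (tsum_eta _).symm
  rw [ap_unit, ← tsum_eta (ap d.comul _)]
  simp (disch := fun_prop) only [ap_tsum, ap_smul, tsum_tsum, tsum_smul, tsum_tm', tm_tsum,
    smul_tm, tm_smul]
  have h := d.comul_tsum (F := fun x g₁ g₂ => eps x • g₁ ⊠ g₂)
    (by fun_prop) (by fun_prop) (by fun_prop)
  simp (disch := fun_prop) only [smul_tsum, eps_mul, mul_smul] at h ⊢
  rw [h]

lemma e_unit : d.e (ap (unit R) one) • (one : El (𝟙_ C)) = one := by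
  rw [ap_unit, d.e_tsum _ (by fun_prop) (by fun_prop)]
  have h := d.counit_tsum (F := fun x => eps x • (one : El (𝟙_ C))) (by fun_prop)
  rw [eps_one, one_smul] at h
  refine Eq.trans ?_ h
  congr 1; funext x g
  rw [(d.lin_e Lin.id).smul, smul_eq_mul, mul_smul, smul_comm]

lemma antipode_m [IsIso 𝒮[B]] (f : El A) : tsum (ap d.comul f) (fun g h =>
    d.m (ap d.antipode g) h) = d.e f • ap (unit R) one := by
  revert f
  refine d.separates.ext (by fun_prop) (by fun_prop) ?_
  simp (disch := fun_prop) only [tm_tsum, tm_smul]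
  rw [d.counit_tsum (F := fun x => x ⊠ ap (unit R) one) (by fun_prop),
    d.comul_tsum (F := fun x g h => x ⊠ d.m (ap d.antipode g) h)
    (by fun_prop) (by fun_prop) (by fun_prop)]
  have e (x : El B) (g : El A) := d.antipode_tsum (F := fun x' g' => (x * x') ⊠ d.m g' g)
    (by fun_prop) (by fun_prop)
  simp only [e]
  refine (tsum_comm _ _ (by fun_prop) (by fun_prop) (by fun_prop) (by fun_prop)).trans ?_
  refine (d.mul_tsum' (F := fun x' x g => (x * sinv x') ⊠ g)
    (by fun_prop) (by fun_prop) (by fun_prop)).trans ?_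
  have e' (x : El B) (g : El A) := mul_sinv_cop x (F := fun y => y ⊠ g) (by fun_prop)
  simp (disch := fun_prop) only [e', ap_unit, tm_tsum, tm_smul]

lemma m_antipode [IsIso 𝒮[B]] (f : El A) : tsum (ap d.comul f) (fun g h =>
    d.m g (ap d.antipode h)) = d.e f • ap (unit R) one := by
  revert f
  refine d.separates.ext (by fun_prop) (by fun_prop) ?_
  simp (disch := fun_prop) only [tm_tsum, tm_smul]
  rw [d.counit_tsum (F := fun x => x ⊠ ap (unit R) one) (by fun_prop),
    d.comul_tsum (F := fun x g h => x ⊠ d.m g (ap d.antipode h))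
    (by fun_prop) (by fun_prop) (by fun_prop)]
  refine (tsum_comm _ _ (by fun_prop) (by fun_prop) (by fun_prop) (by fun_prop)).trans ?_
  have e (x : El B) (g : El A) := d.antipode_tsum (F := fun x' g' => (x' * x) ⊠ d.m g g')
    (by fun_prop) (by fun_prop)
  simp only [e]
  refine (d.mul_tsum' (F := fun x' x g => (sinv x * x') ⊠ g)
    (by fun_prop) (by fun_prop) (by fun_prop)).trans ?_
  have e' (x : El B) (g : El A) := sinv_mul_cop x (F := fun y => y ⊠ g) (by fun_prop)
  simp (disch := fun_prop) only [e', ap_unit, tm_tsum, tm_smul]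

/-- The Hopf algebra structure on `A`. -/
@[reducible] def hopfObj [IsIso 𝒮[B]] : HopfObj A :=
  letI := d.monObj
  letI := d.comonObj
  { mul_comul := by
      refine ap_ext₂ fun f g => ?_
      change ap (d.mul ≫ d.comul) (f ⊠ g) =
        ap ((d.comul ⊗ₘ d.comul) ≫ tensorμ A A A A ≫ (d.mul ⊗ₘ d.mul)) (f ⊠ g)
      simp (disch := fun_prop) only [ap_comp, ap_tensorHom, ap_tensorμ, tsum_tm, tsum_tsum]
      exact d.comul_m f g
    one_comul := by
      refine ap_ext_one ?_
      change ap (unit R ≫ d.comul) one = ap ((λ_ _).inv ≫ (unit R ⊗ₘ unit R)) one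
      simp (disch := fun_prop) only [ap_comp, ap_tensorHom, tsum_tm, ap_leftUnitor_inv]
      exact d.comul_unit
    mul_counit := by
      refine ap_ext₂ fun f g => ?_
      change ap (d.mul ≫ d.counit) (f ⊠ g) = ap ((d.counit ⊗ₘ d.counit) ≫ (λ_ _).hom) (f ⊠ g)
      simp (disch := fun_prop) only [ap_comp, ap_tensorHom, tsum_tm, ap_leftUnitor, ap_counit]
      refine (d.e_m f g).trans ?_
      rw [scal_smul', scal_one, mul_one, mul_smul]
    one_counit := by
      refine ap_ext_one ?_
      change ap (unit R ≫ d.counit) one = ap (𝟙 _) one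
      simp only [ap_comp, ap_counit, ap_id]
      exact d.e_unit
    antipode := d.antipode
    antipode_left := by
      refine ap_ext fun f => ?_
      change ap (d.comul ≫ d.antipode ▷ A ≫ d.mul) f = ap (d.counit ≫ unit R) f
      simp (disch := fun_prop) only [ap_comp, ap_whiskerRight, ap_tsum, ap_counit, ap_smul]
      exact d.antipode_m f
    antipode_right := by
      refine ap_ext fun f => ?_
      change ap (d.comul ≫ A ◁ d.antipode ≫ d.mul) f = ap (d.counit ≫ unit R) f
      simp (disch := fun_prop) only [ap_comp, ap_whiskerLeft, ap_tsum, ap_counit, ap_smul]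
      exact d.m_antipode f }

end DualMaps

end Dual

end

end QuantumDouble

namespace QuantumDouble

noncomputable section

section MatchedPair

variable {K : Type u} [CommRing K] {C : Type (u + 1)} [Category.{u} C] [MonoidalCategory C]
  [SymmetricCategory C] [LinCat K C]

variable {U V W T : C}

/-! ### The matched pair -/

/-- The canonical element `R ∈ B ⊗ A` intertwines the structure maps of the Hopf algebra `A` with
those of `B`, with the coproduct reversed, and the maps `lact : A ⊗ B ⟶ B` and
`ract : A ⊗ B ⟶ A` with the adjoint coaction and the adjoint action of `B`. -/
structure IsDualPair {B A : C} [HopfObj B] [HopfObj A] (R : 𝟙_ C ⟶ B ⊗ A) (lact : A ⊗ B ⟶ B)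
    (ract : A ⊗ B ⟶ A) : Prop where
  separates : Separates R
  one_eq : (1 : El A) = tsum (ap R one) (fun x g => eps x • g)
  counit_spec : tsum (ap R one) (fun x g => eps g • x) = 1
  comul_spec : tsum (ap R one) (fun x g => x ⊠ cop g) =
    tsum (ap R one) (fun x g => tsum (ap R one) (fun x' g' => (x * x') ⊠ (g' ⊠ g)))
  mul_spec : tsum (ap R one) (fun x g => tsum (ap R one) (fun x' g' => x ⊠ x' ⊠ (g * g'))) =
    tsum (ap R one) (fun x g => tsum (cop x) (fun x₁ x₂ => x₁ ⊠ x₂ ⊠ g))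
  lact_spec : ∀ b, tsum (ap R one) (fun x g => x ⊠ actE lact g b) =
    tsum (cop b) (fun b₁ p => tsum (cop p) fun b₂ b₃ => (b₃ * sinv b₁) ⊠ b₂)
  ract_spec : ∀ b, tsum (ap R one) (fun x g => x ⊠ ap ract (g ⊠ b)) =
    tsum (cop b) (fun b₁ b₂ => tsum (ap R one) fun x g => (b₂ * x * sinv b₁) ⊠ g)

variable {B A : C} [HopfObj B] [HopfObj A] {R : 𝟙_ C ⟶ B ⊗ A} {lact : A ⊗ B ⟶ B}
  {ract : A ⊗ B ⟶ A}

lemma ap_exchange (g : El A) (b : El B) : ap (exchange lact ract) (g ⊠ b) =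
    tsum (cop g) fun g₁ g₂ => tsum (cop b) fun b₁ b₂ => actE lact g₁ b₁ ⊠ ap ract (g₂ ⊠ b₂) := by
  simp (disch := fun_prop) only [exchange, ap_comp, ap_tensorHom, tsum_tm, ap_comul, ap_tensorμ,
    tsum_tsum]
  rfl

namespace IsDualPair

variable (d : IsDualPair R lact ract)
include d

lemma counit_tsum {F : El B → El T} (hF : Lin K F) :
    tsum (ap R one) (fun x g => eps g • F x) = F 1 := by
  rw [← d.counit_spec, map_tsum hF _ (by fun_prop) (by fun_prop)]
  simp only [hF.smul]

lemma one_tsum {F : El A → El T} (hF : Lin K F) :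
    tsum (ap R one) (fun x g => eps x • F g) = F 1 := by
  rw [d.one_eq, map_tsum hF _ (by fun_prop) (by fun_prop)]
  simp only [hF.smul]

section

variable {F : El B → El A → El A → El T} (h₁ : ∀ y z, Lin K (fun x => F x y z))
    (h₂ : ∀ x z, Lin K (fun y => F x y z)) (h₃ : ∀ x y, Lin K (fun z => F x y z))
include h₁ h₂ h₃

lemma comul_tsum :
    tsum (ap R one) (fun x g => tsum (cop g) (fun g₁ g₂ => F x g₁ g₂)) =
      tsum (ap R one) (fun x g => tsum (ap R one) (fun x' g' => F (x * x') g' g)) := by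
  have := congrArg (fun t => tsum t (fun a p => tsum p (fun b c => F a b c))) d.comul_spec
  simp (disch := fun_prop) only [tsum_tsum, tsum_tm] at this
  exact this

end

lemma mul_tsum {F : El B → El B → El A → El T} (h₁ : ∀ y z, Lin K (fun x => F x y z))
    (h₂ : ∀ x z, Lin K (fun y => F x y z)) (h₃ : ∀ x y, Lin K (fun z => F x y z)) :
    tsum (ap R one) (fun x g => tsum (ap R one) (fun x' g' => F x x' (g * g'))) =
      tsum (ap R one) (fun x g => tsum (cop x) (fun x₁ x₂ => F x₁ x₂ g)) := by
  have := congrArg (fun t => tsum t (fun a p => tsum p (fun b c => F a b c))) d.mul_spec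
  simp (disch := fun_prop) only [tsum_tsum, tsum_tm] at this
  exact this

lemma mul_tsum_swap {F : El B → El B → El A → El T} (h₁ : ∀ y z, Lin K (fun x => F x y z))
    (h₂ : ∀ x z, Lin K (fun y => F x y z)) (h₃ : ∀ x y, Lin K (fun z => F x y z)) :
    tsum (ap R one) (fun x g => tsum (ap R one) (fun x' g' => F x x' (g' * g))) =
      tsum (ap R one) (fun x g => tsum (cop x) (fun x₁ x₂ => F x₂ x₁ g)) :=
  (tsum_comm _ _ (by fun_prop) (by fun_prop) (by fun_prop) (by fun_prop)).trans
    (d.mul_tsum (F := fun x x' g => F x' x g) (by fun_prop) (by fun_prop) (by fun_prop))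

lemma lact_tsum (b : El B) {F : El B → El B → El T} (h₁ : ∀ y, Lin K (fun x => F x y))
    (h₂ : ∀ x, Lin K (fun y => F x y)) : tsum (ap R one) (fun x g => F x (actE lact g b)) =
    tsum (cop b) (fun b₁ p => tsum (cop p) fun b₂ b₃ => F (b₃ * sinv b₁) b₂) := by
  have := congrArg (fun t => tsum t F) (d.lact_spec b)
  simp (disch := fun_prop) only [tsum_tsum, tsum_tm] at this
  exact this

lemma ract_tsum (b : El B) {F : El B → El A → El T} (h₁ : ∀ y, Lin K (fun x => F x y))
    (h₂ : ∀ x, Lin K (fun y => F x y)) : tsum (ap R one) (fun x g => F x (ap ract (g ⊠ b))) =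
    tsum (cop b) (fun b₁ b₂ => tsum (ap R one) fun x g => F (b₂ * x * sinv b₁) g) := by
  have := congrArg (fun t => tsum t F) (d.ract_spec b)
  simp (disch := fun_prop) only [tsum_tsum, tsum_tm] at this
  exact this

variable [IsIso 𝒮[B]]

/-- The exchange map corresponds to the conjugation `x ↦ b₃ x S⁻¹(b₁) ⊗ b₂` which occurs in the
compatibility condition of Drinfeld-Yetter modules. -/
lemma exchange_tsum (b : El B) {F : El B → El B → El A → El T}
    (h₁ : ∀ y z, Lin K (fun x => F x y z))
    (h₂ : ∀ x z, Lin K (fun y => F x y z)) (h₃ : ∀ x y, Lin K (fun z => F x y z)) :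
    tsum (ap R one) (fun x g => tsum (ap (exchange lact ract) (g ⊠ b)) fun y h => F x y h) =
    tsum (cop b) (fun b₁ p => tsum (cop p) fun b₂ b₃ => tsum (ap R one) fun x g =>
      F (b₃ * x * sinv b₁) b₂ g) := by
  simp (disch := fun_prop) only [ap_exchange, tsum_tsum, tsum_tm]
  rw [d.comul_tsum (F := fun x g₁ g₂ => tsum (cop b) fun b₁ b₂ =>
    F x (actE lact g₁ b₁) (ap ract (g₂ ⊠ b₂))) (by fun_prop) (by fun_prop) (by fun_prop)]
  simp (disch := fun_prop) only [tsum_comm (ap R one) (cop b)]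
  have e₁ (b : El B) (c : El B) (x : El B) (g : El A) := d.lact_tsum b
    (F := fun x' y => F (x * x') y (ap ract (g ⊠ c))) (by fun_prop) (by fun_prop)
  simp (disch := fun_prop) only [e₁, tsum_comm (ap R one) (cop _)]
  have e₂ (z y b : El B) := d.ract_tsum b
    (F := fun x g => F (x * z) y g) (by fun_prop) (by fun_prop)
  simp (disch := fun_prop) only [e₂, coassoc]
  congr 1; funext b₁ p; congr 1; funext b₂ q
  have h := sinv_mul_cancel₁ q (F := fun z r => tsum (ap R one) fun x g =>
    F (r * (x * (z * sinv b₁))) b₂ g) (by fun_prop) (by fun_prop)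
  simpa only [mul_assoc, one_mul] using h


lemma one_lact (b : El B) : actE lact 1 b = b := by
  rw [← d.one_tsum (F := fun g => actE lact g b) (by fun_prop),
    d.lact_tsum b (F := fun x y => eps x • y) (by fun_prop) (by fun_prop)]
  simp (disch := fun_prop) only [eps_mul, eps_sinv, mul_smul, eps_cop_left, eps_cop_right]

lemma mul_lact (f g : El A) (b : El B) :
    actE lact (f * g) b = actE lact f (actE lact g b) := by
  revert f g
  refine d.separates.ext₂ (by fun_prop) (by fun_prop) (by fun_prop) (by fun_prop) ?_
  rw [d.mul_tsum (F := fun x x' g => x ⊠ x' ⊠ actE lact g b)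
    (by fun_prop) (by fun_prop) (by fun_prop),
    d.lact_tsum b (F := fun x y => tsum (cop x) fun x₁ x₂ => x₁ ⊠ x₂ ⊠ y)
    (by fun_prop) (by fun_prop)]
  refine Eq.symm ((tsum_comm _ _ (by fun_prop) (by fun_prop) (by fun_prop) (by fun_prop)).trans ?_)
  have e (x' : El B) (b : El B) := d.lact_tsum b (F := fun x y => x ⊠ x' ⊠ y)
    (by fun_prop) (by fun_prop)
  rw [d.lact_tsum b (F := fun x' y => tsum (ap R one) fun x g => x ⊠ x' ⊠ actE lact g y)
    (by fun_prop) (by fun_prop)]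
  simp (disch := fun_prop) only [e, tsum_cop_mul, tsum_cop_sinv]
  refine Eq.trans ?_ ((coassoc b (F := fun x y p => tsum (cop p) fun b₂ b₃ => tsum (cop b₃)
    fun x₁ x₂ => (x₁ * sinv y) ⊠ (x₂ * sinv x) ⊠ b₂) (by fun_prop) (by fun_prop)
    (by fun_prop)).symm.trans ?_)
  · simp (disch := fun_prop) only [coassoc]
  · congr 1; funext b₁ p
    simp (disch := fun_prop) only [tsum_comm (cop b₁) (cop _)]

lemma ract_one (f : El A) : ap ract (f ⊠ 1) = f := by
  revert f
  refine d.separates.ext (by fun_prop) (by fun_prop) ?_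
  rw [d.ract_tsum 1 (F := fun x g => x ⊠ g) (by fun_prop) (by fun_prop)]
  simp (disch := fun_prop) only [tsum_cop_one, sinv_one, one_mul, mul_one]

lemma ract_mul (f : El A) (b c : El B) :
    ap ract (f ⊠ (b * c)) = ap ract (ap ract (f ⊠ b) ⊠ c) := by
  revert f
  refine d.separates.ext (by fun_prop) (by fun_prop) ?_
  rw [d.ract_tsum b (F := fun x g => x ⊠ ap ract (g ⊠ c)) (by fun_prop) (by fun_prop),
    d.ract_tsum _ (F := fun x g => x ⊠ g) (by fun_prop) (by fun_prop)]
  have e (x y : El B) := d.ract_tsum c (F := fun z g => (x * z * y) ⊠ g)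
    (by fun_prop) (by fun_prop)
  simp (disch := fun_prop) only [e]
  simp (disch := fun_prop) only [tsum_cop_mul, sinv_mul, mul_assoc]

lemma cop_lact (f : El A) (b : El B) : cop (actE lact f b) =
    tsum (cop f) fun f₁ f₂ => tsum (cop b) fun b₁ b₂ => actE lact f₁ b₁ ⊠ actE lact f₂ b₂ := by
  revert f
  refine d.separates.ext (by fun_prop) (by fun_prop) ?_
  have e (x y : El B) : x ⊠ cop y = tsum (cop y) fun y₁ y₂ => x ⊠ y₁ ⊠ y₂ := by
    rw [← tm_tsum _ (by fun_prop) (by fun_prop), tsum_eta]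
  simp (disch := fun_prop) only [tm_tsum, e]
  rw [d.lact_tsum b (F := fun x y => tsum (cop y) fun y₁ y₂ => x ⊠ y₁ ⊠ y₂)
    (by fun_prop) (by fun_prop),
    d.comul_tsum (F := fun x f₁ f₂ => tsum (cop b) fun b₁ b₂ =>
      x ⊠ actE lact f₁ b₁ ⊠ actE lact f₂ b₂) (by fun_prop) (by fun_prop) (by fun_prop)]
  simp (disch := fun_prop) only [tsum_comm (ap R one) (cop b)]
  have e₁ (b c x : El B) (g : El A) := d.lact_tsum b
    (F := fun x' y => (x * x') ⊠ y ⊠ actE lact g c) (by fun_prop) (by fun_prop)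
  simp (disch := fun_prop) only [e₁, tsum_comm (ap R one) (cop _)]
  have e₂ (z y b : El B) := d.lact_tsum b
    (F := fun x w => (x * z) ⊠ y ⊠ w) (by fun_prop) (by fun_prop)
  simp (disch := fun_prop) only [e₂, coassoc]
  congr 1; funext b₁ p; congr 1; funext b₂ q
  have h := sinv_mul_cancel₁ q (F := fun z r => tsum (cop r) fun r₁ r₂ =>
    (r₂ * (z * sinv b₁)) ⊠ b₂ ⊠ r₁) (by fun_prop) (by fun_prop)
  simpa only [mul_assoc, one_mul] using h.symm

lemma eps_lact (f : El A) (b : El B) : eps (actE lact f b) • (one : El (𝟙_ C)) =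
    (eps f * eps b) • one := by
  simp only [mul_smul]
  revert f
  refine d.separates.ext (by fun_prop) (by fun_prop) ?_
  simp (disch := fun_prop) only [tm_smul]
  rw [d.lact_tsum b (F := fun x y => eps y • x ⊠ one) (by fun_prop) (by fun_prop),
    d.counit_tsum (F := fun x => eps b • x ⊠ one) (by fun_prop)]
  simp (disch := fun_prop) only [eps_cop_left]
  exact mul_sinv_cop b (F := fun x => x ⊠ one) (by fun_prop)

lemma cop_ract (f : El A) (b : El B) : cop (ap ract (f ⊠ b)) =
    tsum (cop f) fun f₁ f₂ => tsum (cop b) fun b₁ b₂ =>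
      ap ract (f₁ ⊠ b₁) ⊠ ap ract (f₂ ⊠ b₂) := by
  revert f
  refine d.separates.ext (by fun_prop) (by fun_prop) ?_
  have e (x : El B) (y : El A) : x ⊠ cop y = tsum (cop y) fun y₁ y₂ => x ⊠ y₁ ⊠ y₂ := by
    rw [← tm_tsum _ (by fun_prop) (by fun_prop), tsum_eta]
  simp (disch := fun_prop) only [tm_tsum, e]
  rw [d.ract_tsum b (F := fun x y => tsum (cop y) fun y₁ y₂ => x ⊠ y₁ ⊠ y₂)
    (by fun_prop) (by fun_prop),
    d.comul_tsum (F := fun x f₁ f₂ => tsum (cop b) fun b₁ b₂ =>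
      x ⊠ ap ract (f₁ ⊠ b₁) ⊠ ap ract (f₂ ⊠ b₂)) (by fun_prop) (by fun_prop) (by fun_prop)]
  have e₀ (x y : El B) := d.comul_tsum (F := fun z f₁ f₂ => (x * z * y) ⊠ f₁ ⊠ f₂)
    (by fun_prop) (by fun_prop) (by fun_prop)
  simp (disch := fun_prop) only [e₀, tsum_comm (ap R one) (cop b)]
  have e₁ (b c x : El B) (g : El A) := d.ract_tsum b
    (F := fun x' y => (x * x') ⊠ y ⊠ ap ract (g ⊠ c)) (by fun_prop) (by fun_prop)
  simp (disch := fun_prop) only [e₁, tsum_comm (ap R one) (cop _)]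
  have e₂ (z b : El B) : tsum (ap R one) (fun x g => tsum (ap R one) fun x' g' =>
      (x * (z * x' * sinv b)) ⊠ g' ⊠ g) = tsum (ap R one) (fun x g => tsum (ap R one) fun x' g' =>
      (x * (z * x' * sinv b)) ⊠ g' ⊠ g) := rfl
  have e₂ (z s b : El B) : tsum (ap R one) (fun x g => tsum (ap R one) fun x' g' =>
      (x * (z * x' * s)) ⊠ g' ⊠ ap ract (g ⊠ b)) =
      tsum (cop b) fun b₁ b₂ => tsum (ap R one) fun x g => tsum (ap R one) fun x' g' =>
        (b₂ * x * sinv b₁ * (z * x' * s)) ⊠ g' ⊠ g :=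
    d.ract_tsum b (F := fun x g => tsum (ap R one) fun x' g' => (x * (z * x' * s)) ⊠ g' ⊠ g)
      (by fun_prop) (by fun_prop)
  simp (disch := fun_prop) only [e₂, coassoc]
  congr 1; funext b₁ p
  have h := sinv_mul_cancel₁ p (F := fun z r => tsum (ap R one) fun x g =>
    tsum (ap R one) fun x' g' => (r * (x * (z * (x' * sinv b₁)))) ⊠ g' ⊠ g)
    (by fun_prop) (by fun_prop)
  simpa only [mul_assoc, one_mul] using h.symm

lemma eps_ract (f : El A) (b : El B) : eps (ap ract (f ⊠ b)) • (one : El (𝟙_ C)) =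
    (eps f * eps b) • one := by
  simp only [mul_smul]
  revert f
  refine d.separates.ext (by fun_prop) (by fun_prop) ?_
  simp (disch := fun_prop) only [tm_smul]
  rw [d.ract_tsum b (F := fun x y => eps y • x ⊠ one) (by fun_prop) (by fun_prop),
    d.counit_tsum (F := fun x => eps b • x ⊠ one) (by fun_prop)]
  have e (b c : El B) := d.counit_tsum (F := fun x => (b * x * c) ⊠ one) (by fun_prop)
  simp (disch := fun_prop) only [e, mul_one]
  exact mul_sinv_cop b (F := fun x => x ⊠ one) (by fun_prop)

lemma lact_one (f : El A) : actE lact f 1 = eps f • 1 := by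
  revert f
  refine d.separates.ext (by fun_prop) (by fun_prop) ?_
  simp (disch := fun_prop) only [tm_smul]
  rw [d.lact_tsum 1 (F := fun x y => x ⊠ y) (by fun_prop) (by fun_prop),
    d.counit_tsum (F := fun x => x ⊠ 1) (by fun_prop)]
  simp (disch := fun_prop) only [tsum_cop_one, sinv_one, one_mul]

lemma one_ract (b : El B) : ap ract (1 ⊠ b) = eps b • 1 := by
  rw [← d.one_tsum (F := fun g => ap ract (g ⊠ b)) (by fun_prop),
    d.ract_tsum b (F := fun x y => eps x • y) (by fun_prop) (by fun_prop)]
  simp (disch := fun_prop) only [eps_mul, eps_sinv, mul_smul]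
  have e : ∀ b₁ b₂ : El B, tsum (ap R one) (fun x g => eps b₂ • eps x • eps b₁ • g) =
      eps b₂ • eps b₁ • 1 := fun b₁ b₂ => by
    rw [smul_tsum _ (by fun_prop) (by fun_prop),
      d.one_tsum (F := fun g => eps b₁ • g) (by fun_prop)]
  simp (disch := fun_prop) only [e, eps_cop_right]

/-- `f ▷ (b c) = y (h ▷ c)`, where `y ⊗ h` is the image of `f ⊗ b` under the exchange map. -/
lemma lact_mul (f : El A) (b c : El B) : actE lact f (b * c) =
    tsum (ap (exchange lact ract) (f ⊠ b)) fun y h => y * actE lact h c := by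
  revert f
  refine d.separates.ext (by fun_prop) (by fun_prop) ?_
  simp (disch := fun_prop) only [tm_tsum]
  rw [d.lact_tsum (b * c) (F := fun x y => x ⊠ y) (by fun_prop) (by fun_prop),
    d.exchange_tsum b (F := fun x y h => x ⊠ (y * actE lact h c))
    (by fun_prop) (by fun_prop) (by fun_prop)]
  have e (x y z : El B) := d.lact_tsum c (F := fun w v => (x * w * z) ⊠ (y * v))
    (by fun_prop) (by fun_prop)
  simp (disch := fun_prop) only [e]
  simp (disch := fun_prop) only [tsum_cop_mul, sinv_mul, mul_assoc, tsum_comm (cop _) (cop c)]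

/-- `(f g) ◁ b = (f ◁ y) h`, where `y ⊗ h` is the image of `g ⊗ b` under the exchange map. -/
lemma mul_ract (f g : El A) (b : El B) : ap ract ((f * g) ⊠ b) =
    tsum (ap (exchange lact ract) (g ⊠ b)) fun y h => ap ract (f ⊠ y) * h := by
  revert f g
  refine d.separates.ext₂ (by fun_prop) (by fun_prop) (by fun_prop) (by fun_prop) ?_
  simp (disch := fun_prop) only [tm_tsum]
  rw [d.mul_tsum (F := fun x x' g => x ⊠ x' ⊠ ap ract (g ⊠ b))
    (by fun_prop) (by fun_prop) (by fun_prop),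
    d.ract_tsum b (F := fun x g => tsum (cop x) fun x₁ x₂ => x₁ ⊠ x₂ ⊠ g)
    (by fun_prop) (by fun_prop)]
  have e₁ (x : El B) (f : El A) := d.exchange_tsum b (F := fun x' y h =>
    x ⊠ x' ⊠ (ap ract (f ⊠ y) * h)) (by fun_prop) (by fun_prop) (by fun_prop)
  simp (disch := fun_prop) only [e₁, tsum_comm (ap R one) (cop b), tsum_comm (ap R one) (cop _)]
  have e₂ (s t b : El B) := d.ract_tsum b (F := fun x g => tsum (ap R one) fun x' g' =>
    x ⊠ (s * x' * t) ⊠ (g * g')) (by fun_prop) (by fun_prop)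
  have e₃ (s t s' t' : El B) := d.mul_tsum (F := fun x x' g =>
    (s * x * t) ⊠ (s' * x' * t') ⊠ g) (by fun_prop) (by fun_prop) (by fun_prop)
  simp (disch := fun_prop) only [e₂, e₃]
  simp (disch := fun_prop) only [tsum_cop_mul, tsum_cop_sinv]
  refine Eq.trans ?_ ((coassoc b (F := fun x y p => tsum (cop p) fun b₁ b₂ => tsum (ap R one)
    fun z g => tsum (cop z) fun z₁ z₂ => (b₁ * z₁ * sinv y) ⊠ (b₂ * z₂ * sinv x) ⊠ g)
    (by fun_prop) (by fun_prop) (by fun_prop)).trans (by simp (disch := fun_prop) only [coassoc]))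
  congr 1; funext b₁ p
  simp (disch := fun_prop) only [tsum_comm (cop b₁) (cop _), tsum_comm (cop b₁) (ap R one),
    tsum_comm (ap R one) (cop p)]

lemma exchange_comm (f : El A) (b : El B) : ap (exchange lact ract) (f ⊠ b) =
    tsum (cop f) fun f₁ f₂ => tsum (cop b) fun b₁ b₂ => actE lact f₂ b₂ ⊠ ap ract (f₁ ⊠ b₁) := by
  revert f
  refine d.separates.ext (by fun_prop) (by fun_prop) ?_
  have h₀ := d.exchange_tsum b (F := fun x y h => x ⊠ y ⊠ h)
    (by fun_prop) (by fun_prop) (by fun_prop)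
  simp (disch := fun_prop) only [← tm_tsum, tsum_eta] at h₀
  rw [h₀]
  simp (disch := fun_prop) only [tm_tsum]
  rw [d.comul_tsum (F := fun x f₁ f₂ => tsum (cop b) fun b₁ b₂ =>
      x ⊠ actE lact f₂ b₂ ⊠ ap ract (f₁ ⊠ b₁)) (by fun_prop) (by fun_prop) (by fun_prop)]
  simp (disch := fun_prop) only [tsum_comm (ap R one) (cop b)]
  have e₁ (b c x : El B) (g : El A) := d.ract_tsum b
    (F := fun x' y => (x * x') ⊠ actE lact g c ⊠ y) (by fun_prop) (by fun_prop)
  simp (disch := fun_prop) only [e₁, tsum_comm (ap R one) (cop _)]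
  have e₂ (s t b : El B) := d.lact_tsum b
    (F := fun x w => tsum (ap R one) fun x' g' => (x * (s * x' * t)) ⊠ w ⊠ g')
    (by fun_prop) (by fun_prop)
  simp (disch := fun_prop) only [e₂, coassoc]
  congr 1; funext b₁ p
  have h := sinv_mul_cancel₁ p (F := fun z r => tsum (cop r) fun r₁ r₂ =>
    tsum (ap R one) fun x g => (r₂ * (z * (x * sinv b₁))) ⊠ r₁ ⊠ g) (by fun_prop) (by fun_prop)
  simpa only [mul_assoc, one_mul] using h.symm

lemma isMatchedPair : IsMatchedPair B A lact ract where
  isAction := (isAction_iff _).2 ⟨d.one_lact, d.mul_lact⟩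
  ract_one := ap_ext₂ fun f (c : El (𝟙_ C)) => by
    simp (disch := fun_prop) [d.ract_one]
  ract_mul := ap_ext₃' fun f b c => by
    simp (disch := fun_prop) [d.ract_mul]
  lact_comul := ap_ext₂ fun f b => by
    simp (disch := fun_prop)
    exact d.cop_lact f b
  lact_counit := ap_ext₂ fun f b => by
    simp (disch := fun_prop)
    exact (d.eps_lact f b).trans (by rw [mul_comm, mul_smul])
  ract_comul := ap_ext₂ fun f b => by
    simp (disch := fun_prop)
    exact d.cop_ract f b
  ract_counit := ap_ext₂ fun f b => by
    simp (disch := fun_prop)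
    exact (d.eps_ract f b).trans (by rw [mul_comm, mul_smul])
  lact_one := ap_ext₂ fun f (c : El (𝟙_ C)) => by
    simp (disch := fun_prop)
    exact congrArg _ (d.lact_one f)
  one_ract := ap_ext₂ fun (c : El (𝟙_ C)) b => by
    simp (disch := fun_prop) [d.one_ract]
  lact_mul := ap_ext₃' fun f b c => by
    have h := d.lact_mul f b c
    simp (disch := fun_prop) only [ap_exchange, tsum_tsum, tsum_tm] at h
    simp (disch := fun_prop)
    exact h
  mul_ract := ap_ext₃ fun f g b => by
    have h := d.mul_ract f g b
    simp (disch := fun_prop) only [ap_exchange, tsum_tsum, tsum_tm] at h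
    simp (disch := fun_prop)
    exact h
  compat := ap_ext₂ fun f b => by
    have h := d.exchange_comm f b
    rw [ap_exchange] at h
    simp (disch := fun_prop)
    refine h.trans ?_
    exact tsum_comm _ _ (by fun_prop) (by fun_prop) (by fun_prop) (by fun_prop)

end IsDualPair

end MatchedPair

end

end QuantumDouble

namespace QuantumDouble

noncomputable section

section Double

variable {K : Type u} [CommRing K] {C : Type (u + 1)} [Category.{u} C] [MonoidalCategory C]
  [SymmetricCategory C] [LinCat K C]

variable {U V W T : C} {M : Type*} [AddCommGroup M] [Module K M]

/-! ### The double cross product -/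

section

variable {B A : C}

/-- The element `b ⊗ f` of the double cross product. -/
def dc (b : El B) (f : El A) : El (DoubleCross B A) := b ⊠ f

@[fun_prop] lemma lin_dc_left {g : M → El B} (hg : Lin K g) (f : El A) :
    Lin K (fun x => dc (g x) f) := lin_tm_left hg f

@[fun_prop] lemma lin_dc_right (b : El B) {g : M → El A} (hg : Lin K g) :
    Lin K (fun x => dc b (g x)) := lin_tm_right b hg

lemma dc_ext {F G : El (DoubleCross B A) → El T} (hF : Lin K F) (hG : Lin K G)
    (h : ∀ b f, F (dc b f) = G (dc b f)) (x : El (DoubleCross B A)) : F x = G x :=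
  tm_ext (f := F) (g := G) hF hG h x

end

variable {B A : C} [HopfObj B] [HopfObj A] {R : 𝟙_ C ⟶ B ⊗ A} {lact : A ⊗ B ⟶ B}
  {ract : A ⊗ B ⟶ A}

local notation "X" => exchange lact ract

namespace IsDualPair

variable (d : IsDualPair R lact ract) [IsIso 𝒮[B]]
include d

lemma exchange_one (f : El A) : ap X (f ⊠ 1) = 1 ⊠ f := by
  rw [ap_exchange]
  simp (disch := fun_prop) only [tsum_cop_one, d.lact_one, d.ract_one, smul_tm, eps_cop_left]

lemma one_exchange (b : El B) : ap X (1 ⊠ b) = b ⊠ 1 := by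
  rw [ap_exchange]
  simp (disch := fun_prop) only [tsum_cop_one, d.one_lact, d.one_ract, tm_smul, eps_cop_right]

lemma exchange_mul (f : El A) (b c : El B) {F : El B → El A → El T}
    (h₁ : ∀ y, Lin K (fun x => F x y)) (h₂ : ∀ x, Lin K (fun y => F x y)) :
    tsum (ap X (f ⊠ (b * c))) F = tsum (ap X (f ⊠ b)) fun y h =>
      tsum (ap X (h ⊠ c)) fun y' h' => F (y * y') h' := by
  revert f
  refine d.separates.ext (by fun_prop) (by fun_prop) ?_
  simp (disch := fun_prop) only [tm_tsum]
  rw [d.exchange_tsum (b * c) (F := fun x y h => x ⊠ F y h)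
    (by fun_prop) (by fun_prop) (by fun_prop), d.exchange_tsum b (F := fun x y h =>
      tsum (ap X (h ⊠ c)) fun y' h' => x ⊠ F (y * y') h')
    (by fun_prop) (by fun_prop) (by fun_prop)]
  have e (s t y : El B) := d.exchange_tsum c (F := fun x y' h => (s * x * t) ⊠ F (y * y') h)
    (by fun_prop) (by fun_prop) (by fun_prop)
  simp (disch := fun_prop) only [e]
  simp (disch := fun_prop) only [tsum_cop_mul, sinv_mul, mul_assoc, tsum_comm (cop _) (cop c)]

lemma mul_exchange (f g : El A) (b : El B) {F : El B → El A → El T}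
    (h₁ : ∀ y, Lin K (fun x => F x y)) (h₂ : ∀ x, Lin K (fun y => F x y)) :
    tsum (ap X ((f * g) ⊠ b)) F = tsum (ap X (g ⊠ b)) fun y h =>
      tsum (ap X (f ⊠ y)) fun y' h' => F y' (h' * h) := by
  revert f g
  refine d.separates.ext₂ (by fun_prop) (by fun_prop) (by fun_prop) (by fun_prop) ?_
  simp (disch := fun_prop) only [tm_tsum]
  rw [d.mul_tsum (F := fun x x' g => tsum (ap X (g ⊠ b)) fun y h => x ⊠ x' ⊠ F y h)
    (by fun_prop) (by fun_prop) (by fun_prop)]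
  simp (disch := fun_prop) only [tsum_comm (cop _) (ap X _)]
  rw [d.exchange_tsum b (F := fun x y h => tsum (cop x) fun x₁ x₂ => x₁ ⊠ x₂ ⊠ F y h)
    (by fun_prop) (by fun_prop) (by fun_prop)]
  have e₁ (x : El B) (f : El A) := d.exchange_tsum b (F := fun x' y h =>
    tsum (ap X (f ⊠ y)) fun y' h' => x ⊠ x' ⊠ F y' (h' * h))
    (by fun_prop) (by fun_prop) (by fun_prop)
  simp (disch := fun_prop) only [e₁, tsum_comm (ap R one) (cop b), tsum_comm (ap R one) (cop _)]
  have e₂ (s t b : El B) : tsum (ap R one) (fun x f => tsum (ap R one) fun x' g' =>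
      tsum (ap X (f ⊠ b)) fun y' h' => x ⊠ (s * x' * t) ⊠ F y' (h' * g')) =
      tsum (cop b) (fun b₁ p => tsum (cop p) fun b₂ b₃ => tsum (ap R one) fun x g =>
        tsum (ap R one) fun x' g' => (b₃ * x * sinv b₁) ⊠ (s * x' * t) ⊠ F b₂ (g * g')) := by
    simp (disch := fun_prop) only [tsum_comm (ap R one) (ap X _)]
    exact d.exchange_tsum b (F := fun x y h => tsum (ap R one) fun x' g' =>
      x ⊠ (s * x' * t) ⊠ F y (h * g')) (by fun_prop) (by fun_prop) (by fun_prop)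
  have e₃ (s t s' t' y : El B) := d.mul_tsum (F := fun x x' g =>
    (s * x * t) ⊠ (s' * x' * t') ⊠ F y g) (by fun_prop) (by fun_prop) (by fun_prop)
  simp (disch := fun_prop) only [e₂, e₃]
  simp (disch := fun_prop) only [tsum_cop_mul, tsum_cop_sinv]
  refine Eq.trans ?_ ((coassoc b (F := fun x y p => tsum (cop p) fun b₀ b₃ => tsum (cop b₃)
    fun b₁ b₂ => tsum (ap R one) fun z g => tsum (cop z) fun z₁ z₂ =>
      (b₁ * z₁ * sinv y) ⊠ (b₂ * z₂ * sinv x) ⊠ F b₀ g)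
    (by fun_prop) (by fun_prop) (by fun_prop)).trans (by simp (disch := fun_prop) only [coassoc]))
  congr 1; funext b₁ p
  simp (disch := fun_prop) only [tsum_comm (cop b₁) (cop _), tsum_comm (cop b₁) (ap R one),
    tsum_comm (ap R one) (cop _)]

lemma exchange_cop (f : El A) (b : El B) {F : El B → El B → El A → El A → El T}
    (h₁ : ∀ y z w, Lin K (fun x => F x y z w)) (h₂ : ∀ x z w, Lin K (fun y => F x y z w))
    (h₃ : ∀ x y w, Lin K (fun z => F x y z w)) (h₄ : ∀ x y z, Lin K (fun w => F x y z w)) :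
    tsum (ap X (f ⊠ b)) (fun y h => tsum (cop y) fun y₁ y₂ => tsum (cop h) fun h₁ h₂ =>
      F y₁ y₂ h₁ h₂) =
    tsum (cop f) fun f₁ f₂ => tsum (cop b) fun b₁ b₂ => tsum (ap X (f₁ ⊠ b₁)) fun y h =>
      tsum (ap X (f₂ ⊠ b₂)) fun y' h' => F y y' h h' := by
  revert f
  refine d.separates.ext (by fun_prop) (by fun_prop) ?_
  simp (disch := fun_prop) only [tm_tsum]
  rw [d.exchange_tsum b (F := fun x y h => tsum (cop y) fun y₁ y₂ => tsum (cop h) fun h₁ h₂ =>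
      x ⊠ F y₁ y₂ h₁ h₂) (by fun_prop) (by fun_prop) (by fun_prop),
    d.comul_tsum (F := fun x f₁ f₂ => tsum (cop b) fun b₁ b₂ => tsum (ap X (f₁ ⊠ b₁)) fun y h =>
      tsum (ap X (f₂ ⊠ b₂)) fun y' h' => x ⊠ F y y' h h')
      (by fun_prop) (by fun_prop) (by fun_prop)]
  simp (disch := fun_prop) only [tsum_comm (ap R one) (cop b)]
  have e₁ (b c x : El B) (g : El A) := d.exchange_tsum b (F := fun x' y h =>
    tsum (ap X (g ⊠ c)) fun y' h' => (x * x') ⊠ F y y' h h')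
    (by fun_prop) (by fun_prop) (by fun_prop)
  simp (disch := fun_prop) only [e₁, tsum_comm (ap R one) (cop _)]
  have e₂ (s t c y : El B) : tsum (ap R one) (fun x g => tsum (ap R one) fun x' h =>
      tsum (ap X (g ⊠ c)) fun y' h' => (x * (s * x' * t)) ⊠ F y y' h h') =
      tsum (cop c) (fun b₁ p => tsum (cop p) fun b₂ b₃ => tsum (ap R one) fun x g =>
        tsum (ap R one) fun x' h => (b₃ * x * sinv b₁ * (s * x' * t)) ⊠ F y b₂ h g) := by
    simp (disch := fun_prop) only [tsum_comm (ap R one) (ap X _)]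
    exact d.exchange_tsum c (F := fun x y' h' => tsum (ap R one) fun x' h =>
      (x * (s * x' * t)) ⊠ F y y' h h') (by fun_prop) (by fun_prop) (by fun_prop)
  have e₃ (s t y y' : El B) := d.comul_tsum (F := fun x h h' => (s * x * t) ⊠ F y y' h h')
    (by fun_prop) (by fun_prop) (by fun_prop)
  simp (disch := fun_prop) only [e₂, coassoc, e₃]
  congr 1; funext b₁ p; congr 1; funext b₂ q
  have h := sinv_mul_cancel₁ q (F := fun z r => tsum (cop r) fun r₁ r₂ => tsum (ap R one)
    fun x g => tsum (ap R one) fun x' h => (r₂ * (x * (z * (x' * sinv b₁)))) ⊠ F b₂ r₁ h g)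
    (by fun_prop) (by fun_prop)
  simpa only [mul_assoc, one_mul] using h.symm

lemma exchange_eps (f : El A) (b : El B) :
    tsum (ap X (f ⊠ b)) (fun y h => (eps y * eps h) • (one : El (𝟙_ C))) =
      (eps f * eps b) • one := by
  simp (disch := fun_prop) only [ap_exchange, tsum_tsum, tsum_tm, mul_smul]
  have e₁ (f : El A) (b : El B) : eps (actE lact f b) = eps f * eps b := by
    simpa using congrArg scal (d.eps_lact f b)
  have e₂ (f : El A) (b : El B) : eps (ap ract (f ⊠ b)) = eps f * eps b := by
    simpa using congrArg scal (d.eps_ract f b)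
  simp (disch := fun_prop) only [e₁, e₂, mul_smul]
  have e₃ (f g : El A) : tsum (cop b) (fun b₁ b₂ => eps f • eps b₁ • eps g • eps b₂ •
      (one : El (𝟙_ C))) = eps f • eps g • eps b • one := by
    simp only [smul_comm (eps g)]
    rw [smul_tsum _ (by fun_prop) (by fun_prop)]
    simp (disch := fun_prop) only [eps_cop_left]
  simp (disch := fun_prop) only [e₃, eps_cop_left]

end IsDualPair

end Double

end

end QuantumDouble

namespace QuantumDouble

noncomputable section

section Double

variable {K : Type u} [CommRing K] {C : Type (u + 1)} [Category.{u} C] [MonoidalCategory C]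
  [SymmetricCategory C] [LinCat K C]

variable {U V W T : C} {M : Type*} [AddCommGroup M] [Module K M]

/-! ### The Hopf algebra structure of the double -/

section

variable {B A : C} [HopfObj B] [HopfObj A]

/-- The antipode `b ⊗ f ↦ S(f) S(b)` of the double cross product. -/
def doubleAntipode (lact : A ⊗ B ⟶ B) (ract : A ⊗ B ⟶ A) : DoubleCross B A ⟶ DoubleCross B A :=
  (β_ B A).hom ≫ (𝒮[A] ⊗ₘ 𝒮[B]) ≫ exchange lact ract

/-- The product of the double cross product. -/
def dmul (X : A ⊗ B ⟶ B ⊗ A) : (B ⊗ A) ⊗ (B ⊗ A) ⟶ B ⊗ A :=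
  (α_ B A (B ⊗ A)).hom ≫ B ◁ (α_ A B A).inv ≫
    B ◁ X ▷ A ≫ B ◁ (α_ B A A).hom ≫ (α_ B B (A ⊗ A)).inv ≫ (μ[B] ⊗ₘ μ[A])

lemma ap_dmul (X : A ⊗ B ⟶ B ⊗ A) (b b' : El B) (f f' : El A) :
    ap (dmul X) ((b ⊠ f) ⊠ (b' ⊠ f')) = tsum (ap X (f ⊠ b')) fun y h => (b * y) ⊠ (h * f') := by
  simp (disch := fun_prop) only [dmul, ap_comp, ap_assoc, ap_assoc_inv, ap_whiskerLeft,
    ap_whiskerRight, tsum_tm, ap_tensorHom, ap_mu, ap_tsum, tm_tsum, tsum_tm']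

/-- The coalgebra structure of the double cross product. -/
@[reducible] def doubleComon : ComonObj (DoubleCross B A) := inferInstanceAs (ComonObj (B ⊗ A))

attribute [local instance] doubleComon

lemma tsum_cop_tm (b : El B) (f : El A) {F : El (B ⊗ A) → El (B ⊗ A) → El T}
    (h₁ : ∀ y, Lin K (fun x => F x y)) (h₂ : ∀ x, Lin K (fun y => F x y)) :
    tsum (cop (b ⊠ f)) F = tsum (cop b) fun b₁ b₂ => tsum (cop f) fun f₁ f₂ =>
      F (b₁ ⊠ f₁) (b₂ ⊠ f₂) := by
  have h : cop (b ⊠ f) = tsum (cop b) fun b₁ b₂ => tsum (cop f) fun f₁ f₂ =>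
      (b₁ ⊠ f₁) ⊠ (b₂ ⊠ f₂) := by
    rw [cop, Comon.tensorObj_comul]
    simp (disch := fun_prop) only [ap_comp, ap_tensorHom, tsum_tm, ap_tensorμ, ap_comul]
  rw [h]
  simp (disch := fun_prop) only [tsum_tsum, tsum_tm]

lemma tsum_cop_dc' (b : El B) (f : El A) {F : El (DoubleCross B A) → El (DoubleCross B A) → El T}
    (h₁ : ∀ y, Lin K (fun x => F x y)) (h₂ : ∀ x, Lin K (fun y => F x y)) :
    tsum (cop (dc b f)) F = tsum (cop b) fun b₁ b₂ => tsum (cop f) fun f₁ f₂ =>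
      F (dc b₁ f₁) (dc b₂ f₂) := tsum_cop_tm b f h₁ h₂

lemma eps_dc' (b : El B) (f : El A) : eps (dc b f) = eps b * eps f := eps_tm b f

omit [HopfObj B] [HopfObj A] in
lemma ap_ext_dc {F G : DoubleCross B A ⊗ V ⟶ T}
    (h : ∀ b f v, ap F (dc b f ⊠ v) = ap G (dc b f ⊠ v)) : F = G :=
  ap_ext₂ fun x v => dc_ext (F := fun x => ap F (x ⊠ v)) (G := fun x => ap G (x ⊠ v))
    (by fun_prop) (by fun_prop) (fun b f => h b f v) x

omit [HopfObj B] [HopfObj A] in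
lemma ap_ext_dc₂ {F G : DoubleCross B A ⊗ DoubleCross B A ⟶ T}
    (h : ∀ b f b' f', ap F (dc b f ⊠ dc b' f') = ap G (dc b f ⊠ dc b' f')) : F = G :=
  ap_ext_dc fun b f => dc_ext (by fun_prop) (by fun_prop) (h b f)

omit [HopfObj B] [HopfObj A] in
lemma ap_ext_dc₃ {F G : (DoubleCross B A ⊗ DoubleCross B A) ⊗ DoubleCross B A ⟶ T}
    (h : ∀ b f b' f' b'' f'', ap F ((dc b f ⊠ dc b' f') ⊠ dc b'' f'') =
      ap G ((dc b f ⊠ dc b' f') ⊠ dc b'' f'')) : F = G := by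
  refine ap_ext₃ fun x y z => ?_
  revert z
  refine dc_ext (by fun_prop) (by fun_prop) fun b'' f'' => ?_
  revert y
  refine dc_ext (by fun_prop) (by fun_prop) fun b' f' => ?_
  revert x
  exact dc_ext (by fun_prop) (by fun_prop) fun b f => h b f b' f' b'' f''

variable {R : 𝟙_ C ⟶ B ⊗ A} {lact : A ⊗ B ⟶ B} {ract : A ⊗ B ⟶ A}

local notation "X" => exchange lact ract

namespace IsDualPair

variable (d : IsDualPair R lact ract) [IsIso 𝒮[B]]
include d

/-- The algebra structure of the double cross product. -/
@[reducible] def doubleMon : MonObj (DoubleCross B A) where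
  one := (λ_ _).inv ≫ (η[B] ⊗ₘ η[A])
  mul := dmul X
  one_mul := by
    refine ap_ext₂ fun c => dc_ext (by fun_prop) (by fun_prop) fun b f => ?_
    change ap (((λ_ _).inv ≫ (η[B] ⊗ₘ η[A])) ▷ (B ⊗ A) ≫ dmul X) (c ⊠ b ⊠ f) =
      ap (λ_ (B ⊗ A)).hom (c ⊠ b ⊠ f)
    simp (disch := fun_prop) [ap_dmul, d.one_exchange]
  mul_one := by
    refine ap_ext₂ fun x c => ?_
    revert x
    refine dc_ext (by fun_prop) (by fun_prop) fun b f => ?_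
    change ap ((B ⊗ A) ◁ ((λ_ _).inv ≫ (η[B] ⊗ₘ η[A])) ≫ dmul X) ((b ⊠ f) ⊠ c) =
      ap (ρ_ (B ⊗ A)).hom ((b ⊠ f) ⊠ c)
    simp (disch := fun_prop) [ap_dmul, d.exchange_one]
  mul_assoc := by
    refine ap_ext_dc₃ fun b f b' f' b'' f'' => ?_
    change ap (dmul X ▷ (B ⊗ A) ≫ dmul X) (((b ⊠ f) ⊠ b' ⊠ f') ⊠ b'' ⊠ f'') =
      ap ((α_ (B ⊗ A) (B ⊗ A) (B ⊗ A)).hom ≫ (B ⊗ A) ◁ dmul X ≫ dmul X)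
        (((b ⊠ f) ⊠ b' ⊠ f') ⊠ b'' ⊠ f'')
    simp (disch := fun_prop) only [ap_comp, ap_whiskerRight, ap_whiskerLeft, tsum_tm, ap_assoc,
      ap_dmul, tsum_tm', tm_tsum, ap_tsum, d.mul_exchange, d.exchange_mul, mul_assoc]
    exact tsum_comm _ _ (by fun_prop) (by fun_prop) (by fun_prop) (by fun_prop)

lemma dc_mul_dc (b b' : El B) (f f' : El A) :
    letI := d.doubleMon
    dc b f * dc b' f' = tsum (ap X (f ⊠ b')) fun y h => dc (b * y) (h * f') :=
  ap_dmul X b b' f f'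

lemma one_dc :
    letI := d.doubleMon
    (1 : El (DoubleCross B A)) = dc 1 1 := by
  change ap ((λ_ _).inv ≫ (η[B] ⊗ₘ η[A])) one = (1 : El B) ⊠ (1 : El A)
  simp (disch := fun_prop)

/-- The double cross product as a bialgebra. -/
@[reducible] def doubleBimon : BimonObj (DoubleCross B A) :=
  letI := d.doubleMon
  { mul_comul := by
      refine ap_ext_dc₂ fun b f b' f' => ?_
      simp (disch := fun_prop) only [ap_comp, ap_tensorHom, tsum_tm, ap_tensorμ, ap_comul, ap_mu,
        tsum_tsum, tsum_cop_dc', d.dc_mul_dc]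
      rw [map_tsum (L := fun x => cop x) (by fun_prop) _ (by fun_prop) (by fun_prop)]
      have e (b : El B) (f : El A) : cop (dc b f) = tsum (cop b) fun b₁ b₂ => tsum (cop f)
          fun f₁ f₂ => dc b₁ f₁ ⊠ dc b₂ f₂ := by
        rw [← tsum_cop_dc' b f (F := fun x y => x ⊠ y) (by fun_prop) (by fun_prop), tsum_eta]
      simp (disch := fun_prop) only [e, tsum_cop_mul, tm_tsum, tsum_tm']
      simp (disch := fun_prop) only [tsum_comm (ap X (f ⊠ b')) (cop b), tsum_comm (cop f') (ap X _)]
      congr 1; funext b₁ b₂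
      rw [d.exchange_cop f b' (F := fun y₁ y₂ h₁ h₂ => tsum (cop f') fun f₁ f₂ =>
        dc (b₁ * y₁) (h₁ * f₁) ⊠ dc (b₂ * y₂) (h₂ * f₂)) (by fun_prop) (by fun_prop)
        (by fun_prop) (by fun_prop)]
      congr 1; funext f₁ f₂; congr 1; funext b'₁ b'₂
      exact tsum_comm _ _ (by fun_prop) (by fun_prop) (by fun_prop) (by fun_prop)
    one_comul := by
      refine ap_ext_one ?_
      change ap (η[DoubleCross B A] ≫ Δ[DoubleCross B A]) one =
        ap ((λ_ _).inv ≫ (η[DoubleCross B A] ⊗ₘ η[DoubleCross B A])) one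
      simp only [ap_comp, ap_eta, scal_one, one_smul, ap_comul, d.one_dc]
      rw [← tsum_eta (cop (dc 1 1)), tsum_cop_dc' _ _ (by fun_prop) (by fun_prop)]
      simp (disch := fun_prop) only [tsum_cop_one, ap_leftUnitor_inv,
        ap_tensorHom, tsum_tm, ap_eta, scal_one, one_smul, d.one_dc]
    mul_counit := by
      refine ap_ext_dc₂ fun b f b' f' => ?_
      simp (disch := fun_prop) only [ap_comp, ap_mu, ap_counit, tsum_tm, d.dc_mul_dc, eps_tm,
        eps_dc']
      rw [map_tsum (L := fun x => eps x • one) (by fun_prop) _ (by fun_prop) (by fun_prop)]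
      have h := d.exchange_eps f b'
      simp only [mul_smul] at h
      refine Eq.trans ?_ ((congrArg (fun x => (eps b * eps f') • x) h).trans ?_)
      · rw [← smul_tsum _ (by fun_prop) (by fun_prop)]
        congr 1; funext y h
        simp only [eps_dc', eps_mul, smul_smul]
        congr 1
        ring
      · simp only [smul_smul]
        congr 1
        ring
    one_counit := by
      refine ap_ext_one ?_
      simp (disch := fun_prop) [d.one_dc, eps_dc'] }

lemma dc_eq_mul (b : El B) (f : El A) :
    letI := d.doubleMon
    dc b f = dc b 1 * dc 1 f := by
  simp (disch := fun_prop) only [d.dc_mul_dc, d.exchange_one, tsum_tm, mul_one, one_mul]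

lemma dc_one_mul (b c : El B) :
    letI := d.doubleMon
    (dc b 1 * dc c 1 : El (DoubleCross B A)) = dc (b * c) 1 := by
  simp (disch := fun_prop) only [d.dc_mul_dc, d.one_exchange, tsum_tm, mul_one]

lemma one_dc_mul (f g : El A) :
    letI := d.doubleMon
    (dc 1 f * dc 1 g : El (DoubleCross B A)) = dc 1 (f * g) := by
  simp (disch := fun_prop) only [d.dc_mul_dc, d.exchange_one, tsum_tm, mul_one]

lemma ap_doubleAntipode (b : El B) (f : El A) :
    letI := d.doubleMon
    ap (doubleAntipode lact ract) (dc b f) = dc 1 (anti f) * dc (anti b) 1 := by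
  rw [d.dc_mul_dc]
  simp only [one_mul, mul_one]
  change ap ((β_ B A).hom ≫ (𝒮[A] ⊗ₘ 𝒮[B]) ≫ exchange lact ract) (b ⊠ f) =
    tsum (ap X (anti f ⊠ anti b)) fun y h => y ⊠ h
  simp (disch := fun_prop) only [ap_comp, ap_braiding, ap_tensorHom, tsum_tm, tsum_eta,
    ap_antipode]

/-- The double cross product as a Hopf algebra. -/
@[reducible] def doubleHopf : HopfObj (DoubleCross B A) :=
  letI := d.doubleBimon
  { antipode := doubleAntipode lact ract
    antipode_left := by
      refine ap_ext (dc_ext (by fun_prop) (by fun_prop) fun b f => ?_)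
      simp (disch := fun_prop) only [ap_comp _ (_ ▷ _ ≫ _), ap_comul]
      simp (disch := fun_prop) only [ap_comp (_ ▷ _), ap_whiskerRight, ap_comp ε[_], tsum_cop_dc',
        d.ap_doubleAntipode, ap_tsum, ap_mu_tm, ap_counit, ap_eta, ap_smul,
        eps_dc', scal_one, one_smul, d.one_dc]
      have h₁ (g h : El A) (x y : El B) : (dc 1 g * dc x 1 : El (DoubleCross B A)) * dc y h =
          dc 1 g * dc (x * y) 1 * dc 1 h := by
        rw [d.dc_eq_mul y h, mul_assoc, ← mul_assoc (dc x 1), d.dc_one_mul, mul_assoc]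
      have h₂ (g h : El A) := (congrArg (tsum (cop b)) (funext fun x => funext fun y =>
        h₁ g h (anti x) y)).trans (anti_mul_cop b (F := fun z =>
        (dc 1 g * dc z 1 * dc 1 h : El (DoubleCross B A))) (by fun_prop))
      have h₃ := anti_mul_cop f (F := fun z => (dc 1 z : El (DoubleCross B A))) (by fun_prop)
      simp (disch := fun_prop) only [tsum_comm (cop b) (cop f), h₂, d.one_dc_mul, mul_one, h₃,
        smul_tsum, mul_smul]
    antipode_right := by
      refine ap_ext (dc_ext (by fun_prop) (by fun_prop) fun b f => ?_)
      simp (disch := fun_prop) only [ap_comp _ (_ ◁ _ ≫ _), ap_comul]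
      simp (disch := fun_prop) only [ap_comp (_ ◁ _), ap_whiskerLeft, ap_comp ε[_], tsum_cop_dc',
        d.ap_doubleAntipode, ap_tsum, ap_mu_tm, ap_counit, ap_eta, ap_smul,
        eps_dc', scal_one, one_smul, d.one_dc]
      have h₁ (g h : El A) (x y : El B) : dc x g * (dc 1 h * dc y 1 : El (DoubleCross B A)) =
          dc x 1 * dc 1 (g * h) * dc y 1 := by
        rw [d.dc_eq_mul x g, ← mul_assoc, mul_assoc (dc x 1), d.one_dc_mul]
      have h₂ (x y : El B) := mul_anti_cop f (F := fun z =>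
        (dc x 1 * dc 1 z * dc y 1 : El (DoubleCross B A))) (by fun_prop)
      have h₃ := mul_anti_cop b (F := fun z => (dc z 1 : El (DoubleCross B A))) (by fun_prop)
      simp (disch := fun_prop) only [h₁, h₂, d.dc_one_mul, mul_one, h₃, smul_tsum, mul_smul]
      rw [smul_comm] }

lemma isDoubleCrossProduct :
    letI := d.doubleHopf
    IsDoubleCrossProduct lact ract := by
  letI := d.doubleHopf
  have hl (b : El B) : ap (inl B A) b = dc b 1 := by
    change ap ((ρ_ B).inv ≫ B ◁ η[A]) b = b ⊠ (1 : El A)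
    simp (disch := fun_prop)
  have hr (f : El A) : ap (inr B A) f = dc 1 f := by
    change ap ((λ_ A).inv ≫ η[B] ▷ A) f = (1 : El B) ⊠ f
    simp (disch := fun_prop)
  exact
  { one_eq := rfl
    mul_eq := rfl
    counit_eq := rfl
    comul_eq := Comon.tensorObj_comul B A
    antipode_eq := rfl
    inl_isBimonHom :=
      { one_hom := ap_ext_one (by simp only [ap_comp, ap_eta_one, hl, d.one_dc])
        mul_hom := ap_ext₂ fun b c => by
          simp (disch := fun_prop) only [ap_comp, ap_mu_tm, ap_tensorHom, tsum_tm, hl, d.dc_one_mul]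
        hom_counit := ap_ext fun b => by
          simp only [ap_comp, ap_counit, hl, eps_dc', eps_one, mul_one]
        hom_comul := ap_ext fun b => by
          simp only [ap_comp, ap_comul, hl, ap_tensorHom]
          rw [← tsum_eta (cop (dc b 1)), tsum_cop_dc' _ _ (by fun_prop) (by fun_prop)]
          simp (disch := fun_prop) only [tsum_cop_one] }
    inr_isBimonHom :=
      { one_hom := ap_ext_one (by simp only [ap_comp, ap_eta_one, hr, d.one_dc])
        mul_hom := ap_ext₂ fun b c => by
          simp (disch := fun_prop) only [ap_comp, ap_mu_tm, ap_tensorHom, tsum_tm, hr, d.one_dc_mul]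
        hom_counit := ap_ext fun b => by
          simp only [ap_comp, ap_counit, hr, eps_dc', eps_one, one_mul]
        hom_comul := ap_ext fun b => by
          simp only [ap_comp, ap_comul, hr, ap_tensorHom]
          rw [← tsum_eta (cop (dc 1 b)), tsum_cop_dc' _ _ (by fun_prop) (by fun_prop)]
          simp (disch := fun_prop) only [tsum_cop_one] } }

end IsDualPair

end

end Double

end

end QuantumDouble

namespace QuantumDouble

noncomputable section

section Double

variable {K : Type u} [CommRing K] {C : Type (u + 1)} [Category.{u} C] [MonoidalCategory C]
  [SymmetricCategory C] [LinCat K C]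

variable {U V W T : C} {M : Type*} [AddCommGroup M] [Module K M]

/-! ### The quasitriangular structure of the double -/

section

variable {B A : C} [HopfObj B] [HopfObj A] {lact : A ⊗ B ⟶ B} {ract : A ⊗ B ⟶ A}
  [HopfObj (DoubleCross B A)]

local notation "X" => exchange lact ract

namespace IsDoubleCrossProduct

variable (h : IsDoubleCrossProduct lact ract)
include h

lemma dc_mul_dc (b b' : El B) (f f' : El A) :
    dc b f * dc b' f' = tsum (ap X (f ⊠ b')) fun y h => dc (b * y) (h * f') := by
  change ap μ[DoubleCross B A] (dc b f ⊠ dc b' f') = _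
  rw [h.mul_eq]
  exact ap_dmul X b b' f f'

lemma one_dc : (1 : El (DoubleCross B A)) = dc 1 1 := by
  change ap η[DoubleCross B A] one = (1 : El B) ⊠ (1 : El A)
  rw [h.one_eq]
  change ap ((λ_ _).inv ≫ (η[B] ⊗ₘ η[A])) one = (1 : El B) ⊠ (1 : El A)
  simp (disch := fun_prop)

lemma eps_dc (b : El B) (f : El A) : eps (dc b f) = eps b * eps f := by
  rw [eps, h.counit_eq]
  exact eps_tm b f

lemma tsum_cop_dc (b : El B) (f : El A) {F : El (DoubleCross B A) → El (DoubleCross B A) → El T}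
    (h₁ : ∀ y, Lin K (fun x => F x y)) (h₂ : ∀ x, Lin K (fun y => F x y)) :
    tsum (cop (dc b f)) F = tsum (cop b) fun b₁ b₂ => tsum (cop f) fun f₁ f₂ =>
      F (dc b₁ f₁) (dc b₂ f₂) := by
  rw [cop, h.comul_eq]
  have := Comon.tensorObj_comul B A
  exact (congrArg (fun m => tsum (ap m (b ⊠ f)) F) this.symm).trans (tsum_cop_tm b f h₁ h₂)

end IsDoubleCrossProduct

omit [HopfObj (DoubleCross B A)] in
lemma ap_inl (b : El B) : ap (inl B A) b = dc b 1 := by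
  change ap ((ρ_ B).inv ≫ B ◁ η[A]) b = b ⊠ (1 : El A)
  simp (disch := fun_prop)

omit [HopfObj (DoubleCross B A)] in
lemma ap_inr (f : El A) : ap (inr B A) f = dc 1 f := by
  change ap ((λ_ A).inv ≫ η[B] ▷ A) f = (1 : El B) ⊠ f
  simp (disch := fun_prop)

omit [HopfObj (DoubleCross B A)] in
lemma tsum_doubleR (R : 𝟙_ C ⟶ B ⊗ A) {F : El (DoubleCross B A) → El (DoubleCross B A) → El T}
    (h₁ : ∀ y, Lin K (fun x => F x y)) (h₂ : ∀ x, Lin K (fun y => F x y)) :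
    tsum (ap (doubleR R) one) F = tsum (ap R one) fun x g => F (dc x 1) (dc 1 g) := by
  simp (disch := fun_prop) only [doubleR, ap_comp, ap_tensorHom, tsum_tsum, tsum_tm, ap_inl,
    ap_inr]

variable {R : 𝟙_ C ⟶ B ⊗ A}

namespace IsDualPair

variable (d : IsDualPair R lact ract) [IsIso 𝒮[B]] (h : IsDoubleCrossProduct lact ract)
include d h

lemma dc_one_mul_dc (b c : El B) (f : El A) :
    (dc b 1 * dc c f : El (DoubleCross B A)) = dc (b * c) f := by
  simp (disch := fun_prop) only [h.dc_mul_dc, d.one_exchange, tsum_tm, one_mul]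

lemma dc_mul_one_dc (b : El B) (f g : El A) :
    (dc b f * dc 1 g : El (DoubleCross B A)) = dc b (f * g) := by
  simp (disch := fun_prop) only [h.dc_mul_dc, d.exchange_one, tsum_tm, mul_one]

lemma one_dc_mul_dc_one (b : El B) (f : El A) :
    (dc 1 f * dc b 1 : El (DoubleCross B A)) = tsum (ap X (f ⊠ b)) dc := by
  simp (disch := fun_prop) only [h.dc_mul_dc, mul_one, one_mul]

/-- It suffices to check the intertwining property of the R-matrix on generators. -/
lemma quasitriangular_comm_mul {x y : El (DoubleCross B A)}
    (hx : tsum (ap R one) (fun z g => tsum (cop x) (fun d₁ d₂ =>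
      (dc z 1 * d₁) ⊠ (dc 1 g * d₂))) =
      tsum (cop x) (fun d₁ d₂ => tsum (ap R one) (fun z g => (d₂ * dc z 1) ⊠ (d₁ * dc 1 g))))
    (hy : tsum (ap R one) (fun z g => tsum (cop y) (fun d₁ d₂ =>
      (dc z 1 * d₁) ⊠ (dc 1 g * d₂))) =
      tsum (cop y) (fun d₁ d₂ => tsum (ap R one) (fun z g => (d₂ * dc z 1) ⊠ (d₁ * dc 1 g)))) :
    tsum (ap R one) (fun z g => tsum (cop (x * y)) (fun d₁ d₂ =>
      (dc z 1 * d₁) ⊠ (dc 1 g * d₂))) =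
      tsum (cop (x * y)) (fun d₁ d₂ => tsum (ap R one) (fun z g =>
        (d₂ * dc z 1) ⊠ (d₁ * dc 1 g))) := by
  simp (disch := fun_prop) only [tsum_cop_mul, ← mul_assoc]
  have hx' := congrArg (fun t => tsum t fun a b => tsum (cop y) fun y₁ y₂ =>
    (a * y₁) ⊠ (b * y₂)) hx
  have hy' (x₁ x₂ : El (DoubleCross B A)) := congrArg (fun t => tsum t fun a b =>
    (x₂ * a) ⊠ (x₁ * b)) hy
  simp (disch := fun_prop) only [tsum_tsum, tsum_tm, ← mul_assoc] at hx' hy'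
  rw [hx']
  simp only [← hy']

lemma quasitriangular_comm (x : El (DoubleCross B A)) :
    tsum (ap R one) (fun z g => tsum (cop x) (fun d₁ d₂ =>
      (dc z 1 * d₁) ⊠ (dc 1 g * d₂))) =
    tsum (cop x) (fun d₁ d₂ => tsum (ap R one) (fun z g =>
      (d₂ * dc z 1) ⊠ (d₁ * dc 1 g))) := by
  revert x
  refine dc_ext (by fun_prop) (by fun_prop) fun b f => ?_
  rw [← mul_one b, ← d.dc_one_mul_dc h]
  refine d.quasitriangular_comm_mul h ?_ ?_
  · simp (disch := fun_prop) only [h.tsum_cop_dc, tsum_cop_one, d.dc_one_mul_dc h,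
      d.one_dc_mul_dc_one h, tm_tsum, tsum_comm (ap R one) (cop b)]
    have e (b c : El B) := d.exchange_tsum c (F := fun z y g =>
      (dc (z * b) 1 : El (DoubleCross B A)) ⊠ dc y g) (by fun_prop) (by fun_prop) (by fun_prop)
    simp only [e, mul_one, mul_assoc]
    have h' := sinv_mul_cancel₁ b (F := fun z p => tsum (cop p) fun y c => tsum (ap R one)
      fun x g => (dc (c * (x * z)) 1 : El (DoubleCross B A)) ⊠ (dc y g : El (DoubleCross B A)))
      (by fun_prop) (by fun_prop)
    simp only [mul_one] at h'
    exact h'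
  · simp (disch := fun_prop) only [h.tsum_cop_dc, tsum_cop_one, d.dc_one_mul_dc h,
      d.dc_mul_one_dc h, d.one_dc_mul_dc_one h, tsum_tm', mul_one]
    clear b
    revert f
    refine d.separates.ext (by fun_prop) (by fun_prop) ?_
    simp (disch := fun_prop) only [tm_tsum]
    rw [d.comul_tsum (F := fun w f₁ f₂ => tsum (ap R one) fun z g =>
        tsum (ap X (f₂ ⊠ z)) fun y k => w ⊠ (dc y k : El (DoubleCross B A)) ⊠
          (dc 1 (f₁ * g) : El (DoubleCross B A))) (by fun_prop) (by fun_prop) (by fun_prop)]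
    simp (disch := fun_prop) only [tsum_comm (ap R one) (cop _)]
    rw [d.comul_tsum (F := fun w f₁ f₂ => tsum (ap R one) fun z g =>
      w ⊠ (dc z f₁ : El (DoubleCross B A)) ⊠ (dc 1 (g * f₂) : El (DoubleCross B A)))
      (by fun_prop) (by fun_prop) (by fun_prop)]
    have e₁ (w' : El B) (k' : El A) := d.mul_tsum_swap (F := fun w z g =>
      (w * w') ⊠ (dc z k' : El (DoubleCross B A)) ⊠ (dc 1 g : El (DoubleCross B A)))
      (by fun_prop) (by fun_prop) (by fun_prop)
    have e₂ (w : El B) (k : El A) : tsum (ap R one) (fun w' k' => tsum (ap R one) fun z g =>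
        tsum (ap X (k ⊠ z)) fun y l => (w * w') ⊠ (dc y l : El (DoubleCross B A)) ⊠
          (dc 1 (k' * g) : El (DoubleCross B A))) = _ := d.mul_tsum (F := fun w' z g =>
      tsum (ap X (k ⊠ z)) fun y l => (w * w') ⊠ (dc y l : El (DoubleCross B A)) ⊠
        (dc 1 g : El (DoubleCross B A))) (by fun_prop) (by fun_prop) (by fun_prop)
    simp only [e₂]
    refine (tsum_comm _ _ (by fun_prop) (by fun_prop) (by fun_prop) (by fun_prop)).trans ?_
    simp only [e₁]
    refine (tsum_comm _ _ (by fun_prop) (by fun_prop) (by fun_prop) (by fun_prop)).trans ?_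
    refine Eq.trans ?_ (tsum_comm _ _ (by fun_prop) (by fun_prop) (by fun_prop) (by fun_prop))
    congr 1; funext x g
    have e₃ (x₁ x₂ : El B) := d.exchange_tsum x₂ (F := fun w y l =>
      (w * x₁) ⊠ (dc y l : El (DoubleCross B A)) ⊠ (dc 1 g : El (DoubleCross B A)))
      (by fun_prop) (by fun_prop) (by fun_prop)
    simp (disch := fun_prop) only [tsum_comm (ap R one) (cop x), e₃]
    have h' := sinv_mul_cancel₁ x (F := fun z r => tsum (cop r) fun r₁ r₂ => tsum (ap R one)
      fun w k => (r₂ * (w * z)) ⊠ (dc r₁ k : El (DoubleCross B A)) ⊠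
        (dc 1 g : El (DoubleCross B A))) (by fun_prop) (by fun_prop)
    simp only [mul_one] at h'
    simpa only [mul_assoc] using h'.symm

lemma isQuasitriangular : IsQuasitriangular (DoubleCross B A) (doubleR R) := by
  refine isQuasitriangular_iff.2 ⟨⟨R ≫ (𝒮[B] ≫ inl B A ⊗ₘ inr B A), ?_, ?_⟩, ?_, ?_, ?_⟩
  · simp (disch := fun_prop) only [tsum_doubleR, ap_comp, ap_tensorHom, tsum_tsum, tsum_tm, ap_inl,
      ap_inr, ap_antipode, d.dc_one_mul_dc h, d.dc_mul_one_dc h]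
    rw [d.mul_tsum (F := fun x x' g => dc (x * anti x') 1 ⊠ dc 1 g)
      (by fun_prop) (by fun_prop) (by fun_prop)]
    have e (x : El B) (g : El A) := mul_anti_cop x (F := fun z =>
      (dc z 1 : El (DoubleCross B A)) ⊠ (dc 1 g : El (DoubleCross B A))) (by fun_prop)
    simp only [e, h.one_dc]
    exact d.one_tsum (F := fun g => dc 1 1 ⊠ dc 1 g) (by fun_prop)
  · simp (disch := fun_prop) only [tsum_doubleR, ap_comp, ap_tensorHom, tsum_tsum, tsum_tm, ap_inl,
      ap_inr, ap_antipode, d.dc_one_mul_dc h, d.dc_mul_one_dc h]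
    rw [d.mul_tsum (F := fun x x' g => dc (anti x * x') 1 ⊠ dc 1 g)
      (by fun_prop) (by fun_prop) (by fun_prop)]
    have e (x : El B) (g : El A) := anti_mul_cop x (F := fun z =>
      (dc z 1 : El (DoubleCross B A)) ⊠ (dc 1 g : El (DoubleCross B A))) (by fun_prop)
    simp only [e, h.one_dc]
    exact d.one_tsum (F := fun g => dc 1 1 ⊠ dc 1 g) (by fun_prop)
  · intro x
    simp (disch := fun_prop) only [tsum_doubleR]
    exact d.quasitriangular_comm h x
  · simp (disch := fun_prop) only [tsum_doubleR, h.tsum_cop_dc, tsum_cop_one, d.dc_mul_one_dc h]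
    exact (d.mul_tsum_swap (F := fun x x' g => dc x' 1 ⊠ dc x 1 ⊠ dc 1 g)
      (by fun_prop) (by fun_prop) (by fun_prop)).symm
  · have e (x y : El (DoubleCross B A)) : x ⊠ cop y = tsum (cop y) fun a b => x ⊠ a ⊠ b := by
      rw [← tm_tsum _ (by fun_prop) (by fun_prop), tsum_eta]
    simp (disch := fun_prop) only [e, tsum_doubleR, h.tsum_cop_dc, tsum_cop_one,
      d.dc_one_mul_dc h]
    rw [d.comul_tsum (F := fun x g₁ g₂ => dc x 1 ⊠ dc 1 g₁ ⊠ dc 1 g₂)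
      (by fun_prop) (by fun_prop) (by fun_prop)]
    exact tsum_comm _ _ (by fun_prop) (by fun_prop) (by fun_prop) (by fun_prop)

end IsDualPair

end

end Double

end

end QuantumDouble

namespace QuantumDouble

noncomputable section

section Double

variable {K : Type u} [CommRing K] {C : Type (u + 1)} [Category.{u} C] [MonoidalCategory C]
  [SymmetricCategory C] [LinCat K C]

variable {U V W T : C} {M : Type*} [AddCommGroup M] [Module K M]

section

variable {B A : C} [HopfObj B] [HopfObj A] {lact : A ⊗ B ⟶ B} {ract : A ⊗ B ⟶ A}
  [HopfObj (DoubleCross B A)]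

/-! ### Modules over the double and Drinfeld-Yetter modules -/

/-- The map `ξ : (B ⋈ A) ⊗ V ⟶ V` corresponds to the action and the coaction of `B` on the
Drinfeld-Yetter module `V`: one has `(b ⊗ f) v = b (f v)`, and `(id ⊗ ξ)(R ⊗ v)` is the coaction
of `v`. -/
structure IsXi (R : 𝟙_ C ⟶ B ⊗ A) (V : DY B) (ξ : DoubleCross B A ⊗ V.X ⟶ V.X) : Prop where
  act_eq : ∀ b f v, actE ξ (dc b f) v = actE V.act b (actE ξ (dc 1 f) v)
  coact_eq : ∀ v, tsum (ap R one) (fun x g => x ⊠ actE ξ (dc 1 g) v) = ap V.coact v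

variable {R : 𝟙_ C ⟶ B ⊗ A}

local notation "X" => exchange lact ract

namespace IsXi

variable {V : DY B} {ξ : DoubleCross B A ⊗ V.X ⟶ V.X} (hξ : IsXi R V ξ)
include hξ

omit [HopfObj A] [HopfObj (DoubleCross B A)] in
lemma coact_tsum (v : El V.X) {F : El B → El V.X → El T} (h₁ : ∀ y, Lin K (fun x => F x y))
    (h₂ : ∀ x, Lin K (fun y => F x y)) :
    tsum (ap R one) (fun x g => F x (actE ξ (dc 1 g) v)) = tsum (ap V.coact v) F := by
  rw [← hξ.coact_eq]
  simp (disch := fun_prop) only [tsum_tsum, tsum_tm]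

omit [HopfObj A] [HopfObj (DoubleCross B A)] in
lemma ext (hR : Separates R) {ξ' : DoubleCross B A ⊗ V.X ⟶ V.X} (hξ' : IsXi R V ξ') : ξ = ξ' := by
  refine ap_ext_dc fun b f v => ?_
  refine (hξ.act_eq b f v).trans (Eq.trans ?_ (hξ'.act_eq b f v).symm)
  congr 1
  revert f
  exact hR.ext (by fun_prop) (by fun_prop) ((hξ.coact_eq v).trans (hξ'.coact_eq v).symm)

/-- A morphism of Drinfeld-Yetter modules is a morphism of modules over the double. -/
lemma natural (hR : Separates R) {W : DY B} {ξ' : DoubleCross B A ⊗ W.X ⟶ W.X}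
    (hξ' : IsXi R W ξ') (f : V ⟶ W) :
    ξ ≫ f.hom = DoubleCross B A ◁ f.hom ≫ ξ' := by
  refine ap_ext_dc fun b g v => ?_
  have h₁ (b : El B) (v : El V.X) : ap f.hom (actE V.act b v) = actE W.act b (ap f.hom v) := by
    have := congrArg (fun m => ap m (b ⊠ v)) f.isHom.act_comm
    simp (disch := fun_prop) only [ap_comp, ap_whiskerLeft, tsum_tm] at this
    exact this
  have h₂ (v : El V.X) : tsum (ap V.coact v) (fun x w => x ⊠ ap f.hom w) =
      ap W.coact (ap f.hom v) := by
    have := congrArg (fun m => ap m v) f.isHom.coact_comm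
    simpa (disch := fun_prop) using this
  simp (disch := fun_prop) only [ap_comp, ap_whiskerLeft, tsum_tm]
  change ap f.hom (actE ξ (dc b g) v) = actE ξ' (dc b g) (ap f.hom v)
  rw [hξ.act_eq, hξ'.act_eq, h₁]
  congr 1
  revert g
  refine hR.ext (by fun_prop) (by fun_prop) ?_
  rw [hξ'.coact_eq, ← h₂]
  exact hξ.coact_tsum v (F := fun x w => x ⊠ ap f.hom w) (by fun_prop) (by fun_prop)

end IsXi

variable (R) in
lemma ap_thetaCoact (V : HopfRep (DoubleCross B A)) (v : El V.X) :
    ap (thetaCoact R V) v = tsum (ap R one) fun x g => x ⊠ actE V.act (dc 1 g) v := by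
  simp (disch := fun_prop) only [thetaCoact, ap_comp, ap_whiskerRight, ap_whiskerLeft,
    ap_leftUnitor_inv, tsum_tm, ap_assoc, ap_inr, tsum_tsum]
  rfl

variable (d : IsDualPair R lact ract) [IsIso 𝒮[B]] (h : IsDoubleCrossProduct lact ract)
include d h

/-- The axioms of a Drinfeld-Yetter module imply those of a module over the double. -/
lemma IsXi.isAction {V : DY B} {ξ : DoubleCross B A ⊗ V.X ⟶ V.X} (hξ : IsXi R V ξ) :
    IsAction (DoubleCross B A) V.X ξ := by
  have one_act (v : El V.X) : actE ξ (dc 1 1) v = v := by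
    rw [← d.one_tsum (F := fun g => actE ξ (dc 1 g) v) (by fun_prop),
      hξ.coact_tsum v (F := fun x w => eps x • w) (by fun_prop) (by fun_prop)]
    exact V.isDY.isCoaction.counit_tsum v (F := fun w => w) (by fun_prop)
  have mul_act (f g : El A) (v : El V.X) :
      actE ξ (dc 1 (f * g)) v = actE ξ (dc 1 f) (actE ξ (dc 1 g) v) := by
    revert f g
    refine d.separates.ext₂ (by fun_prop) (by fun_prop) (by fun_prop) (by fun_prop) ?_
    rw [d.mul_tsum (F := fun x x' g => x ⊠ x' ⊠ actE ξ (dc 1 g) v)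
      (by fun_prop) (by fun_prop) (by fun_prop),
      hξ.coact_tsum v (F := fun x w => tsum (cop x) fun x₁ x₂ => x₁ ⊠ x₂ ⊠ w)
      (by fun_prop) (by fun_prop)]
    refine Eq.trans ?_ (tsum_comm _ _ (by fun_prop) (by fun_prop) (by fun_prop) (by fun_prop))
    rw [hξ.coact_tsum v (F := fun x' w => tsum (ap R one) fun x f =>
      x ⊠ x' ⊠ actE ξ (dc 1 f) w) (by fun_prop) (by fun_prop)]
    have e (x' : El B) (w : El V.X) := hξ.coact_tsum w (F := fun x u => x ⊠ x' ⊠ u)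
      (by fun_prop) (by fun_prop)
    simp only [e]
    exact (V.isDY.isCoaction.comul_tsum v (F := fun x' x u => x ⊠ x' ⊠ u)
      (by fun_prop) (by fun_prop) (by fun_prop)).symm
  have act_act (f : El A) (b : El B) (v : El V.X) : actE ξ (dc 1 f) (actE V.act b v) =
      tsum (ap X (f ⊠ b)) fun y g => actE V.act y (actE ξ (dc 1 g) v) := by
    revert f
    refine d.separates.ext (by fun_prop) (by fun_prop) ?_
    rw [hξ.coact_eq]
    simp (disch := fun_prop) only [tm_tsum]
    rw [d.exchange_tsum b (F := fun x y g => x ⊠ actE V.act y (actE ξ (dc 1 g) v))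
      (by fun_prop) (by fun_prop) (by fun_prop), ← tsum_eta (ap V.coact (actE V.act b v)),
      V.isDY.compat_tsum b v (by fun_prop) (by fun_prop)]
    have e (b c b' : El B) := hξ.coact_tsum v (F := fun x w => (b * x * c) ⊠ actE V.act b' w)
      (by fun_prop) (by fun_prop)
    simp only [e]
  refine (isAction_iff _).2 ⟨fun v => by rw [h.one_dc, one_act], fun x y v => ?_⟩
  revert x
  refine dc_ext (by fun_prop) (by fun_prop) fun b f => ?_
  revert y
  refine dc_ext (by fun_prop) (by fun_prop) fun c g => ?_
  simp (disch := fun_prop) only [h.dc_mul_dc, tsum_actE]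
  rw [hξ.act_eq b f, hξ.act_eq c g, act_act]
  simp (disch := fun_prop) only [actE_tsum, ← mul_act, ← V.mul_act]
  congr 1; funext y k
  exact hξ.act_eq _ _ _

/-- The axioms of a module over the double imply those of a Drinfeld-Yetter module. -/
lemma theta_isDY (V : HopfRep (DoubleCross B A)) :
    IsDrinfeldYetter B V.X (thetaAct V) (thetaCoact R V) := by
  have h₁ (b : El B) (v : El V.X) : actE (thetaAct V) b v = actE V.act (dc b 1) v := by
    simp (disch := fun_prop) only [actE, thetaAct, ap_comp, ap_whiskerRight, tsum_tm, ap_inl]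
  have h₂ := ap_thetaCoact R V
  refine .of_elements _ _ ?_ (fun b b' v => ?_) (fun v => ?_) (fun v => ?_) (fun b v => ?_)
  · simp only [h₁, ← h.one_dc, V.one_act, implies_true]
  · simp only [h₁, ← V.mul_act, d.dc_one_mul_dc h]
  · simp (disch := fun_prop) only [h₂, tsum_tsum, tsum_tm]
    rw [d.one_tsum (F := fun g => actE V.act (dc 1 g) v) (by fun_prop), ← h.one_dc, V.one_act]
  · simp (disch := fun_prop) only [h₂, tsum_tsum, tsum_tm, ← V.mul_act, d.dc_mul_one_dc h]
    exact (d.mul_tsum_swap (F := fun x x' g => (x ⊠ x') ⊠ actE V.act (dc 1 g) v)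
      (by fun_prop) (by fun_prop) (by fun_prop)).symm
  · simp (disch := fun_prop) only [h₂, h₁, tsum_tsum, tsum_tm, ← V.mul_act,
      d.dc_one_mul_dc h, d.one_dc_mul_dc_one h, tsum_actE, tm_tsum, mul_one]
    exact d.exchange_tsum b (F := fun x y g => x ⊠ actE V.act (dc y g) v)
      (by fun_prop) (by fun_prop) (by fun_prop)

lemma isXi_theta (V : HopfRep (DoubleCross B A)) :
    IsXi R ⟨V.X, thetaAct V, thetaCoact R V, theta_isDY d h V⟩ V.act := by
  constructor
  · intro b f v
    simp (disch := fun_prop) only [actE, thetaAct, ap_comp, ap_whiskerRight, tsum_tm, ap_inl]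
    change _ = actE V.act (dc b 1) (actE V.act (dc 1 f) v)
    rw [← V.mul_act, d.dc_one_mul_dc h, mul_one]
    rfl
  · intro v
    exact (ap_thetaCoact R V v).symm

lemma IsXi.thetaAct_eq {V : DY B} {ξ : DoubleCross B A ⊗ V.X ⟶ V.X} (hξ : IsXi R V ξ) :
    thetaAct ⟨V.X, ξ, hξ.isAction d h⟩ = V.act := by
  refine ap_ext₂ fun b v => ?_
  simp (disch := fun_prop) only [thetaAct, ap_comp, ap_whiskerRight, tsum_tm, ap_inl]
  refine (hξ.act_eq b 1 v).trans ?_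
  rw [← h.one_dc, ((isAction_iff _).1 (hξ.isAction d h)).1]
  rfl

omit h in
lemma IsXi.thetaCoact_eq (h : IsDoubleCrossProduct lact ract) {V : DY B}
    {ξ : DoubleCross B A ⊗ V.X ⟶ V.X} (hξ : IsXi R V ξ) :
    thetaCoact R ⟨V.X, ξ, hξ.isAction d h⟩ = V.coact := by
  refine ap_ext fun v => ?_
  rw [← hξ.coact_eq]
  exact ap_thetaCoact R _ v

omit [IsIso 𝒮[B]] in
lemma isXi_unit (hu : IsDrinfeldYetter B (𝟙_ C) (DY.unitAct B) (DY.unitCoact B)) :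
    IsXi R ⟨_, _, _, hu⟩ (HopfRep.unitAct (DoubleCross B A)) := by
  constructor
  · intro b f v
    simp only [HopfRep.act_unitAct, DY.act_unitAct, h.eps_dc, eps_one, one_mul, mul_smul]
  · intro (v : El (𝟙_ C))
    simp (disch := fun_prop) only [HopfRep.act_unitAct, h.eps_dc, eps_one, one_mul, tm_smul,
      DY.ap_unitCoact]
    exact d.counit_tsum (F := fun x => x ⊠ v) (by fun_prop)

lemma IsXi.tensor {V W : DY B} {ξ : DoubleCross B A ⊗ V.X ⟶ V.X}
    {ξ' : DoubleCross B A ⊗ W.X ⟶ W.X} (hξ : IsXi R V ξ) (hξ' : IsXi R W ξ')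
    (ht : IsDrinfeldYetter B (V.X ⊗ W.X) (DY.tensorAct V W) (DY.tensorCoact V W)) :
    IsXi R ⟨_, _, _, ht⟩ (HopfRep.tensorAct ⟨V.X, ξ, hξ.isAction d h⟩
      ⟨W.X, ξ', hξ'.isAction d h⟩) := by
  constructor
  · intro b f
    refine tm_ext (by fun_prop) (by fun_prop) fun v w => ?_
    simp (disch := fun_prop) only [HopfRep.act_tensorAct, h.tsum_cop_dc, tsum_cop_one, actE_tsum,
      DY.act_tensorAct]
    have e (b₁ b₂ : El B) (f₁ f₂ : El A) : actE ξ (dc b₁ f₁) v ⊠ actE ξ' (dc b₂ f₂) w =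
        actE V.act b₁ (actE ξ (dc 1 f₁) v) ⊠ actE W.act b₂ (actE ξ' (dc 1 f₂) w) := by
      rw [hξ.act_eq b₁ f₁, hξ'.act_eq b₂ f₂]
    refine (congrArg _ (funext₂ fun _ _ => congrArg _ (funext₂ fun _ _ => e _ _ _ _))).trans ?_
    exact tsum_comm _ _ (by fun_prop) (by fun_prop) (by fun_prop) (by fun_prop)
  · refine tm_ext (by fun_prop) (by fun_prop) fun v w => ?_
    simp (disch := fun_prop) only [HopfRep.act_tensorAct, h.tsum_cop_dc, tsum_cop_one,
      tm_tsum, DY.ap_tensorCoact]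
    rw [d.comul_tsum (F := fun x g₁ g₂ => x ⊠ actE ξ (dc 1 g₁) v ⊠ actE ξ' (dc 1 g₂) w)
      (by fun_prop) (by fun_prop) (by fun_prop)]
    have e (x : El B) (g : El A) := hξ.coact_tsum v
      (F := fun x' v' => (x * x') ⊠ v' ⊠ actE ξ' (dc 1 g) w) (by fun_prop) (by fun_prop)
    have e' (x' : El B) (v' : El V.X) := hξ'.coact_tsum w
      (F := fun y w' => (y * x') ⊠ v' ⊠ w') (by fun_prop) (by fun_prop)
    simp only [e]
    refine (tsum_comm _ _ (by fun_prop) (by fun_prop) (by fun_prop) (by fun_prop)).trans ?_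
    simp only [e']

lemma IsXi.braid {V W : DY B} {ξ : DoubleCross B A ⊗ V.X ⟶ V.X}
    {ξ' : DoubleCross B A ⊗ W.X ⟶ W.X} (hξ : IsXi R V ξ) (hξ' : IsXi R W ξ') :
    DY.braid V W = HopfRep.braid (doubleR R) ⟨V.X, ξ, hξ.isAction d h⟩
      ⟨W.X, ξ', hξ'.isAction d h⟩ := by
  refine ap_ext₂ fun v w => ?_
  simp (disch := fun_prop) only [DY.act_braid, HopfRep.act_braid, tsum_doubleR]
  have e (x : El B) : actE ξ (dc x 1) v = actE V.act x v := by
    rw [hξ.act_eq, ← h.one_dc, ((isAction_iff _).1 (hξ.isAction d h)).1]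
  simp only [e]
  exact (hξ'.coact_tsum w (F := fun x u => u ⊠ actE V.act x v) (by fun_prop) (by fun_prop)).symm

end

end Double

end

end QuantumDouble

namespace QuantumDouble

noncomputable section

section Double

variable {K : Type u} [CommRing K] {C : Type (u + 1)} [Category.{u} C] [MonoidalCategory C]
  [SymmetricCategory C] [LinCat K C]

variable {U V W T : C} {M : Type*} [AddCommGroup M] [Module K M]

section

variable {B A : C} [HopfObj B] [HopfObj A] {lact : A ⊗ B ⟶ B} {ract : A ⊗ B ⟶ A}
  [HopfObj (DoubleCross B A)]

/-! ### The equivalence of braided tensor categories -/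

lemma DY.isHom_id_iff {X : C} {a a' : B ⊗ X ⟶ X} {c c' : X ⟶ B ⊗ X}
    (h : IsDrinfeldYetter B X a c) (h' : IsDrinfeldYetter B X a' c') :
    DY.IsHom ⟨X, a, c, h⟩ ⟨X, a', c', h'⟩ (𝟙 X) ↔ a = a' ∧ c = c' := by
  refine ⟨fun h => ⟨by simpa using h.act_comm, by simpa using h.coact_comm⟩, ?_⟩
  rintro ⟨rfl, rfl⟩
  constructor <;> simp

lemma HopfRep.isHom_id_iff {D : C} [HopfObj D] {X : C} {a a' : D ⊗ X ⟶ X}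
    (h : IsAction D X a) (h' : IsAction D X a') :
    HopfRep.IsHom ⟨X, a, h⟩ ⟨X, a', h'⟩ (𝟙 X) ↔ a = a' := by
  simp [HopfRep.IsHom]

section Coherence

variable (X Y Z : C)

lemma id_assoc_coherence : 𝟙 (X ⊗ Y) ▷ Z ≫ 𝟙 ((X ⊗ Y) ⊗ Z) ≫ (α_ X Y Z).hom =
    (α_ X Y Z).hom ≫ X ◁ 𝟙 (Y ⊗ Z) ≫ 𝟙 (X ⊗ (Y ⊗ Z)) := by simp

lemma id_left_coherence : (λ_ X).hom = 𝟙 (𝟙_ C) ▷ X ≫ 𝟙 (𝟙_ C ⊗ X) ≫ (λ_ X).hom := by simp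

lemma id_right_coherence : (ρ_ X).hom = X ◁ 𝟙 (𝟙_ C) ≫ 𝟙 (X ⊗ 𝟙_ C) ≫ (ρ_ X).hom := by simp

lemma comp_id_eq_id_comp {X Y : C} (f : X ⟶ Y) : f ≫ 𝟙 Y = 𝟙 X ≫ f := by simp

end Coherence

variable {R : 𝟙_ C ⟶ B ⊗ A} (d : IsDualPair R lact ract) [IsIso 𝒮[B]]
  (h : IsDoubleCrossProduct lact ract)
include d h

section Xi

variable {ev : A ⊗ B ⟶ 𝟙_ C} (hx : ∀ V : DY B, IsXi R V (xiAct ev V))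
  (hΞ : ∀ V : DY B, IsAction (DoubleCross B A) V.X (xiAct ev V))
  (hΘ : ∀ V : HopfRep (DoubleCross B A), IsDrinfeldYetter B V.X (thetaAct V) (thetaCoact R V))
include hx

/-- The functors `Ξ` and `Θ` are mutually inverse. -/
lemma xi_theta_equivalence : ∃ e : DY B ≌ HopfRep (DoubleCross B A),
    e.functor = xi ev hΞ ∧ e.inverse = theta R hΘ :=
  ⟨CategoryTheory.Equivalence.mk (xi ev hΞ) (theta R hΘ)
    (NatIso.ofComponents (fun V => DY.mkIso (W := (theta R hΘ).obj ((xi ev hΞ).obj V))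
      (Iso.refl V.X) ((DY.isHom_id_iff V.isDY (hΘ ((xi ev hΞ).obj V))).2
        ⟨((hx V).thetaAct_eq d h).symm, ((hx V).thetaCoact_eq d h).symm⟩))
      fun f => DY.hom_ext (comp_id_eq_id_comp f.hom))
    (NatIso.ofComponents (fun V => HopfRep.mkIso (V := (xi ev hΞ).obj ((theta R hΘ).obj V))
      (Iso.refl V.X) ((HopfRep.isHom_id_iff (hΞ ((theta R hΘ).obj V)) V.isAction).2
        ((hx _).ext d.separates (isXi_theta d h V))))
      fun f => HopfRep.hom_ext (comp_id_eq_id_comp f.hom)), rfl, rfl⟩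

variable (h₁ : DY.IsMonoidal B) (h₂ : DY.IsBraided h₁)
  (h₃ : HopfRep.IsMonoidal (DoubleCross B A)) (h₄ : HopfRep.IsBraided h₃ (doubleR R))

/-- The functor `Ξ` is a braided tensor functor with identity structure maps. -/
lemma xi_braided :
    letI := DY.monoidal h₁
    letI := DY.braided h₁ h₂
    letI := HopfRep.monoidal h₃
    letI := HopfRep.braided h₃ (doubleR R) h₄
    ∃ _ : (xi ev hΞ).Braided, (Functor.LaxMonoidal.ε (xi ev hΞ)).hom = 𝟙 (𝟙_ C) ∧
      ∀ V W : DY B, (Functor.LaxMonoidal.μ (xi ev hΞ) V W).hom = 𝟙 (V.X ⊗ W.X) := by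
  letI := DY.monoidal h₁
  letI := DY.braided h₁ h₂
  letI := HopfRep.monoidal h₃
  letI := HopfRep.braided h₃ (doubleR R) h₄
  let m : (xi ev hΞ).CoreMonoidal :=
    { εIso := HopfRep.mkIso (W := (xi ev hΞ).obj (𝟙_ (DY B))) (Iso.refl (𝟙_ C))
        ((HopfRep.isHom_id_iff h₃.unit (hΞ (𝟙_ (DY B)))).2
          ((isXi_unit d h h₁.unit).ext d.separates (hx _)))
      μIso := fun V W => HopfRep.mkIso (V := (xi ev hΞ).obj V ⊗ (xi ev hΞ).obj W)
        (W := (xi ev hΞ).obj (V ⊗ W)) (Iso.refl (V.X ⊗ W.X))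
        ((HopfRep.isHom_id_iff (h₃.tensor _ _) (hΞ (V ⊗ W))).2
          (((hx V).tensor d h (hx W) (h₁.tensor V W)).ext d.separates (hx _)))
      μIso_hom_natural_left := fun f V => HopfRep.hom_ext (comp_id_eq_id_comp (f.hom ▷ V.X))
      μIso_hom_natural_right := fun V f => HopfRep.hom_ext (comp_id_eq_id_comp (V.X ◁ f.hom))
      associativity := fun U V W => HopfRep.hom_ext (id_assoc_coherence U.X V.X W.X)
      left_unitality := fun V => HopfRep.hom_ext (id_left_coherence V.X)
      right_unitality := fun V => HopfRep.hom_ext (id_right_coherence V.X) }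
  letI := m.toMonoidal
  refine ⟨{ braided := fun V W => HopfRep.hom_ext ?_ }, rfl, fun V W => rfl⟩
  exact (Category.id_comp (DY.braid V W)).trans
    (((hx V).braid d h (hx W)).trans (Category.comp_id _).symm)

end Xi

section Theta

variable (hΘ : ∀ V : HopfRep (DoubleCross B A),
  IsDrinfeldYetter B V.X (thetaAct V) (thetaCoact R V))
  (h₁ : DY.IsMonoidal B) (h₃ : HopfRep.IsMonoidal (DoubleCross B A))

lemma theta_unit_isHom :
    DY.IsHom ⟨_, _, _, h₁.unit⟩ ((theta R hΘ).obj ⟨_, _, h₃.unit⟩) (𝟙 (𝟙_ C)) :=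
  (DY.isHom_id_iff h₁.unit (hΘ ⟨_, _, h₃.unit⟩)).2
    ⟨((isXi_unit d h h₁.unit).thetaAct_eq d h).symm,
      ((isXi_unit d h h₁.unit).thetaCoact_eq d h).symm⟩

lemma theta_tensor_isHom (V W : HopfRep (DoubleCross B A)) :
    DY.IsHom ⟨_, _, _, h₁.tensor ((theta R hΘ).obj V) ((theta R hΘ).obj W)⟩
      ((theta R hΘ).obj ⟨_, _, h₃.tensor V W⟩) (𝟙 (V.X ⊗ W.X)) :=
  (DY.isHom_id_iff (h₁.tensor ((theta R hΘ).obj V) ((theta R hΘ).obj W))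
    (hΘ ⟨_, _, h₃.tensor V W⟩)).2
    ⟨(((isXi_theta d h V).tensor d h (isXi_theta d h W) (h₁.tensor _ _)).thetaAct_eq d h).symm,
      (((isXi_theta d h V).tensor d h (isXi_theta d h W) (h₁.tensor _ _)).thetaCoact_eq d h).symm⟩

lemma theta_braid (V W : HopfRep (DoubleCross B A)) :
    𝟙 (V.X ⊗ W.X) ≫ HopfRep.braid (doubleR R) V W =
      DY.braid ((theta R hΘ).obj V) ((theta R hΘ).obj W) ≫ 𝟙 (W.X ⊗ V.X) := by
  exact (Category.id_comp _).trans
    (((isXi_theta d h V).braid d h (isXi_theta d h W)).symm.trans (Category.comp_id _).symm)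

variable (h₂ : DY.IsBraided h₁) (h₄ : HopfRep.IsBraided h₃ (doubleR R))

/-- The functor `Θ` is a braided tensor functor with identity structure maps. -/
lemma theta_braided :
    letI := DY.monoidal h₁
    letI := DY.braided h₁ h₂
    letI := HopfRep.monoidal h₃
    letI := HopfRep.braided h₃ (doubleR R) h₄
    ∃ _ : (theta R hΘ).Braided, (Functor.LaxMonoidal.ε (theta R hΘ)).hom = 𝟙 (𝟙_ C) ∧
      ∀ V W : HopfRep (DoubleCross B A),
        (Functor.LaxMonoidal.μ (theta R hΘ) V W).hom = 𝟙 (V.X ⊗ W.X) := by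
  letI := DY.monoidal h₁
  letI := DY.braided h₁ h₂
  letI := HopfRep.monoidal h₃
  letI := HopfRep.braided h₃ (doubleR R) h₄
  let m : (theta R hΘ).CoreMonoidal :=
    { εIso := DY.mkIso (W := (theta R hΘ).obj (𝟙_ (HopfRep (DoubleCross B A))))
        (Iso.refl (𝟙_ C)) (theta_unit_isHom d h hΘ h₁ h₃)
      μIso := fun V W => DY.mkIso (V := (theta R hΘ).obj V ⊗ (theta R hΘ).obj W)
        (W := (theta R hΘ).obj (V ⊗ W)) (Iso.refl (V.X ⊗ W.X)) (theta_tensor_isHom d h hΘ h₁ h₃ V W)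
      μIso_hom_natural_left := fun f V => DY.hom_ext (comp_id_eq_id_comp (f.hom ▷ V.X))
      μIso_hom_natural_right := fun V f => DY.hom_ext (comp_id_eq_id_comp (V.X ◁ f.hom))
      associativity := fun U V W => DY.hom_ext (id_assoc_coherence U.X V.X W.X)
      left_unitality := fun V => DY.hom_ext (id_left_coherence V.X)
      right_unitality := fun V => DY.hom_ext (id_right_coherence V.X) }
  letI := m.toMonoidal
  exact ⟨{ braided := fun V W => DY.hom_ext (theta_braid d h hΘ V W) }, rfl, fun V W => rfl⟩

/-- The functor `Θ` to a full braided monoidal subcategory is a braided tensor functor with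
identity structure maps. -/
lemma theta_lift_braided {P : ObjectProperty (DY B)} (hΘ' : ∀ V, P ((theta R hΘ).obj V)) :
    letI := DY.monoidal h₁
    letI := DY.braided h₁ h₂
    letI := HopfRep.monoidal h₃
    letI := HopfRep.braided h₃ (doubleR R) h₄
    ∀ [P.IsMonoidal], ∃ _ : (P.lift (theta R hΘ) hΘ').Braided,
      (Functor.LaxMonoidal.ε (P.lift (theta R hΘ) hΘ')).hom.hom = 𝟙 (𝟙_ C) ∧
      ∀ V W : HopfRep (DoubleCross B A),
        (Functor.LaxMonoidal.μ (P.lift (theta R hΘ) hΘ') V W).hom.hom = 𝟙 (V.X ⊗ W.X) := by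
  letI := DY.monoidal h₁
  letI := DY.braided h₁ h₂
  letI := HopfRep.monoidal h₃
  letI := HopfRep.braided h₃ (doubleR R) h₄
  intro _
  let Θ := P.lift (theta R hΘ) hΘ'
  let m : Θ.CoreMonoidal :=
    { εIso := P.isoMk (X := 𝟙_ P.FullSubcategory)
        (Y := Θ.obj (𝟙_ (HopfRep (DoubleCross B A))))
        (DY.mkIso (V := 𝟙_ (DY B)) (W := (theta R hΘ).obj (𝟙_ (HopfRep (DoubleCross B A))))
          (Iso.refl (𝟙_ C)) (theta_unit_isHom d h hΘ h₁ h₃))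
      μIso := fun V W => P.isoMk (X := Θ.obj V ⊗ Θ.obj W) (Y := Θ.obj (V ⊗ W))
        (DY.mkIso (V := (theta R hΘ).obj V ⊗ (theta R hΘ).obj W)
        (W := (theta R hΘ).obj (V ⊗ W)) (Iso.refl (V.X ⊗ W.X))
        (theta_tensor_isHom d h hΘ h₁ h₃ V W))
      μIso_hom_natural_left := fun f V =>
        ObjectProperty.hom_ext _ (DY.hom_ext (comp_id_eq_id_comp (f.hom ▷ V.X)))
      μIso_hom_natural_right := fun V f =>
        ObjectProperty.hom_ext _ (DY.hom_ext (comp_id_eq_id_comp (V.X ◁ f.hom)))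
      associativity := fun U V W =>
        ObjectProperty.hom_ext _ (DY.hom_ext (id_assoc_coherence U.X V.X W.X))
      left_unitality := fun V => ObjectProperty.hom_ext _ (DY.hom_ext (id_left_coherence V.X))
      right_unitality := fun V => ObjectProperty.hom_ext _ (DY.hom_ext (id_right_coherence V.X)) }
  letI := m.toMonoidal
  exact ⟨{ braided := fun V W => ObjectProperty.hom_ext _ (DY.hom_ext (theta_braid d h hΘ V W)) },
    rfl, fun V W => rfl⟩

end Theta

section Subcategory

variable {P : ObjectProperty (DY B)}
  {ξ : ∀ V : P.FullSubcategory, DoubleCross B A ⊗ V.obj.X ⟶ V.obj.X}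
  (hx : ∀ V, IsXi R V.obj (ξ V)) (hξ : ∀ V, IsAction (DoubleCross B A) V.obj.X (ξ V))
  (nat : ∀ {V W : P.FullSubcategory} (f : V ⟶ W), ξ V ≫ (P.ι ⋙ DY.forget B).map f =
    DoubleCross B A ◁ (P.ι ⋙ DY.forget B).map f ≫ ξ W)
  (hΘ : ∀ V : HopfRep (DoubleCross B A), IsDrinfeldYetter B V.X (thetaAct V) (thetaCoact R V))
  (hΘ' : ∀ V, P ((theta R hΘ).obj V))
include hx

/-- The functors `Ξ` and `Θ` between a full subcategory of Drinfeld-Yetter modules and the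
category of modules over the double are mutually inverse. -/
lemma lift_equivalence : ∃ e : P.FullSubcategory ≌ HopfRep (DoubleCross B A),
    e.functor = HopfRep.lift (P.ι ⋙ DY.forget B) ξ hξ nat ∧
    e.inverse = P.lift (theta R hΘ) hΘ' := by
  let Ξ := HopfRep.lift (P.ι ⋙ DY.forget B) ξ hξ nat
  let Θ := P.lift (theta R hΘ) hΘ'
  exact ⟨CategoryTheory.Equivalence.mk Ξ Θ
    (NatIso.ofComponents (fun V => P.isoMk (X := V) (Y := Θ.obj (Ξ.obj V))
      (DY.mkIso (W := (theta R hΘ).obj (Ξ.obj V))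
        (Iso.refl V.obj.X) ((DY.isHom_id_iff V.obj.isDY (hΘ (Ξ.obj V))).2
        ⟨((hx V).thetaAct_eq d h).symm, ((hx V).thetaCoact_eq d h).symm⟩)))
      fun f => ObjectProperty.hom_ext _ (DY.hom_ext (comp_id_eq_id_comp f.hom.hom)))
    (NatIso.ofComponents (fun V => HopfRep.mkIso (V := Ξ.obj (Θ.obj V))
      (Iso.refl V.X) ((HopfRep.isHom_id_iff (hξ (Θ.obj V)) V.isAction).2
        ((hx _).ext d.separates (isXi_theta d h V))))
      fun f => HopfRep.hom_ext (comp_id_eq_id_comp f.hom)), rfl, rfl⟩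

variable (h₁ : DY.IsMonoidal B) (h₂ : DY.IsBraided h₁)
  (h₃ : HopfRep.IsMonoidal (DoubleCross B A)) (h₄ : HopfRep.IsBraided h₃ (doubleR R))

/-- The functor `Ξ` on a full braided monoidal subcategory is a braided tensor functor with
identity structure maps. -/
lemma lift_braided :
    letI := DY.monoidal h₁
    letI := DY.braided h₁ h₂
    letI := HopfRep.monoidal h₃
    letI := HopfRep.braided h₃ (doubleR R) h₄
    ∀ [P.IsMonoidal], ∃ _ : (HopfRep.lift (P.ι ⋙ DY.forget B) ξ hξ nat).Braided,
      (Functor.LaxMonoidal.ε (HopfRep.lift (P.ι ⋙ DY.forget B) ξ hξ nat)).hom = 𝟙 (𝟙_ C) ∧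
      ∀ V W, (Functor.LaxMonoidal.μ (HopfRep.lift (P.ι ⋙ DY.forget B) ξ hξ nat) V W).hom =
        𝟙 (V.obj.X ⊗ W.obj.X) := by
  letI := DY.monoidal h₁
  letI := DY.braided h₁ h₂
  letI := HopfRep.monoidal h₃
  letI := HopfRep.braided h₃ (doubleR R) h₄
  intro _
  let Ξ := HopfRep.lift (P.ι ⋙ DY.forget B) ξ hξ nat
  let m : Ξ.CoreMonoidal :=
    { εIso := HopfRep.mkIso (W := Ξ.obj (𝟙_ P.FullSubcategory)) (Iso.refl (𝟙_ C))
        ((HopfRep.isHom_id_iff h₃.unit (hξ (𝟙_ P.FullSubcategory))).2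
          ((isXi_unit d h h₁.unit).ext d.separates (hx (𝟙_ P.FullSubcategory))))
      μIso := fun V W => HopfRep.mkIso (V := Ξ.obj V ⊗ Ξ.obj W)
        (W := Ξ.obj (V ⊗ W)) (Iso.refl (V.obj.X ⊗ W.obj.X))
        ((HopfRep.isHom_id_iff (h₃.tensor (Ξ.obj V) (Ξ.obj W)) (hξ (V ⊗ W))).2
          (((hx V).tensor d h (hx W) (h₁.tensor V.obj W.obj)).ext d.separates (hx (V ⊗ W))))
      μIso_hom_natural_left := fun f V =>
        HopfRep.hom_ext (comp_id_eq_id_comp (f.hom.hom ▷ V.obj.X))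
      μIso_hom_natural_right := fun V f =>
        HopfRep.hom_ext (comp_id_eq_id_comp (V.obj.X ◁ f.hom.hom))
      associativity := fun U V W =>
        HopfRep.hom_ext (id_assoc_coherence U.obj.X V.obj.X W.obj.X)
      left_unitality := fun V => HopfRep.hom_ext (id_left_coherence V.obj.X)
      right_unitality := fun V => HopfRep.hom_ext (id_right_coherence V.obj.X) }
  letI := m.toMonoidal
  refine ⟨{ braided := fun V W => HopfRep.hom_ext ?_ }, rfl, fun V W => rfl⟩
  exact (Category.id_comp (DY.braid V.obj W.obj)).trans
    (((hx V).braid d h (hx W)).trans (Category.comp_id _).symm)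

end Subcategory

end

section

variable {B A : C} [HopfObj B] {lact : A ⊗ B ⟶ B} {ract : A ⊗ B ⟶ A} {R : 𝟙_ C ⟶ B ⊗ A}
  [IsIso 𝒮[B]]

/-- The Hopf algebra `A` defined by dual structure maps forms a dual pair with `B`, given the
transposes of the adjoint action and coaction. -/
lemma DualMaps.isDualPair (d : DualMaps R)
    (hl : ∀ b, tsum (ap R one) (fun x g => x ⊠ actE lact g b) =
      tsum (cop b) (fun b₁ p => tsum (cop p) fun b₂ b₃ => (b₃ * sinv b₁) ⊠ b₂))
    (hr : ∀ b, tsum (ap R one) (fun x g => x ⊠ ap ract (g ⊠ b)) =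
      tsum (cop b) (fun b₁ b₂ => tsum (ap R one) fun x g => (b₂ * x * sinv b₁) ⊠ g)) :
    letI := d.hopfObj
    IsDualPair R lact ract :=
  letI := d.hopfObj
  { separates := d.separates
    one_eq := DualMaps.ap_unit
    counit_spec := d.counit_tsum (F := fun x => x) Lin.id
    comul_spec := d.comul_spec
    mul_spec := d.mul_spec
    lact_spec := hl
    ract_spec := hr }

end

end Double

end

end QuantumDouble

namespace QuantumDouble

noncomputable section

section Double

variable {K : Type u} [CommRing K] {C : Type (u + 1)} [Category.{u} C] [MonoidalCategory C]
  [SymmetricCategory C] [LinCat K C]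

variable {U V W T : C} {M : Type*} [AddCommGroup M] [Module K M]

/-! ### Bijectivity of the antipode -/

section Antipode

variable {B : C} [HopfObj B]

/-- The powers of the antipode, as linear functions. -/
def antiPow (n : ℕ) (b : El B) : El B := anti^[n] b

@[fun_prop] lemma lin_antiPow (n : ℕ) {f : M → El B} (hf : Lin K f) :
    Lin K (fun x => antiPow n (f x)) := by
  induction n with
  | zero => exact hf
  | succ n ih => simpa only [antiPow, Function.iterate_succ_apply'] using lin_anti ih

lemma antiPow_succ (n : ℕ) (b : El B) : antiPow (n + 1) b = anti (antiPow n b) :=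
  Function.iterate_succ_apply' _ _ _

lemma antiPow_succ' (n : ℕ) (b : El B) : antiPow (n + 1) b = antiPow n (anti b) :=
  Function.iterate_succ_apply _ _ _

lemma antiPow_one (n : ℕ) : antiPow n (1 : El B) = 1 := by
  induction n with
  | zero => rfl
  | succ n ih => rw [antiPow_succ, ih, anti_one]

lemma eps_antiPow (n : ℕ) (b : El B) : eps (antiPow n b) = eps b := by
  induction n with
  | zero => rfl
  | succ n ih => rw [antiPow_succ, eps_anti, ih]

lemma antiPow_mul (n : ℕ) (x y : El B) : antiPow n (x * y) =
    if Even n then antiPow n x * antiPow n y else antiPow n y * antiPow n x := by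
  induction n with
  | zero => rfl
  | succ n ih =>
    simp only [antiPow_succ, ih, Nat.even_add_one]
    split_ifs <;> simp

lemma cop_antiPow {n : ℕ} (hn : Even n) (b : El B) :
    cop (antiPow n b) = tsum (cop b) (fun x y => antiPow n x ⊠ antiPow n y) := by
  obtain ⟨m, rfl⟩ := hn
  induction m with
  | zero => exact (tsum_eta _).symm
  | succ m ih =>
    have e : m + 1 + (m + 1) = m + m + 1 + 1 := by ring
    simp only [e, antiPow_succ]
    rw [← tsum_eta (cop (anti (anti _)))]
    simp (disch := fun_prop) only [tsum_cop_anti]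
    rw [ih]
    simp (disch := fun_prop) only [tsum_tsum, tsum_tm]

/-- If `T = Sⁿ` is an even power of the antipode and `T = T² q` for some linear map `q` which
commutes with `T` and `S`, then the antipode is injective. Indeed, `π = T q` is an idempotent
endomorphism of the Hopf algebra `B` with `T π = T`, and `y = h₁ S(π(h₂))` satisfies
`y₁ ⊗ π(y₂) = y ⊗ 1`, hence `y₁ ⊗ Sⁿ(y₂) = y ⊗ 1`; the exponent `n` can be lowered to zero by
the antipode axiom, so `y = ε(h)` and `S π = S`, from which `π = id` follows. -/
lemma anti_injective_of_pow {n : ℕ} (hn : Even n) {q : El B → El B} (hq : Lin K q)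
    (hqS : ∀ x, q (anti x) = anti (q x)) (hq' : ∀ x, antiPow n (antiPow n (q x)) = antiPow n x)
    (x : El B) (hx : antiPow n x = 0) : x = 0 := by
  have hqT (x : El B) : q (antiPow n x) = antiPow n (q x) := by
    clear hq' hx hn
    induction n with
    | zero => rfl
    | succ n ih => rw [antiPow_succ, antiPow_succ, hqS, ih]
  have hST (x : El B) : anti (antiPow n x) = antiPow n (anti x) := by
    rw [← antiPow_succ, antiPow_succ']
  have hmul (x y : El B) : antiPow n (x * y) = antiPow n x * antiPow n y := by
    rw [antiPow_mul, if_pos hn]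
  -- `T` is injective on its image, and `T ⊗ T` on its image
  have inj (a b : El B) (h : antiPow n (antiPow n a) = antiPow n (antiPow n b)) :
      antiPow n a = antiPow n b := by
    rw [← hq' a, ← hq' b, ← hqT, ← hqT, ← hqT, ← hqT, h]
  have inj₂ (s t : El (B ⊗ B))
      (h : tsum s (fun x y => antiPow n (antiPow n x) ⊠ antiPow n (antiPow n y)) =
        tsum t (fun x y => antiPow n (antiPow n x) ⊠ antiPow n (antiPow n y))) :
      tsum s (fun x y => antiPow n x ⊠ antiPow n y) =
        tsum t (fun x y => antiPow n x ⊠ antiPow n y) := by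
    have := congrArg (fun t => tsum t fun x y => q x ⊠ q y) h
    simpa (disch := fun_prop) only [tsum_tsum, tsum_tm, hqT, hq'] using this
  -- the idempotent `π = T q` is an endomorphism of the Hopf algebra `B`
  obtain ⟨p, hp⟩ : ∃ p : El B → El B, ∀ x, p x = antiPow n (q x) := ⟨_, fun _ => rfl⟩
  have lin_p : Lin K p := by
    rw [funext hp]
    fun_prop
  have hpT (x : El B) : antiPow n (p x) = antiPow n x := by rw [hp, hq']
  have hpp (x : El B) : p (p x) = p x := by
    rw [hp (p x), ← hqT, hpT, hqT, hp]
  have hpS (x : El B) : p (anti x) = anti (p x) := by rw [hp, hp, hqS, hST]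
  have hp_mul (x y : El B) : p (x * y) = p x * p y := by
    rw [hp, hp, hp, ← hmul]
    exact inj _ _ (by rw [hq']; simp only [hmul, hq'])
  have hp_one : p 1 = 1 := by
    rw [hp, ← antiPow_one n]
    exact inj _ _ (by rw [hq', antiPow_one, antiPow_one])
  have hp_cop (x : El B) : cop (p x) = tsum (cop x) (fun x y => p x ⊠ p y) := by
    have e : tsum (cop x) (fun x y => p x ⊠ p y) =
        tsum (tsum (cop x) (fun x y => q x ⊠ q y)) (fun x y => antiPow n x ⊠ antiPow n y) := by
      simp (disch := fun_prop) only [tsum_tsum, tsum_tm, hp]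
    rw [e, hp, cop_antiPow hn]
    refine inj₂ _ _ ?_
    have h : tsum (cop (antiPow n (antiPow n (q x)))) (fun u v => u ⊠ v) =
        tsum (cop (antiPow n x)) (fun u v => u ⊠ v) := by rw [hq']
    simp (disch := fun_prop) only [tsum_tsum, tsum_tm, cop_antiPow hn] at h
    simp (disch := fun_prop) only [tsum_tsum, tsum_tm, hq']
    exact h
  have eps_p (x : El B) : eps (p x) = eps x := by
    rw [← eps_antiPow n (p x), hpT, eps_antiPow]
  have p_mul_anti (b : El B) (w : El B) :
      tsum (cop b) (fun x y => w ⊠ (p x * anti (p y))) = eps b • (w ⊠ 1) := by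
    have h := mul_anti_cop (p b) (F := fun z => w ⊠ z) (by fun_prop)
    rw [hp_cop, eps_p] at h
    simpa (disch := fun_prop) only [tsum_tsum, tsum_tm] using h
  have key (b : El B) : tsum (cop b) (fun x y => x * anti (p y)) = eps b • 1 := by
    obtain ⟨y, hy⟩ : ∃ y, y = tsum (cop b) (fun x y => x * anti (p y)) := ⟨_, rfl⟩
    have h₀ : tsum (cop y) (fun u v => u ⊠ p v) = y ⊠ 1 := by
      rw [hy]
      simp (disch := fun_prop) only [map_tsum (L := fun b : El B => cop b), tsum_tsum,
        tsum_cop_mul, tsum_cop_anti, hp_cop, tsum_tm, hp_mul, hpS, hpp, tsum_tm']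
      rw [coassoc b (F := fun x₁ x₂ w => tsum (cop w) fun w₁ w₂ =>
        (x₁ * anti (p w₂)) ⊠ (p x₂ * anti (p w₁))) (by fun_prop) (by fun_prop) (by fun_prop)]
      congr 1; funext x₁ z
      rw [← coassoc z (F := fun x₂ w₁ w₂ => (x₁ * anti (p w₂)) ⊠ (p x₂ * anti (p w₁)))
        (by fun_prop) (by fun_prop) (by fun_prop)]
      simp only [p_mul_anti]
      exact eps_cop_left z (F := fun w => (x₁ * anti (p w)) ⊠ 1) (by fun_prop)
    have h₁ : tsum (cop y) (fun u v => u ⊠ antiPow n v) = y ⊠ 1 := by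
      have := congrArg (fun t => tsum t fun u v => u ⊠ antiPow n v) h₀
      simpa (disch := fun_prop) only [tsum_tsum, tsum_tm, hpT, antiPow_one] using this
    -- one power of the antipode is removed by applying `x ↦ x₁ ⊗ Sᵐ(x₂)` to the first factor and
    -- multiplying; the order of the factors depends on the parity of `m`
    have h₂ (m : ℕ) (h : tsum (cop y) (fun u v => u ⊠ antiPow (m + 1) v) = y ⊠ 1) :
        tsum (cop y) (fun u v => u ⊠ antiPow m v) = y ⊠ 1 := by
      have h' := congrArg (fun t => tsum t fun u v => tsum (cop u) fun u₁ u₂ => u₁ ⊠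
        (if Even m then antiPow m u₂ * v else v * antiPow m u₂)) h
      split_ifs at h' with hm
      · simp (disch := fun_prop) only [tsum_tsum, tsum_tm, mul_one] at h'
        rw [← h', coassoc y (F := fun x z w => x ⊠ (antiPow m z * antiPow (m + 1) w))
          (by fun_prop) (by fun_prop) (by fun_prop)]
        have e (z w : El B) : antiPow m z * antiPow (m + 1) w = antiPow m (z * anti w) := by
          rw [antiPow_mul, if_pos hm, antiPow_succ']
        simp only [e]
        rw [mul_anti_cancel₂ y (F := fun x z => x ⊠ antiPow m z) (by fun_prop) (by fun_prop),
          antiPow_one]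
      · simp (disch := fun_prop) only [tsum_tsum, tsum_tm, one_mul] at h'
        rw [← h', coassoc y (F := fun x z w => x ⊠ (antiPow (m + 1) w * antiPow m z))
          (by fun_prop) (by fun_prop) (by fun_prop)]
        have e (z w : El B) : antiPow (m + 1) w * antiPow m z = antiPow m (z * anti w) := by
          rw [antiPow_mul, if_neg hm, antiPow_succ']
        simp only [e]
        rw [mul_anti_cancel₂ y (F := fun x z => x ⊠ antiPow m z) (by fun_prop) (by fun_prop),
          antiPow_one]
    have h₃ : tsum (cop y) (fun u v => u ⊠ v) = y ⊠ 1 :=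
      Nat.decreasingInduction (motive := fun m _ =>
        tsum (cop y) (fun u v => u ⊠ antiPow m v) = y ⊠ 1) (fun m _ => h₂ m) h₁ (Nat.zero_le n)
    have h₄ := congrArg (fun t => tsum t fun u v => eps u • v) h₃
    simp (disch := fun_prop) only [tsum_tsum, tsum_tm] at h₄
    rw [eps_cop_left y (F := fun v => v) Lin.id] at h₄
    have h₅ : eps y = eps b := by
      have e : ap ε[B] y = ap ε[B] b := by
        rw [hy]
        simp (disch := fun_prop) only [ap_tsum, ap_counit, eps_mul, eps_anti, eps_p, mul_smul]
        exact eps_cop_left b (F := fun w => eps w • one) (by fun_prop)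
      exact congrArg scal e
    rw [← hy, h₄, h₅]
  -- `S ∘ π` and `S` are both convolution inverse to the identity
  have hSp (b : El B) : anti (p b) = anti b := by
    have h := anti_mul_cancel₁ b (F := fun u z => u * anti (p z)) (by fun_prop) (by fun_prop)
    rw [one_mul] at h
    rw [← h]
    simp only [mul_assoc]
    have e (x z : El B) : tsum (cop z) (fun y z => anti x * (y * anti (p z))) =
        eps z • anti x := by
      rw [← mul_tsum _ (by fun_prop) (by fun_prop), key, mul_smul', mul_one]
    simp only [e]
    exact eps_cop_right b (F := anti) (by fun_prop)
  -- `π` and the identity are both convolution inverse to `S`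
  have hp_id (b : El B) : p b = b := by
    have h := anti_mul_cancel₂ b (F := fun x u => p x * u) (by fun_prop) (by fun_prop)
    rw [mul_one, ← coassoc b (F := fun x y z => p x * (anti y * z)) (by fun_prop) (by fun_prop)
      (by fun_prop)] at h
    simp only [← mul_assoc] at h
    have e (u z : El B) : tsum (cop u) (fun x y => p x * anti y * z) = eps u • z := by
      have := mul_anti_cop (p u) (F := fun w => w * z) (by fun_prop)
      rw [hp_cop, eps_p] at this
      simpa (disch := fun_prop) only [tsum_tsum, tsum_tm, hSp, one_mul] using this
    simp only [e] at h
    rw [← h]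
    exact eps_cop_left b (F := fun z => z) Lin.id
  rw [← hp_id x, hp, ← hqT, hx, hq.map_zero]

lemma isIso_antipode_of_bijective (h : Function.Bijective (anti : El B → El B)) :
    IsIso 𝒮[B] := by
  let e := Function.invFun (anti : El B → El B)
  have h₁ : ∀ x, anti (e x) = x := Function.rightInverse_invFun h.2
  have h₂ : ∀ x, e (anti x) = x := Function.leftInverse_invFun h.1
  have he : Lin K e := ⟨fun x y => h.1 (by rw [h₁, (lin_anti Lin.id).add, h₁, h₁]),
    fun c x => h.1 (by rw [h₁, anti_smul, h₁])⟩
  exact ⟨mor e he, ap_ext fun x => by simp [h₂], ap_ext fun x => by simp [h₁]⟩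

end Antipode

end Double

end

end QuantumDouble

namespace QuantumDouble

noncomputable section

section Double

variable {K : Type u} [CommRing K] {C : Type (u + 1)} [Category.{u} C] [MonoidalCategory C]
  [SymmetricCategory C] [LinCat K C]

variable {U V W T : C} {M : Type*} [AddCommGroup M] [Module K M]

/-! ### Dual objects -/

section Perfect

variable {B A : C}

/-- The value of a pairing, as a scalar. -/
def pair (ev : A ⊗ B ⟶ 𝟙_ C) (f : El A) (x : El B) : K := scal (ap ev (f ⊠ x))

@[fun_prop] lemma lin_pair_left (ev : A ⊗ B ⟶ 𝟙_ C) {f : M → El A} (hf : Lin K f) (x : El B) :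
    Lin K (fun m => pair ev (f m) x) := lin_scal (lin_ap _ (lin_tm_left hf x))

@[fun_prop] lemma lin_pair_right (ev : A ⊗ B ⟶ 𝟙_ C) (f : El A) {x : M → El B} (hx : Lin K x) :
    Lin K (fun m => pair ev f (x m)) := lin_scal (lin_ap _ (lin_tm_right f hx))

/-- The pairing `ev : A ⊗ B ⟶ 𝟙` and the element `R ∈ B ⊗ A` are mutually inverse, that is, they
present `A` as the dual of `B`. -/
structure IsPerfect (R : 𝟙_ C ⟶ B ⊗ A) (ev : A ⊗ B ⟶ 𝟙_ C) : Prop where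
  pair_left : ∀ f, tsum (ap R one) (fun x g => pair ev f x • g) = f
  pair_right : ∀ y, tsum (ap R one) (fun x g => pair ev g y • x) = y

namespace IsPerfect

variable {R : 𝟙_ C ⟶ B ⊗ A} {ev : A ⊗ B ⟶ 𝟙_ C} (p : IsPerfect R ev)
include p

lemma left_tsum (f : El A) {F : El A → El T} (hF : Lin K F) :
    tsum (ap R one) (fun x g => pair ev f x • F g) = F f := by
  conv_rhs => rw [← p.pair_left f, map_tsum hF _ (by fun_prop) (by fun_prop)]
  simp only [hF.smul]

lemma right_tsum (y : El B) {F : El B → El T} (hF : Lin K F) :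
    tsum (ap R one) (fun x g => pair ev g y • F x) = F y := by
  conv_rhs => rw [← p.pair_right y, map_tsum hF _ (by fun_prop) (by fun_prop)]
  simp only [hF.smul]

lemma separates : Separates R := by
  intro V f g h
  refine ap_ext fun a => ?_
  have h' := congrArg (fun φ => tsum (ap φ one) (fun x v => pair ev a x • v)) h
  simp (disch := fun_prop) only [ap_comp, ap_whiskerLeft, tsum_tsum, tsum_tm] at h'
  rwa [p.left_tsum a (F := fun g => ap f g) (by fun_prop),
    p.left_tsum a (F := fun a => ap g a) (by fun_prop)] at h'

/-- Contracting a tensor `t ∈ B ⊗ V` with `R` gives `t` again. -/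
lemma contract_tsum (t : El (B ⊗ V)) {F : El B → El V → El T} (h₁ : ∀ y, Lin K (fun x => F x y))
    (h₂ : ∀ x, Lin K (fun y => F x y)) :
    tsum (ap R one) (fun x g => F x (tsum t fun y v => pair ev g y • v)) = tsum t F := by
  have e (x : El B) (g : El A) : F x (tsum t fun y v => pair ev g y • v) =
      tsum t fun y v => pair ev g y • F x v := by
    rw [map_tsum (h₂ x) t (by fun_prop) (by fun_prop)]
    simp only [(h₂ x).smul]
  simp only [e]
  refine (tsum_comm _ _ (by fun_prop) (by fun_prop) (by fun_prop) (by fun_prop)).trans ?_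
  congr 1; funext y v
  exact p.right_tsum y (F := fun x => F x v) (by fun_prop)

variable [HopfObj B]

/-- The transposes of the structure maps of `B`, with the coproduct reversed. -/
def dualMaps : DualMaps R where
  separates := p.separates
  counit := mor (fun f => pair ev f 1 • one) (by fun_prop)
  comul := mor (fun f => tsum (ap R one) fun x g => tsum (ap R one) fun x' g' =>
    pair ev f (x * x') • (g' ⊠ g)) (by fun_prop)
  mul := mor (fun t => tsum t fun f f' => tsum (ap R one) fun x g =>
    tsum (cop x) fun x₁ x₂ => pair ev f x₁ • pair ev f' x₂ • g) (by fun_prop)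
  antipode := mor (fun f => tsum (ap R one) fun x g => pair ev f (sinv x) • g) (by fun_prop)
  counit_spec := by
    simp only [ap_mor, tm_smul]
    exact p.right_tsum 1 (F := fun x => x ⊠ one) (by fun_prop)
  comul_spec := by
    simp (disch := fun_prop) only [ap_mor, tm_tsum, tm_smul]
    refine (tsum_comm _ _ (by fun_prop) (by fun_prop) (by fun_prop) (by fun_prop)).trans ?_
    congr 1; funext x g
    refine (tsum_comm _ _ (by fun_prop) (by fun_prop) (by fun_prop) (by fun_prop)).trans ?_
    congr 1; funext x' g'
    exact p.right_tsum (x * x') (F := fun x => x ⊠ (g' ⊠ g)) (by fun_prop)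
  mul_spec := by
    simp (disch := fun_prop) only [ap_mor, tm_tsum, tm_smul, tsum_tm]
    have e (x : El B) (g : El A) : tsum (ap R one) (fun x' g' => tsum (ap R one) fun y h =>
        tsum (cop y) fun y₁ y₂ => pair ev g y₁ • pair ev g' y₂ • (x ⊠ x' ⊠ h)) =
        tsum (ap R one) (fun y h => tsum (cop y) fun y₁ y₂ => pair ev g y₁ • (x ⊠ y₂ ⊠ h)) := by
      refine (tsum_comm _ _ (by fun_prop) (by fun_prop) (by fun_prop) (by fun_prop)).trans ?_
      congr 1; funext y h
      refine (tsum_comm _ _ (by fun_prop) (by fun_prop) (by fun_prop) (by fun_prop)).trans ?_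
      congr 1; funext y₁ y₂
      rw [← p.right_tsum y₂ (F := fun x' => pair ev g y₁ • (x ⊠ x' ⊠ h)) (by fun_prop)]
      congr 1; funext _ _
      exact smul_comm _ _ _
    simp only [e]
    refine (tsum_comm _ _ (by fun_prop) (by fun_prop) (by fun_prop) (by fun_prop)).trans ?_
    congr 1; funext y h
    refine (tsum_comm _ _ (by fun_prop) (by fun_prop) (by fun_prop) (by fun_prop)).trans ?_
    congr 1; funext y₁ y₂
    exact p.right_tsum y₁ (F := fun x => x ⊠ y₂ ⊠ h) (by fun_prop)
  antipode_spec := by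
    simp (disch := fun_prop) only [ap_mor, tm_tsum, tm_smul]
    refine (tsum_comm _ _ (by fun_prop) (by fun_prop) (by fun_prop) (by fun_prop)).trans ?_
    congr 1; funext x g
    exact p.right_tsum (sinv x) (F := fun x => x ⊠ g) (by fun_prop)

lemma pair_mul (f g : El A) (x : El B) : pair ev (ap p.dualMaps.mul (f ⊠ g)) x • (one : El (𝟙_ C)) =
    tsum (cop x) fun x₁ x₂ => pair ev f x₁ • pair ev g x₂ • one := by
  rw [dualMaps, ap_mor, tsum_tm _ _ (by fun_prop) (by fun_prop),
    map_tsum (L := fun f => pair ev f x • (one : El (𝟙_ C))) (by fun_prop) _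
      (by fun_prop) (by fun_prop)]
  have e (x' : El B) (g' : El A) : pair ev (tsum (cop x') fun x₁ x₂ => pair ev f x₁ •
      pair ev g x₂ • g') x • (one : El (𝟙_ C)) = pair ev g' x • (tsum (cop x') fun x₁ x₂ =>
      pair ev f x₁ • pair ev g x₂ • one) := by
    rw [map_tsum (L := fun f => pair ev f x • (one : El (𝟙_ C))) (by fun_prop) _
      (by fun_prop) (by fun_prop), ← smul_tsum _ (by fun_prop) (by fun_prop)]
    congr 1; funext y z
    rw [(lin_pair_left ev Lin.id x).smul, (lin_pair_left ev Lin.id x).smul]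
    simp only [smul_smul, smul_eq_mul]
    congr 1; ring
  simp only [e]
  exact p.right_tsum x (F := fun x => tsum (cop x) fun x₁ x₂ =>
      pair ev f x₁ • pair ev g x₂ • one) (by fun_prop)

lemma lact_spec (b : El B) : tsum (ap R one) (fun x g => x ⊠ actE (coadLeft ev) g b) =
    tsum (cop b) (fun b₁ p => tsum (cop p) fun b₂ b₃ => (b₃ * sinv b₁) ⊠ b₂) := by
  have e (g : El A) : actE (coadLeft ev) g b =
      tsum (ap (adCoact B) b) fun y v => pair ev g y • v := by
    simp (disch := fun_prop) only [actE, coadLeft, ap_comp, ap_whiskerLeft, tsum_tm,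
      ap_whiskerRight, ap_assoc_inv, ap_leftUnitor, tsum_tsum]
    rfl
  simp only [e]
  rw [p.contract_tsum _ (F := fun x v => x ⊠ v) (by fun_prop) (by fun_prop), tsum_eta, ap_adCoact]

lemma ract_spec {ract : A ⊗ B ⟶ A} (hr : ∀ f b x, pair ev (ap ract (f ⊠ b)) x =
    pair ev f (tsum (cop b) fun b₁ b₂ => b₂ * x * sinv b₁)) (b : El B) :
    tsum (ap R one) (fun x g => x ⊠ ap ract (g ⊠ b)) =
      tsum (cop b) (fun b₁ b₂ => tsum (ap R one) fun x g => (b₂ * x * sinv b₁) ⊠ g) := by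
  have e (g : El A) : ap ract (g ⊠ b) = tsum (ap R one) fun x' g' =>
      pair ev g (tsum (cop b) fun b₁ b₂ => b₂ * x' * sinv b₁) • g' := by
    simp only [← hr]
    exact (p.pair_left _).symm
  simp (disch := fun_prop) only [e, tm_tsum, tm_smul]
  refine (tsum_comm _ _ (by fun_prop) (by fun_prop) (by fun_prop) (by fun_prop)).trans ?_
  refine Eq.trans ?_ (tsum_comm _ _ (by fun_prop) (by fun_prop) (by fun_prop) (by fun_prop))
  congr 1; funext x g
  refine (p.right_tsum (tsum (cop b) fun b₁ b₂ => b₂ * x * sinv b₁) (F := fun x => x ⊠ g)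
    (by fun_prop)).trans ?_
  simp (disch := fun_prop) only [tsum_tm']

lemma isXi (V : DY B) [HopfObj A] : IsXi R V (xiAct ev V) := by
  have e (b : El B) (f : El A) (v : El V.X) : actE (xiAct ev V) (dc b f) v =
      actE V.act b (tsum (ap V.coact v) fun y u => pair ev f y • u) := by
    refine (show _ = ap ((α_ B A V.X).hom ≫ B ◁ dualAct ev V ≫ V.act : (B ⊗ A) ⊗ V.X ⟶ V.X)
      ((b ⊠ f) ⊠ v) from rfl).trans ?_
    simp (disch := fun_prop) only [dualAct, ap_comp, ap_whiskerLeft, tsum_tm,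
      ap_whiskerRight, ap_assoc_inv, ap_leftUnitor, tsum_tsum, ap_assoc_tm]
    rfl
  constructor
  · intro b f v
    rw [e, e, V.one_act]
  · intro v
    simp only [e, V.one_act]
    rw [p.contract_tsum _ (F := fun x v => x ⊠ v) (by fun_prop) (by fun_prop), tsum_eta]

end IsPerfect

end Perfect

end Double

end

end QuantumDouble

namespace QuantumDouble

noncomputable section

/-! ### Finite-dimensional Hopf algebras -/

section FiniteDimensional

open scoped TensorProduct

variable {k : Type u} [Field k]

instance : LinCat k (ModuleCat.{u} k) where
  El V := V
  acg _ := inferInstance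
  mod _ := inferInstance
  lin f := f.hom
  ofLin f := ModuleCat.ofHom f
  lin_ofLin _ := rfl
  ofLin_lin _ := rfl
  lin_id _ _ := rfl
  lin_comp _ _ _ := rfl
  tm {V W} := TensorProduct.mk k V W
  lift f := TensorProduct.lift f
  lift_tm _ v w := TensorProduct.lift.tmul v w
  tm_ext _ _ h := TensorProduct.ext' h
  one := (1 : k)
  scal := LinearMap.id
  scal_one := rfl
  scal_smul c := mul_one (M := k) c
  tensorHom_tm _ _ _ _ := rfl
  assoc_tm _ _ _ := rfl
  leftUnitor_tm v := one_smul k v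
  rightUnitor_tm v := one_smul k v
  braiding_tm _ _ := rfl

/-- Fitting's lemma for an endomorphism `s` of a finite-dimensional space. If the minimal polynomial
is `Xⁿ g` with `g(0) ≠ 0`, then `g(s)` vanishes on the image of `sⁿ`, and `a` is read off from
`g = g(0) + X g'`. -/
lemma exists_pow_eq_pow_succ_mul {V : Type*} [AddCommGroup V] [Module k V] [FiniteDimensional k V]
    (s : Module.End k V) : ∃ n, ∃ a : Module.End k V, Commute s a ∧ s ^ n = s ^ (n + 1) * a := by
  obtain ⟨g, hg, hd⟩ := (minpoly k s).exists_eq_pow_rootMultiplicity_mul_and_not_dvd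
    (minpoly.ne_zero (Algebra.IsIntegral.isIntegral s)) 0
  rw [Polynomial.C_0, sub_zero] at hg hd
  have hc : g.coeff 0 ≠ 0 := fun h => hd (Polynomial.X_dvd_iff.2 h)
  generalize Polynomial.rootMultiplicity 0 (minpoly k s) = n at hg
  refine ⟨n, -(g.coeff 0)⁻¹ • Polynomial.aeval s g.divX, ?_, ?_⟩
  · refine Commute.smul_right ?_ _
    simpa using (Commute.all Polynomial.X g.divX).map (Polynomial.aeval s)
  · have h := minpoly.aeval k s
    rw [hg, map_mul, map_pow, Polynomial.aeval_X, ← Polynomial.divX_mul_X_add g, map_add, map_mul,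
      Polynomial.aeval_X, Polynomial.aeval_C, mul_add, Algebra.algebraMap_eq_smul_one] at h
    have hcomm : Polynomial.aeval s g.divX * s = s * Polynomial.aeval s g.divX := by
      simpa using ((Commute.all Polynomial.X g.divX).map (Polynomial.aeval s)).symm.eq
    rw [hcomm, ← mul_assoc, ← pow_succ, mul_smul_comm, mul_one] at h
    rw [mul_smul_comm, neg_smul, ← smul_neg, ← eq_neg_of_add_eq_zero_right h, smul_smul,
      inv_mul_cancel₀ hc, one_smul]

/-- The antipode of a finite-dimensional Hopf algebra is invertible. -/
theorem isIso_antipode (B : ModuleCat.{u} k) [HopfObj B] [FiniteDimensional k B] : IsIso 𝒮[B] := by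
  obtain ⟨n, a, ha, hn⟩ := exists_pow_eq_pow_succ_mul (𝒮[B].hom : Module.End k B)
  set s : Module.End k B := 𝒮[B].hom with hs
  have hj (j : ℕ) : s ^ n = s ^ (n + j) * a ^ j := by
    induction j with
    | zero => simp
    | succ j ih =>
      rw [pow_succ' a, ← mul_assoc, ← add_assoc, add_right_comm, add_comm (n + 1), pow_add,
        mul_assoc _ (s ^ (n + 1)), ← hn, ← pow_add, add_comm, ← ih]
  have hN : s ^ (2 * n + 2) = s ^ (2 * n + 2) * s ^ (2 * n + 2) * a ^ (2 * n + 2) := by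
    conv_lhs => rw [show 2 * n + 2 = (n + 2) + n by ring, pow_add, hj (2 * n + 2), ← mul_assoc,
      ← pow_add]
    rw [← pow_add]
    congr 2; ring
  have pow_apply (m : ℕ) (x : B) : antiPow (C := ModuleCat.{u} k) m x = (s ^ m) x := by
    induction m with
    | zero => rfl
    | succ m ih => rw [antiPow_succ, ih, pow_succ']; rfl
  refine isIso_antipode_of_bijective ?_
  -- the exponent has to be even, and large enough for the image of the power to be stable
  have inj : Function.Injective s := by
    refine (injective_iff_map_eq_zero s).2 fun x hx => ?_
    refine anti_injective_of_pow (C := ModuleCat.{u} k) (n := 2 * n + 2)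
      ⟨n + 1, by ring⟩ (q := (a ^ (2 * n + 2) : Module.End k B))
      ⟨map_add _, map_smul _⟩ (fun y => ?_) (fun y => ?_) x ?_
    · exact LinearMap.congr_fun ((ha.pow_right (2 * n + 2)).eq.symm) y
    · rw [pow_apply, pow_apply, pow_apply]
      exact (LinearMap.congr_fun hN y).symm
    · rw [pow_apply, pow_succ, Module.End.mul_apply, hx, map_zero]
  exact ⟨inj, LinearMap.injective_iff_surjective.1 inj⟩

variable (B : ModuleCat.{u} k)

lemma isPerfect_dual [FiniteDimensional k B] : IsPerfect (canonicalR B) (evDual B) := by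
  have e {V : ModuleCat.{u} k} {F : El B → El (dual B) → El V} (h₁ : ∀ y, Lin k (fun x => F x y))
      (h₂ : ∀ x, Lin k (fun y => F x y)) :
      tsum (ap (canonicalR B) one) F = ∑ i, F (Module.Basis.ofVectorSpace k B i)
        ((Module.Basis.ofVectorSpace k B).coord i) := by
    have h : ap (canonicalR B) one = ∑ i, (Module.Basis.ofVectorSpace k B i : B) ⊠
        ((Module.Basis.ofVectorSpace k B).coord i : dual B) := coevaluation_apply_one k B
    rw [h]
    refine (map_sum (lin_tsum_left Lin.id F).mk' _ _).trans (Finset.sum_congr rfl fun i _ => ?_)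
    exact tsum_tm _ _ h₁ h₂
  constructor
  · intro f
    rw [e (by fun_prop) (by fun_prop)]
    exact (Module.Basis.ofVectorSpace k B).sum_dual_apply_smul_coord f
  · intro y
    rw [e (by fun_prop) (by fun_prop)]
    exact (Module.Basis.ofVectorSpace k B).sum_repr y

variable [HopfObj B]

lemma pair_coadRight [IsIso 𝒮[B]] (f : dual B) (b x : B) :
    pair (C := ModuleCat.{u} k) (evDual B) (ap (coadRight B) (f ⊠ b)) x =
      pair (evDual B) f (tsum (cop b) fun b₁ b₂ => b₂ * x * sinv b₁) := by
  refine congrArg (fun y : B => (f : Module.Dual k B) y) ?_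
  exact ap_adAct (C := ModuleCat.{u} k) b x

/-- The theorem for finite-dimensional Hopf algebras. -/
theorem finiteDimensional_double [FiniteDimensional k B] :
      IsIso 𝒮[B] ∧
      ∃ _ : HopfObj (dual B), IsOppositeDual B ∧
        IsMatchedPair B (dual B) (coadLeft (evDual B)) (coadRight B) ∧
        ∃ _ : HopfObj (DoubleCross B (dual B)),
          IsDoubleCrossProduct (coadLeft (evDual B)) (coadRight B) ∧
          IsQuasitriangular (DoubleCross B (dual B)) (doubleR (canonicalR B)) ∧
          ∃ (h₁ : DY.IsMonoidal B) (h₂ : DY.IsBraided h₁)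
            (h₃ : HopfRep.IsMonoidal (DoubleCross B (dual B)))
            (h₄ : HopfRep.IsBraided h₃ (doubleR (canonicalR B)))
            (hΞ : ∀ V : DY B, IsAction (DoubleCross B (dual B)) V.X (xiAct (evDual B) V))
            (hΘ : ∀ V : HopfRep (DoubleCross B (dual B)),
              IsDrinfeldYetter B V.X (thetaAct V) (thetaCoact (canonicalR B) V)),
            letI := DY.monoidal h₁
            letI := DY.braided h₁ h₂
            letI := HopfRep.monoidal h₃
            letI := HopfRep.braided h₃ (doubleR (canonicalR B)) h₄
            let Ξ := xi (evDual B) hΞ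
            let Θ := theta (canonicalR B) hΘ
            (∃ e : DY B ≌ HopfRep (DoubleCross B (dual B)), e.functor = Ξ ∧ e.inverse = Θ) ∧
            (∃ _ : Ξ.Braided, (Functor.LaxMonoidal.ε Ξ).hom = 𝟙 (𝟙_ (ModuleCat.{u} k)) ∧
              ∀ V W : DY B, (Functor.LaxMonoidal.μ Ξ V W).hom = 𝟙 (V.X ⊗ W.X)) ∧
            (∃ _ : Θ.Braided, (Functor.LaxMonoidal.ε Θ).hom = 𝟙 (𝟙_ (ModuleCat.{u} k)) ∧
              ∀ V W : HopfRep (DoubleCross B (dual B)),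
                (Functor.LaxMonoidal.μ Θ V W).hom = 𝟙 (V.X ⊗ W.X)) := by
  have := isIso_antipode B
  refine ⟨inferInstance, ?_⟩
  have p := isPerfect_dual B
  letI := p.dualMaps.hopfObj
  have d := p.dualMaps.isDualPair (lact := coadLeft (evDual B)) (ract := coadRight B) p.lact_spec
    (p.ract_spec (pair_coadRight B))
  letI := d.doubleHopf
  have h := d.isDoubleCrossProduct
  have hq := d.isQuasitriangular h
  have hΞ (V : DY B) := (p.isXi V).isAction d h
  have hΘ := theta_isDY d h
  refine ⟨inferInstance, ?_, d.isMatchedPair, inferInstance, h, hq, DY.isMonoidal, DY.isBraided,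
    HopfRep.isMonoidal, hq.isBraided, hΞ, hΘ, xi_theta_equivalence d h (fun V => p.isXi V) hΞ hΘ,
    xi_braided d h (fun V => p.isXi V) hΞ _ _ _ _, theta_braided d h hΘ _ _ _ _⟩
  constructor
  · intro x
    have h₁ := congrArg (fun f : El (dual B) =>
      (pair (evDual B) f x • one : El (𝟙_ (ModuleCat.{u} k))))
      d.one_eq
    rw [map_tsum (L := fun f : El (dual B) =>
      (pair (evDual B) f x • one : El (𝟙_ (ModuleCat.{u} k))))
      (by fun_prop) _ (by fun_prop) (by fun_prop)] at h₁
    have e (y : El B) (g : El (dual B)) : (pair (evDual B) (eps y • g) x • one :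
        El (𝟙_ (ModuleCat.{u} k))) = pair (evDual B) g x • eps y • one := by
      rw [(lin_pair_left (evDual B) Lin.id x).smul, smul_assoc, smul_comm]
    simp only [e] at h₁
    rw [p.right_tsum x (F := fun y => eps y • one) (by fun_prop)] at h₁
    have h₂ := congrArg scal h₁
    simp only [scal_smul', scal_one, mul_one] at h₂
    exact h₂
  · intro f g x
    have h₁ := congrArg scal (p.pair_mul f g x)
    simp only [scal_smul', scal_one, mul_one] at h₁
    refine h₁.trans ?_
    refine Eq.trans ?_ (tm_ext (f := fun t : El (B ⊗ B : ModuleCat.{u} k) => tsum t fun x₁ x₂ =>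
      (pair (evDual B) f x₁ • pair (evDual B) g x₂ • one : El (𝟙_ (ModuleCat.{u} k))))
      (g := fun t => TensorProduct.dualDistrib k B B (f ⊗ₜ[k] g) t) (by fun_prop)
      (Lin.linearMap (TensorProduct.dualDistrib k B B (f ⊗ₜ[k] g)) Lin.id) (fun y z => ?_) _)
    · rfl
    · rw [tsum_tm _ _ (by fun_prop) (by fun_prop)]
      exact congrArg (f y * ·) (mul_one (g z))
  · intro f
    exact mul_one (M := k) _
  · intro f x y
    let L : El (dual B ⊗ dual B : ModuleCat.{u} k) → El (𝟙_ (ModuleCat.{u} k)) := fun t =>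
      TensorProduct.dualDistrib k B B t (x ⊗ₜ[k] y)
    have hL : Lin k L :=
      ⟨fun s t => LinearMap.congr_fun (map_add (TensorProduct.dualDistrib k B B) s t) _,
        fun c t => LinearMap.congr_fun (map_smul (TensorProduct.dualDistrib k B B) c t) _⟩
    have e : L (cop f) = tsum (ap (canonicalR B) one) fun x₁ g₁ =>
        tsum (ap (canonicalR B) one) fun x₂ g₂ =>
          pair (evDual B) g₁ y • pair (evDual B) g₂ x • pair (evDual B) f (x₁ * x₂) • one := by
      refine (congrArg L (ap_mor (V := dual B) _ _ f)).trans ?_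
      rw [map_tsum hL _ (by fun_prop) (by fun_prop)]
      congr 1; funext x₁ g₁
      rw [map_tsum hL _ (by fun_prop) (by fun_prop)]
      congr 1; funext x₂ g₂
      rw [hL.smul]
      have hc (a b c : k) : a * (b * c) = c * (b * (a * 1)) := by ring
      exact hc (f (x₁ * x₂)) (pair (evDual B) g₂ x) (pair (evDual B) g₁ y)
    have e₂ (x₁ : El B) (g₁ : El (dual B)) : tsum (ap (canonicalR B) one) (fun x₂ g₂ =>
          pair (evDual B) g₁ y • pair (evDual B) g₂ x • pair (evDual B) f (x₁ * x₂) •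
            (one : El (𝟙_ (ModuleCat.{u} k)))) =
        pair (evDual B) g₁ y • pair (evDual B) f (x₁ * x) • one := by
      rw [smul_tsum _ (by fun_prop) (by fun_prop)]
      congr 1
      exact p.right_tsum x (F := fun x₂ => pair (evDual B) f (x₁ * x₂) • one) (by fun_prop)
    simp only [e₂] at e
    rw [p.right_tsum y (F := fun x₁ => pair (evDual B) f (x₁ * x) • one) (by fun_prop)] at e
    exact e.trans (mul_one (M := k) _)

end FiniteDimensional

end

end QuantumDouble

namespace QuantumDouble

noncomputable section

namespace TopFree

open scoped PowerSeries

variable {k : Type u} [Field k]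

/-! ### Topologically free modules -/

instance : LinCat k⟦X⟧ (TopFree k) where
  El V := V
  acg _ := inferInstance
  mod _ := inferInstance
  lin f := f.hom
  ofLin f := ⟨f⟩
  lin_ofLin _ := rfl
  ofLin_lin _ := rfl
  lin_id _ _ := rfl
  lin_comp _ _ _ := rfl
  tm := tmul
  lift f := tensorLift f
  lift_tm f v w := tensorLift_tmul f v w
  tm_ext _ _ h := tensor_ext h
  one := unitOne k
  scal := LinearMap.id
  scal_one := rfl
  scal_smul c := toSeries_smul_unitOne c
  tensorHom_tm f g v w := tensorHom_pure f g v w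
  assoc_tm u v w := associator_hom_pure u v w
  leftUnitor_tm v := by
    refine (leftUnitor_hom_pure (unitOne k) v).trans ?_
    rw [toSeries_unitOne, one_smul]
  rightUnitor_tm v := by
    refine (rightUnitor_hom_pure (unitOne k) v).trans ?_
    rw [toSeries_unitOne, one_smul]
  braiding_tm v w := braiding_hom_pure v w

local notation "ħ" => (PowerSeries.X : k⟦X⟧)

variable {U V W T : TopFree k}

/-- The submodule `ħⁿ V` of `V`. -/
def fil (V : TopFree k) (n : ℕ) : Submodule k⟦X⟧ (El V) :=
  LinearMap.range (LinearMap.lsmul k⟦X⟧ (El V) (ħ ^ n))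

lemma mem_fil {n : ℕ} {v : El V} : v ∈ fil V n ↔ ∃ z : El V, v = ħ ^ n • z :=
  ⟨fun ⟨z, hz⟩ => ⟨z, hz.symm⟩, fun ⟨z, hz⟩ => ⟨z, hz.symm⟩⟩

lemma smul_mem_fil (n : ℕ) (z : El V) : ħ ^ n • z ∈ fil V n := mem_fil.2 ⟨z, rfl⟩

@[simp] lemma fil_zero : fil V 0 = ⊤ := top_unique fun v _ => mem_fil.2 ⟨v, by simp⟩

lemma fil_mono {m n : ℕ} (h : m ≤ n) : fil V n ≤ fil V m := fun v hv => by
  obtain ⟨z, rfl⟩ := mem_fil.1 hv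
  obtain ⟨c, rfl⟩ := Nat.exists_eq_add_of_le h
  rw [pow_add, mul_smul]
  exact smul_mem_fil _ _

lemma fil_map {f : El V → El W} (hf : Lin k⟦X⟧ f) {n : ℕ} {v : El V} (hv : v ∈ fil V n) :
    f v ∈ fil W n := by
  obtain ⟨z, rfl⟩ := mem_fil.1 hv
  rw [hf.smul]
  exact smul_mem_fil _ _

lemma pow_smul_inj (n : ℕ) {v w : El V} (h : ħ ^ n • v = ħ ^ n • w) : v = w := by
  have : ħ ^ n • (v - w) = 0 := by rw [smul_sub, h, sub_self]
  have := (smul_eq_zero (M := V)).1 this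
  exact sub_eq_zero.1 (this.resolve_left (pow_ne_zero _ PowerSeries.X_ne_zero))

lemma pow_smul_mem_fil {m n : ℕ} {v : El V} : ħ ^ m • v ∈ fil V (m + n) ↔ v ∈ fil V n := by
  simp only [mem_fil, pow_add, mul_smul]
  exact ⟨fun ⟨z, hz⟩ => ⟨z, pow_smul_inj m hz⟩, fun ⟨z, hz⟩ => ⟨z, by rw [hz]⟩⟩

lemma tm_mem_fil {m n : ℕ} {v : El V} {w : El W} (hv : v ∈ fil V m) (hw : w ∈ fil W n) :
    v ⊠ w ∈ fil (V ⊗ W) (m + n) := by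
  obtain ⟨z, rfl⟩ := mem_fil.1 hv
  obtain ⟨z', rfl⟩ := mem_fil.1 hw
  rw [tm_smul, smul_tm, smul_smul, ← pow_add, add_comm]
  exact smul_mem_fil _ _

/-- If the bilinear function `F` takes values in `ħⁿ T`, then so do its sums over tensors. -/
lemma tsum_mem_fil {n : ℕ} (t : El (V ⊗ W)) {F : El V → El W → El T}
    (h₁ : ∀ w, Lin k⟦X⟧ (fun v => F v w)) (h₂ : ∀ v, Lin k⟦X⟧ (fun w => F v w))
    (h : ∀ v w, F v w ∈ fil T n) : tsum t F ∈ fil T n := by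
  choose G hG using fun v w => mem_fil.1 (h v w)
  have g₁ (w : El W) : Lin k⟦X⟧ (fun v => G v w) :=
    ⟨fun x y => pow_smul_inj n (by rw [← hG, (h₁ w).add, hG, hG, smul_add]),
      fun c x => pow_smul_inj n (by rw [← hG, (h₁ w).smul, hG, smul_comm])⟩
  have g₂ (v : El V) : Lin k⟦X⟧ (fun w => G v w) :=
    ⟨fun x y => pow_smul_inj n (by rw [← hG, (h₂ v).add, hG, hG, smul_add]),
      fun c x => pow_smul_inj n (by rw [← hG, (h₂ v).smul, hG, smul_comm])⟩
  rw [show F = fun v w => ħ ^ n • G v w from funext₂ hG, smul_tsum _ g₁ g₂]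
  exact smul_mem_fil _ _

lemma eq_zero_of_mem_fil {v : El V} (h : ∀ n, v ∈ fil V n) : v = 0 := by
  have := (IsHausdorff.eq_iff_smodEq (I := hIdeal k) (M := V) (x := v) (y := 0)).2 fun n => by
    obtain ⟨z, hz⟩ := mem_fil.1 (h n)
    exact (smodEq_iff n _ _).2 ⟨z, by rw [sub_zero]; exact hz⟩
  exact this

lemma eq_of_sub_mem_fil {v w : El V} (h : ∀ n, v - w ∈ fil V n) : v = w :=
  sub_eq_zero.1 (eq_zero_of_mem_fil h)

lemma exists_lim (f : ℕ → El V) (hf : ∀ n, f (n + 1) - f n ∈ fil V n) :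
    ∃ l, ∀ n, l - f n ∈ fil V n := by
  have h (m n : ℕ) (hmn : m ≤ n) : f n - f m ∈ fil V m := by
    induction n, hmn using Nat.le_induction with
    | base => simp
    | succ n hmn ih =>
      rw [← sub_add_sub_cancel _ (f n)]
      exact add_mem (fil_mono hmn (hf n)) ih
  obtain ⟨l, hl⟩ := IsPrecomplete.prec (I := hIdeal k) (M := V) inferInstance (f := f)
    fun {m n} hmn => (smodEq_iff m _ _).2 (by
      obtain ⟨z, hz⟩ := mem_fil.1 (h m n hmn)
      exact ⟨-z, by rw [smul_neg, ← neg_sub]; exact congrArg _ hz⟩)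
  refine ⟨l, fun n => ?_⟩
  obtain ⟨z, hz⟩ := (smodEq_iff n _ _).1 (hl n)
  exact mem_fil.2 ⟨-z, by rw [smul_neg, ← neg_sub]; exact congrArg _ hz⟩

open TensorProduct in
lemma exists_sub_of_mem (z : AdicCompletion (hIdeal k) (V ⊗[k⟦X⟧] W)) (n : ℕ) :
    ∃ (m : V ⊗[k⟦X⟧] W) (y : AdicCompletion (hIdeal k) (V ⊗[k⟦X⟧] W)),
      z = AdicCompletion.of _ _ m + ħ ^ n • y := by
  obtain ⟨m, hm⟩ := Submodule.mkQ_surjective _ (AdicCompletion.eval (hIdeal k) _ n z)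
  have hx : z - AdicCompletion.of _ _ m ∈
      ((hIdeal k) ^ n • ⊤ : Submodule k⟦X⟧ (AdicCompletion (hIdeal k) (V ⊗[k⟦X⟧] W))) := by
    rw [AdicCompletion.pow_smul_top_eq_ker_eval hIdeal_fg, LinearMap.mem_ker, map_sub,
      AdicCompletion.eval_of, hm, sub_self]
  obtain ⟨y, hy⟩ := (smul_top_iff n _).1 hx
  exact ⟨m, y, by rw [← hy]; abel⟩

/-- Every element of the completed tensor product is approximated by elements of any submodule
which contains the pure tensors. -/
lemma exists_sub_mem_fil {P : Submodule k⟦X⟧ (El (V ⊗ W))} (hP : ∀ v w, v ⊠ w ∈ P)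
    (z : El (V ⊗ W)) (n : ℕ) : ∃ y ∈ P, z - y ∈ fil (V ⊗ W) n := by
  obtain ⟨m, y, hy⟩ := exists_sub_of_mem z n
  refine ⟨AdicCompletion.of (hIdeal k) _ m, ?_, mem_fil.2 ⟨y, sub_eq_of_eq_add' hy⟩⟩
  clear hy
  induction m using TensorProduct.induction_on with
  | zero =>
    rw [map_zero]
    exact P.zero_mem
  | tmul v w => exact hP v w
  | add x y hx hy =>
    rw [map_add]
    exact P.add_mem hx hy

/-! ### Convergent sums -/

/-- The family `t` has the sum `l`, in the `ħ`-adic topology. -/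
def HSum {I : Type*} (t : I → El V) (l : El V) : Prop :=
  ∀ n, ∃ s₀ : Finset I, ∀ s, s₀ ⊆ s → l - ∑ i ∈ s, t i ∈ fil V n

/-- The family `t` converges to zero. -/
def Null {I : Type*} (t : I → El V) : Prop := ∀ n, {i | t i ∉ fil V n}.Finite

section HSum

variable {I : Type*} {t t' : I → El V} {l l' : El V}

lemma HSum.map {f : El V → El W} (hf : Lin k⟦X⟧ f) (h : HSum t l) :
    HSum (fun i => f (t i)) (f l) := by
  intro n
  obtain ⟨s, hs⟩ := h n
  refine ⟨s, fun S hS => ?_⟩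
  have := fil_map hf (hs S hS)
  have e : f (l - ∑ i ∈ S, t i) = f l - ∑ i ∈ S, f (t i) :=
    (map_sub hf.mk' _ _).trans (congrArg _ (map_sum hf.mk' _ _))
  rwa [e] at this

lemma Null.exists_hsum (h : Null t) : ∃ l, HSum t l := by
  classical
  have hmono (n : ℕ) (s : Finset I) (hs : (h n).toFinset ⊆ s) :
      ∑ i ∈ s, t i - ∑ i ∈ (h n).toFinset, t i ∈ fil V n := by
    rw [← Finset.sum_sdiff hs, add_sub_cancel_right]
    refine sum_mem fun i hi => ?_
    simpa using (Finset.mem_sdiff.1 hi).2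
  obtain ⟨l, hl⟩ := exists_lim (fun n => ∑ i ∈ (h n).toFinset, t i)
    fun n => hmono n _ fun i hi => by
    simp only [Set.Finite.mem_toFinset, Set.mem_ofPred_eq] at hi ⊢
    exact fun h' => hi (fil_mono (Nat.le_succ n) h')
  refine ⟨l, fun n => ⟨(h n).toFinset, fun s hs => ?_⟩⟩
  rw [← sub_sub_sub_cancel_right _ _ (∑ i ∈ (h n).toFinset, t i)]
  exact sub_mem (hl n) (hmono n s hs)

end HSum

/-! ### Linear functionals -/

/-- Reduction modulo `ħ`, with values in a vector space. -/
structure IsReduction {Q : Type*} [AddCommGroup Q] [Module k Q]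
    (p : El V →ₛₗ[PowerSeries.constantCoeff (R := k)] Q) : Prop where
  surjective : Function.Surjective p
  eq_zero_iff : ∀ v, p v = 0 ↔ v ∈ fil V 1

section Functionals

variable {Q : Type*} [AddCommGroup Q] [Module k Q]
  {p : El V →ₛₗ[PowerSeries.constantCoeff (R := k)] Q}

lemma exists_isReduction (V : TopFree k) : ∃ (Q : Type u) (_ : AddCommGroup Q) (_ : Module k Q)
    (p : El V →ₛₗ[PowerSeries.constantCoeff (R := k)] Q), IsReduction p := by
  letI : Module k (El V ⧸ fil V 1) := Module.compHom _ (PowerSeries.C (R := k))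
  refine ⟨El V ⧸ fil V 1, inferInstance, inferInstance,
    { toFun := (fil V 1).mkQ
      map_add' := map_add _
      map_smul' := fun c v => ?_ }, (fil V 1).mkQ_surjective,
    fun v => Submodule.Quotient.mk_eq_zero _⟩
  change (fil V 1).mkQ (c • v) = (fil V 1).mkQ (PowerSeries.C (PowerSeries.constantCoeff c) • v)
  rw [← sub_eq_zero, ← map_sub, ← sub_smul]
  obtain ⟨d, hd⟩ := (PowerSeries.X_dvd_iff (φ := c - PowerSeries.C (PowerSeries.constantCoeff c))).2
    (by simp)
  refine (Submodule.Quotient.mk_eq_zero _).2 (mem_fil.2 ⟨d • v, ?_⟩)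
  rw [hd, mul_smul, pow_one]

/-- An additive map to `k⟦ħ⟧` which commutes with `k` and `ħ` is `k⟦ħ⟧`-linear. -/
lemma map_series_smul {F : El V → k⟦X⟧} (h₀ : ∀ x y, F (x + y) = F x + F y)
    (h₁ : ∀ (c : k) x, F (PowerSeries.C c • x) = PowerSeries.C c * F x)
    (h₂ : ∀ x, F (ħ • x) = ħ * F x) (c : k⟦X⟧) (x : El V) : F (c • x) = c * F x := by
  have h (n : ℕ) : ∀ c : k⟦X⟧, ħ ^ n ∣ F (c • x) - c * F x := by
    induction n with
    | zero => simp
    | succ n ih =>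
      intro c
      obtain ⟨d, hd⟩ := (PowerSeries.X_dvd_iff
        (φ := c - PowerSeries.C (PowerSeries.constantCoeff c))).2 (by simp)
      have hc : c = PowerSeries.C (PowerSeries.constantCoeff c) + ħ * d := by rw [← hd]; ring
      have e : F (c • x) - c * F x = ħ * (F (d • x) - d * F x) := by
        rw [hc, add_smul, h₀, h₁, mul_smul, h₂]
        ring
      rw [e, pow_succ']
      exact mul_dvd_mul_left _ (ih d)
  refine sub_eq_zero.1 (PowerSeries.ext fun n => ?_)
  rw [map_zero]
  exact PowerSeries.X_pow_dvd_iff.1 (h (n + 1) c) n (Nat.lt_succ_self n)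

/-- The coordinate functionals of a lift of a basis of `V / ħ V`. -/
lemma IsReduction.exists_coord (hp : IsReduction p) {I : Type*} (u : Module.Basis I k Q)
    (β : I → El V) (hβ : ∀ i, p (β i) = u i) : ∃ F : I → (El V →ₗ[k⟦X⟧] k⟦X⟧),
      (∀ i x, PowerSeries.constantCoeff (F i x) = u.repr (p x) i) ∧
      (∀ i, F i (β i) = 1) ∧ ∀ i j, i ≠ j → F i (β j) = 0 := by
  letI : Module k (El V) := Module.compHom _ (PowerSeries.C (R := k))
  have hC (c : k) (x : El V) : PowerSeries.C c • x = c • x := rfl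
  have hpk (c : k) (x : El V) : p (c • x) = c • p x := by
    rw [← hC, map_smulₛₗ, PowerSeries.constantCoeff_C]
  have hpX (x : El V) : p (ħ • x) = 0 := by
    rw [map_smulₛₗ, PowerSeries.constantCoeff_X, zero_smul]
  -- `D x = (x - σ(p x)) / ħ`, so that `x = ∑ₙ ħⁿ σ(p (Dⁿ x))`; the coordinate `F i` collects the
  -- `i`-th coordinates of the terms
  let σ : Q →ₗ[k] El V := u.constr k β
  have hσ (i : I) : σ (u i) = β i := u.constr_basis k β i
  have hpσ (q : Q) : p (σ q) = q := by
    let g : Q →ₗ[k] Q :=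
      { toFun := fun q => p (σ q)
        map_add' := by simp
        map_smul' := by simp [hpk] }
    have : g = LinearMap.id := u.ext fun i => by
      change p (σ (u i)) = u i
      rw [hσ, hβ]
    exact LinearMap.congr_fun this q
  have hD (x : El V) : ∃ y : El V, x = σ (p x) + ħ • y := by
    have : p (x - σ (p x)) = 0 := by rw [map_sub, hpσ, sub_self]
    obtain ⟨y, hy⟩ := mem_fil.1 ((hp.eq_zero_iff _).1 this)
    exact ⟨y, by rw [pow_one] at hy; rw [← hy]; abel⟩
  choose D hD using hD
  have inj {x y : El V} (h : ħ • x = ħ • y) : x = y := pow_smul_inj 1 (by simpa using h)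
  have D_add (x y : El V) : D (x + y) = D x + D y := inj (by
    have h := hD (x + y)
    nth_rewrite 1 [hD x, hD y] at h
    rw [map_add, map_add] at h
    rw [smul_add]
    refine add_left_cancel (a := σ (p x) + σ (p y)) (h.symm.trans ?_)
    abel)
  have D_smul (c : k) (x : El V) : D (c • x) = c • D x := inj (by
    have h := hD (c • x)
    nth_rewrite 1 [hD x] at h
    rw [hpk, map_smul, smul_add] at h
    rw [← add_left_cancel h, ← hC, ← hC, smul_comm])
  have D_X (x : El V) : D (ħ • x) = x := inj (by
    have h := hD (ħ • x)
    rw [hpX, map_zero, zero_add] at h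
    exact h.symm)
  have Dn_add (n : ℕ) (x y : El V) : D^[n] (x + y) = D^[n] x + D^[n] y := by
    induction n generalizing x y with
    | zero => rfl
    | succ n ih => rw [Function.iterate_succ_apply, D_add, ih]; rfl
  have Dn_smul (n : ℕ) (c : k) (x : El V) : D^[n] (c • x) = c • D^[n] x := by
    induction n generalizing x with
    | zero => rfl
    | succ n ih => rw [Function.iterate_succ_apply, D_smul, ih]; rfl
  have hDβ (j : I) : D (β j) = 0 := inj (by
    have h := hD (β j)
    rw [hβ, hσ] at h
    rw [smul_zero]
    exact (left_eq_add.1 h))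
  have Dn_zero (n : ℕ) : D^[n] 0 = 0 := by
    have := Dn_smul n 0 0
    rwa [zero_smul, zero_smul] at this
  let F (i : I) (x : El V) : k⟦X⟧ := PowerSeries.mk fun n => u.repr (p (D^[n] x)) i
  have F_add (i : I) (x y : El V) : F i (x + y) = F i x + F i y := by
    ext n
    simp [F, Dn_add]
  have F_C (i : I) (c : k) (x : El V) : F i (PowerSeries.C c • x) = PowerSeries.C c * F i x := by
    ext n
    simp [F, hC, Dn_smul, hpk]
  have F_X (i : I) (x : El V) : F i (ħ • x) = ħ * F i x := by
    ext n
    cases n with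
    | zero => simp [F, hpX]
    | succ n =>
      rw [PowerSeries.coeff_succ_X_mul]
      simp [F, D_X]
  have Fβ (i j : I) : F i (β j) = PowerSeries.C (u.repr (u j) i) := by
    ext n
    cases n with
    | zero => simp [F, hβ]
    | succ n => simp [F, hDβ, Dn_zero]
  refine ⟨fun i => ⟨⟨F i, F_add i⟩, map_series_smul (F_add i) (F_C i) (F_X i)⟩,
    fun i x => by simp [F], fun i => ?_, fun i j hij => ?_⟩
  · exact (Fβ i i).trans (by simp)
  · exact (Fβ i j).trans (by simp [Finsupp.single_eq_of_ne hij])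

/-- Coordinates on `V`, of which finitely many suffice to describe an element modulo `ħ`. -/
lemma exists_coords (V : TopFree k) : ∃ (I : Type u) (e : I → El V)
    (F : I → (El V →ₗ[k⟦X⟧] k⟦X⟧)), ∀ v, ∃ s₀ : Finset I, ∀ s, s₀ ⊆ s →
      v - ∑ i ∈ s, F i v • e i ∈ fil V 1 := by
  obtain ⟨Q, _, _, p, hp⟩ := exists_isReduction V
  let u := Module.Basis.ofVectorSpace k Q
  choose β hβ using fun i => hp.surjective (u i)
  obtain ⟨F, hF, -⟩ := hp.exists_coord u β hβ
  refine ⟨_, β, F, fun v => ⟨(u.repr (p v)).support, fun s hs => ?_⟩⟩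
  rw [← hp.eq_zero_iff, map_sub, map_sum, sub_eq_zero]
  simp only [map_smulₛₗ, hF, hβ]
  conv_lhs => rw [← u.linearCombination_repr (p v), Finsupp.linearCombination_apply,
    Finsupp.sum_of_support_subset _ hs _ (by simp)]

/-- Linear functionals detect divisibility by powers of `ħ`. -/
lemma mem_fil_of_functionals {n : ℕ} {v : El V} (h : ∀ F : El V →ₗ[k⟦X⟧] k⟦X⟧, ħ ^ n ∣ F v) :
    v ∈ fil V n := by
  induction n generalizing v with
  | zero => simp
  | succ n ih =>
    obtain ⟨I, e, F, hF⟩ := exists_coords V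
    obtain ⟨s, hs⟩ := hF v
    have h₁ : v ∈ fil V 1 := by
      rw [← sub_add_cancel v (∑ i ∈ s, F i v • e i)]
      refine add_mem (hs s subset_rfl) (sum_mem fun i _ => ?_)
      obtain ⟨c, hc⟩ := h (F i)
      rw [hc, mul_smul]
      exact fil_mono (by omega) (smul_mem_fil _ _)
    obtain ⟨z, rfl⟩ := mem_fil.1 h₁
    rw [add_comm, pow_smul_mem_fil]
    refine ih fun G => ?_
    have := h G
    rw [map_smul, smul_eq_mul, pow_one, pow_succ'] at this
    exact (mul_dvd_mul_iff_left PowerSeries.X_ne_zero).1 this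

/-- The maps `id ⊗ G`, for linear functionals `G` on `V`, detect divisibility by powers of `ħ` on
`W ⊗ V`. -/
lemma mem_fil_of_slices {n : ℕ} {z : El (W ⊗ V)}
    (h : ∀ G : El V →ₗ[k⟦X⟧] k⟦X⟧, tsum z (fun w v => G v • w) ∈ fil W n) :
    z ∈ fil (W ⊗ V) n := by
  induction n generalizing z with
  | zero => simp
  | succ n ih =>
    obtain ⟨I, e, F, hF⟩ := exists_coords V
    let L (s : Finset I) : El (W ⊗ V) →ₗ[k⟦X⟧] El (W ⊗ V) :=
      ∑ i ∈ s, (lin_tsum_left Lin.id fun w v => w ⊠ (F i v • e i)).mk'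
    have L_apply (s : Finset I) (z : El (W ⊗ V)) :
        L s z = ∑ i ∈ s, tsum z (fun w v => w ⊠ (F i v • e i)) := LinearMap.sum_apply _ _ _
    -- the elements which are described modulo `ħ` by finitely many of their slices `F i`; these
    -- contain the pure tensors
    let P : Submodule k⟦X⟧ (El (W ⊗ V)) :=
      { carrier := {z | ∃ s₀ : Finset I, ∀ s, s₀ ⊆ s → z - L s z ∈ fil (W ⊗ V) 1}
        zero_mem' := ⟨∅, fun s _ => by rw [map_zero, sub_zero]; exact zero_mem _⟩
        add_mem' := by
          classical
          rintro a b ⟨s, hs⟩ ⟨s', hs'⟩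
          refine ⟨s ∪ s', fun S hS => ?_⟩
          rw [map_add, add_sub_add_comm]
          exact add_mem (hs S (Finset.subset_union_left.trans hS))
            (hs' S (Finset.subset_union_right.trans hS))
        smul_mem' := by
          rintro c a ⟨s, hs⟩
          refine ⟨s, fun S hS => ?_⟩
          rw [map_smul, ← smul_sub]
          exact Submodule.smul_mem _ c (hs S hS) }
    have hP (w : El W) (v : El V) : w ⊠ v ∈ P := by
      obtain ⟨s₀, hs₀⟩ := hF v
      refine ⟨s₀, fun s hs => ?_⟩
      have e₁ : L s (w ⊠ v) = w ⊠ ∑ i ∈ s, F i v • e i := by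
        rw [L_apply]
        simp (disch := fun_prop) only [tsum_tm]
        exact (map_sum (lin_tm_right w Lin.id).mk' _ _).symm
      have e₂ : w ⊠ v - w ⊠ ∑ i ∈ s, F i v • e i = w ⊠ (v - ∑ i ∈ s, F i v • e i) :=
        (map_sub (lin_tm_right w Lin.id).mk' _ _).symm
      rw [e₁, e₂]
      exact fil_map (f := fun v => w ⊠ v) (by fun_prop) (hs₀ s hs)
    have h₁ : z ∈ fil (W ⊗ V) 1 := by
      obtain ⟨y, ⟨s, hs⟩, hy⟩ := exists_sub_mem_fil hP z 1
      have hLz : L s z ∈ fil (W ⊗ V) 1 := by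
        rw [L_apply]
        refine sum_mem fun i _ => ?_
        have e₁ : tsum z (fun w v => w ⊠ (F i v • e i)) = tsum z (fun w v => F i v • w) ⊠ e i := by
          rw [tsum_tm' _ (by fun_prop) (by fun_prop)]
          simp only [tm_smul, smul_tm]
        rw [e₁]
        exact fil_mono (by omega) (tm_mem_fil (n := 0) (h (F i)) (by simp))
      have e₁ : z = (z - y) + (y - L s y) - L s (z - y) + L s z := by
        rw [map_sub]
        abel
      rw [e₁]
      exact add_mem (sub_mem (add_mem hy (hs s subset_rfl))
        (fil_map ⟨map_add _, map_smul _⟩ hy)) hLz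
    obtain ⟨z', rfl⟩ := mem_fil.1 h₁
    rw [add_comm, pow_smul_mem_fil]
    refine ih fun G => ?_
    have := h G
    rwa [tsum_smul, add_comm, pow_smul_mem_fil] at this

end Functionals

end TopFree

end

end QuantumDouble

namespace QuantumDouble

noncomputable section

/-! ### Powers of primitive elements in the universal enveloping algebra -/

section Enveloping

attribute [local instance 100] LieRing.ofAssociativeRing

variable {k : Type u} [Field k] {b : Type u} [LieRing b] [LieAlgebra k b]

local notation "ιU" => UniversalEnvelopingAlgebra.ι k

/-- The universal enveloping algebra is generated by the Lie algebra. -/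
lemma enveloping_induction {P : UniversalEnvelopingAlgebra k b → Prop}
    (h_smul : ∀ (c : k), P (algebraMap k _ c)) (h_add : ∀ x y, P x → P y → P (x + y))
    (h_mul : ∀ x y, P x → P y → P (x * y)) (h_gen : ∀ x : b, P (ιU x)) (u) :
    P u := by
  let S : Subalgebra k (UniversalEnvelopingAlgebra k b) :=
    { carrier := {u | P u}
      mul_mem' := h_mul _ _
      add_mem' := h_add _ _
      algebraMap_mem' := h_smul }
  let f : b →ₗ⁅k⁆ S :=
    { toFun := fun x => ⟨ιU x, h_gen x⟩
      map_add' := fun x y => Subtype.ext (map_add _ _ _)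
      map_smul' := fun c x => Subtype.ext (map_smul _ _ _)
      map_lie' := fun {x y} => Subtype.ext (LieHom.map_lie (ιU) x y) }
  have h : S.val.comp (UniversalEnvelopingAlgebra.lift k f) = AlgHom.id k _ := by
    refine UniversalEnvelopingAlgebra.hom_ext _ (LieHom.ext fun x => ?_)
    change ((UniversalEnvelopingAlgebra.lift k f (ιU x) : S) :
      UniversalEnvelopingAlgebra k b) = ιU x
    rw [UniversalEnvelopingAlgebra.lift_ι_apply]
    rfl
  have h' := AlgHom.congr_fun h u
  change ((UniversalEnvelopingAlgebra.lift k f u : S) : UniversalEnvelopingAlgebra k b) = u at h'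
  rw [← h']
  exact (UniversalEnvelopingAlgebra.lift k f u).2

variable (k b) in
/-- The span of the powers `yⁱ`, where `y ∈ b` and `i ≤ m`. -/
def powSpan (m : ℕ) : Submodule k (UniversalEnvelopingAlgebra k b) :=
  Submodule.span k {u | ∃ i ≤ m, ∃ y : b, u = ιU y ^ i}

lemma pow_mem_powSpan {i m : ℕ} (h : i ≤ m) (y : b) : ιU y ^ i ∈ powSpan k b m :=
  Submodule.subset_span ⟨i, h, y, rfl⟩

lemma powSpan_mono {m n : ℕ} (h : m ≤ n) : powSpan k b m ≤ powSpan k b n :=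
  Submodule.span_mono fun _ ⟨i, hi, y, hy⟩ => ⟨i, hi.trans h, y, hy⟩

instance [FiniteDimensional k b] (m : ℕ) : FiniteDimensional k (powSpan k b m) := by
  let N : Submodule k (UniversalEnvelopingAlgebra k b) :=
    LinearMap.range (ιU : b →ₗ⁅k⁆ _).toLinearMap
  have hN : N.FG := Module.Finite.iff_fg.1 (inferInstanceAs (Module.Finite k (LinearMap.range _)))
  have h : powSpan k b m ≤ ⨆ i ∈ Finset.range (m + 1), N ^ i := by
    refine Submodule.span_le.2 ?_
    rintro _ ⟨i, hi, y, rfl⟩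
    have h₀ : ιU y ∈ N := ⟨y, rfl⟩
    have h₁ := Submodule.pow_mem_pow N h₀ i
    exact Submodule.mem_iSup_of_mem i
      (Submodule.mem_iSup_of_mem (Finset.mem_range.2 (Nat.lt_succ_of_le hi)) h₁)
  have hfg : (⨆ i ∈ Finset.range (m + 1), N ^ i).FG :=
    Submodule.fg_biSup _ _ fun i _ => hN.pow i
  have := Module.Finite.iff_fg.2 hfg
  exact Submodule.finiteDimensional_of_le h

/-- The coefficients of `(y + t x) ^ n`, as a polynomial in `t`. -/
def powCoeff {U : Type*} [Ring U] (x y : U) : ℕ → ℕ → U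
  | 0, 0 => 1
  | 0, _ + 1 => 0
  | n + 1, 0 => powCoeff x y n 0 * y
  | n + 1, i + 1 => powCoeff x y n (i + 1) * y + powCoeff x y n i * x

section powCoeff

variable {U : Type*} [Ring U] [Algebra k U] (x y : U)

lemma powCoeff_eq_zero {n i : ℕ} (h : n < i) : powCoeff x y n i = 0 := by
  induction n generalizing i with
  | zero =>
    obtain ⟨i, rfl⟩ := Nat.exists_eq_succ_of_ne_zero h.ne'
    rfl
  | succ n ih =>
    obtain ⟨i, rfl⟩ := Nat.exists_eq_succ_of_ne_zero (Nat.ne_zero_of_lt h)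
    rw [powCoeff, ih (by omega), ih (by omega), zero_mul, zero_mul, add_zero]

lemma powCoeff_zero (n : ℕ) : powCoeff x y n 0 = y ^ n := by
  induction n with
  | zero => rw [powCoeff, pow_zero]
  | succ n ih => rw [powCoeff, ih, pow_succ]

lemma powCoeff_one (n : ℕ) :
    powCoeff x y n 1 = ∑ l ∈ Finset.range n, y ^ l * x * y ^ (n - 1 - l) := by
  induction n with
  | zero => rw [powCoeff, Finset.sum_range_zero]
  | succ n ih =>
    rw [powCoeff, ih, powCoeff_zero, Finset.sum_range_succ, Finset.sum_mul]
    simp only [Nat.add_sub_cancel, Nat.sub_self, pow_zero, mul_one]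
    congr 1
    refine Finset.sum_congr rfl fun l hl => ?_
    have := Finset.mem_range.1 hl
    rw [mul_assoc _ _ y, ← pow_succ]
    congr 2
    omega

lemma add_smul_pow (n : ℕ) (t : k) :
    (y + t • x) ^ n = ∑ i ∈ Finset.range (n + 1), t ^ i • powCoeff x y n i := by
  induction n with
  | zero => simp [powCoeff]
  | succ n ih =>
    rw [pow_succ, ih, Finset.sum_range_succ' _ (n + 1), mul_add, Finset.sum_mul, Finset.sum_mul]
    have e : ∑ i ∈ Finset.range (n + 1), t ^ i • powCoeff x y n i * y =
        ∑ i ∈ Finset.range (n + 1), t ^ (i + 1) • (powCoeff x y n (i + 1) * y) +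
          powCoeff x y n 0 * y := by
      rw [Finset.sum_range_succ', Finset.sum_range_succ, powCoeff_eq_zero x y (Nat.lt_succ_self n)]
      simp
    rw [e]
    simp only [powCoeff, smul_add, Finset.sum_add_distrib, pow_zero, one_smul]
    rw [add_right_comm]
    congr 2
    refine Finset.sum_congr rfl fun i _ => ?_
    rw [smul_mul_assoc, mul_smul_comm, smul_smul, pow_succ]

end powCoeff

/-- If the values of a polynomial lie in a subspace, then so do its coefficients. -/
lemma mem_of_sum_pow_smul_mem [Infinite k] {M : Type*} [AddCommGroup M] [Module k M]
    {N : Submodule k M} {n : ℕ} {c : ℕ → M}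
    (h : ∀ t : k, ∑ i ∈ Finset.range n, t ^ i • c i ∈ N) {i : ℕ} (hi : i < n) : c i ∈ N := by
  rw [← Submodule.Quotient.mk_eq_zero, ← Module.forall_dual_apply_eq_zero_iff k]
  intro φ
  have hp : ∑ i ∈ Finset.range n, Polynomial.C (φ (N.mkQ (c i))) * Polynomial.X ^ i = 0 := by
    refine Polynomial.zero_of_eval_zero _ fun t => ?_
    rw [Polynomial.eval_finsetSum]
    have := congrArg φ ((Submodule.Quotient.mk_eq_zero N).2 (h t))
    change φ (N.mkQ _) = _ at this
    rw [map_sum, map_sum, map_zero] at this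
    rw [← this]
    refine Finset.sum_congr rfl fun i _ => ?_
    simp only [map_smul, Polynomial.eval_mul, Polynomial.eval_C, Polynomial.eval_pow,
      Polynomial.eval_X, smul_eq_mul]
    ring
  have := congrArg (fun p => Polynomial.coeff p i) hp
  simpa [Polynomial.finsetSum_coeff, Polynomial.coeff_C_mul, Polynomial.coeff_X_pow, hi] using this

variable [CharZero k]

/-- The element `yˡ x yʳ` is a combination of powers: up to terms of lower degree, it does not depend
on the position of `x`, and the sum over all positions is the linear coefficient of `(y + t x)ⁿ⁺¹`.
This uses that the characteristic is zero. -/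
lemma pow_mul_pow_mem_iSup_powSpan (n : ℕ) (x y : b) (l r : ℕ) (h : l + r = n) :
    ιU y ^ l * ιU x * ιU y ^ r ∈ ⨆ m, powSpan k b m := by
  induction n generalizing x l r with
  | zero =>
    obtain ⟨rfl, rfl⟩ := Nat.add_eq_zero_iff.1 h
    rw [pow_zero, one_mul, mul_one]
    have := pow_mem_powSpan (k := k) le_rfl x (m := 1)
    rw [pow_one] at this
    exact Submodule.mem_iSup_of_mem 1 this
  | succ n ih =>
    have hstep (l r : ℕ) (h : l + r = n) : ιU y ^ (l + 1) * ιU x * ιU y ^ r -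
        ιU y ^ l * ιU x * ιU y ^ (r + 1) ∈ ⨆ m, powSpan k b m := by
      have := ih ⁅y, x⁆ l r h
      rw [LieHom.map_lie, LieRing.of_associative_ring_bracket] at this
      convert this using 1
      rw [pow_succ, pow_succ']
      noncomm_ring
    have h₀ (l r : ℕ) (h : l + r = n + 1) : ιU y ^ l * ιU x * ιU y ^ r -
        ιU x * ιU y ^ (n + 1) ∈ ⨆ m, powSpan k b m := by
      induction l generalizing r with
      | zero =>
        obtain rfl : r = n + 1 := by omega
        simp
      | succ l ihl =>
        rw [← sub_add_sub_cancel _ (ιU y ^ l * ιU x * ιU y ^ (r + 1))]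
        exact add_mem (hstep l r (by omega)) (ihl (r + 1) (by omega))
    have h₁ : powCoeff (ιU x) (ιU y) (n + 2) 1 ∈ ⨆ m, powSpan k b m := by
      refine mem_of_sum_pow_smul_mem (n := n + 3) (fun t : k => ?_) (by omega)
      rw [← add_smul_pow, ← map_smul, ← map_add]
      exact Submodule.mem_iSup_of_mem _ (pow_mem_powSpan le_rfl _)
    have h₂ : ((n + 2 : ℕ) : k) • (ιU x * ιU y ^ (n + 1)) ∈ ⨆ m, powSpan k b m := by
      have : ∑ l ∈ Finset.range (n + 2), (ιU y ^ l * ιU x * ιU y ^ (n + 2 - 1 - l) -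
          ιU x * ιU y ^ (n + 1)) ∈ ⨆ m, powSpan k b m :=
        sum_mem fun l hl => h₀ _ _ (by have := Finset.mem_range.1 hl; omega)
      rw [Finset.sum_sub_distrib, ← powCoeff_one, Finset.sum_const, Finset.card_range] at this
      have := sub_mem h₁ this
      rwa [sub_sub_cancel, ← Nat.cast_smul_eq_nsmul k] at this
    have h₃ : ιU x * ιU y ^ (n + 1) ∈ ⨆ m, powSpan k b m :=
      (Submodule.smul_mem_iff _ (Nat.cast_ne_zero.2 (by omega))).1 h₂
    have := add_mem (h₀ l r h) h₃
    rwa [sub_add_cancel] at this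

/-- The universal enveloping algebra is spanned by the powers of the elements of `b`. -/
lemma exists_mem_powSpan (u : UniversalEnvelopingAlgebra k b) : ∃ m, u ∈ powSpan k b m := by
  suffices h : u ∈ ⨆ m, powSpan k b m from
    (Submodule.mem_iSup_of_directed _ (Monotone.directed_le fun _ _ h => powSpan_mono h)).1 h
  have h : ∀ v ∈ ⨆ m, powSpan k b m, u * v ∈ ⨆ m, powSpan k b m := by
    induction u using enveloping_induction with
    | h_smul c =>
      intro v hv
      rw [← Algebra.smul_def]
      exact Submodule.smul_mem _ c hv
    | h_add x y hx hy =>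
      intro v hv
      rw [add_mul]
      exact add_mem (hx v hv) (hy v hv)
    | h_mul x y hx hy =>
      intro v hv
      rw [mul_assoc]
      exact hx _ (hy v hv)
    | h_gen x =>
      intro v hv
      induction hv using Submodule.iSup_induction' with
      | mem i v hv =>
        induction hv using Submodule.span_induction with
        | mem _ h =>
          obtain ⟨i, -, y, rfl⟩ := h
          simpa using pow_mul_pow_mem_iSup_powSpan i x y 0 i (zero_add i)
        | zero => simp
        | add _ _ _ _ h₁ h₂ =>
          rw [mul_add]
          exact add_mem h₁ h₂
        | smul c _ _ h =>
          rw [mul_smul_comm]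
          exact Submodule.smul_mem _ c h
      | zero => simp
      | add _ _ _ _ h₁ h₂ =>
        rw [mul_add]
        exact add_mem h₁ h₂
  simpa using h 1 (Submodule.mem_iSup_of_mem 0 (by
    simpa using pow_mem_powSpan (k := k) le_rfl (0 : b) (m := 0)))

/-- If every power `yⁿ` is an eigenvector of `J`, with nonzero eigenvalue for `n > m`, then the
kernel of `J` is contained in the span of the powers of degree at most `m`. -/
lemma mem_powSpan_of_apply_eq_zero
    {J : UniversalEnvelopingAlgebra k b →ₗ[k] UniversalEnvelopingAlgebra k b} {c : ℕ → k}
    (hJ : ∀ (y : b) n, J (ιU y ^ n) = c n • ιU y ^ n) {m : ℕ} (hc : ∀ n, m < n → c n ≠ 0)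
    {u : UniversalEnvelopingAlgebra k b} (hu : J u = 0) : u ∈ powSpan k b m := by
  have hJm (n : ℕ) {v} (hv : v ∈ powSpan k b n) : J v ∈ powSpan k b n := by
    refine (Submodule.span_le (p := (powSpan k b n).comap J)).2 ?_ hv
    rintro _ ⟨i, hi, y, rfl⟩
    change J (ιU y ^ i) ∈ powSpan k b n
    rw [hJ]
    exact Submodule.smul_mem _ _ (pow_mem_powSpan hi y)
  -- `J` acts on the graded piece of degree `N` by the scalar `c N`
  have key (N : ℕ) {v} (hv : v ∈ powSpan k b N) : J v - c N • v ∈ powSpan k b (N - 1) := by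
    refine (Submodule.span_le (p := (powSpan k b (N - 1)).comap (J - c N • LinearMap.id))).2 ?_ hv
    rintro _ ⟨i, hi, y, rfl⟩
    change J (ιU y ^ i) - c N • ιU y ^ i ∈
      powSpan k b (N - 1)
    rw [hJ, ← sub_smul]
    rcases hi.eq_or_lt with rfl | hi
    · simp
    · exact Submodule.smul_mem _ _ (pow_mem_powSpan (by omega) y)
  obtain ⟨N, hN⟩ := exists_mem_powSpan u
  replace hu : J u ∈ powSpan k b m := by rw [hu]; exact zero_mem _
  induction N generalizing u with
  | zero => exact powSpan_mono (Nat.zero_le m) hN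
  | succ N ih =>
    rcases le_or_gt (N + 1) m with h | h
    · exact powSpan_mono h hN
    · have h₀ : J u - c (N + 1) • u ∈ powSpan k b N := key (N + 1) hN
      have h₁ := ih h₀ (by
        rw [map_sub, map_smul]
        exact sub_mem (hJm m hu) (Submodule.smul_mem _ _ hu))
      have h₂ := sub_mem hu h₁
      rw [sub_sub_cancel] at h₂
      exact (Submodule.smul_mem_iff _ (hc _ h)).1 h₂

end Enveloping

end

end QuantumDouble

namespace QuantumDouble

noncomputable section

namespace TopFree

open scoped PowerSeries

variable {k : Type u} [Field k]

local notation "ħ" => (PowerSeries.X : k⟦X⟧)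

variable {U V W T : TopFree k}

/-! ### Congruences modulo powers of `ħ` -/

lemma smod_map {f : El V → El W} (hf : Lin k⟦X⟧ f) {n : ℕ} {x y : El V}
    (h : x ≡ y [SMOD fil V n]) : f x ≡ f y [SMOD fil W n] := by
  rw [SModEq.sub_mem] at h ⊢
  have e : f (x - y) = f x - f y := map_sub hf.mk' x y
  rw [← e]
  exact fil_map hf h

lemma smod_of_eq {n : ℕ} {x y : El V} (h : x = y) : x ≡ y [SMOD fil V n] := h ▸ SModEq.rfl

@[fun_prop] lemma lin_sub {M N : Type*} [AddCommGroup M] [Module k⟦X⟧ M] [AddCommGroup N]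
    [Module k⟦X⟧ N] {f g : M → N} (hf : Lin k⟦X⟧ f) (hg : Lin k⟦X⟧ g) :
    Lin k⟦X⟧ (fun x => f x - g x) :=
  ⟨fun x y => by rw [hf.add, hg.add]; abel, fun c x => by rw [hf.smul, hg.smul, smul_sub]⟩

lemma smod_sum {I : Type*} {s : Finset I} {f g : I → El V} {n : ℕ}
    (h : ∀ i ∈ s, f i ≡ g i [SMOD fil V n]) : ∑ i ∈ s, f i ≡ ∑ i ∈ s, g i [SMOD fil V n] :=
  SModEq.sum h

lemma smod_tsum (t : El (V ⊗ W)) {F G : El V → El W → El T} {n : ℕ}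
    (h₁ : ∀ w, Lin k⟦X⟧ (fun v => F v w)) (h₂ : ∀ v, Lin k⟦X⟧ (fun w => F v w))
    (g₁ : ∀ w, Lin k⟦X⟧ (fun v => G v w)) (g₂ : ∀ v, Lin k⟦X⟧ (fun w => G v w))
    (h : ∀ v w, F v w ≡ G v w [SMOD fil T n]) : tsum t F ≡ tsum t G [SMOD fil T n] := by
  have e : tsum t F = tsum t (fun v w => F v w - G v w) + tsum t G := by
    refine tm_ext (f := fun t => tsum t F)
      (g := fun t => tsum t (fun v w => F v w - G v w) + tsum t G) (by fun_prop) (by fun_prop)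
      (fun v w => ?_) t
    rw [tsum_tm _ _ h₁ h₂, tsum_tm _ _ g₁ g₂, tsum_tm _ _ (fun w => lin_sub (h₁ w) (g₁ w))
      (fun v => lin_sub (h₂ v) (g₂ v)), sub_add_cancel]
  rw [SModEq.sub_mem, e, add_sub_cancel_right]
  exact tsum_mem_fil t (fun w => lin_sub (h₁ w) (g₁ w)) (fun v => lin_sub (h₂ v) (g₂ v))
    fun v w => SModEq.sub_mem.1 (h v w)

/-- A linear endomorphism which is the identity modulo `ħ` is bijective. -/
lemma bijective_of_smod_id {E : El V → El V} (hE : Lin k⟦X⟧ E)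
    (h : ∀ v, E v ≡ v [SMOD fil V 1]) : Function.Bijective E := by
  have hsub (x y : El V) : E (x - y) = E x - E y := map_sub hE.mk' x y
  have hn (n : ℕ) {v : El V} (hv : v ∈ fil V n) : E v - v ∈ fil V (n + 1) := by
    obtain ⟨z, rfl⟩ := mem_fil.1 hv
    rw [hE.smul, ← smul_sub, pow_smul_mem_fil]
    exact SModEq.sub_mem.1 (h z)
  constructor
  · refine fun x y hxy => sub_eq_zero.1 (eq_zero_of_mem_fil fun n => ?_)
    induction n with
    | zero => simp
    | succ n ih =>
      have := hn n ih
      rwa [hsub, hxy, sub_self, zero_sub, neg_mem_iff] at this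
  · intro w
    let f : ℕ → El V := fun n => Nat.rec 0 (fun _ v => v + (w - E v)) n
    have hf (n : ℕ) : f (n + 1) = f n + (w - E (f n)) := rfl
    have hfn (n : ℕ) : w - E (f n) ∈ fil V n := by
      induction n with
      | zero => simp
      | succ n ih =>
        have := hn n ih
        rw [hsub] at this
        rw [hf, hE.add, hsub, ← neg_mem_iff]
        convert this using 1
        abel
    obtain ⟨l, hl⟩ := exists_lim f fun n => by
      rw [hf, add_sub_cancel_left]
      exact hfn n
    refine ⟨l, (eq_of_sub_mem_fil fun n => ?_).symm⟩
    have := sub_mem (hfn n) (fil_map hE (hl n))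
    rwa [hsub, sub_sub_sub_cancel_right] at this

lemma IsReduction.eq_iff {Q : Type*} [AddCommGroup Q] [Module k Q]
    {p : El V →ₛₗ[PowerSeries.constantCoeff (R := k)] Q} (hp : IsReduction p) {x y : El V} :
    p x = p y ↔ x ≡ y [SMOD fil V 1] := by
  rw [SModEq.sub_mem, ← hp.eq_zero_iff, map_sub, sub_eq_zero]

lemma IsReduction.exists_desc {Q : Type*} [AddCommGroup Q] [Module k Q]
    {p : El V →ₛₗ[PowerSeries.constantCoeff (R := k)] Q} (hp : IsReduction p) {f : El V → El V}
    (hf : Lin k⟦X⟧ f) : ∃ J : Q →ₗ[k] Q, ∀ a, J (p a) = p (f a) := by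
  let σ := Function.surjInv hp.surjective
  have hσ (q : Q) : p (σ q) = q := Function.surjInv_eq hp.surjective q
  have h {x y : El V} (hxy : p x = p y) : p (f x) = p (f y) :=
    hp.eq_iff.2 (smod_map hf (hp.eq_iff.1 hxy))
  refine ⟨{ toFun := fun q => p (f (σ q)), map_add' := fun x y => ?_, map_smul' := fun c x => ?_ },
    fun a => h (hσ _)⟩
  · rw [← map_add, ← hf.add]
    exact h (by rw [hσ, map_add, hσ, hσ])
  · have e : p (f (PowerSeries.C c • σ x)) = c • p (f (σ x)) := by
      rw [hf.smul, map_smulₛₗ, PowerSeries.constantCoeff_C]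
    rw [RingHom.id_apply, ← e]
    exact h (by rw [hσ, map_smulₛₗ, PowerSeries.constantCoeff_C, hσ])

/-! ### Quantised enveloping algebras modulo `ħ` -/

section QUE

variable {B : TopFree k} [HopfObj B]

lemma smod_mul {x x' y y' : El B} {n : ℕ} (hx : x ≡ x' [SMOD fil B n])
    (hy : y ≡ y' [SMOD fil B n]) : x * y ≡ x' * y' [SMOD fil B n] :=
  (smod_map (f := fun x => x * y) (by fun_prop) hx).trans
    (smod_map (f := fun y => x' * y) (by fun_prop) hy)

/-- The element `b - ε(b)`. -/
def red (b : El B) : El B := b - eps b • 1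

@[fun_prop] lemma lin_red {M : Type*} [AddCommGroup M] [Module k⟦X⟧ M] {f : M → El B}
    (hf : Lin k⟦X⟧ f) : Lin k⟦X⟧ (fun x => red (f x)) :=
  lin_sub hf ((lin_eps hf).smul_left 1)

lemma ap_reduced (b : El B) : ap (reduced B) b = red b := by
  have : ap (reduced B) b = b - ap (ε[B] ≫ η[B]) b := rfl
  rw [this, ap_comp, ap_eta]
  rfl

/-- The map `(id - η ∘ ε)^{⊗ n} ∘ Δ⁽ⁿ⁾`. -/
def del (B : TopFree k) [HopfObj B] (n : ℕ) : B ⟶ tpow B n := iterComul B n ≫ tpowMap (reduced B) n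

lemma mem_prime {b : B} : b ∈ prime B ↔ ∀ n, ap (del B n) b ∈ fil (tpow B n) n :=
  forall_congr' fun _ => mem_fil.symm

lemma ap_del_zero (b : El B) : ap (del B 0) b = eps b • (one : El (𝟙_ (TopFree k))) :=
  ap_counit b

lemma ap_del_succ (n : ℕ) (b : El B) : ap (del B (n + 1)) b =
    tsum (cop b) (fun x y => ap (del B n) x ⊠ red y) := by
  refine (show _ = ap ((Δ[B] ≫ iterComul B n ▷ B) ≫ (tpowMap (reduced B) n ⊗ₘ reduced B)) b
    from rfl).trans ?_
  simp (disch := fun_prop) only [ap_comp, ap_comul, ap_whiskerRight, ap_tensorHom, tsum_tsum,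
    tsum_tm, ap_reduced]
  simp only [del, ap_comp]

/-- The map `b ↦ (b₁ - ε(b₁)) ⋯ (bₙ - ε(bₙ))`. -/
def mulRed : ℕ → El B → El B
  | 0, b => eps b • 1
  | n + 1, b => tsum (cop b) (fun x y => mulRed n x * red y)

@[fun_prop] lemma lin_mulRed (n : ℕ) {M : Type*} [AddCommGroup M] [Module k⟦X⟧ M] {f : M → El B}
    (hf : Lin k⟦X⟧ f) : Lin k⟦X⟧ (fun x => mulRed n (f x)) := by
  have : Lin k⟦X⟧ (fun x : El B => mulRed n x) := by
    induction n with
    | zero =>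
      simp only [mulRed]
      fun_prop
    | succ n ih =>
      simp only [mulRed]
      fun_prop
  exact this.comp hf

/-- The map `mulRed n` is the composite of `del B n` with the iterated product. -/
lemma exists_ap_del_eq_mulRed (n : ℕ) :
    ∃ L : tpow B n ⟶ B, ∀ b, ap L (ap (del B n) b) = mulRed n b := by
  induction n with
  | zero =>
    refine ⟨η[B], fun b => ?_⟩
    rw [ap_del_zero]
    refine (ap_eta (D := B) _).trans ?_
    rw [scal_smul', scal_one, mul_one]
    rfl
  | succ n ih =>
    obtain ⟨L, hL⟩ := ih
    refine ⟨L ▷ B ≫ μ[B], fun b => ?_⟩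
    rw [ap_del_succ]
    refine (show _ = ap (L ▷ B ≫ μ[B]) _ from rfl).trans ?_
    simp (disch := fun_prop) only [ap_comp, ap_whiskerRight, tsum_tsum, tsum_tm, hL, ap_mu]
    rfl

/-- The number of surjections from a set with `n` elements to a set with `j` elements. -/
def surjCount : ℕ → ℕ → ℕ
  | 0, n => if n = 0 then 1 else 0
  | j + 1, n => ∑ i ∈ Finset.HasAntidiagonal.antidiagonal n,
    if i.2 = 0 then 0 else n.choose i.1 * surjCount j i.1

lemma surjCount_pos {j n : ℕ} (h : j < n) : 0 < surjCount (j + 1) n := by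
  induction j generalizing n with
  | zero =>
    rw [surjCount]
    refine Finset.sum_pos' (fun _ _ => Nat.zero_le _) ⟨(0, n), by simp, ?_⟩
    simp [h.ne', surjCount]
  | succ j ih =>
    rw [surjCount]
    refine Finset.sum_pos' (fun _ _ => Nat.zero_le _) ⟨(j + 1, n - (j + 1)), ?_, ?_⟩
    · simp only [Finset.HasAntidiagonal.mem_antidiagonal]
      omega
    · rw [if_neg (by change ¬ n - (j + 1) = 0; omega)]
      exact Nat.mul_pos (Nat.choose_pos h.le) (ih (Nat.lt_succ_self j))

variable {b : Type u} [LieRing b] [LieAlgebra k b]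

/-- The reduction modulo `ħ` of a quantisation of the universal enveloping algebra `Ub`. -/
structure IsQuantisation
    (p : El B →ₛₗ[PowerSeries.constantCoeff (R := k)] UniversalEnvelopingAlgebra k b) : Prop
    extends IsReduction p where
  map_one : p 1 = 1
  map_mul : ∀ x y, p (x * y) = p x * p y
  prim : ∀ a x, p a = UniversalEnvelopingAlgebra.ι k x →
    cop a ≡ a ⊠ 1 + 1 ⊠ a [SMOD fil (B ⊗ B) 1]

lemma IsQUE.exists_isQuantisation (h : B.IsQUE b) :
    ∃ p : El B →ₛₗ[PowerSeries.constantCoeff (R := k)] UniversalEnvelopingAlgebra k b,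
      IsQuantisation p := by
  obtain ⟨p, h₁, h₂, h₃, h₄, h₅⟩ := h
  refine ⟨p, ⟨h₁, fun v => ?_⟩, h₃, h₄, fun a x hx => ?_⟩
  · simp only [mem_fil, pow_one]
    exact h₂ v
  · obtain ⟨z, hz⟩ := h₅ a x hx
    rw [SModEq.sub_mem, mem_fil]
    exact ⟨z, sub_eq_of_eq_add' hz⟩

namespace IsQuantisation

variable {p : El B →ₛₗ[PowerSeries.constantCoeff (R := k)] UniversalEnvelopingAlgebra k b}
  (hp : IsQuantisation p)
include hp

/-- Modulo `ħ`, the algebra `B` is generated by lifts of elements of `b`. -/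
lemma induction {P : El B → Prop} (h_fil : ∀ x ∈ fil B 1, P x) (h_one : P 1)
    (h_smul : ∀ (c : k⟦X⟧) x, P x → P (c • x)) (h_add : ∀ x y, P x → P y → P (x + y))
    (h_mul : ∀ x y, P x → P y → P (x * y))
    (h_gen : ∀ a x, p a = UniversalEnvelopingAlgebra.ι k x → P a) (a : El B) : P a := by
  have h : ∀ u, ∃ a, p a = u ∧ P a := by
    refine enveloping_induction (fun c => ?_) ?_ ?_ fun x => ?_
    · refine ⟨PowerSeries.C c • 1, ?_, h_smul _ _ h_one⟩
      rw [map_smulₛₗ, hp.map_one, PowerSeries.constantCoeff_C, Algebra.algebraMap_eq_smul_one]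
    · rintro _ _ ⟨a, rfl, ha⟩ ⟨a', rfl, ha'⟩
      exact ⟨a + a', map_add _ _ _, h_add _ _ ha ha'⟩
    · rintro _ _ ⟨a, rfl, ha⟩ ⟨a', rfl, ha'⟩
      exact ⟨a * a', hp.map_mul _ _, h_mul _ _ ha ha'⟩
    · obtain ⟨a, ha⟩ := hp.surjective (UniversalEnvelopingAlgebra.ι k x)
      exact ⟨a, ha, h_gen a x ha⟩
  obtain ⟨a', ha, ha'⟩ := h (p a)
  rw [← sub_add_cancel a a']
  exact h_add _ _ (h_fil _ (SModEq.sub_mem.1 (hp.eq_iff.1 ha.symm))) ha'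

section Primitive

variable {a : El B} {x : b} (ha : p a = UniversalEnvelopingAlgebra.ι k x)
include ha

lemma tsum_cop_smod {F : El B → El B → El T} (h₁ : ∀ w, Lin k⟦X⟧ (fun v => F v w))
    (h₂ : ∀ v, Lin k⟦X⟧ (fun w => F v w)) : tsum (cop a) F ≡ F a 1 + F 1 a [SMOD fil T 1] := by
  have := smod_map (f := fun t => tsum t F) (by fun_prop) (hp.prim a x ha)
  simp only [(lin_tsum_left Lin.id F).add] at this
  rwa [tsum_tm _ _ h₁ h₂, tsum_tm _ _ h₁ h₂] at this

lemma eps_smul_mem_fil (v : El T) : eps a • v ∈ fil T 1 := by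
  have h := hp.tsum_cop_smod ha (F := fun x y => eps x • y) (by fun_prop) (by fun_prop)
  rw [eps_cop_left a Lin.id, eps_one, one_smul, SModEq.sub_mem, ← neg_mem_iff, neg_sub,
    add_sub_cancel_right] at h
  have h' := fil_map (f := fun z => eps z • v) (by fun_prop) h
  simpa using h'

lemma anti_smod : anti a ≡ -a [SMOD fil B 1] := by
  have h := hp.tsum_cop_smod ha (F := fun x y => anti x * y) (by fun_prop) (by fun_prop)
  rw [anti_mul_cop a Lin.id, anti_one, mul_one, one_mul] at h
  have h' := sub_mem (hp.eps_smul_mem_fil ha (1 : El B)) (SModEq.sub_mem.1 h)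
  rw [SModEq.sub_mem]
  convert h' using 1
  abel

lemma tsum_cop_pow_smod (n : ℕ) {F : El B → El B → El T} (h₁ : ∀ w, Lin k⟦X⟧ (fun v => F v w))
    (h₂ : ∀ v, Lin k⟦X⟧ (fun w => F v w)) : tsum (cop (a ^ n)) F ≡
      ∑ i ∈ Finset.HasAntidiagonal.antidiagonal n, n.choose i.1 • F (a ^ i.1) (a ^ i.2)
        [SMOD fil T 1] := by
  induction n generalizing F with
  | zero =>
    simp only [pow_zero]
    rw [tsum_cop_one h₁ h₂]
    simp
  | succ n ih =>
    rw [pow_succ', tsum_cop_mul _ _ h₁ h₂]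
    refine (hp.tsum_cop_smod ha (F := fun x₁ x₂ => tsum (cop (a ^ n))
      fun y₁ y₂ => F (x₁ * y₁) (x₂ * y₂))
      (by fun_prop) (by fun_prop)).trans ?_
    have e := Finset.sum_antidiagonal_choose_succ_nsmul (fun i j => F (a ^ i) (a ^ j)) n
    refine (SModEq.add ?_ ?_).trans (smod_of_eq (e.trans (add_comm _ _)).symm)
    · refine (ih (F := fun y₁ y₂ => F (a * y₁) (1 * y₂)) (by fun_prop) (by fun_prop)).trans ?_
      refine smod_of_eq (Finset.sum_congr rfl fun i hi => ?_)
      rw [one_mul, ← pow_succ',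
        Nat.choose_symm_of_eq_add (Finset.HasAntidiagonal.mem_antidiagonal.1 hi).symm]
    · refine (ih (F := fun y₁ y₂ => F (1 * y₁) (a * y₂)) (by fun_prop) (by fun_prop)).trans ?_
      refine smod_of_eq (Finset.sum_congr rfl fun i hi => ?_)
      rw [one_mul, ← pow_succ']

lemma red_pow_smod (n : ℕ) : red (a ^ n) ≡ if n = 0 then 0 else a ^ n [SMOD fil B 1] := by
  cases n with
  | zero => simp [red]
  | succ n =>
    rw [if_neg n.succ_ne_zero, SModEq.sub_mem, red, sub_sub_cancel_left, neg_mem_iff, pow_succ',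
      eps_mul, mul_smul]
    exact hp.eps_smul_mem_fil ha _

/-- Modulo `ħ`, the powers of a primitive element are eigenvectors of `mulRed j`. -/
lemma mulRed_pow_smod (j n : ℕ) : mulRed j (a ^ n) ≡ surjCount j n • a ^ n [SMOD fil B 1] := by
  induction j generalizing n with
  | zero =>
    cases n with
    | zero => simp [mulRed, surjCount]
    | succ n =>
      have : mulRed 0 (a ^ (n + 1)) ∈ fil B 1 := by
        rw [mulRed, pow_succ', eps_mul, mul_smul]
        exact hp.eps_smul_mem_fil ha _
      simpa [surjCount, SModEq.sub_mem] using this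
  | succ j ih =>
    rw [mulRed]
    refine (hp.tsum_cop_pow_smod ha n (by fun_prop) (by fun_prop)).trans ?_
    rw [surjCount, Finset.sum_smul]
    refine smod_sum fun i hi => ?_
    have h := smod_map (f := fun z : El B => (n.choose i.1 : k⟦X⟧) • z) (by fun_prop)
      (smod_mul (ih i.1) (hp.red_pow_smod ha i.2))
    simp only [Nat.cast_smul_eq_nsmul] at h
    refine h.trans (smod_of_eq ?_)
    split_ifs with h0
    · simp only [zero_smul]
      have : (surjCount j i.1 • a ^ i.1) * (0 : El B) = 0 := (lin_mul_right _ Lin.id).map_zero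
      rw [this, smul_zero]
    · rw [← Finset.HasAntidiagonal.mem_antidiagonal.1 hi, pow_add, mul_smul]
      congr 1
      rw [← Nat.cast_smul_eq_nsmul k⟦X⟧, smul_mul', Nat.cast_smul_eq_nsmul]

end Primitive

lemma anti_anti_smod (a : El B) : anti (anti a) ≡ a [SMOD fil B 1] := by
  induction a using hp.induction with
  | h_fil x hx =>
    rw [SModEq.sub_mem]
    exact sub_mem (fil_map (f := fun x => anti (anti x)) (by fun_prop) hx) hx
  | h_one => simp
  | h_smul c x hx =>
    simp only [anti_smul]
    exact hx.smul c
  | h_add x y hx hy =>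
    rw [(lin_anti (lin_anti Lin.id)).add]
    exact hx.add hy
  | h_mul x y hx hy =>
    simp only [anti_mul]
    exact smod_mul hx hy
  | h_gen a x ha =>
    refine (smod_map (f := fun x => anti x) (by fun_prop) (hp.anti_smod ha)).trans ?_
    have h := smod_map (f := fun x : El B => (-1 : k⟦X⟧) • x) (by fun_prop) (hp.anti_smod ha)
    simp only [neg_smul, one_smul, neg_neg] at h
    refine SModEq.trans (smod_of_eq ?_) h
    exact map_neg (lin_anti Lin.id).mk' a

/-- The antipode of a quantised enveloping algebra is invertible. -/
theorem isIso_antipode : IsIso 𝒮[B] := by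
  have h := bijective_of_smod_id (E := fun a : El B => anti (anti a)) (by fun_prop)
    hp.anti_anti_smod
  exact isIso_antipode_of_bijective ⟨fun x y hxy => h.1 (congrArg anti hxy),
    fun y => (h.2 y).imp' (fun x => anti x) fun _ hx => hx⟩

/-- A quantised enveloping algebra is cocommutative modulo `ħ`. -/
lemma cop_smod_swap (a : El B) : cop a ≡ tsum (cop a) (fun x y => y ⊠ x) [SMOD fil (B ⊗ B) 1] := by
  induction a using hp.induction with
  | h_fil x hx =>
    rw [SModEq.sub_mem]
    exact sub_mem (fil_map (f := fun x => cop x) (by fun_prop) hx)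
      (fil_map (f := fun a => tsum (cop a) (fun x y => y ⊠ x)) (by fun_prop) hx)
  | h_one => rw [tsum_cop_one (by fun_prop) (by fun_prop), cop_one]
  | h_smul c x hx =>
    simp only [cop_smul, tsum_smul]
    exact hx.smul c
  | h_add x y hx hy =>
    rw [(lin_cop Lin.id).add, (lin_tsum_left Lin.id _).add]
    exact hx.add hy
  | h_mul x y hx hy =>
    rw [tsum_cop_mul _ _ (by fun_prop) (by fun_prop), cop_mul]
    have h₁ := smod_map (f := fun t => tsum t (fun x₁ x₂ => tsum (cop y) (fun y₁ y₂ =>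
      (x₁ * y₁) ⊠ (x₂ * y₂)))) (by fun_prop) hx
    refine h₁.trans ?_
    rw [tsum_tsum _ (by fun_prop) (by fun_prop)]
    simp (disch := fun_prop) only [tsum_tm]
    refine smod_tsum _ (by fun_prop) (by fun_prop) (by fun_prop) (by fun_prop) fun x₁ x₂ => ?_
    have h₂ := smod_map (f := fun t => tsum t (fun y₁ y₂ => (x₂ * y₁) ⊠ (x₁ * y₂))) (by fun_prop) hy
    rw [tsum_tsum _ (by fun_prop) (by fun_prop)] at h₂
    simp (disch := fun_prop) only [tsum_tm] at h₂
    exact h₂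
  | h_gen a x ha =>
    refine (hp.prim a x ha).trans ?_
    rw [add_comm]
    exact (hp.tsum_cop_smod ha (F := fun x y => y ⊠ x) (by fun_prop) (by fun_prop)).symm

/-- If `ħᵐ a` is in `B'`, then `a` modulo `ħ` is a combination of powers of degree at most `m`: it is
annihilated by the reduction of `mulRed (m + 1)`, whose eigenvalues on the powers of degree `n > m`
are the nonzero numbers `surjCount (m + 1) n`. -/
lemma mem_powSpan [CharZero k] {m : ℕ} {a : El B} (h : ħ ^ m • a ∈ prime B) :
    p a ∈ powSpan k b m := by
  have h₁ := mem_prime.1 h (m + 1)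
  rw [ap_smul, pow_smul_mem_fil] at h₁
  obtain ⟨L, hL⟩ := exists_ap_del_eq_mulRed (B := B) (m + 1)
  have h₂ := fil_map (f := fun z => ap L z) (by fun_prop) h₁
  rw [hL] at h₂
  obtain ⟨J, hJ⟩ := hp.exists_desc (f := fun a => mulRed (m + 1) a) (by fun_prop)
  refine mem_powSpan_of_apply_eq_zero (J := J)
    (c := fun n => (surjCount (m + 1) n : k)) (fun y n => ?_)
    (fun n hn => Nat.cast_ne_zero.2 (surjCount_pos hn).ne') ?_
  · obtain ⟨a, ha⟩ := hp.surjective (UniversalEnvelopingAlgebra.ι k y)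
    have hpow : p (a ^ n) = UniversalEnvelopingAlgebra.ι k y ^ n := by
      induction n with
      | zero => simpa using hp.map_one
      | succ n ih => rw [pow_succ, hp.map_mul, ih, ha, pow_succ]
    rw [← hpow, hJ, hp.eq_iff.2 (hp.mulRed_pow_smod ha (m + 1) n), map_nsmul,
      Nat.cast_smul_eq_nsmul]
  · rw [hJ]
    exact (hp.eq_zero_iff _).2 h₂

end IsQuantisation

end QUE

end TopFree

end

end QuantumDouble

namespace QuantumDouble

noncomputable section

namespace TopFree

open scoped PowerSeries

variable {k : Type u} [Field k]

local notation "ħ" => (PowerSeries.X : k⟦X⟧)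

/-! ### Topological bases of `B'` -/

section AdaptedSet

variable {Q : Type*} [AddCommGroup Q] [Module k Q]

/-- A basis of the union of a chain of subspaces which is adapted to the chain. -/
lemma exists_adapted_set {W : ℕ → Submodule k Q} (hW : Monotone W) : ∃ S : ℕ → Set Q,
    Monotone S ∧ (∀ m, S m ⊆ W m) ∧ (∀ m, W m ≤ Submodule.span k (S m)) ∧
      LinearIndepOn k id (⋃ m, S m) := by
  let T (m : ℕ) :=
    {s : Set Q // s ⊆ W m ∧ (W m : Set Q) ⊆ Submodule.span k s ∧ LinearIndepOn k id s}
  have h (m : ℕ) (s : Set Q) (hs : s ⊆ W m) (hs' : LinearIndepOn k id s) :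
      ∃ t : T m, s ⊆ t.1 := by
    obtain ⟨t, ht, hst, hWt, hi⟩ := exists_linearIndepOn_id_extension hs' hs
    exact ⟨⟨t, ht, hWt, hi⟩, hst⟩
  choose g hg using h
  let S (m : ℕ) : T m := Nat.rec (g 0 ∅ (Set.empty_subset _) (linearIndepOn_empty k id))
    (fun m t => g (m + 1) t.1 (t.2.1.trans (hW (Nat.le_succ m))) t.2.2.2) m
  have hS : Monotone fun m => (S m).1 := monotone_nat_of_le_succ fun m => hg _ _ _ _
  exact ⟨fun m => (S m).1, hS, fun m => (S m).2.1, fun m => (S m).2.2.1,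
    linearIndepOn_iUnion_of_directed hS.directed_le fun m => (S m).2.2.2⟩

end AdaptedSet

variable {B : TopFree k} [HopfObj B]

lemma smul_mem_prime (c : k⟦X⟧) {x : El B} (hx : x ∈ prime B) : c • x ∈ prime B :=
  (prime B).smul_mem c hx

lemma prime_closed {x : El B} (h : ∀ n, ∃ y ∈ prime B, x - y ∈ fil B n) : x ∈ prime B := by
  refine mem_prime.2 fun n => ?_
  obtain ⟨y, hy, hxy⟩ := h n
  have e : ap (del B n) x - ap (del B n) y = ap (del B n) (x - y) :=
    (map_sub (lin_ap (del B n) Lin.id).mk' x y).symm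
  have := add_mem (fil_map (f := fun x => ap (del B n) x) (by fun_prop) hxy) (mem_prime.1 hy n)
  rwa [← e, sub_add_cancel] at this

/-- The value at `x ∈ B'` of a continuous functional. -/
def fn (f : El (contDual B)) (x : prime B) : k⟦X⟧ := toFunctional f x

@[fun_prop] lemma lin_fn {M : Type*} [AddCommGroup M] [Module k⟦X⟧ M] {f : M → El (contDual B)}
    (hf : Lin k⟦X⟧ f) (x : prime B) : Lin k⟦X⟧ (fun m => fn (f m) x) :=
  ⟨fun a b => by rw [hf.add]; rfl, fun c a => by rw [hf.smul]; rfl⟩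

lemma fn_cont (f : El (contDual B)) (n : ℕ) :
    ∃ m, ∀ x : prime B, (x : El B) ∈ fil B m → ħ ^ n ∣ fn f x := by
  obtain ⟨m, hm⟩ := f.2 n
  exact ⟨m, fun x hx => hm x (mem_fil.1 hx)⟩

lemma mem_fil_contDual {f : El (contDual B)} {n : ℕ} (h : ∀ x, ħ ^ n ∣ fn f x) :
    f ∈ fil (contDual B) n :=
  mem_fil.2 (exists_eq_pow_smul n f h)

variable (B) in
/-- A topological basis `e` of `B'` and its dual basis `f`. Up to the power `wt i` of `ħ`, the
functional `f i` on `B'` is the restriction of a linear functional `F i` on `B`. Only the topology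
induced from `B` matters: `null` says that `e i` converges to zero in `B`, and `expand` that
`x = ∑ fᵢ(x) eᵢ` in `B`, uniformly in `x ∈ B'`. -/
structure Frame where
  I : Type u
  e : I → prime B
  f : I → El (contDual B)
  wt : I → ℕ
  F : I → (El B →ₗ[k⟦X⟧] k⟦X⟧)
  F_eq : ∀ i (x : prime B), F i (x : El B) = ħ ^ wt i * fn (f i) x
  null : ∀ n, ∃ s : Finset I, ∀ i ∉ s, (e i : El B) ∈ fil B n
  expand : ∀ n, ∃ s₀ : Finset I, ∀ s, s₀ ⊆ s → ∀ x : prime B,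
    (x : El B) - ∑ i ∈ s, fn (f i) x • (e i : El B) ∈ fil B n

/-- If the reductions modulo `ħ` of the `b ∈ B` with `ħᵐ b ∈ B'` span a finite-dimensional space,
for all `m`, then an adapted basis of the union of these spaces gives a topological basis of
`B'`. -/
lemma exists_frame {Q : Type u} [AddCommGroup Q] [Module k Q]
    {p : El B →ₛₗ[PowerSeries.constantCoeff (R := k)] Q} (hp : IsReduction p)
    (hfin : ∀ m, ∃ N : Submodule k Q, FiniteDimensional k N ∧
      ∀ x : El B, ħ ^ m • x ∈ prime B → p x ∈ N) : Nonempty (Frame B) := by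
  classical
  -- `W m` consists of the reductions of the `x ∈ B` with `ħᵐ x ∈ B'`
  let W (m : ℕ) : Submodule k Q :=
    { carrier := {q | ∃ x, p x = q ∧ ħ ^ m • x ∈ prime B}
      zero_mem' := ⟨0, map_zero p, by rw [smul_zero]; exact zero_mem _⟩
      add_mem' := by
        rintro _ _ ⟨x, rfl, hx⟩ ⟨y, rfl, hy⟩
        exact ⟨x + y, map_add _ _ _, by rw [smul_add]; exact add_mem hx hy⟩
      smul_mem' := by
        rintro c _ ⟨x, rfl, hx⟩
        refine ⟨PowerSeries.C c • x, ?_, ?_⟩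
        · rw [map_smulₛₗ, PowerSeries.constantCoeff_C]
        · rw [smul_comm]
          exact smul_mem_prime _ hx }
  have hWfin (m : ℕ) : FiniteDimensional k (W m) := by
    obtain ⟨N, hN, h⟩ := hfin m
    refine Submodule.finiteDimensional_of_le (S₂ := N) ?_
    rintro _ ⟨x, rfl, hx⟩
    exact h x hx
  have hW : Monotone W := monotone_nat_of_le_succ fun m => by
    rintro _ ⟨x, rfl, hx⟩
    refine ⟨x, rfl, ?_⟩
    rw [pow_succ', mul_smul]
    exact smul_mem_prime _ hx
  obtain ⟨S, hS, hSW, hWS, hSi⟩ := exists_adapted_set hW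
  have hSfin (m : ℕ) : (S m).Finite := by
    have hi : LinearIndepOn k id (S m) := hSi.mono (Set.subset_iUnion S m)
    have hi' : LinearIndependent k (fun x : S m => (⟨x.1, hSW m x.2⟩ : W m)) :=
      LinearIndependent.of_comp (W m).subtype hi
    have := hi'.finite
    exact Set.toFinite _
  let u := Module.Basis.extend hSi
  have hext := hSi.subset_extend (Set.subset_univ (⋃ m, S m))
  let I := ↥(⋃ m, S m)
  have hI (i : I) : ∃ m, i.1 ∈ S m := Set.mem_iUnion.1 i.2
  -- the smallest exponent for which `i ∈ W m`
  let wt (i : I) : ℕ := Nat.find (hI i)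
  have hwt (i : I) : i.1 ∈ S (wt i) := Nat.find_spec (hI i)
  have wt_le {i : I} {m : ℕ} : wt i ≤ m ↔ i.1 ∈ S m :=
    ⟨fun h => hS h (hwt i), fun h => Nat.find_min' (hI i) h⟩
  let j (i : I) : ↥(hSi.extend (Set.subset_univ (⋃ m, S m))) := ⟨i.1, hext i.2⟩
  have j_inj : Function.Injective j := fun a b h => Subtype.ext (congrArg (fun x => x.1) h)
  have hu (i) : u i = i.1 := Module.Basis.extend_apply_self hSi i
  have hβ' (i) : ∃ x, p x = u i ∧ ∀ i', j i' = i → ħ ^ wt i' • x ∈ prime B := by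
    by_cases h : ∃ i', j i' = i
    · obtain ⟨i', rfl⟩ := h
      obtain ⟨x, hx, hx'⟩ := hSW _ (hwt i')
      exact ⟨x, by rw [hx, hu], fun i'' h => by rwa [j_inj h]⟩
    · obtain ⟨x, hx⟩ := hp.surjective (u i)
      exact ⟨x, hx, fun i' h' => (h ⟨i', h'⟩).elim⟩
  -- a lift of the basis `u` to `B`, chosen so that `ħ ^ wt i • β i ∈ B'`
  choose β hβ hβP using hβ'
  obtain ⟨F, hF, hF₁, hF₀⟩ := hp.exists_coord u β hβ
  let e (i : I) : prime B := ⟨ħ ^ wt i • β (j i), hβP _ i rfl⟩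
  have he (i : I) : (e i : El B) = ħ ^ wt i • β (j i) := rfl
  have hFe (i i' : I) : F (j i) (e i' : El B) = if i = i' then ħ ^ wt i else 0 := by
    rw [he, map_smul, smul_eq_mul]
    split_ifs with h
    · rw [h, hF₁, mul_one]
    · rw [hF₀ _ _ (j_inj.ne h), mul_zero]
  -- approximation of the elements of `B'` by combinations of the `e i`
  have happ (n : ℕ) (x : El B) (hx : x ∈ prime B) :
      ∃ y ∈ Submodule.span k⟦X⟧ (Set.range fun i => (e i : El B)), x - y ∈ fil B n := by
    induction n with
    | zero => exact ⟨0, zero_mem _, by simp⟩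
    | succ n ih =>
      obtain ⟨y, hy, hxy⟩ := ih
      obtain ⟨z, hz⟩ := mem_fil.1 hxy
      have hyP : y ∈ prime B := by
        refine (Submodule.span_le (p := prime B)).2 ?_ hy
        rintro _ ⟨i, rfl⟩
        exact (e i).2
      have hzW : p z ∈ Submodule.span k (S n) :=
        hWS n ⟨z, rfl, by rw [← hz]; exact sub_mem hx hyP⟩
      have key : ∀ q ∈ Submodule.span k (S n), ∃ w,
          p w = q ∧ ħ ^ n • w ∈ Submodule.span k⟦X⟧ (Set.range fun i => (e i : El B)) := by
        intro q hq
        induction hq using Submodule.span_induction with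
        | mem q hq =>
          let i : I := ⟨q, Set.mem_iUnion.2 ⟨n, hq⟩⟩
          obtain ⟨c, hc⟩ := Nat.exists_eq_add_of_le (wt_le.2 hq : wt i ≤ n)
          refine ⟨β (j i), by rw [hβ, hu], ?_⟩
          rw [hc, add_comm, pow_add, mul_smul]
          exact Submodule.smul_mem _ _ (Submodule.subset_span ⟨i, rfl⟩)
        | zero => exact ⟨0, map_zero p, by rw [smul_zero]; exact zero_mem _⟩
        | add _ _ _ _ h₁ h₂ =>
          obtain ⟨w, rfl, hw⟩ := h₁
          obtain ⟨w', rfl, hw'⟩ := h₂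
          exact ⟨w + w', map_add _ _ _, by rw [smul_add]; exact add_mem hw hw'⟩
        | smul c _ _ h =>
          obtain ⟨w, rfl, hw⟩ := h
          refine ⟨PowerSeries.C c • w, ?_, ?_⟩
          · rw [map_smulₛₗ, PowerSeries.constantCoeff_C]
          · rw [smul_comm]
            exact Submodule.smul_mem _ _ hw
      obtain ⟨w, hw, hw'⟩ := key _ hzW
      refine ⟨y + ħ ^ n • w, add_mem hy hw', ?_⟩
      rw [← sub_sub, hz, ← smul_sub, pow_smul_mem_fil]
      exact SModEq.sub_mem.1 (hp.eq_iff.1 hw.symm)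
  -- hence the coordinates on `B'` are divisible by the powers of `ħ` which occur in `e i`
  have hdvd (i : I) (x : prime B) : ħ ^ wt i ∣ F (j i) (x : El B) := by
    obtain ⟨y, hy, hxy⟩ := happ (wt i) x x.2
    obtain ⟨z, hz⟩ := mem_fil.1 hxy
    have h₁ : F (j i) (x : El B) = F (j i) y + ħ ^ wt i * F (j i) z := by
      rw [← smul_eq_mul, ← map_smul, ← hz, ← map_add, add_sub_cancel]
    rw [h₁]
    refine dvd_add ?_ (dvd_mul_right _ _)
    clear hxy hz h₁
    induction hy using Submodule.span_induction with
    | mem _ h =>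
      obtain ⟨i', rfl⟩ := h
      rw [hFe]
      split_ifs <;> simp
    | zero => simp
    | add _ _ _ _ h₁ h₂ => rw [map_add]; exact dvd_add h₁ h₂
    | smul c _ _ h => rw [map_smul]; exact Dvd.dvd.mul_left h c
  choose g hg using hdvd
  have hX (n : ℕ) : ħ ^ n ≠ 0 := pow_ne_zero _ PowerSeries.X_ne_zero
  let f (i : I) : El (contDual B) :=
    ⟨{ toFun := g i
       map_add' := fun x y => mul_left_cancel₀ (hX (wt i)) (by
        rw [← hg, mul_add, ← hg, ← hg]; exact map_add (F (j i)) _ _)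
       map_smul' := fun c x => mul_left_cancel₀ (hX (wt i)) (by
        rw [← hg, RingHom.id_apply, smul_eq_mul, mul_left_comm, ← hg]
        exact map_smul (F (j i)) _ _) }, fun n => ⟨wt i + n, fun x ⟨y, hy⟩ => by
        refine ⟨F (j i) y, mul_left_cancel₀ (hX (wt i)) ?_⟩
        refine (hg i x).symm.trans ?_
        rw [← mul_assoc, ← pow_add]
        exact (congrArg (F (j i)) hy).trans (map_smul (F (j i)) _ _)⟩⟩
  have hf (i : I) (x : prime B) : F (j i) (x : El B) = ħ ^ wt i * fn (f i) x := hg i x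
  have hfe (i : I) (x : prime B) : fn (f i) x • (e i : El B) = F (j i) (x : El B) • β (j i) := by
    rw [hf, he, smul_smul, mul_comm]
  let s₀ (n : ℕ) : Finset I :=
    ((hSfin n).preimage (f := fun i : I => i.1) Subtype.val_injective.injOn).toFinset
  have hnull (n : ℕ) (i : I) (hi : i ∉ s₀ n) : (e i : El B) ∈ fil B n := by
    rw [Set.Finite.mem_toFinset, Set.mem_preimage, ← wt_le, not_le] at hi
    exact fil_mono hi.le (smul_mem_fil _ _)
  refine ⟨⟨I, e, f, wt, fun i => F (j i), hf, fun n => ⟨s₀ n, hnull n⟩, fun n => ⟨s₀ n, ?_⟩⟩⟩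
  · intro s hs x
    obtain ⟨y, hy, hxy⟩ := happ n x x.2
    let E : El B →ₗ[k⟦X⟧] El B := ∑ i ∈ s, (F (j i)).smulRight (β (j i))
    have hE (z : El B) : E z = ∑ i ∈ s, F (j i) z • β (j i) := LinearMap.sum_apply _ _ _
    simp only [hfe]
    rw [← hE]
    have h₁ : y - E y ∈ fil B n := by
      clear hxy
      induction hy using Submodule.span_induction with
      | mem _ h =>
        obtain ⟨i, rfl⟩ := h
        rw [hE]
        have h₂ : ∑ i' ∈ s, F (j i') (e i : El B) • β (j i') =
            if i ∈ s then (e i : El B) else 0 := by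
          rw [← Finset.sum_ite_eq s i (fun i' => (e i' : El B))]
          refine Finset.sum_congr rfl fun i' _ => ?_
          rw [hFe, he, ite_smul, zero_smul]
          simp only [eq_comm]
        rw [h₂]
        split_ifs with h
        · simp
        · rw [sub_zero]
          exact hnull n i fun h' => h (hs h')
      | zero => simp
      | add a b _ _ ha hb =>
        rw [map_add, add_sub_add_comm]
        exact add_mem ha hb
      | smul c a _ ha =>
        rw [map_smul, ← smul_sub]
        exact Submodule.smul_mem _ _ ha
    have h₂ : (x : El B) - E x = ((x : El B) - y) - E ((x : El B) - y) + (y - E y) := by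
      rw [map_sub]
      abel
    rw [h₂]
    exact add_mem (sub_mem hxy (fil_map ⟨map_add _, map_smul _⟩ hxy)) h₁

variable [CharZero k] {b : Type u} [LieRing b] [LieAlgebra k b] [FiniteDimensional k b]

lemma IsQUE.nonempty_frame (h : B.IsQUE b) : Nonempty (Frame B) := by
  obtain ⟨p, hp⟩ := h.exists_isQuantisation
  exact exists_frame hp.toIsReduction fun m =>
    ⟨powSpan k b m, inferInstance, fun x hx => hp.mem_powSpan hx⟩

end TopFree

end

end QuantumDouble

namespace QuantumDouble

noncomputable section

namespace TopFree

open scoped PowerSeries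

variable {k : Type u} [Field k]

local notation "ħ" => (PowerSeries.X : k⟦X⟧)

variable {U V W T : TopFree k}

/-! ### Slices -/

/-- The map `id ⊗ G : W ⊗ V → W`, for a linear functional `G` on `V`. -/
def slice (G : El V →ₗ[k⟦X⟧] k⟦X⟧) (x : El (W ⊗ V)) : El W := tsum x fun w v => G v • w

@[fun_prop] lemma lin_slice (G : El V →ₗ[k⟦X⟧] k⟦X⟧) {M : Type*} [AddCommGroup M] [Module k⟦X⟧ M]
    {x : M → El (W ⊗ V)} (hx : Lin k⟦X⟧ x) : Lin k⟦X⟧ (fun m => slice G (x m)) :=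
  lin_tsum_left hx _

@[simp] lemma slice_tm (G : El V →ₗ[k⟦X⟧] k⟦X⟧) (w : El W) (v : El V) :
    slice G (w ⊠ v) = G v • w := tsum_tm _ _ (by fun_prop) (by fun_prop)

lemma slice_smul (G : El V →ₗ[k⟦X⟧] k⟦X⟧) (c : k⟦X⟧) (x : El (W ⊗ V)) :
    slice G (c • x) = c • slice G x := (lin_slice G Lin.id).smul c x

lemma slice_add (G : El V →ₗ[k⟦X⟧] k⟦X⟧) (x y : El (W ⊗ V)) :
    slice G (x + y) = slice G x + slice G y := (lin_slice G Lin.id).add x y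

lemma slice_sub (G : El V →ₗ[k⟦X⟧] k⟦X⟧) (x y : El (W ⊗ V)) :
    slice G (x - y) = slice G x - slice G y := map_sub (lin_slice G Lin.id).mk' x y

lemma slice_tsum (G : El V →ₗ[k⟦X⟧] k⟦X⟧) {X Y : TopFree k} (t : El (X ⊗ Y))
    {F : El X → El Y → El (W ⊗ V)} (h₁ : ∀ y, Lin k⟦X⟧ (fun x => F x y))
    (h₂ : ∀ x, Lin k⟦X⟧ (fun y => F x y)) :
    slice G (tsum t F) = tsum t fun x y => slice G (F x y) :=
  map_tsum (lin_slice G Lin.id) t h₁ h₂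

lemma slice_map_left (G : El V →ₗ[k⟦X⟧] k⟦X⟧) {f : El U → El W} (hf : Lin k⟦X⟧ f) (x : El (U ⊗ V)) :
    slice G (tsum x fun u v => f u ⊠ v) = f (slice G x) := by
  rw [slice_tsum _ _ (by fun_prop) (by fun_prop), slice, map_tsum hf _ (by fun_prop) (by fun_prop)]
  simp only [slice_tm, hf.smul]

lemma slice_map_right (G : El V →ₗ[k⟦X⟧] k⟦X⟧) {f : El U → El V} (hf : Lin k⟦X⟧ f)
    (x : El (W ⊗ U)) :
    slice G (tsum x fun w u => w ⊠ f u) = slice (G ∘ₗ hf.mk') x := by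
  rw [slice_tsum _ _ (by fun_prop) (by fun_prop), slice]
  simp only [slice_tm]
  rfl

lemma slice_ext {x y : El (W ⊗ V)} (h : ∀ G : El V →ₗ[k⟦X⟧] k⟦X⟧, slice G x = slice G y) : x = y :=
  eq_of_sub_mem_fil fun n => mem_fil_of_slices fun G => by
    have : slice G (x - y) = 0 := by rw [slice_sub, h, sub_self]
    rw [show (tsum (x - y) fun w v => G v • w) = 0 from this]
    exact zero_mem _

lemma functional_ext {v w : El V} (h : ∀ G : El V →ₗ[k⟦X⟧] k⟦X⟧, G v = G w) : v = w :=
  eq_of_sub_mem_fil fun n => mem_fil_of_functionals fun G => by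
    rw [map_sub, h, sub_self]
    exact dvd_zero _

/-! ### The completed tensor product `B' ⊗ V` and its contraction with functionals on `B'` -/

section InPrime

variable {B : TopFree k} [HopfObj B]

/-- The slices of `x ∈ B ⊗ V` are in `B'`, or equivalently, `x ∈ B' ⊗ V`. -/
def InPrime (x : El (B ⊗ V)) : Prop := ∀ G : El V →ₗ[k⟦X⟧] k⟦X⟧, slice G x ∈ prime B

lemma InPrime.tm {b : El B} (hb : b ∈ prime B) (v : El V) : InPrime (b ⊠ v) := fun G => by
  rw [slice_tm]
  exact smul_mem_prime _ hb

lemma InPrime.map_right {f : El U → El V} (hf : Lin k⟦X⟧ f) {x : El (B ⊗ U)} (hx : InPrime x) :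
    InPrime (tsum x fun b u => b ⊠ f u) := fun G => by
  rw [slice_map_right _ hf]
  exact hx _

lemma inPrime_closed {x : El (B ⊗ V)} (h : ∀ n, ∃ y, InPrime y ∧ x - y ∈ fil (B ⊗ V) n) :
    InPrime x := fun G => prime_closed fun n => by
  obtain ⟨y, hy, hxy⟩ := h n
  refine ⟨slice G y, hy G, ?_⟩
  rw [← slice_sub]
  exact fil_map (f := fun x => slice G x) (by fun_prop) hxy

lemma inPrime_iff_del {x : El (B ⊗ V)} :
    InPrime x ↔ ∀ n, tsum x (fun b v => ap (del B n) b ⊠ v) ∈ fil (tpow B n ⊗ V) n := by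
  have e (G : El V →ₗ[k⟦X⟧] k⟦X⟧) (n : ℕ) : slice G (tsum x fun b v => ap (del B n) b ⊠ v) =
      ap (del B n) (slice G x) := slice_map_left G (f := fun b => ap (del B n) b) (by fun_prop) x
  refine ⟨fun h n => mem_fil_of_slices fun G => ?_, fun h G => mem_prime.2 fun n => ?_⟩
  · have := mem_prime.1 (h G) n
    rw [← e] at this
    exact this
  · rw [← e]
    exact fil_map (f := fun x => slice G x) (by fun_prop) (h n)

lemma incl_tmul (b : prime B) (v : El V) :
    incl V (TensorProduct.tmul k⟦X⟧ b v) = (b : El B) ⊠ v := TensorProduct.lift.tmul _ _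

lemma inPrime_incl (t : TensorProduct k⟦X⟧ (prime B) V) : InPrime (incl V t : El (B ⊗ V)) := by
  intro G
  induction t using TensorProduct.induction_on with
  | zero =>
    rw [map_zero]
    have : slice G (0 : El (B ⊗ V)) = 0 := (lin_slice G Lin.id).map_zero
    exact this ▸ zero_mem _
  | tmul b v =>
    rw [incl_tmul]
    exact InPrime.tm b.2 v G
  | add t t' h h' =>
    rw [map_add]
    have := slice_add G (incl V t : El (B ⊗ V)) (incl V t')
    exact this ▸ add_mem h h'

lemma congMod_iff {n : ℕ} {v w : El V} : CongMod n v w ↔ v - w ∈ fil V n :=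
  ⟨fun ⟨z, hz⟩ => mem_fil.2 ⟨z, sub_eq_of_eq_add' hz⟩, fun h => by
    obtain ⟨z, hz⟩ := mem_fil.1 h
    exact ⟨z, eq_add_of_sub_eq' hz⟩⟩

lemma MemPrime.inPrime {x : El (B ⊗ V)} (h : MemPrime x) : InPrime x := inPrime_closed fun n => by
  obtain ⟨t, ht⟩ := h n
  exact ⟨_, inPrime_incl t, congMod_iff.1 ht⟩

/-- The element `v` is the contraction `(f ⊗ id)(x)` of `x ∈ B' ⊗ V`. -/
def Sl (f : El (contDual B)) (x : El (B ⊗ V)) (v : El V) : Prop :=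
  ∀ G : El V →ₗ[k⟦X⟧] k⟦X⟧, ∃ h : slice G x ∈ prime B, G v = fn f ⟨slice G x, h⟩

section Sl

variable {f g : El (contDual B)} {x y : El (B ⊗ V)} {v w : El V}

lemma Sl.inPrime (h : Sl f x v) : InPrime x := fun G => (h G).1

lemma Sl.unique (h : Sl f x v) (h' : Sl f x w) : v = w := functional_ext fun G => by
  obtain ⟨_, h₁⟩ := h G
  obtain ⟨_, h₂⟩ := h' G
  rw [h₁, h₂]

lemma Sl.add (h : Sl f x v) (h' : Sl f y w) : Sl f (x + y) (v + w) := fun G => by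
  obtain ⟨hx, h₁⟩ := h G
  obtain ⟨hy, h₂⟩ := h' G
  have e := slice_add G x y
  refine ⟨e ▸ add_mem hx hy, ?_⟩
  rw [map_add, h₁, h₂]
  refine (map_add (toFunctional f) _ _).symm.trans (congrArg (toFunctional f) (Subtype.ext e.symm))

lemma Sl.smul (c : k⟦X⟧) (h : Sl f x v) : Sl f (c • x) (c • v) := fun G => by
  obtain ⟨hx, h₁⟩ := h G
  have e := slice_smul G c x
  refine ⟨e ▸ smul_mem_prime _ hx, ?_⟩
  rw [map_smul, h₁]
  refine (map_smul (toFunctional f) _ _).symm.trans (congrArg (toFunctional f) (Subtype.ext e.symm))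

lemma Sl.add_left (h : Sl f x v) (h' : Sl g x w) : Sl (f + g) x (v + w) := fun G => by
  obtain ⟨hx, h₁⟩ := h G
  obtain ⟨_, h₂⟩ := h' G
  refine ⟨hx, ?_⟩
  rw [map_add, h₁, h₂]
  rfl

lemma Sl.smul_left (c : k⟦X⟧) (h : Sl f x v) : Sl (c • f) x (c • v) := fun G => by
  obtain ⟨hx, h₁⟩ := h G
  refine ⟨hx, ?_⟩
  rw [map_smul, h₁]
  rfl

lemma Sl.map_right {φ : El V → El W} (hφ : Lin k⟦X⟧ φ) (h : Sl f x v) :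
    Sl f (tsum x fun b v => b ⊠ φ v) (φ v) := fun G => by
  obtain ⟨hx, h₁⟩ := h (G ∘ₗ hφ.mk')
  have e := slice_map_right G hφ x
  refine ⟨e ▸ hx, h₁.trans ?_⟩
  exact congrArg (toFunctional f) (Subtype.ext e.symm)

end Sl

end InPrime

/-! ### The canonical element -/

section Canonical

variable {B : TopFree k} [HopfObj B]

namespace Frame

variable (D : Frame B)

/-- The approximations of the elements of `B'` in terms of its topological basis. -/
lemma fn_expand (f : El (contDual B)) (n : ℕ) : ∃ s₀ : Finset D.I, ∀ s, s₀ ⊆ s → ∀ x : prime B,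
    ħ ^ n ∣ fn f x - ∑ i ∈ s, fn (D.f i) x * fn f (D.e i) := by
  obtain ⟨m, hm⟩ := fn_cont f n
  obtain ⟨s₀, hs₀⟩ := D.expand m
  refine ⟨s₀, fun s hs x => ?_⟩
  have := hm (x - ∑ i ∈ s, fn (D.f i) x • D.e i) (by
    have h := hs₀ s hs x
    convert h using 1
    rw [Submodule.coe_sub, Submodule.coe_sum]
    rfl)
  convert this using 1
  refine Eq.trans ?_ ((map_sub (toFunctional f) _ _).trans
    (congrArg _ (map_sum (toFunctional f) _ _))).symm
  congr 1
  refine Finset.sum_congr rfl fun i _ => ?_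
  exact (map_smul (toFunctional f) _ _).symm

include D in
lemma prime_ext {x y : prime B} (h : ∀ f, fn f x = fn f y) : x = y := by
  refine Subtype.ext (eq_of_sub_mem_fil (V := B) fun n => ?_)
  obtain ⟨s₀, hs₀⟩ := D.expand n
  have := sub_mem (hs₀ s₀ subset_rfl x) (hs₀ s₀ subset_rfl y)
  simp only [h] at this
  rwa [sub_sub_sub_cancel_right] at this

/-- The terms of the expansion of an element of `B' ⊗ V`. The map `F i ⊗ id` is defined on `B ⊗ V`,
and its value at `x` is divisible by `ħ ^ wt i`. -/
lemma exists_coeff {x : El (B ⊗ V)} (hx : InPrime x) (i : D.I) : ∃ v, Sl (D.f i) x v := by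
  have h (G : El V →ₗ[k⟦X⟧] k⟦X⟧) : G (tsum x fun b v => D.F i b • v) =
      ħ ^ D.wt i * fn (D.f i) ⟨slice G x, hx G⟩ := by
    rw [← D.F_eq]
    have := tm_ext (f := fun x : El (B ⊗ V) =>
        G (tsum x fun b v => D.F i b • v) • (one : El (𝟙_ (TopFree k))))
      (g := fun x => D.F i (slice G x) • one) (by fun_prop) (by fun_prop) (fun b v => by
        rw [tsum_tm _ _ (by fun_prop) (by fun_prop), slice_tm, map_smul, map_smul, smul_eq_mul,
          smul_eq_mul, mul_comm]) x
    simpa using congrArg scal this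
  obtain ⟨v, hv⟩ := mem_fil.1 (mem_fil_of_functionals fun G => ⟨_, h G⟩)
  refine ⟨v, fun G => ⟨hx G, mul_left_cancel₀ (pow_ne_zero (D.wt i) PowerSeries.X_ne_zero) ?_⟩⟩
  rw [← h, hv, map_smul, smul_eq_mul]

lemma sub_sum_mem_fil {x : El (B ⊗ V)} (hx : InPrime x) {v : D.I → El V}
    (hv : ∀ i, Sl (D.f i) x (v i)) (n : ℕ) :
    ∃ s₀ : Finset D.I, ∀ s, s₀ ⊆ s → x - ∑ i ∈ s, (D.e i : El B) ⊠ v i ∈ fil (B ⊗ V) n := by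
  obtain ⟨s₀, hs₀⟩ := D.expand n
  refine ⟨s₀, fun s hs => mem_fil_of_slices fun G => ?_⟩
  change slice G _ ∈ _
  have e : slice G (∑ i ∈ s, (D.e i : El B) ⊠ v i) =
      ∑ i ∈ s, fn (D.f i) ⟨slice G x, hx G⟩ • (D.e i : El B) := by
    refine (map_sum (lin_slice G Lin.id).mk' _ _).trans (Finset.sum_congr rfl fun i _ => ?_)
    obtain ⟨_, h⟩ := hv i G
    rw [← h]
    exact slice_tm G _ _
  rw [slice_sub, e]
  exact hs₀ s hs ⟨slice G x, hx G⟩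

lemma null_fn (f : El (contDual B)) (n : ℕ) : ∃ s : Finset D.I, ∀ i ∉ s, ħ ^ n ∣ fn f (D.e i) := by
  obtain ⟨m, hm⟩ := fn_cont f n
  obtain ⟨s, hs⟩ := D.null m
  exact ⟨s, fun i hi => hm _ (hs i hi)⟩

lemma exists_hsum {t : D.I → El V} (h : ∀ n, ∃ s : Finset D.I, ∀ i ∉ s, t i ∈ fil V n) :
    ∃ l, HSum t l := by
  refine Null.exists_hsum fun n => ?_
  obtain ⟨s, hs⟩ := h n
  refine s.finite_toSet.subset fun i hi => ?_
  by_contra h'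
  exact hi (hs i h')

include D in
/-- The contraction `(f ⊗ id)(x)` is the sum of the terms `f(eᵢ) vᵢ`, where `x = ∑ eᵢ ⊗ vᵢ`. -/
lemma exists_sl (f : El (contDual B)) {x : El (B ⊗ V)} (hx : InPrime x) : ∃ v, Sl f x v := by
  classical
  choose v hv using D.exists_coeff hx
  obtain ⟨l, hl⟩ := D.exists_hsum (t := fun i => fn f (D.e i) • v i) fun n => by
    obtain ⟨s, hs⟩ := D.null_fn f n
    refine ⟨s, fun i hi => ?_⟩
    obtain ⟨c, hc⟩ := hs i hi
    rw [hc, mul_smul]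
    exact smul_mem_fil _ _
  refine ⟨l, fun G => ⟨hx G, ?_⟩⟩
  refine sub_eq_zero.1 (PowerSeries.ext fun n => ?_)
  rw [map_zero]
  refine PowerSeries.X_pow_dvd_iff.1 ?_ n (Nat.lt_succ_self n)
  obtain ⟨s, hs⟩ := hl (n + 1)
  obtain ⟨s', hs'⟩ := D.fn_expand f (n + 1)
  obtain ⟨z, hz⟩ := mem_fil.1 (hs (s ∪ s') Finset.subset_union_left)
  have h₁ : ħ ^ (n + 1) ∣ G l - ∑ i ∈ s ∪ s', fn (D.f i) ⟨slice G x, hx G⟩ * fn f (D.e i) := by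
    refine ⟨G z, ?_⟩
    rw [← smul_eq_mul, ← map_smul, ← hz, map_sub, map_sum]
    congr 1
    refine Finset.sum_congr rfl fun i _ => ?_
    obtain ⟨_, h⟩ := hv i G
    rw [map_smul, h, smul_eq_mul, mul_comm]
  have h₂ := hs' (s ∪ s') Finset.subset_union_right ⟨slice G x, hx G⟩
  have := dvd_sub h₁ h₂
  rwa [sub_sub_sub_cancel_right] at this

lemma exists_approx (f : El (contDual B)) {x : El (B ⊗ V)} {v : El V} (h : Sl f x v) (n : ℕ) :
    ∃ (s : Finset D.I) (w : D.I → El V), (∀ i, Sl (D.f i) x (w i)) ∧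
      x - ∑ i ∈ s, (D.e i : El B) ⊠ w i ∈ fil (B ⊗ V) n ∧
      v - ∑ i ∈ s, fn f (D.e i) • w i ∈ fil V n := by
  classical
  choose w hw using D.exists_coeff h.inPrime
  obtain ⟨s, hs⟩ := D.sub_sum_mem_fil h.inPrime hw n
  obtain ⟨s', hs'⟩ := D.fn_expand f n
  refine ⟨s ∪ s', w, hw, hs _ Finset.subset_union_left, mem_fil_of_functionals fun G => ?_⟩
  obtain ⟨hx, hv⟩ := h G
  have := hs' (s ∪ s') Finset.subset_union_right ⟨slice G x, hx⟩
  rw [map_sub, map_sum, hv]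
  convert this using 3 with i hi
  obtain ⟨_, h⟩ := hw i G
  rw [map_smul, h, smul_eq_mul, mul_comm]

include D in
lemma isSlice {f : El (contDual B)} {x : El (B ⊗ V)} {v : El V} (h : Sl f x v) :
    IsSlice f x v := fun n => by
  obtain ⟨s, w, -, h₁, h₂⟩ := D.exists_approx f h n
  refine ⟨∑ i ∈ s, TensorProduct.tmul k⟦X⟧ (D.e i) (w i), congMod_iff.2 ?_, congMod_iff.2 ?_⟩
  · rw [map_sum]
    exact h₁
  · rw [map_sum]
    exact h₂

include D in
lemma memPrime {x : El (B ⊗ V)} (h : InPrime x) : MemPrime x := fun n => by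
  obtain ⟨v, hv⟩ := D.exists_sl 0 h
  obtain ⟨t, ht, -⟩ := D.isSlice hv n
  exact ⟨t, ht⟩

include D in
/-- The contractions of a linear family of elements of `B' ⊗ V` with functionals on `B'`. -/
lemma exists_contraction {x : El W → El (B ⊗ V)} (hx : Lin k⟦X⟧ x) (h : ∀ w, InPrime (x w)) :
    ∃ φ : contDual B ⊗ W ⟶ V, ∀ f w, Sl f (x w) (ap φ (f ⊠ w)) := by
  choose φ hφ using fun f w => D.exists_sl f (h w)
  have h₁ (w : El W) : Lin k⟦X⟧ (fun f => φ f w) :=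
    ⟨fun f g => (hφ (f + g) w).unique ((hφ f w).add_left (hφ g w)),
      fun c f => (hφ (c • f) w).unique ((hφ f w).smul_left c)⟩
  have h₂ (f : El (contDual B)) : Lin k⟦X⟧ (fun w => φ f w) :=
    ⟨fun w w' => (hφ f (w + w')).unique (by rw [hx.add]; exact (hφ f w).add (hφ f w')),
      fun c w => (hφ f (c • w)).unique (by rw [hx.smul]; exact (hφ f w).smul c)⟩
  refine ⟨mor (fun t => tsum t φ) (by fun_prop), fun f w => ?_⟩
  rw [ap_mor, tsum_tm _ _ h₁ h₂]
  exact hφ f w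

include D in
lemma exists_contraction_one {x : El (B ⊗ V)} (h : InPrime x) :
    ∃ φ : contDual B ⟶ V, ∀ f, Sl f x (ap φ f) := by
  choose φ hφ using fun f => D.exists_sl f h
  have h₁ : Lin k⟦X⟧ (fun f => φ f) :=
    ⟨fun f g => (hφ (f + g)).unique ((hφ f).add_left (hφ g)),
      fun c f => (hφ (c • f)).unique ((hφ f).smul_left c)⟩
  exact ⟨mor φ h₁, fun f => by rw [ap_mor]; exact hφ f⟩

end Frame

/-- The functional `f ↦ f(x)` on the continuous dual of `B'`. -/
def evalFn (x : prime B) : El (contDual B) →ₗ[k⟦X⟧] k⟦X⟧ := (lin_fn Lin.id x).mk'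

/-- `R` is the canonical element of `B' ⊗ B^∨`. -/
structure IsCanon (R : 𝟙_ (TopFree k) ⟶ B ⊗ contDual B) : Prop where
  sl : ∀ f, Sl f (ap R one) f
  sum : ∀ x : prime B, tsum (ap R one) (fun y g => fn g x • y) = (x : El B)

lemma Frame.exists_isCanon (D : Frame B) : ∃ R : 𝟙_ (TopFree k) ⟶ B ⊗ contDual B, IsCanon R := by
  classical
  obtain ⟨r, hr⟩ := D.exists_hsum (t := fun i => (D.e i : El B) ⊠ D.f i) fun n => by
    obtain ⟨s, hs⟩ := D.null n
    exact ⟨s, fun i hi => fil_map (f := fun x => x ⊠ D.f i) (by fun_prop) (hs i hi)⟩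
  have hR (G : El (contDual B) →ₗ[k⟦X⟧] k⟦X⟧) :
      HSum (fun i => G (D.f i) • (D.e i : El B)) (slice G r) := by
    have := hr.map (lin_slice G Lin.id)
    simpa only [slice_tm] using this
  have hP : InPrime r := fun G => prime_closed fun n => by
    obtain ⟨s, hs⟩ := hR G n
    exact ⟨_, sum_mem fun i _ => smul_mem_prime _ (D.e i).2, hs s subset_rfl⟩
  have hsl (f : El (contDual B)) : Sl f r f := fun G => ⟨hP G, by
    refine sub_eq_zero.1 (PowerSeries.ext fun n => ?_)
    rw [map_zero]
    refine PowerSeries.X_pow_dvd_iff.1 ?_ n (Nat.lt_succ_self n)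
    obtain ⟨s, hs⟩ := D.fn_expand f (n + 1)
    obtain ⟨m, hm⟩ := fn_cont f (n + 1)
    obtain ⟨s', hs'⟩ := hR G m
    have e₀ : f - ∑ i ∈ s ∪ s', fn f (D.e i) • D.f i ∈ fil (contDual B) (n + 1) := by
      refine mem_fil_contDual fun x => ?_
      have e := (map_sub (evalFn x) f (∑ i ∈ s ∪ s', fn f (D.e i) • D.f i)).trans
        (congrArg _ (map_sum (evalFn x) _ _))
      simp only [map_smul] at e
      have h := hs (s ∪ s') Finset.subset_union_left x
      rw [show fn (f - ∑ i ∈ s ∪ s', fn f (D.e i) • D.f i) x = _ from e]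
      simp only [smul_eq_mul, mul_comm (fn f _)]
      exact h
    have h₁ : ħ ^ (n + 1) ∣ G f - ∑ i ∈ s ∪ s', fn f (D.e i) * G (D.f i) := by
      obtain ⟨z, hz⟩ := mem_fil.1 e₀
      refine ⟨G z, ?_⟩
      rw [← smul_eq_mul, ← map_smul, ← hz, map_sub, map_sum]
      simp only [map_smul, smul_eq_mul]
    have h₂ : ħ ^ (n + 1) ∣ fn f ⟨slice G r, hP G⟩ - ∑ i ∈ s ∪ s', fn f (D.e i) * G (D.f i) := by
      have := hm (⟨slice G r, hP G⟩ - ∑ i ∈ s ∪ s', G (D.f i) • D.e i) (by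
        have h := hs' (s ∪ s') Finset.subset_union_right
        rw [Submodule.coe_sub, Submodule.coe_sum]
        exact h)
      convert this using 1
      refine Eq.trans ?_ ((map_sub (toFunctional f) _ _).trans
        (congrArg _ (map_sum (toFunctional f) _ _))).symm
      congr 1
      refine Finset.sum_congr rfl fun i _ => ?_
      rw [mul_comm]
      exact (map_smul (toFunctional f) _ _).symm
    have := dvd_sub h₁ h₂
    rwa [sub_sub_sub_cancel_right] at this⟩
  let R : 𝟙_ (TopFree k) ⟶ B ⊗ contDual B := mor (fun c => scal c • r) (by fun_prop)
  have hRr : ap R one = r := by rw [ap_mor, scal_one, one_smul]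
  refine ⟨R, fun f => hRr.symm ▸ hsl f, fun x => ?_⟩
  rw [hRr]
  have : (⟨slice (evalFn x) r, hP _⟩ : prime B) = x := D.prime_ext fun f => by
    obtain ⟨_, h⟩ := hsl f (evalFn x)
    exact h.symm
  exact congrArg Subtype.val this

namespace IsCanon

variable {R : 𝟙_ (TopFree k) ⟶ B ⊗ contDual B} (h : IsCanon R)
include h

lemma inPrime : InPrime (ap R one) := (h.sl 0).inPrime

lemma tsum_eq_of_sl {x : El (B ⊗ V)} (hx : InPrime x) {φ : El (contDual B) → El V}
    (hφ : Lin k⟦X⟧ φ) (hs : ∀ f, Sl f x (φ f)) : tsum (ap R one) (fun y g => y ⊠ φ g) = x := by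
  refine slice_ext fun G => ?_
  rw [slice_map_right _ hφ]
  refine Eq.trans ?_ (h.sum ⟨slice G x, hx G⟩)
  rw [slice]
  congr 1
  funext y g
  obtain ⟨_, e⟩ := hs g G
  exact congrArg (· • y) e

lemma tsum_sum {F : El B → El V} (hF : Lin k⟦X⟧ F) (x : prime B) :
    tsum (ap R one) (fun y g => fn g x • F y) = F x := by
  conv_rhs => rw [← h.sum x, map_tsum hF _ (by fun_prop) (by fun_prop)]
  simp only [hF.smul]

lemma separates : Separates R := by
  intro V φ ψ e
  refine ap_ext fun f => ?_
  have h₁ := congrArg (fun φ => ap φ one) e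
  simp only [ap_comp, ap_whiskerLeft] at h₁
  have h₂ := (h.sl f).map_right (lin_ap φ Lin.id)
  have h₃ := (h.sl f).map_right (lin_ap ψ Lin.id)
  rw [← h₁] at h₃
  exact h₂.unique h₃

end IsCanon

lemma Frame.isCanonical (D : Frame B) {R : 𝟙_ (TopFree k) ⟶ B ⊗ contDual B} (h : IsCanon R) :
    IsCanonical R := fun f => D.isSlice (h.sl f)

end Canonical

end TopFree

end

end QuantumDouble

namespace QuantumDouble

noncomputable section

namespace TopFree

open scoped PowerSeries

variable {k : Type u} [Field k]

local notation "ħ" => (PowerSeries.X : k⟦X⟧)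

variable {U V W T : TopFree k} {B : TopFree k} [HopfObj B]

/-! ### `B'` is a Hopf subalgebra, stable under the adjoint action and coaction -/

lemma tsum_mem_fil_add {m n : ℕ} {t : El (V ⊗ W)} (ht : t ∈ fil (V ⊗ W) m) {F : El V → El W → El T}
    (h₁ : ∀ w, Lin k⟦X⟧ (fun v => F v w)) (h₂ : ∀ v, Lin k⟦X⟧ (fun w => F v w))
    (h : ∀ v w, F v w ∈ fil T n) : tsum t F ∈ fil T (m + n) := by
  obtain ⟨t, rfl⟩ := mem_fil.1 ht
  rw [tsum_smul, pow_smul_mem_fil]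
  exact tsum_mem_fil t h₁ h₂ h

@[simp] lemma red_one : red (1 : El B) = 0 := by rw [red, eps_one, one_smul, sub_self]

lemma red_add_eps (x : El B) : red x + eps x • 1 = x := sub_add_cancel _ _

lemma red_mul (x y : El B) : red (x * y) = red x * y + eps x • red y := by
  have : red x * y = x * y - (eps x • 1) * y := map_sub (lin_mul_left Lin.id y).mk' _ _
  rw [this, smul_mul', one_mul, red, red, eps_mul, smul_sub, smul_smul]
  abel

lemma one_mem_prime : (1 : El B) ∈ prime B := mem_prime.2 fun n => by
  cases n with
  | zero => simp
  | succ n =>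
    have : ap (del B (n + 1)) (1 : El B) = 0 := by
      rw [ap_del_succ, tsum_cop_one (by fun_prop) (by fun_prop), red_one]
      exact (lin_tm_right _ Lin.id).map_zero
    rw [this]
    exact zero_mem _

lemma red_mem_fil_of_del {n : ℕ} {x : El B} (h : ap (del B 1) x ∈ fil (tpow B 1) n) :
    red x ∈ fil B n := by
  have h₁ : tsum (cop x) (fun a y => (eps a • (one : El (𝟙_ (TopFree k)))) ⊠ red y) ∈
      fil (𝟙_ (TopFree k) ⊗ B) n := by
    have h := h
    rw [ap_del_succ] at h
    simp only [ap_del_zero] at h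
    exact h
  have h₂ := fil_map (f := fun t : El (𝟙_ (TopFree k) ⊗ B) => tsum t (fun c y => scal c • y))
    (by fun_prop) h₁
  rw [tsum_tsum _ (by fun_prop) (by fun_prop)] at h₂
  simp (disch := fun_prop) only [tsum_tm, scal_smul', scal_one, mul_one] at h₂
  rwa [eps_cop_left x (F := fun x => red x) (by fun_prop)] at h₂

lemma red_mem_fil {x : El B} (hx : x ∈ prime B) : red x ∈ fil B 1 :=
  red_mem_fil_of_del (mem_prime.1 hx 1)

lemma mem_fil_of_del {n : ℕ} {x : El B} (h : ∀ m, ap (del B m) x ∈ fil (tpow B m) n) :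
    x ∈ fil B n := by
  have h₀ := h 0
  rw [ap_del_zero] at h₀
  have h₁ := fil_map (f := fun c : El (𝟙_ (TopFree k)) => scal c • (1 : El B)) (by fun_prop) h₀
  rw [scal_smul', scal_one, mul_one] at h₁
  rw [← red_add_eps x]
  exact add_mem (red_mem_fil_of_del (h 1)) h₁

lemma exists_ap_del_add (m n : ℕ) : ∃ c : tpow B (m + n) ⟶ tpow B m ⊗ tpow B n, ∀ x,
    ap c (ap (del B (m + n)) x) = tsum (cop x) fun y z => ap (del B m) y ⊠ ap (del B n) z := by
  induction n with
  | zero =>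
    refine ⟨(ρ_ (tpow B m)).inv, fun x => ?_⟩
    refine (ap_rightUnitor_inv (ap (del B m) x)).trans ?_
    simp only [ap_del_zero]
    refine Eq.symm ((congrArg (tsum (cop x)) (funext₂ fun y z => tm_smul _ _ _)).trans ?_)
    exact eps_cop_right x (F := fun x => ap (del B m) x ⊠ (one : El (𝟙_ (TopFree k)))) (by fun_prop)
  | succ n ih =>
    obtain ⟨c, hc⟩ := ih
    refine ⟨c ▷ B ≫ (α_ _ _ _).hom, fun x => ?_⟩
    have e₁ := ap_del_succ (m + n) x
    have e₂ : tsum (cop x) (fun y z => ap (del B m) y ⊠ ap (del B (n + 1)) z) =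
        tsum (cop x) fun y z => ap (del B m) y ⊠
          tsum (cop z) fun z₁ z₂ => ap (del B n) z₁ ⊠ red z₂ := by
      simp only [ap_del_succ]
      rfl
    refine (congrArg (ap (c ▷ B ≫ (α_ _ _ _).hom)) e₁).trans (Eq.trans ?_ e₂.symm)
    simp (disch := fun_prop) only [ap_comp, ap_whiskerRight, tsum_tsum, tsum_tm, hc,
      ap_assoc, tm_tsum]
    exact coassoc x (F := fun x y z => ap (del B m) x ⊠ ap (del B n) y ⊠ red z) (by fun_prop)
      (by fun_prop) (by fun_prop)

/-- The filtration on `B'` in both tensor factors of the coproduct. -/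
lemma tsum_del_del_mem_fil {x : El B} (hx : x ∈ prime B) (m n : ℕ) :
    tsum (cop x) (fun y z => ap (del B m) y ⊠ ap (del B n) z) ∈
      fil (tpow B m ⊗ tpow B n) (m + n) := by
  obtain ⟨c, hc⟩ := exists_ap_del_add (B := B) m n
  rw [← hc]
  exact fil_map (f := fun x => ap c x) (by fun_prop) (mem_prime.1 hx (m + n))

lemma inPrime_cop {x : El B} (hx : x ∈ prime B) : InPrime (cop x) := inPrime_iff_del.2 fun n => by
  have e : tsum (cop x) (fun y z => ap (del B n) y ⊠ z) =
      tsum (cop x) (fun y z => ap (del B n) y ⊠ red z) + ap (del B n) x ⊠ 1 := by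
    have h := eps_cop_right x (F := fun x => ap (del B n) x ⊠ (1 : El B)) (by fun_prop)
    rw [← h]
    have (t : El (B ⊗ B)) : tsum t (fun y z => ap (del B n) y ⊠ z) =
        tsum t (fun y z => ap (del B n) y ⊠ red z) +
          tsum t (fun y z => eps z • ap (del B n) y ⊠ (1 : El B)) := by
      refine tm_ext (f := fun t => tsum t (fun y z => ap (del B n) y ⊠ z)) (g := fun t =>
        tsum t (fun y z => ap (del B n) y ⊠ red z) +
          tsum t (fun y z => eps z • ap (del B n) y ⊠ (1 : El B))) (by fun_prop) (by fun_prop)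
          (fun y z => ?_) t
      simp (disch := fun_prop) only [tsum_tm]
      rw [← tm_smul]
      refine Eq.trans ?_ ((lin_tm_right (ap (del B n) y) Lin.id).add _ _)
      rw [red_add_eps]
    exact this _
  rw [e]
  refine add_mem ?_ (fil_map (f := fun t => t ⊠ (1 : El B)) (by fun_prop) (mem_prime.1 hx n))
  have h := mem_prime.1 hx (n + 1)
  rw [ap_del_succ] at h
  exact fil_mono (Nat.le_succ n) h

namespace Frame

variable (D : Frame B)
include D

/-- If `x ∈ B' ⊗ ħⁿ W` up to the map `L`, then the same holds for its contractions. -/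
lemma map_mem_fil_of_sl {L : El W → El T} (hL : Lin k⟦X⟧ L) {n : ℕ} {x : El (B ⊗ W)}
    (h : ∀ m, tsum x (fun b w => ap (del B m) b ⊠ L w) ∈ fil (tpow B m ⊗ T) (m + n))
    {f : El (contDual B)} {y : El W} (hy : Sl f x y) : L y ∈ fil T n := by
  have h₁ : tsum x (fun b w => b ⊠ L w) ∈ fil (B ⊗ T) n := by
    refine mem_fil_of_slices fun G => mem_fil_of_del fun m => ?_
    change ap (del B m) (slice G _) ∈ _
    rw [← slice_map_left G (f := fun b => ap (del B m) b) (by fun_prop), tsum_tsum _ (by fun_prop)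
      (by fun_prop)]
    simp (disch := fun_prop) only [tsum_tm]
    exact fil_mono (by omega) (fil_map (f := fun x => slice G x) (by fun_prop) (h m))
  obtain ⟨z, hz⟩ := mem_fil.1 h₁
  have hz' : InPrime z := inPrime_iff_del.2 fun m => by
    have := h m
    have e : tsum x (fun b w => ap (del B m) b ⊠ L w) =
        ħ ^ n • tsum z (fun b w => ap (del B m) b ⊠ w) := by
      rw [← tsum_smul, ← hz, tsum_tsum _ (by fun_prop) (by fun_prop)]
      simp (disch := fun_prop) only [tsum_tm]
    rwa [e, add_comm, pow_smul_mem_fil] at this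
  obtain ⟨w, hw⟩ := D.exists_sl f hz'
  have h₂ := hy.map_right hL
  rw [hz] at h₂
  rw [h₂.unique (hw.smul (ħ ^ n))]
  exact smul_mem_fil _ _

/-- The coproduct maps `B'` to `B' ⊗ B'`. -/
lemma mem_prime_of_sl_cop {x : El B} (hx : x ∈ prime B) {f : El (contDual B)} {y : El B}
    (hy : Sl f (cop x) y) : y ∈ prime B := mem_prime.2 fun n =>
  D.map_mem_fil_of_sl (L := fun y => ap (del B n) y) (by fun_prop)
    (fun m => tsum_del_del_mem_fil hx m n) hy

lemma inPrime_of_sl {x : El (B ⊗ (B ⊗ V))} (hx : ∀ m n, tsum x (fun b t => ap (del B m) b ⊠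
      tsum t fun b' v => ap (del B n) b' ⊠ v) ∈ fil (tpow B m ⊗ (tpow B n ⊗ V)) (m + n))
    {f : El (contDual B)} {y : El (B ⊗ V)} (hy : Sl f x y) : InPrime y :=
  inPrime_iff_del.2 fun n => D.map_mem_fil_of_sl
    (L := fun t => tsum t fun b' v => ap (del B n) b' ⊠ v) (by fun_prop) (fun m => hx m n) hy

lemma map_mem_fil_of_inPrime {L : El (B ⊗ V) → El T} (hL : Lin k⟦X⟧ L) {n : ℕ}
    (h : ∀ (b : El B) v, b ∈ prime B → L (b ⊠ v) ∈ fil T n) {x : El (B ⊗ V)} (hx : InPrime x) :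
    L x ∈ fil T n := by
  obtain ⟨v, hv⟩ := D.exists_sl 0 hx
  obtain ⟨s, w, hw, hs, -⟩ := D.exists_approx 0 hv n
  rw [← sub_add_cancel x (∑ i ∈ s, (D.e i : El B) ⊠ w i), hL.add]
  refine add_mem (fil_map hL hs) ?_
  rw [show L (∑ i ∈ s, (D.e i : El B) ⊠ w i) = _ from map_sum hL.mk' _ _]
  exact sum_mem fun i _ => h _ _ (D.e i).2

lemma inPrime_tsum {x : El (B ⊗ V)} (hx : InPrime x) {F : El B → El V → El (B ⊗ W)}
    (h₁ : ∀ w, Lin k⟦X⟧ (fun v => F v w)) (h₂ : ∀ v, Lin k⟦X⟧ (fun w => F v w))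
    (h : ∀ (b : El B) v, b ∈ prime B → InPrime (F b v)) :
    InPrime (tsum x F) := inPrime_iff_del.2 fun n => by
  rw [tsum_tsum _ (by fun_prop) (by fun_prop)]
  refine D.map_mem_fil_of_inPrime (L := fun x => tsum x fun b v =>
    tsum (F b v) fun b v => ap (del B n) b ⊠ v) (by fun_prop) (fun b v hb => ?_) hx
  rw [tsum_tm _ _ (by fun_prop) (by fun_prop)]
  exact inPrime_iff_del.1 (h b v hb) n

lemma map_cop_mem_fil {L : El (B ⊗ B) → El T} (hL : Lin k⟦X⟧ L) {n : ℕ}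
    (h : ∀ b b' : El B, b ∈ prime B → b' ∈ prime B → L (b ⊠ b') ∈ fil T n)
    {x : El B} (hx : x ∈ prime B) :
    L (cop x) ∈ fil T n := by
  obtain ⟨v, hv⟩ := D.exists_sl 0 (inPrime_cop hx)
  obtain ⟨s, w, hw, hs, -⟩ := D.exists_approx 0 hv n
  rw [← sub_add_cancel (cop x) (∑ i ∈ s, (D.e i : El B) ⊠ w i), hL.add]
  refine add_mem (fil_map hL hs) ?_
  rw [show L (∑ i ∈ s, (D.e i : El B) ⊠ w i) = _ from map_sum hL.mk' _ _]
  exact sum_mem fun i _ => h _ _ (D.e i).2 (D.mem_prime_of_sl_cop hx (hw i))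

/-- `B'` is closed under products. Since the coproduct maps `B'` to `B' ⊗ B'`, this follows by
induction from `Δⁿ⁺¹(x y) = Δⁿ(x₁ y₁) ⊗ x₂ y₂`. -/
lemma mul_mem_prime {x y : El B} (hx : x ∈ prime B) (hy : y ∈ prime B) : x * y ∈ prime B := by
  refine mem_prime.2 fun n => ?_
  induction n generalizing x y with
  | zero => simp
  | succ n ih =>
    rw [ap_del_succ, tsum_cop_mul _ _ (by fun_prop) (by fun_prop)]
    refine D.map_cop_mem_fil (L := fun t => tsum t fun x₁ x₂ => tsum (cop y) fun y₁ y₂ =>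
      ap (del B n) (x₁ * y₁) ⊠ red (x₂ * y₂)) (by fun_prop) (fun x₁ x₂ hx₁ hx₂ => ?_) hx
    rw [tsum_tm _ _ (by fun_prop) (by fun_prop)]
    refine D.map_cop_mem_fil (L := fun t => tsum t fun y₁ y₂ =>
      ap (del B n) (x₁ * y₁) ⊠ red (x₂ * y₂)) (by fun_prop) (fun y₁ y₂ hy₁ hy₂ => ?_) hy
    rw [tsum_tm _ _ (by fun_prop) (by fun_prop)]
    refine tm_mem_fil (ih hx₁ hy₁) ?_
    rw [red_mul]
    exact add_mem (fil_map (f := fun x => x * y₂) (by fun_prop) (red_mem_fil hx₂))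
      (Submodule.smul_mem _ _ (red_mem_fil hy₂))

variable [IsIso 𝒮[B]]

omit D in
lemma red_sinv (x : El B) : red (sinv x) = sinv (red x) := by
  have : sinv (red x) = sinv x - sinv (eps x • 1) := map_sub (lin_sinv Lin.id).mk' _ _
  rw [this, sinv_smul, sinv_one, red, eps_sinv]

lemma sinv_mem_prime {x : El B} (hx : x ∈ prime B) : sinv x ∈ prime B := by
  refine mem_prime.2 fun n => ?_
  induction n generalizing x with
  | zero => simp
  | succ n ih =>
    rw [ap_del_succ, tsum_cop_sinv _ (by fun_prop) (by fun_prop)]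
    refine D.map_cop_mem_fil (L := fun t => tsum t fun x₁ x₂ =>
      ap (del B n) (sinv x₂) ⊠ red (sinv x₁)) (by fun_prop) (fun x₁ x₂ hx₁ hx₂ => ?_) hx
    rw [tsum_tm _ _ (by fun_prop) (by fun_prop)]
    refine tm_mem_fil (ih hx₂) ?_
    rw [red_sinv]
    exact fil_map (f := fun x => sinv x) (by fun_prop) (red_mem_fil hx₁)

end Frame

/-- The element `b₃ x S⁻¹(b₁) ⊗ b₂`, which is the adjoint coaction of `b` for `x = 1` and maps to the
adjoint action of `b` on `x` under `id ⊗ ε`. -/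
def twist (b x : El B) : El (B ⊗ B) :=
  tsum (cop b) fun b₁ p => tsum (cop p) fun b₂ b₃ => (b₃ * x * sinv b₁) ⊠ b₂

@[fun_prop] lemma lin_twist_left {M : Type*} [AddCommGroup M] [Module k⟦X⟧ M] {f : M → El B}
    (hf : Lin k⟦X⟧ f) (x : El B) : Lin k⟦X⟧ (fun m => twist (f m) x) := by
  unfold twist
  fun_prop

section Twist

variable {b : Type u} [LieRing b] [LieAlgebra k b]
  {p : El B →ₛₗ[PowerSeries.constantCoeff (R := k)] UniversalEnvelopingAlgebra k b}
  (hp : IsQuantisation p) (D : Frame B) [IsIso 𝒮[B]]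
include hp D

/-- Since `B` is cocommutative modulo `ħ`, the two factors `b₂` and `b₃` may be exchanged. -/
lemma IsQuantisation.tsum_red_mem_fil (c : El B) {x : El B} (hx : x ∈ prime B) :
    tsum (cop c) (fun e r => tsum (cop r) fun q d => q ⊠ red (d * x * sinv e)) ∈ fil (B ⊗ B) 1 := by
  have h₁ : tsum (cop c) (fun e r => tsum (cop r) fun q d => q ⊠ red (d * sinv e)) ∈
      fil (B ⊗ B) 1 := by
    have h := smod_tsum (cop c) (F := fun e r => tsum (cop r) fun q d => q ⊠ red (d * sinv e))
      (G := fun e r => tsum (cop r) fun q d => d ⊠ red (q * sinv e)) (n := 1) (by fun_prop)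
      (by fun_prop) (by fun_prop) (by fun_prop) fun e r => by
        have := smod_map (f := fun t => tsum t fun q d => q ⊠ red (d * sinv e)) (by fun_prop)
          (hp.cop_smod_swap r)
        rw [tsum_tsum _ (by fun_prop) (by fun_prop)] at this
        simpa (disch := fun_prop) only [tsum_tm] using this
    rw [mul_sinv_cancel₁ c (F := fun y z => z ⊠ red y) (by fun_prop) (by fun_prop), red_one,
      (lin_tm_right c Lin.id).map_zero, SModEq.sub_mem, sub_zero] at h
    exact h
  have e : tsum (cop c) (fun e r => tsum (cop r) fun q d => q ⊠ red (d * x * sinv e)) =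
      tsum (cop c) (fun e r => tsum (cop r) fun q d => q ⊠ red (d * red x * sinv e)) +
        eps x • tsum (cop c) (fun e r => tsum (cop r) fun q d => q ⊠ red (d * sinv e)) := by
    have h (y : El B) : Lin k⟦X⟧ (fun x => tsum (cop c) (fun e r => tsum (cop r) fun q d =>
      q ⊠ red (d * x * sinv e))) := by fun_prop
    conv_lhs => rw [← red_add_eps x, (h x).add, (h x).smul]
    simp only [mul_one]
  rw [e]
  refine add_mem ?_ (Submodule.smul_mem _ _ h₁)
  exact fil_map (f := fun x => tsum (cop c) (fun e r => tsum (cop r) fun q d =>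
      q ⊠ red (d * x * sinv e))) (by fun_prop) (red_mem_fil hx)

/-- The element `b₃ x S⁻¹(b₁) ⊗ b₂` is in `B' ⊗ B` for `x ∈ B'`. By induction on `n`, one applies the
`n`-fold reduced coproduct to the first factor, and splits off its last component
`b₃ x₂ S⁻¹(b₁)`, which is in `ħ B` after reduction; what remains is an element of the same
form. -/
lemma IsQuantisation.inPrime_twist (c : El B) {x : El B} (hx : x ∈ prime B) :
    InPrime (twist c x) := by
  refine inPrime_iff_del.2 fun n => ?_
  induction n generalizing c x with
  | zero => simp
  | succ n ih =>
    suffices h : tsum (twist c x) (fun y z => (tsum (cop y) fun y₁ y₂ =>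
        ap (del B n) y₁ ⊠ red y₂) ⊠ z) ∈ fil ((tpow B n ⊗ B) ⊗ B) (n + 1) by
      have e : (fun y z => ap (del B (n + 1)) y ⊠ z) = (fun y (z : El B) =>
          (tsum (cop y) fun y₁ y₂ => ap (del B n) y₁ ⊠ red y₂) ⊠ z) :=
        funext₂ fun y z => congrArg (fun t : El (tpow B n ⊗ B) => t ⊠ z) (ap_del_succ n y)
      rw [e]
      exact h
    have e : tsum (twist c x) (fun y z => (tsum (cop y) fun y₁ y₂ =>
        ap (del B n) y₁ ⊠ red y₂) ⊠ z) =
        tsum (cop c) fun b₁ p => tsum (cop p) fun b₂ b₃ => tsum (cop b₃) fun u v =>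
          tsum (cop x) fun x₁ x₂ => tsum (cop b₁) fun e f =>
            (ap (del B n) (u * x₁ * sinv f) ⊠ red (v * x₂ * sinv e)) ⊠ b₂ := by
      unfold twist
      simp (disch := fun_prop) only [tsum_tsum, tsum_tm, tsum_cop_mul, tsum_cop_sinv, tsum_tm']
    rw [e]
    refine D.map_cop_mem_fil (L := fun t => tsum (cop c) fun b₁ p => tsum (cop p) fun b₂ b₃ =>
      tsum (cop b₃) fun u v => tsum t fun x₁ x₂ => tsum (cop b₁) fun e f =>
        (ap (del B n) (u * x₁ * sinv f) ⊠ red (v * x₂ * sinv e)) ⊠ b₂) (by fun_prop)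
      (fun x₁ x₂ hx₁ hx₂ => ?_) hx
    simp (disch := fun_prop) only [tsum_tm]
    have e₁ : (tsum (cop c) fun b₁ p => tsum (cop p) fun b₂ b₃ => tsum (cop b₃) fun u v =>
          tsum (cop b₁) fun e f => (ap (del B n) (u * x₁ * sinv f) ⊠ red (v * x₂ * sinv e)) ⊠ b₂) =
        tsum (tsum (cop c) fun e r => tsum (cop r) fun q d => q ⊠ red (d * x₂ * sinv e))
          fun q z => tsum (tsum (twist q x₁) fun y b₂ => ap (del B n) y ⊠ b₂) fun y b₂ =>
            (y ⊠ z) ⊠ b₂ := by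
      unfold twist
      simp (disch := fun_prop) only [tsum_tsum, tsum_tm]
      have s₁ (b₁ b₂ b₃ : El B) : (tsum (cop b₃) fun u v => tsum (cop b₁) fun e f =>
          (ap (del B n) (u * x₁ * sinv f) ⊠ red (v * x₂ * sinv e)) ⊠ b₂) =
          tsum (cop b₁) fun e f => tsum (cop b₃) fun u v =>
          (ap (del B n) (u * x₁ * sinv f) ⊠ red (v * x₂ * sinv e)) ⊠ b₂ :=
        tsum_comm _ _ (by fun_prop) (by fun_prop) (by fun_prop) (by fun_prop)
      simp only [s₁]
      have s₂ (b₁ p : El B) : (tsum (cop p) fun b₂ b₃ => tsum (cop b₁) fun e f =>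
          tsum (cop b₃) fun u v => (ap (del B n) (u * x₁ * sinv f) ⊠ red (v * x₂ * sinv e)) ⊠ b₂) =
          tsum (cop b₁) fun e f => tsum (cop p) fun b₂ b₃ => tsum (cop b₃) fun u v =>
          (ap (del B n) (u * x₁ * sinv f) ⊠ red (v * x₂ * sinv e)) ⊠ b₂ :=
        tsum_comm _ _ (by fun_prop) (by fun_prop) (by fun_prop) (by fun_prop)
      simp only [s₂]
      rw [coassoc c (F := fun e f p => tsum (cop p) fun b₂ b₃ => tsum (cop b₃) fun u v =>
          (ap (del B n) (u * x₁ * sinv f) ⊠ red (v * x₂ * sinv e)) ⊠ b₂) (by fun_prop)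
        (by fun_prop) (by fun_prop)]
      congr 1; funext e r
      rw [coassoc r (F := fun f s d => tsum (cop s) fun b₂ u =>
          (ap (del B n) (u * x₁ * sinv f) ⊠ red (d * x₂ * sinv e)) ⊠ b₂) (by fun_prop)
        (by fun_prop) (by fun_prop)]
      congr 1; funext f p
      exact (coassoc p (F := fun b₂ u d =>
          (ap (del B n) (u * x₁ * sinv f) ⊠ red (d * x₂ * sinv e)) ⊠ b₂) (by fun_prop)
        (by fun_prop) (by fun_prop)).symm
    rw [e₁, add_comm]
    unfold twist
    refine tsum_mem_fil_add (hp.tsum_red_mem_fil D c hx₂) (by fun_prop) (by fun_prop) fun q z => ?_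
    exact fil_map (f := fun t => tsum t fun y b₂ => (y ⊠ z) ⊠ b₂) (by fun_prop) (ih q hx₁)

lemma IsQuantisation.adj_mem_prime (c : El B) {x : El B} (hx : x ∈ prime B) :
    tsum (cop c) (fun b₁ b₂ => b₂ * x * sinv b₁) ∈ prime B := by
  have h := hp.inPrime_twist D c hx (lin_eps Lin.id).mk'
  have e : slice (lin_eps (B := B) Lin.id).mk' (twist c x) =
      tsum (cop c) (fun b₁ b₂ => b₂ * x * sinv b₁) := by
    unfold twist
    rw [slice_tsum _ _ (by fun_prop) (by fun_prop)]
    congr 1; funext b₁ p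
    rw [slice_tsum _ _ (by fun_prop) (by fun_prop)]
    simp only [slice_tm]
    exact eps_cop_left p (F := fun y => y * x * sinv b₁) (by fun_prop)
  rwa [e] at h

end Twist

end TopFree

end

end QuantumDouble

namespace QuantumDouble

noncomputable section

namespace TopFree

open scoped PowerSeries

variable {k : Type u} [Field k]


variable {V W : TopFree k} {B : TopFree k} [HopfObj B]

/-! ### The Hopf algebra structure on the dual of `B'` -/

section Dual

variable {R : 𝟙_ (TopFree k) ⟶ B ⊗ contDual B}

namespace Frame

variable (D : Frame B)
include D

lemma inPrime_cop_tsum (hR : IsCanon R) :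
    InPrime (tsum (ap R one) fun x g => tsum (cop x) fun x₁ x₂ => x₁ ⊠ x₂ ⊠ g) :=
  D.inPrime_tsum hR.inPrime (by fun_prop) (by fun_prop) fun _ g hb =>
    (inPrime_cop hb).map_right (f := fun x₂ => x₂ ⊠ g) (by fun_prop)

lemma inPrime_of_sl_cop_tsum (hR : IsCanon R) {f : El (contDual B)} {y : El (B ⊗ contDual B)}
    (hy : Sl f (tsum (ap R one) fun x g => tsum (cop x) fun x₁ x₂ => x₁ ⊠ x₂ ⊠ g) y) :
    InPrime y := by
  refine D.inPrime_of_sl (fun m n => ?_) hy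
  refine D.map_mem_fil_of_inPrime (L := fun r => tsum (tsum r fun x g =>
    tsum (cop x) fun x₁ x₂ => x₁ ⊠ x₂ ⊠ g) fun b t => ap (del B m) b ⊠
      tsum t fun b' v => ap (del B n) b' ⊠ v) (by fun_prop) (fun b g hb => ?_) hR.inPrime
  have := fil_map (f := fun t => tsum t fun y z => y ⊠ z ⊠ g) (by fun_prop)
    (tsum_del_del_mem_fil hb m n)
  simpa (disch := fun_prop) only [tsum_tsum, tsum_tm] using this

/-- The structure maps of the dual of `B'`. The product `f g` is obtained by contracting
`x₁ ⊗ x₂ ⊗ g` with `f` and `g` in turn, where `x ⊗ g` is the canonical element; the intermediate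
result is in `B' ⊗ B^∨`. -/
lemma nonempty_dualMaps [IsIso 𝒮[B]] (hR : IsCanon R) : Nonempty (DualMaps R) := by
  obtain ⟨e, he⟩ := D.exists_contraction_one (InPrime.tm one_mem_prime (one : El (𝟙_ (TopFree k))))
  have hc : InPrime (tsum (ap R one) fun x g => tsum (ap R one) fun x' g' =>
      (x * x') ⊠ (g' ⊠ g)) :=
    D.inPrime_tsum hR.inPrime (by fun_prop) (by fun_prop) fun b g hb =>
      D.inPrime_tsum hR.inPrime (by fun_prop) (by fun_prop) fun b' g' hb' =>
        InPrime.tm (D.mul_mem_prime hb hb') _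
  obtain ⟨c, hc'⟩ := D.exists_contraction_one hc
  have hs : InPrime (tsum (ap R one) fun x g => sinv x ⊠ g) :=
    D.inPrime_tsum hR.inPrime (by fun_prop) (by fun_prop) fun b g hb =>
      InPrime.tm (D.sinv_mem_prime hb) _
  obtain ⟨s, hs'⟩ := D.exists_contraction_one hs
  have ht := D.inPrime_cop_tsum hR
  obtain ⟨φ, hφ⟩ := D.exists_contraction_one ht
  have hi (f) := D.inPrime_of_sl_cop_tsum hR (hφ f)
  obtain ⟨m, hm⟩ := D.exists_contraction (x := fun f => ap φ f) (by fun_prop) hi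
  refine ⟨hR.separates, e, c, (β_ _ _).hom ≫ m, s, ?_, ?_, ?_, ?_⟩
  · exact hR.tsum_eq_of_sl (InPrime.tm one_mem_prime _) (by fun_prop) he
  · exact hR.tsum_eq_of_sl hc (by fun_prop) hc'
  · rw [← hR.tsum_eq_of_sl ht (by fun_prop) hφ]
    congr 1; funext x g
    rw [← hR.tsum_eq_of_sl (hi g) (φ := fun g' => ap m (g' ⊠ g)) (by fun_prop) (fun f => hm f g)]
    simp (disch := fun_prop) only [ap_comp, ap_braiding_tm, tm_tsum]
  · exact hR.tsum_eq_of_sl hs (by fun_prop) hs'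

end Frame

variable [IsIso 𝒮[B]] (D : Frame B) (hR : IsCanon R) (d : DualMaps R)
include D hR

/-- The product is dual to the coproduct of `B'`: `(f g)(x) = g(y)`, where `y = (f ⊗ id)(Δ x)`
lies in `B'`. -/
lemma Frame.fn_dualMaps_mul (f g : El (contDual B)) (x : prime B) : ∃ (y : El B) (hy : y ∈ prime B),
    Sl f (cop (x : El B)) y ∧ fn (ap d.mul (f ⊠ g)) x = fn g ⟨y, hy⟩ := by
  -- contract the two sides of `R₁₃ R₂₃ = (Δ ⊗ id)(R)` with `f`, and evaluate at `x`
  have h₁ := (hR.sl f).map_right (φ := fun g => tsum (ap R one) fun x' g' =>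
    x' ⊠ ap d.mul (g ⊠ g')) (by fun_prop)
  have h₂ := d.mul_spec
  simp (disch := fun_prop) only [tm_tsum] at h₁
  rw [h₂] at h₁
  obtain ⟨hy, h₃⟩ := (hR.sl g).map_right (φ := fun g => ap d.mul (f ⊠ g)) (by fun_prop) (evalFn x)
  refine ⟨_, hy, ?_, h₃⟩
  have h₄ := h₁.map_right (φ := fun t => slice (evalFn x) t) (by fun_prop)
  simp (disch := fun_prop) only [tsum_tsum, tsum_tm, slice_tm] at h₄
  convert h₄ using 1
  rw [← hR.tsum_sum (F := fun x => cop x) (by fun_prop) x]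
  congr 1; funext x' g'
  simp (disch := fun_prop) only [tm_smul, smul_tsum, tsum_eta]
  rfl

lemma Frame.isPairing (f g : El (contDual B)) (x : prime B) :
    IsPairing f g (show El (B ⊗ B : TopFree k) from cop (x : El B))
      (fn (ap d.mul (f ⊠ g)) x) := fun n => by
  obtain ⟨y, hy, hs, e⟩ := D.fn_dualMaps_mul hR d f g x
  obtain ⟨m, hm⟩ := fn_cont g n
  obtain ⟨s, w, hw, h₁, h₂⟩ := D.exists_approx f hs (max m n)
  have hw' (i) : w i ∈ prime B := D.mem_prime_of_sl_cop x.2 (hw i)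
  refine ⟨∑ i ∈ s, TensorProduct.tmul k⟦X⟧ (D.e i) ⟨w i, hw' i⟩, congMod_iff.2 ?_, ?_⟩
  · rw [map_sum]
    exact fil_mono (le_max_right m n) h₁
  · have := hm (⟨y, hy⟩ - ∑ i ∈ s, fn f (D.e i) • ⟨w i, hw' i⟩) (by
      rw [Submodule.coe_sub, Submodule.coe_sum]
      exact fil_mono (le_max_left m n) h₂)
    obtain ⟨c, hc⟩ := this
    refine ⟨c, ?_⟩
    rw [e, map_sum]
    refine (eq_add_of_sub_eq' (hc.symm.trans ?_).symm)
    rw [fn, map_sub, map_sum]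
    simp only [map_smul]
    rfl

/-- The continuous dual of `B'` is the opposite dual of the Hopf algebra `B'`. -/
lemma Frame.isOppositeDual :
    letI := d.hopfObj
    IsOppositeDual B := by
  letI := d.hopfObj
  refine ⟨fun x => ?_, D.isPairing hR d, ⟨one_mem_prime, fun f => ?_⟩, fun x y =>
    ⟨D.mul_mem_prime y.2 x.2, fun f => ?_⟩⟩
  · have h := hR.tsum_sum (F := fun x => eps x • (one : El (𝟙_ (TopFree k)))) (by fun_prop) x
    have h₁ : fn (ap (DualMaps.unit R) one) x • (one : El (𝟙_ (TopFree k))) =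
        tsum (ap R one) fun y g => fn g x • eps y • one := by
      rw [DualMaps.ap_unit, map_tsum (L := fun f => fn f x • (one : El (𝟙_ (TopFree k))))
        (by fun_prop) _ (by fun_prop) (by fun_prop)]
      congr 1; funext y g
      rw [(lin_fn (B := B) Lin.id x).smul, smul_assoc, smul_comm]
    have h₂ := congrArg scal (h₁.trans h)
    simp only [scal_smul', scal_one, mul_one] at h₂
    exact h₂
  · have h := (hR.sl f).map_right (φ := fun g => ap d.counit g) (by fun_prop)
    rw [d.counit_spec] at h
    obtain ⟨h₁, h₂⟩ := h (lin_scal Lin.id).mk'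
    refine h₂.trans (congrArg (fn f) (Subtype.ext ?_))
    exact (slice_tm _ _ _).trans (one_smul _ _)
  · have h := (hR.sl f).map_right (φ := fun g => ap d.comul g) (by fun_prop)
    rw [d.comul_spec] at h
    obtain ⟨h₁, h₂⟩ := h (lin_scal (lin_ap (evalAt₂ x y) Lin.id)).mk'
    refine h₂.trans (congrArg (fn f) (Subtype.ext ?_))
    have e (g' g : El (contDual B)) : scal (ap (evalAt₂ x y) (g' ⊠ g)) = fn g' x * fn g y := by
      rw [evalAt₂, ap_comp, ap_tensorHom_tm, ap_leftUnitor_tm, scal_smul']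
      rfl
    refine (slice_tsum _ _ (by fun_prop) (by fun_prop)).trans ?_
    refine Eq.trans ?_ (hR.tsum_sum (F := fun z => z * (x : El B)) (by fun_prop) y)
    congr 1; funext z g
    rw [slice_tsum _ _ (by fun_prop) (by fun_prop),
      ← hR.tsum_sum (F := fun z' => z * z') (by fun_prop) x,
      ← smul_tsum _ (by fun_prop) (by fun_prop)]
    congr 1; funext z' g'
    rw [slice_tm, smul_smul, mul_comm (fn g y), ← e]
    rfl


end Dual

end TopFree

end

end QuantumDouble

namespace QuantumDouble

noncomputable section

namespace TopFree

open scoped PowerSeries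

variable {k : Type u} [Field k]


variable {V W : TopFree k} {B : TopFree k} [HopfObj B]

/-! ### The quantum double of a quantised enveloping algebra -/

section Double

variable {R : 𝟙_ (TopFree k) ⟶ B ⊗ contDual B} {b : Type u} [LieRing b] [LieAlgebra k b]
  {p : El B →ₛₗ[PowerSeries.constantCoeff (R := k)] UniversalEnvelopingAlgebra k b}

lemma ap_adCoact_eq_twist (b : El B) : ap (adCoact B) b = twist b 1 := by
  simp only [ap_adCoact, twist, mul_one]

/-- The coadjoint action of the dual of `B'` on `B`. -/
lemma IsQuantisation.exists_lact [IsIso 𝒮[B]] (hp : IsQuantisation p) (D : Frame B)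
    (hR : IsCanon R) :
    ∃ lact : contDual B ⊗ B ⟶ B, IsCoadLeft lact ∧
      ∀ b, tsum (ap R one) (fun x g => x ⊠ actE lact g b) =
        tsum (cop b) fun b₁ p => tsum (cop p) fun b₂ b₃ => (b₃ * sinv b₁) ⊠ b₂ := by
  obtain ⟨φ, hφ⟩ := D.exists_contraction (x := fun b : El B => twist b 1) (by fun_prop)
    fun c => hp.inPrime_twist D c one_mem_prime
  refine ⟨φ, fun f c => ?_, fun c => ?_⟩
  · have := D.isSlice (hφ f c)
    rw [← ap_adCoact_eq_twist] at this
    exact this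
  · refine (hR.tsum_eq_of_sl (hp.inPrime_twist D c one_mem_prime) (by fun_prop)
      (fun f => hφ f c)).trans ?_
    simp only [twist, mul_one]

/-- The coadjoint action of `B` on the dual of `B'`. -/
lemma IsQuantisation.exists_ract [IsIso 𝒮[B]] (hp : IsQuantisation p) (D : Frame B)
    (hR : IsCanon R) :
    ∃ ract : contDual B ⊗ B ⟶ contDual B, IsCoadRight ract ∧
      ∀ b, tsum (ap R one) (fun x g => x ⊠ ap ract (g ⊠ b)) =
        tsum (cop b) fun b₁ b₂ => tsum (ap R one) fun x g => (b₂ * x * sinv b₁) ⊠ g := by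
  let x (b : El B) : El (B ⊗ contDual B) :=
    tsum (cop b) fun b₁ b₂ => tsum (ap R one) fun x g => (b₂ * x * sinv b₁) ⊠ g
  have hx'' (b : El B) : x b =
    tsum (cop b) fun b₁ b₂ => tsum (ap R one) fun x g => (b₂ * x * sinv b₁) ⊠ g := rfl
  have hx : Lin k⟦X⟧ x := by unfold x; fun_prop
  have e (c : El B) : x c = tsum (ap R one) fun x g =>
      (tsum (cop c) fun b₁ b₂ => b₂ * x * sinv b₁) ⊠ g := by
    unfold x
    refine (tsum_comm _ _ (by fun_prop) (by fun_prop) (by fun_prop) (by fun_prop)).trans ?_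
    simp (disch := fun_prop) only [tsum_tm']
  have hx' (c : El B) : InPrime (x c) := by
    rw [e]
    exact D.inPrime_tsum hR.inPrime (by fun_prop) (by fun_prop) fun b g hb =>
      InPrime.tm (hp.adj_mem_prime D c hb) _
  have hs (c : El B) (y : prime B) : slice (evalFn y) (x c) =
      tsum (cop c) fun b₁ b₂ => b₂ * (y : El B) * sinv b₁ := by
    rw [e, slice_map_left (evalFn y)
      (f := fun x => tsum (cop c) fun b₁ b₂ => b₂ * x * sinv b₁) (by fun_prop)]
    exact congrArg (fun x => tsum (cop c) fun b₁ b₂ => b₂ * x * sinv b₁) (hR.sum y)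
  obtain ⟨φ, hφ⟩ := D.exists_contraction hx hx'
  clear_value x
  refine ⟨φ, fun c y => ?_, fun c => ?_⟩
  · have hm := hp.adj_mem_prime D c y.2
    rw [← ap_adAct] at hm
    refine ⟨hm, fun f => ?_⟩
    obtain ⟨h₁, h₂⟩ := hφ f c (evalFn y)
    refine h₂.trans (congrArg (fn f) (Subtype.ext ?_))
    exact (hs c y).trans (ap_adAct (C := TopFree k) (B := B) c (y : El B)).symm
  · rw [← hx'']
    exact hR.tsum_eq_of_sl (hx' c) (by fun_prop) (fun f => hφ f c)

/-- The action of the double on an admissible Drinfeld-Yetter module. -/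
lemma Frame.exists_xi [HopfObj (contDual B)] (D : Frame B) (hR : IsCanon R) {V : DY B}
    (hV : IsAdmissible B V) :
    ∃ ξ : DoubleCross B (contDual B) ⊗ V.X ⟶ V.X, IsXi R V ξ ∧ IsXiAct V ξ := by
  obtain ⟨φ, hφ⟩ := D.exists_contraction (x := fun v : El V.X => ap V.coact v) (by fun_prop)
    fun v => (hV v).inPrime
  let ξ : DoubleCross B (contDual B) ⊗ V.X ⟶ V.X :=
    (α_ B (contDual B) V.X).hom ≫ B ◁ φ ≫ V.act
  have e (b : El B) (f : El (contDual B)) (v : El V.X) :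
      actE ξ (dc b f) v = actE V.act b (ap φ (f ⊠ v)) := by
    refine (show _ = ap ((α_ B (contDual B) V.X).hom ≫ B ◁ φ ≫ V.act :
      (B ⊗ contDual B) ⊗ V.X ⟶ V.X) ((b ⊠ f) ⊠ v) from rfl).trans ?_
    simp (disch := fun_prop) only [ap_comp, ap_whiskerLeft, tsum_tm, ap_assoc_tm]
    rfl
  refine ⟨ξ, ⟨fun b f v => ?_, fun v => ?_⟩, fun b f v =>
    ⟨ap φ (f ⊠ v), D.isSlice (hφ f v), e b f v⟩⟩
  · rw [e, e, V.one_act]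
  · simp only [e, V.one_act]
    exact hR.tsum_eq_of_sl (hV v).inPrime (by fun_prop) fun f => hφ f v

lemma inPrime_map {U : TopFree k} {L : El (V ⊗ W) → El (B ⊗ U)} (hL : Lin k⟦X⟧ L)
    (h : ∀ v w, InPrime (L (v ⊠ w))) (t : El (V ⊗ W)) : InPrime (L t) :=
  inPrime_iff_del.2 fun n => by
    rw [← tsum_eta t, map_tsum hL _ (by fun_prop) (by fun_prop),
      tsum_tsum _ (by fun_prop) (by fun_prop)]
    exact tsum_mem_fil t (by fun_prop) (by fun_prop) fun v w => inPrime_iff_del.1 (h v w) n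

lemma Frame.isMonoidal_isAdmissible (D : Frame B) (h₁ : DY.IsMonoidal B) :
    letI := DY.monoidal h₁
    B.IsAdmissible.IsMonoidal := by
  letI := DY.monoidal h₁
  refine { prop_unit := fun c => ?_, prop_tensor := fun V W hV hW => ?_ }
  · refine D.memPrime ?_
    refine (?_ : InPrime (ap (DY.unitCoact B) c))
    rw [DY.ap_unitCoact]
    exact InPrime.tm one_mem_prime c
  · refine (?_ : ∀ v, MemPrime (ap (DY.tensorCoact V W) v))
    refine fun t => D.memPrime (inPrime_map (by fun_prop) (fun v w => ?_) t)
    rw [DY.ap_tensorCoact]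
    exact D.inPrime_tsum (hV v).inPrime (by fun_prop) (by fun_prop) fun x v' hx =>
      D.inPrime_tsum (hW w).inPrime (by fun_prop) (by fun_prop) fun y w' hy =>
        InPrime.tm (D.mul_mem_prime hy hx) _

lemma Frame.isAdmissible_theta [HopfObj (contDual B)] [HopfObj (DoubleCross B (contDual B))]
    (D : Frame B) (hR : IsCanon R) (hΘ : ∀ V : HopfRep (DoubleCross B (contDual B)),
      IsDrinfeldYetter B V.X (thetaAct V) (thetaCoact R V)) (V) :
    IsAdmissible B ((theta R hΘ).obj V) := fun (v : El V.X) => by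
  have h := hR.inPrime.map_right (V := V.X) (f := fun g => actE V.act (dc 1 g) v) (by fun_prop)
  rw [← ap_thetaCoact] at h
  exact D.memPrime h

/-- The theorem for quantised enveloping algebras. -/
theorem quantised_double {k : Type u} [Field k] [CharZero k] (B : TopFree k) [HopfObj B]
    (b : Type u) [LieRing b] [LieAlgebra k b] [FiniteDimensional k b] (hB : B.IsQUE b) :
      IsIso 𝒮[B] ∧
      ∃ (_ : HopfObj B.contDual) (lact : B.contDual ⊗ B ⟶ B) (ract : B.contDual ⊗ B ⟶ B.contDual)
        (R : 𝟙_ (TopFree k) ⟶ B ⊗ B.contDual),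
        B.IsOppositeDual ∧ TopFree.IsCoadLeft lact ∧ TopFree.IsCoadRight ract ∧
        TopFree.IsCanonical R ∧
        IsMatchedPair B B.contDual lact ract ∧
        ∃ _ : HopfObj (DoubleCross B B.contDual),
          IsDoubleCrossProduct lact ract ∧
          IsQuasitriangular (DoubleCross B B.contDual) (doubleR R) ∧
          ∃ (h₁ : DY.IsMonoidal B) (h₂ : DY.IsBraided h₁)
            (h₃ : HopfRep.IsMonoidal (DoubleCross B B.contDual))
            (h₄ : HopfRep.IsBraided h₃ (doubleR R)),
            letI := DY.monoidal h₁
            letI := DY.braided h₁ h₂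
            letI := HopfRep.monoidal h₃
            letI := HopfRep.braided h₃ (doubleR R) h₄
            ∃ (_ : B.IsAdmissible.IsMonoidal)
              (ξ : ∀ V : B.IsAdmissible.FullSubcategory,
                DoubleCross B B.contDual ⊗ V.obj.X ⟶ V.obj.X)
              (hξ : ∀ V, IsAction (DoubleCross B B.contDual) V.obj.X (ξ V))
              (nat : ∀ {V W : B.IsAdmissible.FullSubcategory} (f : V ⟶ W),
                ξ V ≫ (B.IsAdmissible.ι ⋙ DY.forget B).map f =
                  DoubleCross B B.contDual ◁ (B.IsAdmissible.ι ⋙ DY.forget B).map f ≫ ξ W)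
              (hΘ : ∀ V : HopfRep (DoubleCross B B.contDual),
                IsDrinfeldYetter B V.X (thetaAct V) (thetaCoact R V))
              (hΘ' : ∀ V, B.IsAdmissible ((theta R hΘ).obj V)),
              let Ξ := HopfRep.lift (B.IsAdmissible.ι ⋙ DY.forget B) ξ hξ nat
              let Θ := B.IsAdmissible.lift (theta R hΘ) hΘ'
              (∀ V, TopFree.IsXiAct V.obj (ξ V)) ∧
              (∃ e : B.IsAdmissible.FullSubcategory ≌ HopfRep (DoubleCross B B.contDual),
                e.functor = Ξ ∧ e.inverse = Θ) ∧
              (∃ _ : Ξ.Braided, (Functor.LaxMonoidal.ε Ξ).hom = 𝟙 (𝟙_ (TopFree k)) ∧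
                ∀ V W, (Functor.LaxMonoidal.μ Ξ V W).hom = 𝟙 (V.obj.X ⊗ W.obj.X)) ∧
              (∃ _ : Θ.Braided, (Functor.LaxMonoidal.ε Θ).hom.hom = 𝟙 (𝟙_ (TopFree k)) ∧
                ∀ V W : HopfRep (DoubleCross B B.contDual),
                  (Functor.LaxMonoidal.μ Θ V W).hom.hom = 𝟙 (V.X ⊗ W.X)) := by
  obtain ⟨p, hp⟩ := hB.exists_isQuantisation
  have := hp.isIso_antipode
  obtain ⟨D⟩ := hB.nonempty_frame
  obtain ⟨R, hR⟩ := D.exists_isCanon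
  obtain ⟨m⟩ := D.nonempty_dualMaps hR
  obtain ⟨lact, hlact, hl⟩ := hp.exists_lact D hR
  obtain ⟨ract, hract, hr⟩ := hp.exists_ract D hR
  letI := m.hopfObj
  have d := m.isDualPair hl hr
  letI := d.doubleHopf
  have h := d.isDoubleCrossProduct
  have hq := d.isQuasitriangular h
  have h₁ : DY.IsMonoidal B := DY.isMonoidal
  have h₂ : DY.IsBraided h₁ := DY.isBraided
  have h₃ : HopfRep.IsMonoidal (DoubleCross B B.contDual) := HopfRep.isMonoidal
  have h₄ : HopfRep.IsBraided h₃ (doubleR R) := hq.isBraided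
  choose ξ hx hξ using fun V : B.IsAdmissible.FullSubcategory => D.exists_xi hR V.property
  have nat {V W : B.IsAdmissible.FullSubcategory} (f : V ⟶ W) :=
    (hx V).natural hR.separates (hx W) f.hom
  have hΞ (V) := (hx V).isAction d h
  have hΘ := theta_isDY d h
  have hΘ' := D.isAdmissible_theta hR hΘ
  refine ⟨inferInstance, inferInstance, lact, ract, R, D.isOppositeDual hR m, hlact, hract,
    D.isCanonical hR, d.isMatchedPair, inferInstance, h, hq, h₁, h₂, h₃, h₄, ?_⟩
  letI := DY.monoidal h₁
  letI := DY.braided h₁ h₂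
  letI := HopfRep.monoidal h₃
  letI := HopfRep.braided h₃ (doubleR R) h₄
  have := D.isMonoidal_isAdmissible h₁
  exact ⟨this, ξ, hΞ, nat, hΘ, hΘ', hξ, lift_equivalence d h hx hΞ nat hΘ hΘ',
    lift_braided d h hx hΞ nat h₁ h₂ h₃ h₄, theta_lift_braided d h hΘ h₁ h₃ h₂ h₄ hΘ'⟩

end Double

end TopFree

end

end QuantumDouble

theorem theoremA1 :
    -- finite-dimensional Hopf algebras
    (∀ (k : Type u) [Field k] (B : ModuleCat.{u} k) [HopfObj B] [FiniteDimensional k B],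
      IsIso 𝒮[B] ∧
      ∃ _ : HopfObj (dual B), IsOppositeDual B ∧
        IsMatchedPair B (dual B) (coadLeft (evDual B)) (coadRight B) ∧
        ∃ _ : HopfObj (DoubleCross B (dual B)),
          IsDoubleCrossProduct (coadLeft (evDual B)) (coadRight B) ∧
          IsQuasitriangular (DoubleCross B (dual B)) (doubleR (canonicalR B)) ∧
          ∃ (h₁ : DY.IsMonoidal B) (h₂ : DY.IsBraided h₁)
            (h₃ : HopfRep.IsMonoidal (DoubleCross B (dual B)))
            (h₄ : HopfRep.IsBraided h₃ (doubleR (canonicalR B)))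
            (hΞ : ∀ V : DY B, IsAction (DoubleCross B (dual B)) V.X (xiAct (evDual B) V))
            (hΘ : ∀ V : HopfRep (DoubleCross B (dual B)),
              IsDrinfeldYetter B V.X (thetaAct V) (thetaCoact (canonicalR B) V)),
            letI := DY.monoidal h₁
            letI := DY.braided h₁ h₂
            letI := HopfRep.monoidal h₃
            letI := HopfRep.braided h₃ (doubleR (canonicalR B)) h₄
            let Ξ := xi (evDual B) hΞ
            let Θ := theta (canonicalR B) hΘ
            (∃ e : DY B ≌ HopfRep (DoubleCross B (dual B)), e.functor = Ξ ∧ e.inverse = Θ) ∧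
            (∃ _ : Ξ.Braided, (Functor.LaxMonoidal.ε Ξ).hom = 𝟙 (𝟙_ (ModuleCat.{u} k)) ∧
              ∀ V W : DY B, (Functor.LaxMonoidal.μ Ξ V W).hom = 𝟙 (V.X ⊗ W.X)) ∧
            (∃ _ : Θ.Braided, (Functor.LaxMonoidal.ε Θ).hom = 𝟙 (𝟙_ (ModuleCat.{u} k)) ∧
              ∀ V W : HopfRep (DoubleCross B (dual B)),
                (Functor.LaxMonoidal.μ Θ V W).hom = 𝟙 (V.X ⊗ W.X))) ∧
    -- quantised enveloping algebras
    (∀ (k : Type u) [Field k] [CharZero k] (B : TopFree k) [HopfObj B]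
        (b : Type u) [LieRing b] [LieAlgebra k b] [FiniteDimensional k b], B.IsQUE b →
      IsIso 𝒮[B] ∧
      ∃ (_ : HopfObj B.contDual) (lact : B.contDual ⊗ B ⟶ B) (ract : B.contDual ⊗ B ⟶ B.contDual)
        (R : 𝟙_ (TopFree k) ⟶ B ⊗ B.contDual),
        B.IsOppositeDual ∧ TopFree.IsCoadLeft lact ∧ TopFree.IsCoadRight ract ∧
        TopFree.IsCanonical R ∧
        IsMatchedPair B B.contDual lact ract ∧
        ∃ _ : HopfObj (DoubleCross B B.contDual),
          IsDoubleCrossProduct lact ract ∧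
          IsQuasitriangular (DoubleCross B B.contDual) (doubleR R) ∧
          ∃ (h₁ : DY.IsMonoidal B) (h₂ : DY.IsBraided h₁)
            (h₃ : HopfRep.IsMonoidal (DoubleCross B B.contDual))
            (h₄ : HopfRep.IsBraided h₃ (doubleR R)),
            letI := DY.monoidal h₁
            letI := DY.braided h₁ h₂
            letI := HopfRep.monoidal h₃
            letI := HopfRep.braided h₃ (doubleR R) h₄
            ∃ (_ : B.IsAdmissible.IsMonoidal)
              (ξ : ∀ V : B.IsAdmissible.FullSubcategory,
                DoubleCross B B.contDual ⊗ V.obj.X ⟶ V.obj.X)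
              (hξ : ∀ V, IsAction (DoubleCross B B.contDual) V.obj.X (ξ V))
              (nat : ∀ {V W : B.IsAdmissible.FullSubcategory} (f : V ⟶ W),
                ξ V ≫ (B.IsAdmissible.ι ⋙ DY.forget B).map f =
                  DoubleCross B B.contDual ◁ (B.IsAdmissible.ι ⋙ DY.forget B).map f ≫ ξ W)
              (hΘ : ∀ V : HopfRep (DoubleCross B B.contDual),
                IsDrinfeldYetter B V.X (thetaAct V) (thetaCoact R V))
              (hΘ' : ∀ V, B.IsAdmissible ((theta R hΘ).obj V)),
              let Ξ := HopfRep.lift (B.IsAdmissible.ι ⋙ DY.forget B) ξ hξ nat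
              let Θ := B.IsAdmissible.lift (theta R hΘ) hΘ'
              (∀ V, TopFree.IsXiAct V.obj (ξ V)) ∧
              (∃ e : B.IsAdmissible.FullSubcategory ≌ HopfRep (DoubleCross B B.contDual),
                e.functor = Ξ ∧ e.inverse = Θ) ∧
              (∃ _ : Ξ.Braided, (Functor.LaxMonoidal.ε Ξ).hom = 𝟙 (𝟙_ (TopFree k)) ∧
                ∀ V W, (Functor.LaxMonoidal.μ Ξ V W).hom = 𝟙 (V.obj.X ⊗ W.obj.X)) ∧
              (∃ _ : Θ.Braided, (Functor.LaxMonoidal.ε Θ).hom.hom = 𝟙 (𝟙_ (TopFree k)) ∧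
                ∀ V W : HopfRep (DoubleCross B B.contDual),
                  (Functor.LaxMonoidal.μ Θ V W).hom.hom = 𝟙 (V.X ⊗ W.X))) := by
  exact ⟨fun k _ B _ _ => finiteDimensional_double B,
    fun k _ _ B _ b _ _ _ hB => TopFree.quantised_double B b hB⟩
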